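/- **Setting.** Let $O=(0,0)$, $a=(\frac12,\frac{\sqrt3}2)$, $b=(1,0)$. Let $F'_0$ be the graph of the triangle $Oab$, $F'_{N+1}=\bigcup_{c\in\{O,a,b\}}\frac12(F'_N+c)$, let $F_N$ be the union of $F'_N$ and its mirror image in the $y$-axis, and $F^V_N=F_N\cup(F'_N+b)$. Let $G_N$, $G_N^V$ be the vertex sets of $F_N$, $F_N^V$. The $2^{-N}$-triangles are the upward triangles of side $2^{-N}$ of which these graphs are made up. For a path $w$, let $T^M_0=0$ and let $T^M_i$ be the first time after $T^M_{i-1}$ at which $w$ hits a vertex of level $M$ (i.e. of $G^V_M$) other than $w(T^M_{i-1})$; put $Q_Mw=(w(T^M_0),w(T_1^M),\dots)$. Let $W_N$ be the set of paths on $F_N$ from $O$, stopped when first hitting $a$, that do not hit $G_0\setminus\{O\}$ on the way; let $V_N$ be the set of paths on $F_N^V$ from $O$, stopped when first hitting $a$, with $Q_0w=(O,b,a)$; let $\Gamma_N$ be the set of loopless paths in $W_N\cup V_N$. **Self-repelling walks.** Fix $u\in[0,1]$. For $w\in W_1$ let $\ell(w)$ be its number of steps, $N(w)$ the number of sharp turns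 and backtracks (negative inner product of consecutive steps) at vertices outside $G_0$, and $M(w)$ the number of returns to $O$. Let $x_u>0$ be the solution of $\sum_{w\in W_1}u^{N(w)+M(w)}x^{\ell(w)}=x$, put $P_1(w)=u^{N(w)+M(w)}x_u^{\ell(w)-1}$ (with $0^0=1$), $P_0\equiv 1$ on $W_0=\{(O,a)\}$, and $P_N(w)=P_{N-1}(Q_{N-1}w)\prod_iP_1(w_i)$, where $w_i$ is the segment of $w\in W_N$ between the times $T^{N-1}_{i-1}$ and $T^{N-1}_i$, identified with an element of $W_1$ by similarity. On $V_N$ put $P'_N(w)=P_N(w')P_N(w'')$, where $w',w''$ are the parts of $w$ before and after $T^0_1$. **Skeleton and loop erasure.** The $2^{-M}$-skeleton $\sigma_M(w)=(\Delta_1,\dots,\Delta_k)$ is the sequence of $2^{-M}$-triangles that $w$ passes through: $\Delta_1$ contains $w(T^M_0)$ and $w(T^M_1)$; the exit time of $\Delta_i$ is the first time $T^M_j$ after its entrance such that $w(T^M_{j+1})\notin\Delta_i$ (or the end of the path), and $\Delta_{i+1}$ contains $w(T^M_j)$ and $w(T^M_{j+1})$. The part of $w$ between entrance and exit is the segment $w|_{\Delta_i}$;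 $\Delta_i$ is of Type 1 or 2 according to whether the exit is one or two hitting times $T^M_\cdot$ after the entrance. $S^M_j(w)$ is the number of Type $j$ triangles in $\sigma_M(w)$, and $\mathbf S^M=(S^M_1,S^M_2)$. Loops are erased larger ones first: for $M=0,1,2,\dots$ successively, within each $2^{-M}$-triangle of the skeleton of the path reached so far, the loops of the $Q_{M+1}$-coarse graining of the path segment are erased chronologically, and the fine structure of the remaining coarse steps is kept. $\hat Q_Mw\in\Gamma_M$ denotes $Q_M$ of the path obtained after $M$ such stages; $Lw=\hat Q_Nw$ for $w\in W_N\cup V_N$. Let $\hat P_N=P_N\circ L^{-1}$, $\hat P'_N=P'_N\circ L^{-1}$, $$\hat\Phi(x,y)=\sum_{w\in\Gamma_1}\hat P_1(w)x^{S^1_1(w)}y^{S^1_2(w)},\qquad \hat\Theta(x,y)=\sum_{w\in\Gamma_1}\hat P'_1(w)x^{S^1_1(w)}y^{S^1_2(w)}.$$ **Limit objects.** Let $\mathbf M=\begin{pmatrix}\partial_x\hat\Phi&\partial_y\hat\Phi\\ \partial_x\hat\Theta&\partial_y\hat\Theta\end{pmatrix}(1,1)$, let $\lambda$ be its larger eigenvalue,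 and let $\mathbf u=(u_1,u_2)^t$ and $\mathbf v=(v_1,v_2)$ be its right and left eigenvectors for $\lambda$ with $u_1,u_2>0$, $v_1,v_2\ge0$, $(\mathbf u,\mathbf v)=1$ and $(\mathbf u,\mathbf 1)=1$. Let $P$ be the probability measure on sequences $(Y_0,Y_1,\dots)$ of paths for which, for every $N$, the law of $(Y_0,\dots,Y_N)$ is that of $(\hat Q_0w,\dots,\hat Q_Nw)$ with $w$ distributed according to $P_N$. **Proposition.** $\lambda,\mathbf u,\mathbf v$ and $P$ as above exist, and $v_1,v_2>0$ if $u>0$. There are random variables $B_1,B_2$ with the following properties. For every $M\ge0$ and every $v\in\Gamma_M$ with $P[Y_M=v]>0$, with $\sigma_M(v)=(\Delta_1,\dots,\Delta_k)$, under $P[\,\cdot\mid Y_M=v]$: (1) for each $i$, $\lambda^{-(M+N)}\mathbf S^{M+N}(Y_{M+N}|_{\Delta_i})$ converges a.s. as $N\to\infty$ to an $\mathbb R^2$-valued random variable $\mathbf S^{*M,i}$; (2) $\mathbf S^{*M,1},\dots,\mathbf S^{*M,k}$ are independent; (3) each $\Delta_i$ is of Type 1 or 2 (as a triangle of $\sigma_M(v)$),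 and $\mathbf S^{*M,i}$ has the law of $\lambda^{-M}B_j\mathbf v$ if it is of Type $j$. Moreover: (4) for $j=1,2$: $B_j>0$ a.s., $E[B_j]=u_j$, and the law of $B_j$ has a probability density that is strictly positive on $(0,\infty)$ and vanishes elsewhere; (5) for $j=1,2$ and all $t\in\mathbb C$, $e^{-tB_j}$ is integrable, $g_j(t)=E[e^{-tB_j}]$ is an entire function, and $g_1(\lambda t)=\hat\Phi(g_1(t),g_2(t))$, $g_2(\lambda t)=\hat\Theta(g_1(t),g_2(t))$, $g_1(0)=g_2(0)=1$. -/

import Mathlib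

open MeasureTheory ProbabilityTheory Filter Topology

noncomputable section

namespace Gasket

/-! ### The pre-Sierpinski gaskets -/

/-- Points of the plane in the oblique rational coordinates attached to the basis `(b, a)`:
`(s, t)` stands for the point `s • b + t • a`, where `b = (1, 0)` and `a = (1/2, √3/2)`. All the
vertices that occur have dyadic coordinates. -/
abbrev Pt : Type := ℚ × ℚ

/-- The vertex `O = (0, 0)`. -/
def vO : Pt := (0, 0)

/-- The vertex `a = (1/2, √3/2)`. -/
def va : Pt := (0, 1)

/-- The vertex `b = (1, 0)`. -/
def vb : Pt := (1, 0)

/-- The point of the Euclidean plane with the given oblique coordinates. -/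
def toPlane (p : Pt) : EuclideanSpace ℝ (Fin 2) :=
  !₂[(p.1 : ℝ) + (p.2 : ℝ) / 2, (p.2 : ℝ) * (Real.sqrt 3 / 2)]

/-- The Euclidean inner product in the oblique coordinates. -/
def dot (p q : Pt) : ℚ := p.1 * q.1 + p.2 * q.2 + (p.1 * q.2 + p.2 * q.1) / 2

theorem inner_toPlane (p q : Pt) : inner ℝ (toPlane p) (toPlane q) = (dot p q : ℝ) := by
  have h : Real.sqrt 3 * Real.sqrt 3 = 3 := Real.mul_self_sqrt (by norm_num)
  simp only [toPlane, dot, PiLp.inner_apply, Fin.sum_univ_two]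
  simp
  linear_combination ((p.2 : ℝ) * q.2 / 4) * h

/-- The similarity `x ↦ (x + c) / 2`; the maps `f₁, f₂, f₃` are the cases `c = O, a, b`. -/
def contr (c x : Pt) : Pt := ((x.1 + c.1) / 2, (x.2 + c.2) / 2)

/-- The reflection with respect to the `y`-axis (it maps `b` to `-b` and `a` to `a - b`). -/
def mirror (x : Pt) : Pt := (-x.1 - x.2, x.2)

/-- The `2⁻ᴺ`-triangles (given by their three vertices) that make up the graph `F'_N`:
`F'_0` is the triangle `Oab` and `F'_{N+1} = f₁(F'_N) ∪ f₂(F'_N) ∪ f₃(F'_N)`. -/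
def cells' : ℕ → Finset (Finset Pt)
  | 0 => {{vO, va, vb}}
  | N + 1 => ({vO, va, vb} : Finset Pt).biUnion fun c => (cells' N).image (Finset.image (contr c))

/-- The `2⁻ᴺ`-triangles of `F_N`, the union of `F'_N` and its reflection. -/
def cells (N : ℕ) : Finset (Finset Pt) := cells' N ∪ (cells' N).image (Finset.image mirror)

/-- The `2⁻ᴺ`-triangles of `F^V_N = F_N ∪ (F'_N + b)`. -/
def cellsV (N : ℕ) : Finset (Finset Pt) :=
  cells N ∪ (cells' N).image (Finset.image fun x => x + vb)

/-- The vertices `G_N` of `F_N`. -/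
def vert (N : ℕ) : Finset Pt := (cells N).biUnion id

/-- The vertices `G^V_N` of `F^V_N`. -/
def vertV (N : ℕ) : Finset Pt := (cellsV N).biUnion id

/-- Adjacency in `F_N`: the edges are the sides of the `2⁻ᴺ`-triangles. -/
def Adj (N : ℕ) (x y : Pt) : Prop := x ≠ y ∧ ∃ D ∈ cells N, x ∈ D ∧ y ∈ D

/-- Adjacency in `F^V_N`. -/
def AdjV (N : ℕ) (x y : Pt) : Prop := x ≠ y ∧ ∃ D ∈ cellsV N, x ∈ D ∧ y ∈ D

/-! ### Paths, hitting times and coarse graining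

A path `w = (w(0), …, w(n))` is the list of its vertices; it has `w.length - 1` steps. -/

/-- The coarse graining `Q_M w`: the successive vertices of level `M` that `w` hits, where hits of
the same vertex several times in a row count once. -/
def coarse (M : ℕ) (w : List Pt) : List Pt := (w.filter (· ∈ vertV M)).destutter (· ≠ ·)

/-- Auxiliary to `split`: `p` is the last vertex of `S` that was hit, `acc` is the path since the
time `T` at which it was first hit, and the third argument is the future of the path. -/
def splitAux (S : Finset Pt) : Pt → List Pt → List Pt → List (List Pt)
  | _, _, [] => []
  | p, acc, y :: t =>
    if y ∈ S ∧ y ≠ p then (acc ++ [y]) :: splitAux S y [y] t else splitAux S p (acc ++ [y]) t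

/-- The path segments `(w(T_{i-1}), …, w(T_i))`, `i = 1, …, m`, where `T₀ = 0` and
`T_i = inf {j > T_{i-1} : w(j) ∈ S \ {w(T_{i-1})}}` are the successive hitting times of `S`. -/
def split (S : Finset Pt) : List Pt → List (List Pt)
  | [] => []
  | x :: t => splitAux S x [x] t

/-- Concatenation of consecutive path segments (each starts where the previous one ends). -/
def glue : List (List Pt) → List Pt
  | [] => []
  | s :: t => s ++ (glue t).tail

/-- `W_N`: the paths on `F_N` from `O` to `a`, stopped when they first hit `a`, that do not hit
`G_0 \ {O}` on the way. -/
def W (N : ℕ) : Set (List Pt) :=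
  {w | w.IsChain (Adj N) ∧ w.head? = some vO ∧ w.getLast? = some va ∧
    ∀ p ∈ w.dropLast, p ∈ vert 0 → p = vO}

/-- `V_N`: the paths on `F^V_N` from `O` to `a`, stopped when they first hit `a`, with
`Q_0 w = (O, b, a)`. -/
def V (N : ℕ) : Set (List Pt) :=
  {w | w.IsChain (AdjV N) ∧ w.head? = some vO ∧ w.getLast? = some va ∧
    (∀ p ∈ w.dropLast, p ≠ va) ∧ coarse 0 w = [vO, vb, va]}

/-- `Γ_N`: the loopless paths in `W_N ∪ V_N`. -/
def Loopless (N : ℕ) : Set (List Pt) := {w | (w ∈ W N ∨ w ∈ V N) ∧ w.Nodup}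

/-! ### The skeleton of a path -/

/-- The (unique) `2⁻ᴹ`-triangle that contains the starting point and the end point of the path
segment `s`, for `s` leading from a vertex of level `M` to an adjacent one. -/
def triangleOf (M : ℕ) (s : List Pt) : Finset Pt :=
  ((cellsV M).filter fun D => s.headD vO ∈ D ∧ s.getLastD vO ∈ D).sup id

/-- The decomposition of `w` at its exit times from the `2⁻ᴹ`-triangles that it passes through.
Each entry is the list of the segments (between successive hitting times of level `M`) performed
in one triangle, from the entrance to the exit. -/
def runs (M : ℕ) (w : List Pt) : List (List (List Pt)) :=
  (split (vertV M) w).splitBy fun s t => decide (triangleOf M s = triangleOf M t)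

/-- The `2⁻ᴹ`-skeleton `σ_M(w) = (Δ_1, …, Δ_k)`. -/
def skeleton (M : ℕ) (w : List Pt) : List (Finset Pt) :=
  (runs M w).map fun r => triangleOf M (r.headD [])

/-- The part of the decomposition `runs` that belongs to the triangle `D` of the skeleton. -/
def runIn (M : ℕ) (w : List Pt) (D : Finset Pt) : List (List Pt) :=
  ((runs M w).find? fun r => decide (triangleOf M (r.headD []) = D)).getD []

/-- The path segment `w|_D` of `w` in the triangle `D` of its `2⁻ᴹ`-skeleton. -/
def segmentIn (M : ℕ) (w : List Pt) (D : Finset Pt) : List Pt := glue (runIn M w D)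

/-- The type of the triangle `D` of the `2⁻ᴹ`-skeleton of `w`: the number of hitting times of level
`M` that it takes from the entrance to the exit (`1` or `2` for loopless paths). -/
def typeIn (M : ℕ) (w : List Pt) (D : Finset Pt) : ℕ := (runIn M w D).length

/-- The number of triangles of type `j` in the `2⁻ᴹ`-skeleton of `w`. -/
def typeCount (M : ℕ) (w : List Pt) (j : ℕ) : ℕ := (runs M w).countP fun r => r.length == j

/-- The vector `S^M(w) = (S^M_1(w), S^M_2(w))`. -/
def typeVec (M : ℕ) (w : List Pt) : Fin 2 → ℝ := ![(typeCount M w 1 : ℝ), (typeCount M w 2 : ℝ)]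

/-! ### Erasing larger loops first -/

/-- Chronological loop erasure of a coarse path whose steps carry a fine structure. If
`x_0, …, x_m` are the end points of the successive segments, the segment kept first is the one that
follows the last visit to `x_0`, the next one is the one that follows the last visit to the end
point of the segment just kept, and so on. -/
def eraseLoops : List (List Pt) → List (List Pt)
  | [] => []
  | s :: t =>
    match h : (s :: t).rtakeWhile (fun r => decide (r.getLast? ≠ s.head?)) with
    | [] => []
    | r :: l => r :: eraseLoops l
termination_by l => l.length
decreasing_by
  have := (List.rtakeWhile_suffix (fun r : List Pt => decide (r.getLast? ≠ s.head?))
    (s :: t)).length_le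
  rw [h] at this
  simp only [List.length_cons] at this ⊢
  omega

/-- One stage: within each `2⁻ᴹ`-triangle of the skeleton, the largest scale loops of the path
segment (those seen in its coarse graining of level `M + 1`) are erased, and the fine structure of
the remaining part is kept. -/
def eraseStage (M : ℕ) (w : List Pt) : List Pt :=
  glue ((runs M w).flatMap fun r => eraseLoops (split (vertV (M + 1)) (glue r)))

/-- The path obtained from `w` by erasing the loops of the scales `2⁻¹, …, 2⁻ᴹ`, successively. -/
def erased : ℕ → List Pt → List Pt
  | 0, w => w
  | M + 1, w => eraseStage M (erased M w)

/-- The loop-erased coarse path `Q̂_M w`. For `w ∈ W_N ∪ V_N`, the loop erasure of `w` is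
`L w = Q̂_N w`. -/
def Qhat (M : ℕ) (w : List Pt) : List Pt := coarse M (erased M w)

/-! ### The self-repelling walks -/

/-- The number of sharp turns and backtracks at vertices outside `S`. -/
def turnCount (S : Finset Pt) : List Pt → ℕ
  | x :: y :: z :: t =>
    (if dot (y - x) (z - y) < 0 ∧ y ∉ S then 1 else 0) + turnCount S (y :: z :: t)
  | _ => 0

/-- The number of revisits to the starting point. -/
def returnCount (w : List Pt) : ℕ := w.tail.count (w.headD vO)

/-- The exponent `N(w) + M(w)` of the penalty, for a path segment that joins two adjacent vertices
of level `M`. Sharp turns and revisits are preserved by the similarity that identifies the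
segment with a path from `O` to `a`, so they can be counted in place. -/
def penalty (M : ℕ) (w : List Pt) : ℕ := turnCount (vertV M) w + returnCount w

/-- The fixed point `x_u > 0` of `x ↦ Φ(x, u) = ∑_{w ∈ W_1} u^{N(w) + M(w)} x^{ℓ(w)}`. -/
def fixedPt (u : ℝ) : ℝ :=
  sInf {x : ℝ | 0 < x ∧
    HasSum (fun w : W 1 => u ^ penalty 0 (w : List Pt) * x ^ ((w : List Pt).length - 1)) x}

/-- The probability `u^{N(s) + M(s)} x_u^{ℓ(s) - 1}` of a segment `s` on level `M + 1` between two
adjacent vertices of level `M`. -/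
def stepProb (u : ℝ) (M : ℕ) (s : List Pt) : ℝ :=
  u ^ penalty M s * fixedPt u ^ (s.length - 2)

/-- The probability `P_N^u(w)` of a path `w`, defined recursively through the decomposition
of `w` on level `N - 1`. -/
def pathProb (u : ℝ) : ℕ → List Pt → ℝ
  | 0, _ => 1
  | N + 1, w =>
    pathProb u N (coarse N w) * ((split (vertV N) w).map (stepProb u N)).prod

instance : MeasurableSpace (List Pt) := ⊤

/-- The law `P_N^u` of the self-repelling walk, on `W_N`. -/
def walkLaw (u : ℝ) (N : ℕ) : Measure (List Pt) :=
  Measure.sum fun w : W N => ENNReal.ofReal (pathProb u N w) • Measure.dirac (w : List Pt)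

/-- The law `P'_N^u` on `V_N`: the probability of `w` is `P_N^u(w') P_N^u(w'')`, where `w'` and
`w''` are the parts of `w` from `O` to `b` and from `b` to `a`. -/
def walkLaw' (u : ℝ) (N : ℕ) : Measure (List Pt) :=
  Measure.sum fun w : V N =>
    ENNReal.ofReal ((split (vertV 0) (w : List Pt)).map (pathProb u N)).prod •
      Measure.dirac (w : List Pt)

/-- The law `P̂_N^u` of the loop-erased walk. -/
def erasedLaw (u : ℝ) (N : ℕ) : Measure (List Pt) := (walkLaw u N).map (Qhat N)

/-- The law `P̂'_N^u`. -/
def erasedLaw' (u : ℝ) (N : ℕ) : Measure (List Pt) := (walkLaw' u N).map (Qhat N)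

/-! ### Generating functions and the mean matrix -/

/-- The generating function `∑_{w ∈ Γ_1} μ(w) x^{s_1(w)} y^{s_2(w)}` (a finite sum). -/
def genFun {𝕜 : Type*} [RCLike 𝕜] (μ : Measure (List Pt)) (x y : 𝕜) : 𝕜 :=
  ∑' w : Loopless 1, ((μ.real {(w : List Pt)} : ℝ) : 𝕜) *
    x ^ typeCount 1 (w : List Pt) 1 * y ^ typeCount 1 (w : List Pt) 2

/-- The generating function `Φ̂ = Φ̂_1`. -/
def genPhi {𝕜 : Type*} [RCLike 𝕜] (u : ℝ) (x y : 𝕜) : 𝕜 := genFun (erasedLaw u 1) x y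

/-- The generating function `Θ̂ = Θ̂_1`. -/
def genTheta {𝕜 : Type*} [RCLike 𝕜] (u : ℝ) (x y : 𝕜) : 𝕜 := genFun (erasedLaw' u 1) x y

/-- The mean matrix: the partial derivatives of `Φ̂` and `Θ̂` at `(1, 1)`. -/
def meanMatrix (u : ℝ) : Matrix (Fin 2) (Fin 2) ℝ :=
  !![deriv (fun x : ℝ => genPhi u x 1) 1, deriv (fun y : ℝ => genPhi u 1 y) 1;
     deriv (fun x : ℝ => genTheta u x 1) 1, deriv (fun y : ℝ => genTheta u 1 y) 1]

/-- `lam` is the larger eigenvalue of `A`, and `r`, `l` are its positive right and nonnegative left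
eigenvectors, normalized by `(r, l) = 1` and `(r, 1) = 1`. -/
structure IsPerronTriple (A : Matrix (Fin 2) (Fin 2) ℝ) (lam : ℝ) (r l : Fin 2 → ℝ) : Prop where
  greatest : IsGreatest {μ : ℝ | Module.End.HasEigenvalue (Matrix.toLin' A) μ} lam
  right_eq : A.mulVec r = lam • r
  left_eq : Matrix.vecMul l A = lam • l
  right_pos : ∀ j, 0 < r j
  left_nonneg : ∀ j, 0 ≤ l j
  dot_eq : ∑ j, r j * l j = 1
  sum_eq : ∑ j, r j = 1

/-! ### The coupled sequence of loop-erased walks -/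

/-- `P` is the law of the coupled sequence `(Y_0, Y_1, …)`: for each `N`, the law of
`(Y_0, …, Y_N)` is that of `(Q̂_0 w, …, Q̂_N w)` for `w` distributed according to `P_N^u`. -/
def IsCoupledLaw (u : ℝ) (P : Measure (ℕ → List Pt)) : Prop :=
  ∀ N : ℕ, P.map (fun ω (i : Fin (N + 1)) => ω i) =
    (walkLaw u N).map (fun w (i : Fin (N + 1)) => Qhat i w)

end Gasket

end

noncomputable section

namespace Gasket

open scoped ENNReal
open ENNReal (ofReal ofReal_mul ofReal_le_ofReal toReal_nonneg tsum_comm ofReal_one tsum_eq_zero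
  toReal_ofReal ofReal_ne_top)
open Prod (fst snd snd_add fst_add)
open Real (exp exp_pos exp_add exp_le_exp exp_zero exp_nat_mul)
open List (map_cons exists_cons_of_ne_nil Forall₂ mem_cons_of_mem mem_flatten isChain_cons_cons
  flatten_cons map_congr_left mem_cons cons_append flatMap_def dropLast_cons_cons replicate ofFn
  map_flatten splitBy flatMap_cons tail length_map flatten_flatten flatMap of_mem_zip
  mem_iff_getElem length_cons getElem_mem getLast?_cons_cons mem_map_of_mem nodup_cons headD_cons
  flatMap_map eq_nil_or_concat concat_eq_append nodup_append map_singleton mem_flatMap)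
open Finset (range mem_image sum_congr sum_nonneg single_le_sum mem_singleton mem_univ
  image_singleton mem_union mem_insert mem_biUnion image_insert image mem_image_of_mem mem_erase
  univ image_image)
open PMF (map_comp mem_support_iff mem_support_map_iff bind_apply pure_map)
open Function (comp_def Injective uncurry)
open Or (inl inr)
open Metric (ball mem_ball ball_subset_ball)
open Set (indicator_of_mem indicator_of_notMem Ioi Icc)
open Fin (init)

/-- A step of a path. -/
abbrev Step := Pt × Pt

/-- A list of steps. -/
abbrev Steps := List Step

/-! ### Independent lists -/

/-- The law of a list of independent entries with the given laws. -/
def seqPMF {β : Type*} : List (PMF β) → PMF (List β)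
  | [] => PMF.pure []
  | p :: ps => p.bind fun a => (seqPMF ps).map (a :: ·)

/-- The entries of a list selected by a mask. -/
def mask {β : Type*} : List Bool → List β → List β
  | true :: m, a :: l => a :: mask m l
  | false :: m, _ :: l => mask m l
  | _, _ => []

lemma seqPMF_map {β γ : Type*} (f : β → γ) (ps : List (PMF β)) :
    seqPMF (ps.map (PMF.map f)) = (seqPMF ps).map (List.map f) := by
  induction ps with
  | nil => simp [seqPMF, pure_map]
  | cons p ps ih =>
    simp only [map_cons, seqPMF, ih, PMF.map_bind, map_comp, PMF.bind_map]
    congr 1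

lemma seqPMF_append {β : Type*} (ps qs : List (PMF β)) :
    seqPMF (ps ++ qs) = (seqPMF ps).bind fun a => (seqPMF qs).map (a ++ ·) := by
  induction ps with
  | nil => simp only [List.nil_append, seqPMF, PMF.pure_bind]; exact (PMF.map_id _).symm
  | cons p ps ih =>
    simp only [cons_append, seqPMF, ih, PMF.map_bind, map_comp, PMF.bind_bind,
      PMF.bind_map]
    congr 1

lemma seqPMF_flatten {β : Type*} (L : List (List (PMF β))) :
    seqPMF L.flatten = (seqPMF (L.map seqPMF)).map List.flatten := by
  induction L with
  | nil => simp [seqPMF, pure_map]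
  | cons p ps ih =>
    simp only [flatten_cons, seqPMF_append, map_cons, seqPMF, ih, PMF.map_bind,
      map_comp]
    congr 1

lemma seqPMF_mask {β : Type*} (m : List Bool) (ps : List (PMF β)) :
    (seqPMF ps).map (mask m) = seqPMF (mask m ps) := by
  induction ps generalizing m with
  | nil => cases m <;> simp [seqPMF, mask, pure_map]
  | cons p ps ih =>
    cases m with
    | nil =>
      have : (mask [] : List β → List β) = fun _ => [] := by
        funext l; cases l <;> rfl
      have h2 : mask [] (p :: ps) = [] := rfl
      rw [h2, this]
      exact PMF.map_const _ _
    | cons b m =>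
      cases b with
      | true =>
        simp only [seqPMF, mask, PMF.map_bind, map_comp, ← ih m]
        congr 1
      | false =>
        simp only [seqPMF, mask, PMF.map_bind, map_comp, ← ih m]
        have : ∀ a : β, (mask (false :: m)) ∘ (fun x : List β => a :: x) = mask m := by
          intro a; funext l; rfl
        simp [this]

lemma mem_support_seqPMF {β : Type*} {ps : List (PMF β)} {l : List β} :
    l ∈ (seqPMF ps).support ↔ Forall₂ (fun p a => a ∈ p.support) ps l := by
  induction ps generalizing l with
  | nil => simp [seqPMF]
  | cons p ps ih =>
    rw [seqPMF]
    simp only [PMF.mem_support_bind_iff, mem_support_map_iff, ih,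
      List.forall₂_cons_left_iff]
    constructor
    · rintro ⟨a, ha, b, hb, rfl⟩; exact ⟨a, b, ha, hb, rfl⟩
    · rintro ⟨a, b, ha, hb, rfl⟩; exact ⟨a, ha, b, hb, rfl⟩

lemma seqPMF_cons_apply {β : Type*} (p : PMF β) (ps : List (PMF β)) (a : β) (l : List β) :
    seqPMF (p :: ps) (a :: l) = p a * seqPMF ps l := by
  classical
  rw [seqPMF, bind_apply, tsum_eq_single a]
  · rw [PMF.map_apply, tsum_eq_single l]
    · simp
    · intro b hb; simp [hb.symm]
  · intro b hb
    rw [PMF.map_apply]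
    refine mul_eq_zero_of_right _ (tsum_eq_zero.2 fun x => if_neg ?_)
    simp [hb.symm]

lemma exists_mask {α : Type*} {l' l : List α} (h : l'.Sublist l) :
    ∃ m : List Bool, ∀ (β : Type) (f : α → β), mask m (l.map f) = l'.map f := by
  induction h with
  | slnil => exact ⟨[], fun _ _ => rfl⟩
  | cons a _ ih => obtain ⟨m, hm⟩ := ih; exact ⟨false :: m, fun β f => by simp [mask, hm]⟩
  | cons_cons a _ ih => obtain ⟨m, hm⟩ := ih; exact ⟨true :: m, fun β f => by simp [mask, hm]⟩

/-! ### Chronological loop erasure -/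

/-- Chronological loop erasure of a list of steps with starting points `hd` and end points
`lst`. -/
def eraseK {β κ : Type*} [DecidableEq κ] (hd lst : β → κ) : List β → List β
  | [] => []
  | s :: t =>
    match h : (s :: t).rtakeWhile (fun r => decide (lst r ≠ hd s)) with
    | [] => []
    | r :: l => r :: eraseK hd lst l
termination_by l => l.length
decreasing_by
  have := (List.rtakeWhile_suffix (fun r : β => decide (lst r ≠ hd s)) (s :: t)).length_le
  rw [h] at this
  simp only [length_cons] at this ⊢
  omega

section Trail
variable {β κ : Type*}

/-- `IsTrail src tgt x l y`: the steps `l` lead from `x` to `y`. -/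
def IsTrail (src tgt : β → κ) : κ → List β → κ → Prop
  | x, [], y => x = y
  | x, s :: t, y => src s = x ∧ IsTrail src tgt (tgt s) t y

lemma isTrail_append {src tgt : β → κ} {x y : κ} {l l' : List β} :
    IsTrail src tgt x (l ++ l') y ↔ ∃ z, IsTrail src tgt x l z ∧ IsTrail src tgt z l' y := by
  induction l generalizing x <;> grind [IsTrail]

end Trail

section EraseK
variable {β γ κ κ' : Type*} [DecidableEq κ] [DecidableEq κ']

lemma eraseK_nil (hd lst : β → κ) : eraseK hd lst [] = [] := by rw [eraseK]

lemma eraseK_of_nil {hd lst : β → κ} {s : β} {t : List β}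
    (h : (s :: t).rtakeWhile (fun r => decide (lst r ≠ hd s)) = []) :
    eraseK hd lst (s :: t) = [] := by
  rw [eraseK]; split
  · rfl
  · next h' => rw [h] at h'; cases h'

lemma eraseK_of_cons {hd lst : β → κ} {s r : β} {t l : List β}
    (h : (s :: t).rtakeWhile (fun r => decide (lst r ≠ hd s)) = r :: l) :
    eraseK hd lst (s :: t) = r :: eraseK hd lst l := by
  rw [eraseK]; split
  · next h' => rw [h] at h'; cases h'
  · next h' => rw [h] at h'; cases h'; rfl

lemma eraseLoops_eq (l : List (List Pt)) :
    eraseLoops l = eraseK List.head? List.getLast? l := by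
  induction hn : l.length using Nat.strong_induction_on generalizing l with
  | _ n ih =>
    cases l with
    | nil => rw [eraseK, eraseLoops]
    | cons s t =>
      rw [eraseLoops]
      split
      · next h => rw [eraseK_of_nil h]
      · next r l h =>
        rw [eraseK_of_cons h]
        congr 1
        refine ih _ ?_ l rfl
        have := (List.rtakeWhile_suffix
          (fun r : List Pt => decide (r.getLast? ≠ s.head?)) (s :: t)).length_le
        rw [h] at this
        simp only [length_cons] at this hn
        omega

lemma rtakeWhile_cons_length_lt {p : β → Bool} {s r : β} {t l : List β}
    (h : (s :: t).rtakeWhile p = r :: l) : l.length < (s :: t).length := by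
  have := (List.rtakeWhile_suffix p (s :: t)).length_le
  rw [h] at this
  simp only [length_cons] at this ⊢
  omega

lemma rtakeWhile_map (p : γ → Bool) (f : β → γ) (l : List β) :
    (l.map f).rtakeWhile p = (l.rtakeWhile (p ∘ f)).map f := by
  induction l using List.reverseRecOn with
  | nil => simp
  | append_singleton l a ih =>
    rw [List.map_append, map_singleton, List.rtakeWhile_concat, List.rtakeWhile_concat, ih]
    by_cases h : p (f a) <;> simp [h]

lemma rtakeWhile_congr {p q : β → Bool} {l : List β} (h : ∀ a ∈ l, p a = q a) :
    l.rtakeWhile p = l.rtakeWhile q := by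
  induction l using List.reverseRecOn with
  | nil => simp
  | append_singleton l a ih =>
    rw [List.rtakeWhile_concat, List.rtakeWhile_concat, h a (by simp),
      ih fun b hb => h b (by simp [hb])]

lemma eraseK_map {hd lst : β → κ} {hd' lst' : γ → κ'} (f : β → γ) (l : List β)
    (h : ∀ s ∈ l, ∀ t ∈ l, lst' (f s) = hd' (f t) ↔ lst s = hd t) :
    eraseK hd' lst' (l.map f) = (eraseK hd lst l).map f := by
  induction hn : l.length using Nat.strong_induction_on generalizing l with
  | _ n ih =>
    cases l with
    | nil => simp [eraseK_nil]
    | cons s t =>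
      have h1 : ((s :: t).map f).rtakeWhile (fun r => decide (lst' r ≠ hd' (f s))) =
          ((s :: t).rtakeWhile (fun r => decide (lst r ≠ hd s))).map f := by
        rw [rtakeWhile_map]
        congr 1
        refine rtakeWhile_congr fun a ha => ?_
        simp [h a ha s (by simp)]
      cases hr : (s :: t).rtakeWhile (fun r => decide (lst r ≠ hd s)) with
      | nil => rw [hr] at h1; rw [eraseK_of_nil hr, map_cons, eraseK_of_nil h1]; rfl
      | cons r l =>
        rw [hr] at h1
        rw [eraseK_of_cons hr, map_cons, eraseK_of_cons h1, map_cons]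
        congr 1
        have hs := List.rtakeWhile_suffix (fun r => decide (lst r ≠ hd s)) (s :: t)
        rw [hr] at hs
        exact ih _ (hn ▸ rtakeWhile_cons_length_lt hr) l
          (fun a ha b hb => h a (hs.subset (by simp [ha])) b (hs.subset (by simp [hb]))) rfl

lemma eraseK_sublist (hd lst : β → κ) (l : List β) : (eraseK hd lst l).Sublist l := by
  induction hn : l.length using Nat.strong_induction_on generalizing l with
  | _ n ih =>
    cases l with
    | nil => simp [eraseK_nil]
    | cons s t =>
      cases hr : (s :: t).rtakeWhile (fun r => decide (lst r ≠ hd s)) with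
      | nil => rw [eraseK_of_nil hr]; simp
      | cons r l =>
        rw [eraseK_of_cons hr]
        have hs := List.rtakeWhile_suffix (fun r => decide (lst r ≠ hd s)) (s :: t)
        rw [hr] at hs
        exact ((ih _ (hn ▸ rtakeWhile_cons_length_lt hr) l rfl).cons_cons r).trans hs.sublist

variable {src tgt : β → κ}

lemma IsTrail.eraseK {x y : κ} {l : List β} (h : IsTrail src tgt x l y) :
    IsTrail src tgt x (eraseK src tgt l) y ∧ ((Gasket.eraseK src tgt l).map src ++ [y]).Nodup ∧
      (l ≠ [] → Gasket.eraseK src tgt l = [] → x = y) := by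
  induction hn : l.length using Nat.strong_induction_on generalizing l x with
  | _ n ih =>
    cases l with
    | nil => simp only [eraseK_nil]; exact ⟨h, by simp, by simp⟩
    | cons s t =>
      have hsrc : src s = x := h.1
      have key := List.rdropWhile_append_rtakeWhile (p := fun r => decide (tgt r ≠ src s))
        (l := s :: t)
      have hx : IsTrail src tgt x ((s :: t).rtakeWhile (fun r => decide (tgt r ≠ src s))) y := by
        rw [← key, isTrail_append] at h
        obtain ⟨z, h1, h2⟩ := h
        suffices z = x by rwa [this] at h2
        rcases eq_nil_or_concat
          ((s :: t).rdropWhile (fun r => decide (tgt r ≠ src s))) with h0 | ⟨L, b, h0⟩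
        · rw [h0] at h1; exact h1.symm
        · have hne : (s :: t).rdropWhile (fun r => decide (tgt r ≠ src s)) ≠ [] := by
            rw [h0]; simp
          have := List.rdropWhile_last_not (p := fun r => decide (tgt r ≠ src s)) (s :: t) hne
          have hb : tgt b = src s := by
            have hb' : ((s :: t).rdropWhile (fun r => decide (tgt r ≠ src s))).getLast hne = b := by
              simp only [h0]; simp
            rw [hb'] at this
            simpa using this
          rw [h0, concat_eq_append, isTrail_append] at h1
          obtain ⟨w, _, h4⟩ := h1
          exact h4.2.symm.trans (hb.trans hsrc)
      have hall : ∀ r ∈ (s :: t).rtakeWhile (fun r => decide (tgt r ≠ src s)), tgt r ≠ src s := by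
        intro r hr; simpa using List.mem_rtakeWhile_imp hr
      cases hr : (s :: t).rtakeWhile (fun r => decide (tgt r ≠ src s)) with
      | nil =>
        rw [hr] at hx
        rw [eraseK_of_nil hr]
        exact ⟨hx, by simp, fun _ _ => hx⟩
      | cons r l =>
        rw [hr] at hx hall
        rw [eraseK_of_cons hr]
        obtain ⟨i1, i2, -⟩ := ih _ (hn ▸ rtakeWhile_cons_length_lt hr) hx.2 rfl
        refine ⟨⟨hx.1, i1⟩, ?_, by simp⟩
        rw [map_cons, cons_append, nodup_cons]
        refine ⟨?_, i2⟩
        -- every vertex after the first step is the end point of a step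
        have hv : ∀ (m : List β) (z : κ), IsTrail src tgt z m y →
            ∀ v ∈ m.map src ++ [y], v = z ∨ v ∈ m.map tgt := by
          intro m
          induction m with
          | nil => intro z hz v hv; left; simp at hv; exact hv.trans hz.symm
          | cons a m ihm =>
            intro z hz v hv
            simp only [map_cons, cons_append, mem_cons] at hv
            rcases hv with rfl | hv
            · left; exact hz.1
            · right
              rcases ihm _ hz.2 v hv with rfl | h'
              · simp
              · simp [h']
        intro hmem
        have hsub := eraseK_sublist src tgt l
        rcases hv _ _ i1 _ hmem with h' | h'
        · exact hall r (by simp) (by rw [← h', hx.1, hsrc])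
        · obtain ⟨b, hb, hb'⟩ := List.mem_map.1 h'
          exact hall b (by simp [hsub.subset hb]) (by rw [hb', hx.1, hsrc])

end EraseK

/-! ### Coarse graining of lists of steps -/

section Group
variable {α β : Type*}

/-- Auxiliary to `group`: `p` is the last vertex of `S` that was hit. -/
def groupAux (S : Finset Pt) (tgt : α → Pt) : Pt → List α → List α → List (List α)
  | _, _, [] => []
  | p, acc, s :: t =>
    if tgt s ∈ S ∧ tgt s ≠ p then (acc ++ [s]) :: groupAux S tgt (tgt s) [] t
    else groupAux S tgt p (acc ++ [s]) t

/-- The steps grouped according to the successive hitting times of `S`. -/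
def group (S : Finset Pt) (src tgt : α → Pt) : List α → List (List α)
  | [] => []
  | s :: t => groupAux S tgt (src s) [] (s :: t)

/-- The starting point of a list of steps. -/
def gsrc (src : α → Pt) (g : List α) : Pt := (g.head?.map src).getD vO

/-- The end point of a list of steps. -/
def gtgt (tgt : α → Pt) (g : List α) : Pt := (g.getLast?.map tgt).getD vO

/-- The triangle of level `M` with the vertices `x` and `y`. -/
def tri (M : ℕ) (x y : Pt) : Finset Pt := ((cellsV M).filter fun D => x ∈ D ∧ y ∈ D).sup id

/-- The groups of level `j` in one triangle. -/
def triRuns (j : ℕ) (src tgt : α → Pt) (l : List α) : List (List α) :=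
  l.splitBy fun g g' => decide (tri j (src g) (tgt g) = tri j (src g') (tgt g'))

/-- One stage of loop erasure on a list of steps. -/
def stage (src tgt : α → Pt) (j : ℕ) (l : List α) : List α :=
  ((triRuns j (gsrc src) (gtgt tgt) (group (vertV j) src tgt l)).flatMap fun r =>
    eraseK (gsrc src) (gtgt tgt) (group (vertV (j + 1)) src tgt r.flatten)).flatten

/-- The first stages of loop erasure on a list of steps. -/
def stages (src tgt : α → Pt) : ℕ → List α → List α
  | 0, l => l
  | j + 1, l => stage src tgt j (stages src tgt j l)

lemma splitBy_loop_map (f : α → β) (r : β → β → Bool) (l : List α) (a : α) (g : List α)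
    (gs : List (List α)) :
    splitBy.loop r (l.map f) (f a) (g.map f) (gs.map (List.map f)) =
      (splitBy.loop (fun x y => r (f x) (f y)) l a g gs).map (List.map f) := by
  induction l generalizing a g gs with
  | nil => simp [splitBy.loop]
  | cons b l ih =>
    simp only [map_cons, splitBy.loop]
    cases r (f a) (f b) with
    | true => exact ih b (a :: g) gs
    | false => simpa using ih b [] ((a :: g).reverse :: gs)

lemma splitBy_map (f : α → β) (r : β → β → Bool) (l : List α) :
    (l.map f).splitBy r = (l.splitBy fun x y => r (f x) (f y)).map (List.map f) := by
  cases l with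
  | nil => rfl
  | cons a l => exact splitBy_loop_map f r l a [] []

lemma splitBy_loop_congr {r r' : α → α → Bool} (l : List α) (a : α) (g : List α)
    (gs : List (List α)) (h : ∀ x ∈ a :: l, ∀ y ∈ a :: l, r x y = r' x y) :
    splitBy.loop r l a g gs = splitBy.loop r' l a g gs := by
  induction l generalizing a g gs <;> grind [splitBy.loop]

lemma splitBy_congr {r r' : α → α → Bool} {l : List α}
    (h : ∀ x ∈ l, ∀ y ∈ l, r x y = r' x y) : l.splitBy r = l.splitBy r' := by
  cases l with
  | nil => rfl
  | cons a l => exact splitBy_loop_congr l a [] [] h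

lemma groupAux_map (S : Finset Pt) {tgt : α → Pt} {tgt' : β → Pt} (f : α → β)
    {l : List α} (ht : ∀ s ∈ l, tgt' (f s) = tgt s) (p : Pt) (acc : List α) :
    groupAux S tgt' p (acc.map f) (l.map f) = (groupAux S tgt p acc l).map (List.map f) := by
  induction l generalizing p acc <;> grind [groupAux]

lemma group_map (S : Finset Pt) {src tgt : α → Pt} {src' tgt' : β → Pt} (f : α → β)
    {l : List α} (hs : ∀ s ∈ l, src' (f s) = src s) (ht : ∀ s ∈ l, tgt' (f s) = tgt s) :
    group S src' tgt' (l.map f) = (group S src tgt l).map (List.map f) := by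
  cases l with
  | nil => rfl
  | cons s t =>
    simp only [map_cons, group, hs s (by simp)]
    exact groupAux_map S f ht (src s) []

lemma groupAux_flatten (S : Finset Pt) (tgt : α → Pt) (l : List α) (p : Pt) (acc : List α) :
    (groupAux S tgt p acc l).flatten <+: acc ++ l := by
  induction l generalizing p acc with
  | nil => simp [groupAux]
  | cons s t ih =>
    rw [groupAux]
    split
    · rw [flatten_cons]
      have := ih (tgt s) []
      rw [List.nil_append] at this
      calc _ <+: (acc ++ [s]) ++ t := (List.prefix_append_right_inj _).2 this
        _ = _ := by simp
    · have := ih p (acc ++ [s])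
      simpa using this

lemma group_flatten (S : Finset Pt) (src tgt : α → Pt) (l : List α) :
    (group S src tgt l).flatten <+: l := by
  cases l with
  | nil => simp [group]
  | cons s t => exact groupAux_flatten S tgt (s :: t) (src s) []

lemma mem_of_mem_group {S : Finset Pt} {src tgt : α → Pt} {l g : List α} {s : α}
    (hg : g ∈ group S src tgt l) (hs : s ∈ g) : s ∈ l :=
  (group_flatten S src tgt l).subset (mem_flatten.2 ⟨g, hg, hs⟩)

lemma groupAux_ne_nil {S : Finset Pt} {tgt : α → Pt} {l : List α} {p : Pt} {acc : List α}
    {g : List α} (hg : g ∈ groupAux S tgt p acc l) : g ≠ [] := by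
  induction l generalizing p acc with
  | nil => simp [groupAux] at hg
  | cons s t ih =>
    rw [groupAux] at hg
    split at hg
    · rcases mem_cons.1 hg with rfl | hg
      · simp
      · exact ih hg
    · exact ih hg

lemma group_ne_nil {S : Finset Pt} {src tgt : α → Pt} {l : List α}
    {g : List α} (hg : g ∈ group S src tgt l) : g ≠ [] := by
  cases l with
  | nil => simp [group] at hg
  | cons s t => exact groupAux_ne_nil hg

lemma gsrc_map {src : α → Pt} {src' : β → Pt} (f : α → β) {g : List α}
    (hs : ∀ s ∈ g, src' (f s) = src s) : gsrc src' (g.map f) = gsrc src g := by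
  cases g with
  | nil => rfl
  | cons s t => simp [gsrc, hs]

lemma gtgt_map {tgt : α → Pt} {tgt' : β → Pt} (f : α → β) {g : List α}
    (hs : ∀ s ∈ g, tgt' (f s) = tgt s) : gtgt tgt' (g.map f) = gtgt tgt g := by
  rcases eq_nil_or_concat g with rfl | ⟨L, s, rfl⟩
  · rfl
  · simp [gtgt, hs]

lemma gtgt_concat (tgt : α → Pt) (t : List α) (s : α) : gtgt tgt (t ++ [s]) = tgt s := by
  simp [gtgt]

lemma IsTrail.gsrc_eq {src tgt : α → Pt} {x y : Pt} {l : List α} (h : IsTrail src tgt x l y)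
    (hl : l ≠ []) : gsrc src l = x := by
  cases l with
  | nil => exact absurd rfl hl
  | cons s t => exact h.1

lemma IsTrail.gtgt_eq {src tgt : α → Pt} {x y : Pt} {l : List α} (h : IsTrail src tgt x l y)
    (hl : l ≠ []) : gtgt tgt l = y := by
  rcases eq_nil_or_concat l with rfl | ⟨L, s, rfl⟩
  · exact absurd rfl hl
  · rw [concat_eq_append, isTrail_append] at h
    obtain ⟨z, _, h⟩ := h
    rw [concat_eq_append, gtgt_concat]; exact h.2

lemma triRuns_map {src tgt : α → Pt} {src' tgt' : β → Pt} (f : α → β) {l : List α} (j : ℕ)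
    (hs : ∀ s ∈ l, src' (f s) = src s) (ht : ∀ s ∈ l, tgt' (f s) = tgt s) :
    triRuns j src' tgt' (l.map f) = (triRuns j src tgt l).map (List.map f) := by
  rw [triRuns, splitBy_map]
  congr 1
  exact splitBy_congr fun x hx y hy => by rw [hs x hx, hs y hy, ht x hx, ht y hy]

lemma triRuns_flatten (j : ℕ) (src tgt : α → Pt) (l : List α) :
    (triRuns j src tgt l).flatten = l := List.flatten_splitBy _ _

lemma mem_of_mem_triRuns {j : ℕ} {src tgt : α → Pt} {l r : List α} {s : α}
    (hg : r ∈ triRuns j src tgt l) (hs : s ∈ r) : s ∈ l := by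
  rw [← triRuns_flatten j src tgt l]; exact mem_flatten.2 ⟨r, hg, hs⟩

lemma flatMap_sublist {γ δ : Type*} {f : γ → List δ} {g : γ → List δ} {l : List γ}
    (h : ∀ a ∈ l, (f a).Sublist (g a)) : (l.flatMap f).Sublist (l.flatMap g) := by
  induction l <;> grind

lemma stage_sublist (src tgt : α → Pt) (j : ℕ) (l : List α) :
    (stage src tgt j l).Sublist l := by
  rw [stage, flatMap_def, flatten_flatten, List.map_map, ← flatMap_def]
  refine (flatMap_sublist (g := List.flatten) fun r _ =>
    ((eraseK_sublist _ _ _).flatten).trans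
      (group_flatten (vertV (j + 1)) src tgt r.flatten).sublist).trans ?_
  have : (triRuns j (gsrc src) (gtgt tgt) (group (vertV j) src tgt l)).flatMap List.flatten =
      (group (vertV j) src tgt l).flatten := by
    conv_rhs => rw [← triRuns_flatten j (gsrc src) (gtgt tgt) (group (vertV j) src tgt l)]
    rw [flatten_flatten, flatMap_def]
  rw [this]
  exact (group_flatten (vertV j) src tgt l).sublist

lemma stages_sublist (src tgt : α → Pt) (j : ℕ) (l : List α) :
    (stages src tgt j l).Sublist l := by
  induction j with
  | zero => exact List.Sublist.refl _
  | succ j ih => exact (stage_sublist src tgt j _).trans ih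

lemma stage_map {src tgt : α → Pt} {src' tgt' : β → Pt} (f : α → β) (j : ℕ)
    {l : List α} (hs : ∀ s ∈ l, src' (f s) = src s) (ht : ∀ s ∈ l, tgt' (f s) = tgt s) :
    stage src' tgt' j (l.map f) = (stage src tgt j l).map f := by
  have h1 := group_map (vertV j) f hs ht
  have h2 : ∀ g ∈ group (vertV j) src tgt l, gsrc src' (g.map f) = gsrc src g := fun g hg =>
    gsrc_map f fun s hs' => hs s (mem_of_mem_group hg hs')
  have h3 : ∀ g ∈ group (vertV j) src tgt l, gtgt tgt' (g.map f) = gtgt tgt g := fun g hg =>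
    gtgt_map f fun s hs' => ht s (mem_of_mem_group hg hs')
  rw [stage, h1, triRuns_map (List.map f) j h2 h3, stage, map_flatten, flatMap_map,
    List.map_flatMap]
  congr 1
  rw [flatMap_def, flatMap_def]
  congr 1
  refine map_congr_left fun r hr => ?_
  have hr' : ∀ s ∈ r.flatten, s ∈ l := by
    intro s hs'
    obtain ⟨g, hg, hsg⟩ := mem_flatten.1 hs'
    exact mem_of_mem_group (mem_of_mem_triRuns hr hg) hsg
  rw [← map_flatten, group_map (vertV (j + 1)) f (fun s h => hs s (hr' s h))
    fun s h => ht s (hr' s h)]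
  refine eraseK_map (List.map f) _ fun g hg g' hg' => ?_
  rw [gtgt_map f fun s h => ht s (hr' s (mem_of_mem_group hg h)),
    gsrc_map f fun s h => hs s (hr' s (mem_of_mem_group hg' h))]

lemma stages_map {src tgt : α → Pt} {src' tgt' : β → Pt} (f : α → β) (j : ℕ)
    {l : List α} (hs : ∀ s ∈ l, src' (f s) = src s) (ht : ∀ s ∈ l, tgt' (f s) = tgt s) :
    stages src' tgt' j (l.map f) = (stages src tgt j l).map f := by
  induction j with
  | zero => rfl
  | succ j ih =>
    rw [stages, ih, stage_map (src := src) (tgt := tgt) f j, stages]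
    · exact fun s h => hs s ((stages_sublist src tgt j l).subset h)
    · exact fun s h => ht s ((stages_sublist src tgt j l).subset h)

end Group

/-! ### Paths as lists of segments -/

/-- The starting point of a path. -/
def src₀ (s : List Pt) : Pt := s.headD vO

/-- The end point of a path. -/
def tgt₀ (s : List Pt) : Pt := s.getLastD vO

/-- `s` has at least one step and hits no vertex of `S` before its end, except its starting
point. -/
def IsSeg (S : Finset Pt) (s : List Pt) : Prop :=
  ∃ x m y, s = x :: (m ++ [y]) ∧ ∀ p ∈ m, p ∈ S → p = x

lemma IsSeg.mono {S S' : Finset Pt} {s : List Pt} (h : IsSeg S s) (hS : S' ⊆ S) :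
    IsSeg S' s := by
  obtain ⟨x, m, y, rfl, h⟩ := h
  exact ⟨x, m, y, rfl, fun p hp hp' => h p hp (hS hp')⟩

lemma IsSeg.ne_nil {S : Finset Pt} {s : List Pt} (h : IsSeg S s) : s ≠ [] := by
  obtain ⟨x, m, y, rfl, h⟩ := h; simp

lemma IsSeg.tail_ne_nil {S : Finset Pt} {s : List Pt} (h : IsSeg S s) : s.tail ≠ [] := by
  obtain ⟨x, m, y, rfl, h⟩ := h; simp

lemma tgt₀_concat (l : List Pt) (y : Pt) : tgt₀ (l ++ [y]) = y := by
  simp [tgt₀, List.getLastD_eq_getLast?]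

lemma tgt₀_cons_concat (x : Pt) (l : List Pt) (y : Pt) : tgt₀ (x :: (l ++ [y])) = y :=
  tgt₀_concat (x :: l) y

lemma src₀_eq_of_head? {s : List Pt} {x : Pt} (h : s.head? = some x) : src₀ s = x := by
  cases s with
  | nil => simp at h
  | cons a t => simpa [src₀] using h

lemma head?_eq_src₀ {s : List Pt} (h : s ≠ []) : s.head? = some (src₀ s) := by
  cases s with
  | nil => exact absurd rfl h
  | cons a t => rfl

lemma getLast?_eq_tgt₀ {s : List Pt} (h : s ≠ []) : s.getLast? = some (tgt₀ s) := by
  rcases eq_nil_or_concat s with rfl | ⟨L, a, rfl⟩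
  · exact absurd rfl h
  · rw [concat_eq_append, tgt₀_concat]; simp

/-- The path that starts from `x` and follows the segments `ss`. -/
def gl (x : Pt) (ss : List (List Pt)) : List Pt := x :: ss.flatMap tail

lemma gl_append (x : Pt) (A B : List (List Pt)) :
    gl x (A ++ B) = gl x A ++ B.flatMap tail := by simp [gl]

lemma glue_append {A : List (List Pt)} (B : List (List Pt)) (hA : ∀ s ∈ A, s ≠ [])
    (hA' : A ≠ []) : glue (A ++ B) = glue A ++ (glue B).tail := by
  induction A with
  | nil => exact absurd rfl hA'
  | cons s A ih =>
    cases A with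
    | nil => simp [glue]
    | cons s' A =>
      grind [glue]

lemma glue_map_glue {L : List (List (List Pt))} (hL : ∀ g ∈ L, g ≠ [])
    (hs : ∀ g ∈ L, ∀ s ∈ g, s ≠ []) : glue (L.map glue) = glue L.flatten := by
  induction L with
  | nil => rfl
  | cons g L ih =>
    rw [map_cons, flatten_cons, glue, ih (fun g hg => hL g (by simp [hg]))
      (fun g hg => hs g (by simp [hg])), glue_append _ (hs g (by simp)) (hL g (by simp))]

lemma glue_tail {A : List (List Pt)} (hA : ∀ s ∈ A, s ≠ []) :
    (glue A).tail = A.flatMap tail := by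
  induction A with
  | nil => rfl
  | cons s A ih =>
    rw [glue, List.tail_append_of_ne_nil (hA s (by simp)), ih fun s hs => hA s (by simp [hs]),
      flatMap_cons]

lemma glue_eq_gl {A : List (List Pt)} {x y : Pt} (hA : ∀ s ∈ A, s ≠ []) (hA' : A ≠ [])
    (h : IsTrail src₀ tgt₀ x A y) : glue A = gl x A := by
  rw [gl, ← glue_tail hA]
  cases A with
  | nil => exact absurd rfl hA'
  | cons s A =>
    have hs := hA s (by simp)
    obtain ⟨a, s, rfl⟩ := exists_cons_of_ne_nil hs
    have : a = x := h.1
    simp [glue, this]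

lemma gl_ne_nil (x : Pt) (A : List (List Pt)) : gl x A ≠ [] := by simp [gl]

lemma tgt₀_gl {A : List (List Pt)} {x y : Pt} {S : Finset Pt} (hA : ∀ s ∈ A, IsSeg S s)
    (h : IsTrail src₀ tgt₀ x A y) : tgt₀ (gl x A) = y := by
  induction A using List.reverseRecOn with
  | nil => exact h
  | append_singleton A s _ =>
    obtain ⟨a, m, b, rfl, -⟩ := hA s (by simp)
    rw [isTrail_append] at h
    obtain ⟨z, -, -, h⟩ := h
    rw [tgt₀_cons_concat] at h
    rw [gl_append]
    simp only [flatMap_cons, List.tail_cons, List.flatMap_nil, List.append_nil,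
      ← List.append_assoc, tgt₀_concat]
    exact h

lemma splitAux_append {S : Finset Pt} {p : Pt} {acc m rest : List Pt}
    (h : ∀ q ∈ m, q ∈ S → q = p) :
    splitAux S p acc (m ++ rest) = splitAux S p (acc ++ m) rest := by
  induction m generalizing acc with
  | nil => simp
  | cons a m ih =>
    rw [cons_append, splitAux, if_neg, ih fun q hq => h q (by simp [hq])]
    · simp
    · rintro ⟨h1, h2⟩; exact h2 (h a (by simp) h1)

lemma splitAux_flatMap {S : Finset Pt} {ss acc : List (List Pt)} {p c y : Pt}
    (hss : ∀ s ∈ ss, IsSeg S s) (hacc : ∀ s ∈ acc, IsSeg S s) (h : IsTrail src₀ tgt₀ c ss y)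
    (h' : IsTrail src₀ tgt₀ p acc c) (hc : c ∈ S → c = p) :
    splitAux S p (gl p acc) (ss.flatMap tail) = (groupAux S tgt₀ p acc ss).map glue := by
  induction ss generalizing acc p c with
  | nil => simp [splitAux, groupAux]
  | cons s ss ih =>
    have hs := hss s (by simp)
    obtain ⟨a, m, b, rfl, hm⟩ := hs
    have hss' : ∀ s ∈ ss, IsSeg S s := fun s hs => hss s (by simp [hs])
    have hac : a = c := h.1
    have h2 := h.2
    rw [tgt₀_cons_concat] at h2
    subst hac
    have hacc' : ∀ s ∈ acc ++ [a :: (m ++ [b])], IsSeg S s := by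
      grind
    have htr : IsTrail src₀ tgt₀ p (acc ++ [a :: (m ++ [b])]) b :=
      isTrail_append.2 ⟨a, h', rfl, tgt₀_cons_concat _ _ _⟩
    have hgl : gl p acc ++ m ++ [b] = gl p (acc ++ [a :: (m ++ [b])]) := by
      rw [gl_append]; simp
    rw [flatMap_cons, List.tail_cons, List.append_assoc,
      splitAux_append (fun q hq hqS => by
        grind), groupAux, tgt₀_cons_concat, List.singleton_append, splitAux]
    split_ifs with hb
    · rw [map_cons, hgl, glue_eq_gl (fun s hs => (hacc' s hs).ne_nil) (by simp) htr]
      congr 1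
      exact ih (acc := []) hss' (by simp) h2 rfl fun _ => rfl
    · grind

lemma split_glue {S : Finset Pt} {ss : List (List Pt)} {x y : Pt}
    (hss : ∀ s ∈ ss, IsSeg S s) (h : IsTrail src₀ tgt₀ x ss y) :
    split S (glue ss) = (group S src₀ tgt₀ ss).map glue := by
  cases hs : ss with
  | nil => rfl
  | cons s t =>
    rw [← hs, glue_eq_gl (fun s hs => (hss s hs).ne_nil) (by simp [hs]) h, gl, split]
    have hx : src₀ s = x := by rw [hs] at h; exact h.1
    have : group S src₀ tgt₀ ss = groupAux S tgt₀ x [] ss := by rw [hs, group, hx]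
    rw [this]
    exact splitAux_flatMap (acc := []) hss (by simp) h rfl fun _ => rfl

/-- The vertices of level `M` in the future of a path that has last hit `p`. -/
def coarseAux (S : Finset Pt) : Pt → List Pt → List Pt
  | _, [] => []
  | p, y :: t => if y ∈ S ∧ y ≠ p then y :: coarseAux S y t else coarseAux S p t

lemma coarse_cons {M : ℕ} {x : Pt} (hx : x ∈ vertV M) (l : List Pt) :
    coarse M (x :: l) = x :: coarseAux (vertV M) x l := by
  have key : ∀ (l : List Pt) (p : Pt), List.destutter' (· ≠ ·) p
      (l.filter (· ∈ vertV M)) = p :: coarseAux (vertV M) p l := by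
    intro l
    induction l with
    | nil => intro p; simp [coarseAux]
    | cons y t ih =>
      grind [List.destutter'_cons, coarseAux]
  rw [coarse, List.filter_cons_of_pos (by simpa using hx), List.destutter_cons', key]

lemma coarseAux_append {S : Finset Pt} {p : Pt} {m rest : List Pt}
    (h : ∀ q ∈ m, q ∈ S → q = p) : coarseAux S p (m ++ rest) = coarseAux S p rest := by
  induction m with
  | nil => simp
  | cons a m ih =>
    rw [cons_append, coarseAux, if_neg, ih fun q hq => h q (by simp [hq])]
    rintro ⟨h1, h2⟩; exact h2 (h a (by simp) h1)

lemma coarseAux_flatMap {S : Finset Pt} {ss : List (List Pt)} {p c y : Pt}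
    (hss : ∀ s ∈ ss, IsSeg S s) (h : IsTrail src₀ tgt₀ c ss y) (hc : c ∈ S → c = p) :
    coarseAux S p (ss.flatMap tail) = coarseAux S p (ss.map tgt₀) := by
  induction ss generalizing p c with
  | nil => rfl
  | cons s ss ih =>
    obtain ⟨a, m, b, rfl, hm⟩ := hss s (by simp)
    have hss' : ∀ s ∈ ss, IsSeg S s := fun s hs => hss s (by simp [hs])
    have hac : a = c := h.1
    have h2 := h.2
    rw [tgt₀_cons_concat] at h2
    subst hac
    rw [flatMap_cons, List.tail_cons, List.append_assoc, coarseAux_append (fun q hq hqS => by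
        grind), map_cons, tgt₀_cons_concat, List.singleton_append, coarseAux, coarseAux]
    split_ifs with hb
    · rw [ih hss' h2 fun _ => rfl]
    · exact ih hss' h2 fun hbS => by
        by_contra hne
        exact hb ⟨hbS, hne⟩

/-- The vertices that a list of steps from `x` visits. -/
def verts {α : Type*} (tgt : α → Pt) (x : Pt) (l : List α) : List Pt := x :: l.map tgt

lemma coarse_gl {M : ℕ} {ss : List (List Pt)} {x y : Pt} (hx : x ∈ vertV M)
    (hss : ∀ s ∈ ss, IsSeg (vertV M) s) (h : IsTrail src₀ tgt₀ x ss y) :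
    coarse M (gl x ss) = coarse M (verts tgt₀ x ss) := by
  rw [gl, coarse_cons hx, verts, coarse_cons hx, coarseAux_flatMap hss h fun _ => rfl]

lemma coarseAux_of_isChain {S : Finset Pt} {p : Pt} {l : List Pt} (hl : ∀ q ∈ l, q ∈ S)
    (h : (p :: l).IsChain (· ≠ ·)) : coarseAux S p l = l := by
  induction l generalizing p with
  | nil => rfl
  | cons a l ih =>
    rw [isChain_cons_cons] at h
    rw [coarseAux, if_pos ⟨hl a (by simp), h.1.symm⟩, ih (fun q hq => hl q (by simp [hq])) h.2]

lemma coarse_of_isChain {M : ℕ} {l : List Pt} (hl : ∀ q ∈ l, q ∈ vertV M)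
    (h : l.IsChain (· ≠ ·)) : coarse M l = l := by
  cases l with
  | nil => rfl
  | cons a l =>
    rw [coarse_cons (hl a (by simp)), coarseAux_of_isChain (fun q hq => hl q (by simp [hq])) h]

/-! ### Completeness of the groups -/

section Complete
variable {α : Type*} {src tgt : α → Pt}

lemma groupAux_flatten_eq {S : Finset Pt} {l acc : List α} {p c y : Pt}
    (h : IsTrail src tgt c l y) (hl : l ≠ []) (hy : y ∈ S) (hp : p ≠ y)
    (hsrc : ∀ s ∈ l, src s ≠ y) : (groupAux S tgt p acc l).flatten = acc ++ l := by
  induction l generalizing p acc c with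
  | nil => exact absurd rfl hl
  | cons s t ih =>
    rw [groupAux]
    have hsrc' : ∀ s ∈ t, src s ≠ y := fun s hs => hsrc s (by simp [hs])
    by_cases ht : t = []
    · subst ht
      have : tgt s = y := h.2
      rw [if_pos ⟨this ▸ hy, this ▸ hp.symm⟩]
      simp [groupAux]
    · split_ifs with hb
      · rw [flatten_cons, ih h.2 ht ?_ hsrc']
        · simp
        · obtain ⟨b, t, rfl⟩ := exists_cons_of_ne_nil ht
          rw [← h.2.1]; exact hsrc b (by simp)
      · rw [ih h.2 ht hp hsrc']; simp

lemma group_flatten_eq {S : Finset Pt} {l : List α} {x y : Pt}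
    (h : IsTrail src tgt x l y) (hy : y ∈ S) (hsrc : ∀ s ∈ l, src s ≠ y) :
    (group S src tgt l).flatten = l := by
  cases l with
  | nil => rfl
  | cons s t => exact groupAux_flatten_eq h (by simp) hy (hsrc s (by simp)) hsrc

/-- If the last step of the list completes a group, the first part may be arbitrary. -/
lemma groupAux_flatten_eq' {S : Finset Pt} {l g acc : List α} {p c x y : Pt}
    (hl : IsTrail src tgt c l x) (hg : IsTrail src tgt x g y) (hg' : g ≠ []) (hx : x ∈ S)
    (hc : c ∈ S → c = p) (hy : y ∈ S) (hsrc : ∀ s ∈ g, src s ≠ y) :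
    (groupAux S tgt p acc (l ++ g)).flatten = acc ++ (l ++ g) := by
  induction l generalizing p acc c with
  | nil =>
    have hcx : c = x := hl
    subst hcx
    obtain ⟨s, t, rfl⟩ := exists_cons_of_ne_nil hg'
    refine groupAux_flatten_eq hg hg' hy ?_ hsrc
    rw [← hc hx, ← hg.1]; exact hsrc s (by simp)
  | cons s t ih =>
    rw [cons_append, groupAux]
    split_ifs with hb
    · rw [flatten_cons, ih hl.2 fun _ => rfl]; simp
    · rw [ih hl.2 fun hbS => by
        by_contra hne
        exact hb ⟨hbS, hne⟩]
      simp

lemma group_flatten_eq' {S : Finset Pt} {l g : List α} {c x y : Pt}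
    (hl : IsTrail src tgt c l x) (hg : IsTrail src tgt x g y) (hg' : g ≠ []) (hx : x ∈ S)
    (hy : y ∈ S) (hsrc : ∀ s ∈ g, src s ≠ y) :
    (group S src tgt (l ++ g)).flatten = l ++ g := by
  cases hlg : l ++ g with
  | nil => simp at hlg; exact absurd hlg.2 hg'
  | cons s t =>
    have hs : src s = c := by
      have : IsTrail src tgt c (l ++ g) y := isTrail_append.2 ⟨x, hl, hg⟩
      rw [hlg] at this; exact this.1
    rw [group, ← hlg]
    exact groupAux_flatten_eq' hl hg hg' hx (fun _ => hs.symm) hy hsrc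

/-- The groups that the steps `groupAux` forms: their end points, and the vertices between. -/
lemma groupAux_spec {S : Finset Pt} {l acc : List α} {p c y : Pt}
    (h : IsTrail src tgt c l y) (hacc : IsTrail src tgt p acc c) (hc : c ∈ S → c = p)
    (hacc' : ∀ s ∈ acc, src s ∈ S → src s = p) :
    (∀ g ∈ groupAux S tgt p acc l, IsTrail src tgt (gsrc src g) g (gtgt tgt g) ∧
      gtgt tgt g ∈ S ∧ gtgt tgt g ≠ gsrc src g ∧ (∀ s ∈ g, src s ∈ S → src s = gsrc src g) ∧
      (gsrc src g = p ∨ gsrc src g ∈ S)) ∧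
    ∃ z, IsTrail (gsrc src) (gtgt tgt) p (groupAux S tgt p acc l) z := by
  induction l generalizing acc p c with
  | nil => exact ⟨by simp [groupAux], p, rfl⟩
  | cons s t ih =>
    have h1 : src s = c := h.1
    have h2 := h.2
    have htr : IsTrail src tgt p (acc ++ [s]) (tgt s) :=
      isTrail_append.2 ⟨c, hacc, h1, rfl⟩
    have hacc2 : ∀ r ∈ acc ++ [s], src r ∈ S → src r = p := by
      grind
    have e1 : gsrc src (acc ++ [s]) = p := htr.gsrc_eq (by simp)
    have e2 : gtgt tgt (acc ++ [s]) = tgt s := gtgt_concat _ _ _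
    rw [groupAux]
    split_ifs with hb
    · obtain ⟨i1, z, i2⟩ := ih (acc := []) h2 rfl (fun _ => rfl) (by simp)
      refine ⟨?_, z, e1, ?_⟩
      · grind
      · rw [e2]; exact i2
    · exact ih h2 htr (fun hbS => by
        by_contra hne
        exact hb ⟨hbS, hne⟩) hacc2

lemma group_spec {S : Finset Pt} {l : List α} {x y : Pt} (h : IsTrail src tgt x l y) :
    (∀ g ∈ group S src tgt l, IsTrail src tgt (gsrc src g) g (gtgt tgt g) ∧
      gtgt tgt g ∈ S ∧ gtgt tgt g ≠ gsrc src g ∧ (∀ s ∈ g, src s ∈ S → src s = gsrc src g) ∧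
      (gsrc src g = x ∨ gsrc src g ∈ S)) ∧
    ∃ z, IsTrail (gsrc src) (gtgt tgt) x (group S src tgt l) z := by
  cases l with
  | nil => exact ⟨by simp [group], x, rfl⟩
  | cons s t =>
    rw [group, h.1]
    exact groupAux_spec h rfl (fun _ => rfl) (by simp)

lemma isTrail_flatten {L : List (List α)} {x y : Pt} (hne : ∀ g ∈ L, g ≠ [])
    (hg : ∀ g ∈ L, IsTrail src tgt (gsrc src g) g (gtgt tgt g)) :
    IsTrail src tgt x L.flatten y ↔ IsTrail (gsrc src) (gtgt tgt) x L y := by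
  induction L generalizing x with
  | nil => rfl
  | cons g L ih =>
    have ih' := fun x => ih (x := x) (fun g hg => hne g (by simp [hg]))
      (fun g' hg' => hg g' (by simp [hg']))
    have h1 := hg g (by simp)
    rw [flatten_cons, isTrail_append]
    constructor
    · rintro ⟨z, h2, h3⟩
      have e1 := h2.gsrc_eq (hne g (by simp))
      have e2 := h2.gtgt_eq (hne g (by simp))
      exact ⟨e1, (ih' _).1 (e2 ▸ h3)⟩
    · rintro ⟨e1, h3⟩
      exact ⟨_, e1 ▸ h1, (ih' _).2 h3⟩

end Complete

/-! ### The triangles in lattice coordinates -/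

/-- The lattice point of level `N` with integer coordinates `i`, `j`. -/
def pt (N : ℕ) (i j : ℤ) : Pt := ((i : ℚ) / 2 ^ N, (j : ℚ) / 2 ^ N)

/-- The upward triangle of level `N` with lower left vertex `pt N i j`. -/
def lcell (N : ℕ) (i j : ℤ) : Finset Pt := {pt N i j, pt N (i + 1) j, pt N i (j + 1)}

/-- The three triangles of the next level in a triangle. -/
def sub (D : Finset Pt) : Finset (Finset Pt) := D.image fun c => D.image (contr c)

lemma pt_inj {N : ℕ} {i j i' j' : ℤ} : pt N i j = pt N i' j' ↔ i = i' ∧ j = j' := by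
  have h : (2 : ℚ) ^ N ≠ 0 := by positivity
  simp [pt, div_left_inj' h]

lemma pt_succ (N : ℕ) (i j : ℤ) : pt N i j = pt (N + 1) (2 * i) (2 * j) := by
  have h : (2 : ℚ) ^ N ≠ 0 := by positivity
  simp only [pt, pow_succ, Int.cast_mul, Int.cast_ofNat]
  ext <;> field_simp

lemma contr_pt (N : ℕ) (i j i' j' : ℤ) :
    contr (pt N i j) (pt N i' j') = pt (N + 1) (i + i') (j + j') := by
  have h : (2 : ℚ) ^ N ≠ 0 := by positivity
  simp only [pt, contr, pow_succ, Int.cast_add]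
  ext <;> field_simp <;> ring

lemma mem_lcell {N : ℕ} {i j i' j' : ℤ} : pt N i' j' ∈ lcell N i j ↔
    (i' = i ∧ j' = j) ∨ (i' = i + 1 ∧ j' = j) ∨ (i' = i ∧ j' = j + 1) := by
  simp [lcell, pt_inj]

lemma exists_of_mem_lcell {N : ℕ} {i j : ℤ} {x : Pt} (h : x ∈ lcell N i j) :
    ∃ i' j', x = pt N i' j' ∧
      ((i' = i ∧ j' = j) ∨ (i' = i + 1 ∧ j' = j) ∨ (i' = i ∧ j' = j + 1)) := by
  grind [lcell]

lemma contr_self (x : Pt) : contr x x = x := by ext <;> simp [contr]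

lemma contr_comm (x y : Pt) : contr x y = contr y x := by
  ext <;> simp only [contr] <;> ring

lemma contr_inj {x y z : Pt} : contr x y = contr x z ↔ y = z := by
  constructor
  · intro h
    simp only [contr, Prod.mk.injEq] at h
    ext <;> linarith [h.1, h.2]
  · rintro rfl; rfl

lemma contr_lcell_origin (N : ℕ) (a b i j : ℤ) :
    (lcell N i j).image (contr (a, b)) = lcell (N + 1) (i + a * 2 ^ N) (j + b * 2 ^ N) := by
  have h : (2 : ℚ) ^ N ≠ 0 := by positivity
  have e : ∀ i j : ℤ, contr (a, b) (pt N i j) = pt (N + 1) (i + a * 2 ^ N) (j + b * 2 ^ N) := by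
    intro i j
    simp only [pt, contr, pow_succ]
    push_cast
    ext <;> field_simp
  simp only [lcell, image_insert, image_singleton, e]
  congr 2
  · ring_nf
  · ring_nf

lemma cells'_spec {N : ℕ} {D : Finset Pt} (h : D ∈ cells' N) :
    ∃ i j : ℤ, D = lcell N i j ∧ 0 ≤ i ∧ 0 ≤ j ∧ i + j + 1 ≤ 2 ^ N := by
  induction N generalizing D with
  | zero =>
    rw [cells', mem_singleton] at h
    refine ⟨0, 0, ?_, by norm_num⟩
    rw [h, lcell, vO, va, vb]
    simp [pt]
    ext x; simp; tauto
  | succ N ih =>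
    simp only [cells', mem_biUnion, mem_image] at h
    obtain ⟨c, hc, D', hD', rfl⟩ := h
    obtain ⟨i, j, rfl, h0, h1, h2⟩ := ih hD'
    have hpow : (2 : ℤ) ^ (N + 1) = 2 * 2 ^ N := by ring
    have hp : (0 : ℤ) < 2 ^ N := by positivity
    simp only [mem_insert, mem_singleton] at hc
    rcases hc with rfl | rfl | rfl
    · refine ⟨_, _, by simpa [vO] using contr_lcell_origin N 0 0 i j, ?_⟩
      omega
    · refine ⟨_, _, by simpa [va] using contr_lcell_origin N 0 1 i j, ?_⟩
      omega
    · refine ⟨_, _, by simpa [vb] using contr_lcell_origin N 1 0 i j, ?_⟩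
      omega

lemma mirror_lcell (N : ℕ) (i j : ℤ) :
    (lcell N i j).image mirror = lcell N (-i - j - 1) j := by
  have e : ∀ i j : ℤ, mirror (pt N i j) = pt N (-i - j) j := by
    intro i j
    simp only [pt, mirror]; push_cast
    ext <;> simp; ring
  simp only [lcell, image_insert, image_singleton, e]
  ext x
  simp only [mem_insert, mem_singleton]
  ring_nf
  tauto

lemma shift_lcell (N : ℕ) (i j : ℤ) :
    ((lcell N i j).image fun x => x + vb) = lcell N (i + 2 ^ N) j := by
  have h : (2 : ℚ) ^ N ≠ 0 := by positivity
  have e : ∀ i j : ℤ, pt N i j + vb = pt N (i + 2 ^ N) j := by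
    intro i j
    simp only [pt, vb]; push_cast
    ext <;> simp; field_simp
  simp only [lcell, image_insert, image_singleton, e]
  congr 2
  · ring_nf

lemma cells_spec {N : ℕ} {D : Finset Pt} (h : D ∈ cells N) :
    ∃ i j : ℤ, D = lcell N i j ∧ 0 ≤ j ∧ i + j + 1 ≤ 2 ^ N := by
  rw [cells, mem_union, mem_image] at h
  have hp : (0 : ℤ) < 2 ^ N := by positivity
  rcases h with h | ⟨D', h, rfl⟩
  · obtain ⟨i, j, rfl, h0, h1, h2⟩ := cells'_spec h
    exact ⟨i, j, rfl, h1, h2⟩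
  · obtain ⟨i, j, rfl, h0, h1, h2⟩ := cells'_spec h
    exact ⟨_, _, mirror_lcell N i j, h1, by omega⟩

lemma cellsV_spec {N : ℕ} {D : Finset Pt} (h : D ∈ cellsV N) : ∃ i j : ℤ, D = lcell N i j := by
  rw [cellsV, mem_union, mem_image] at h
  rcases h with h | ⟨D', h, rfl⟩
  · obtain ⟨i, j, rfl, -⟩ := cells_spec h
    exact ⟨i, j, rfl⟩
  · obtain ⟨i, j, rfl, -⟩ := cells'_spec h
    exact ⟨_, _, shift_lcell N i j⟩

lemma sub_image {f : Pt → Pt} (hf : ∀ c x, f (contr c x) = contr (f c) (f x))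
    (D : Finset Pt) : sub (D.image f) = (sub D).image (image f) := by
  rw [sub, sub, image_image, image_image]
  congr 1
  funext c
  simp only [Function.comp, image_image]
  congr 1
  funext x
  exact (hf c x).symm

lemma cells'_succ_eq (N : ℕ) : cells' (N + 1) =
    ({vO, va, vb} : Finset Pt).biUnion fun c => (cells' N).image (image (contr c)) := rfl

lemma cells'_succ (N : ℕ) : cells' (N + 1) = (cells' N).biUnion sub := by
  induction N with
  | zero =>
    have h0 : cells' 0 = {{vO, va, vb}} := rfl
    rw [cells'_succ_eq, h0, Finset.singleton_biUnion, sub]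
    ext D
    simp only [mem_biUnion, mem_insert, mem_singleton, mem_image]
    constructor
    · rintro ⟨c, hc, E, rfl, rfl⟩; exact ⟨c, hc, rfl⟩
    · rintro ⟨c, hc, rfl⟩; exact ⟨c, hc, _, rfl, rfl⟩
  | succ N ih =>
    rw [cells'_succ_eq (N + 1), ih]
    conv_rhs => rw [← ih, cells'_succ_eq]
    ext D
    simp only [mem_biUnion, mem_image]
    have hsub : ∀ (c : Pt) E, sub (E.image (contr c)) = (sub E).image (image (contr c)) :=
      fun c E => sub_image (fun d x => by ext <;> simp only [contr] <;> ring) E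
    constructor
    · grind
    · grind

lemma cells_succ (N : ℕ) : cells (N + 1) = (cells N).biUnion sub := by
  rw [cells, cells, cells'_succ, Finset.union_biUnion]
  congr 1
  rw [Finset.image_biUnion, Finset.biUnion_image]
  refine Finset.biUnion_congr rfl fun D _ => (sub_image (fun c x => ?_) D).symm
  ext <;> simp only [contr, mirror] <;> ring

lemma cellsV_succ (N : ℕ) : cellsV (N + 1) = (cellsV N).biUnion sub := by
  rw [cellsV, cellsV, cells_succ, cells'_succ, Finset.union_biUnion]
  congr 1
  rw [Finset.image_biUnion, Finset.biUnion_image]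
  refine Finset.biUnion_congr rfl fun D _ => (sub_image (fun c x => ?_) D).symm
  ext <;> simp only [contr, vb, fst_add, snd_add] <;> ring

lemma cells_subset (N : ℕ) : cells N ⊆ cellsV N := Finset.subset_union_left

lemma mem_vertV {N : ℕ} {x : Pt} : x ∈ vertV N ↔ ∃ D ∈ cellsV N, x ∈ D := by
  simp [vertV]

lemma mem_vert {N : ℕ} {x : Pt} : x ∈ vert N ↔ ∃ D ∈ cells N, x ∈ D := by
  simp [vert]

lemma mem_sub {D Δ : Finset Pt} : Δ ∈ sub D ↔ ∃ c ∈ D, Δ = D.image (contr c) := by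
  simp [sub, eq_comm]

lemma mem_cellsV_succ {N : ℕ} {Δ : Finset Pt} :
    Δ ∈ cellsV (N + 1) ↔ ∃ D ∈ cellsV N, Δ ∈ sub D := by
  simp [cellsV_succ]

lemma mem_subcell {N : ℕ} {D : Finset Pt} (hD : D ∈ cellsV N) {Δ : Finset Pt}
    (hΔ : Δ ∈ sub D) : Δ ∈ cellsV (N + 1) := mem_cellsV_succ.2 ⟨D, hD, hΔ⟩

lemma mem_image_contr {D : Finset Pt} {x : Pt} (hx : x ∈ D) : x ∈ D.image (contr x) :=
  mem_image.2 ⟨x, hx, contr_self x⟩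

lemma vertV_mono_succ (N : ℕ) : vertV N ⊆ vertV (N + 1) := by
  intro x hx
  obtain ⟨D, hD, hx⟩ := mem_vertV.1 hx
  exact mem_vertV.2 ⟨_, mem_subcell hD (mem_sub.2 ⟨x, hx, rfl⟩), mem_image_contr hx⟩

lemma vertV_mono {M N : ℕ} (h : M ≤ N) : vertV M ⊆ vertV N := by
  induction h with
  | refl => exact Finset.Subset.refl _
  | step _ ih => exact ih.trans (vertV_mono_succ _)

lemma cell_eq {N : ℕ} {D D' : Finset Pt} (hD : D ∈ cellsV N) (hD' : D' ∈ cellsV N)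
    {x y : Pt} (hxy : x ≠ y) (hx : x ∈ D) (hy : y ∈ D) (hx' : x ∈ D') (hy' : y ∈ D') :
    D = D' := by
  obtain ⟨i, j, rfl⟩ := cellsV_spec hD
  obtain ⟨i', j', rfl⟩ := cellsV_spec hD'
  obtain ⟨a, b, rfl, h1⟩ := exists_of_mem_lcell hx
  obtain ⟨c, d, rfl, h2⟩ := exists_of_mem_lcell hy
  rw [mem_lcell] at hx' hy'
  have : ¬ (a = c ∧ b = d) := fun h => hxy (by rw [h.1, h.2])
  have h : i = i' ∧ j = j' := by omega
  rw [h.1, h.2]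

lemma exists_pt_of_mem_vertV {N : ℕ} {x : Pt} (hx : x ∈ vertV N) : ∃ i j, x = pt N i j := by
  obtain ⟨D, hD, hx⟩ := mem_vertV.1 hx
  obtain ⟨i, j, rfl⟩ := cellsV_spec hD
  obtain ⟨a, b, rfl, -⟩ := exists_of_mem_lcell hx
  exact ⟨a, b, rfl⟩

lemma contr_notMem_vertV {N : ℕ} {D : Finset Pt} (hD : D ∈ cellsV N) {x y : Pt} (hx : x ∈ D)
    (hy : y ∈ D) (hxy : x ≠ y) : contr x y ∉ vertV N := by
  obtain ⟨i, j, rfl⟩ := cellsV_spec hD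
  obtain ⟨a, b, rfl, h1⟩ := exists_of_mem_lcell hx
  obtain ⟨c, d, rfl, h2⟩ := exists_of_mem_lcell hy
  have : ¬ (a = c ∧ b = d) := fun h => hxy (by rw [h.1, h.2])
  intro h
  obtain ⟨e, f, h⟩ := exists_pt_of_mem_vertV h
  rw [contr_pt, pt_succ N, pt_inj] at h
  omega

/-- Midpoints of sides of different triangles are different. -/
lemma cell_eq_of_contr_eq {N : ℕ} {D D' : Finset Pt} (hD : D ∈ cellsV N) (hD' : D' ∈ cellsV N)
    {x y x' y' : Pt} (hx : x ∈ D) (hy : y ∈ D) (hxy : x ≠ y) (hx' : x' ∈ D') (hy' : y' ∈ D')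
    (hxy' : x' ≠ y') (h : contr x y = contr x' y') : D = D' := by
  obtain ⟨i, j, rfl⟩ := cellsV_spec hD
  obtain ⟨i', j', rfl⟩ := cellsV_spec hD'
  obtain ⟨a, b, rfl, h1⟩ := exists_of_mem_lcell hx
  obtain ⟨c, d, rfl, h2⟩ := exists_of_mem_lcell hy
  obtain ⟨a', b', rfl, h1'⟩ := exists_of_mem_lcell hx'
  obtain ⟨c', d', rfl, h2'⟩ := exists_of_mem_lcell hy'
  rw [contr_pt, contr_pt, pt_inj] at h
  have h3 : ¬ (a = c ∧ b = d) := fun h => hxy (by rw [h.1, h.2])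
  have h4 : ¬ (a' = c' ∧ b' = d') := fun h => hxy' (by rw [h.1, h.2])
  have h : i = i' ∧ j = j' := by omega
  rw [h.1, h.2]

lemma card_cell {N : ℕ} {D : Finset Pt} (hD : D ∈ cellsV N) : D.card = 3 := by
  obtain ⟨i, j, rfl⟩ := cellsV_spec hD
  rw [lcell, Finset.card_eq_three]
  refine ⟨_, _, _, ?_, ?_, ?_, rfl⟩ <;> simp [pt_inj]

lemma exists_third {N : ℕ} {D : Finset Pt} (hD : D ∈ cellsV N) {x y : Pt} (hx : x ∈ D)
    (hy : y ∈ D) (hxy : x ≠ y) : ∃ z, z ≠ x ∧ z ≠ y ∧ D = {x, y, z} := by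
  have h1 : ((D.erase x).erase y).card = 1 := by
    rw [Finset.card_erase_of_mem (mem_erase.2 ⟨hxy.symm, hy⟩), Finset.card_erase_of_mem hx,
      card_cell hD]
  obtain ⟨z, hz⟩ := Finset.card_eq_one.1 h1
  have hz' : z ∈ (D.erase x).erase y := by rw [hz]; simp
  simp only [mem_erase] at hz'
  refine ⟨z, hz'.2.1, hz'.1, ?_⟩
  rw [← Finset.insert_erase hx, ← Finset.insert_erase (mem_erase.2 ⟨hxy.symm, hy⟩), hz]

lemma exists_other {N : ℕ} {D : Finset Pt} (hD : D ∈ cellsV N) {x : Pt} (hx : x ∈ D) :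
    ∃ y z, y ≠ x ∧ z ≠ x ∧ y ≠ z ∧ D = {x, y, z} := by
  have : ∃ y ∈ D, y ≠ x := Finset.exists_mem_ne (by rw [card_cell hD]; norm_num) x
  obtain ⟨y, hy, hyx⟩ := this
  obtain ⟨z, h1, h2, h3⟩ := exists_third hD hx hy hyx.symm
  exact ⟨y, z, hyx, h1, h2.symm, h3⟩

/-- The first coordinates of the vertices of `lcell 0 0 0`. -/
def offX (k : Fin 3) : ℤ := if k = 1 then 1 else 0

/-- The second coordinates of the vertices of `lcell 0 0 0`. -/
def offY (k : Fin 3) : ℤ := if k = 2 then 1 else 0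

lemma exists_off {N : ℕ} {i j : ℤ} {x : Pt} (h : x ∈ lcell N i j) :
    ∃ k, x = pt N (i + offX k) (j + offY k) := by
  obtain ⟨i', j', rfl, h₁⟩ := exists_of_mem_lcell h
  rcases h₁ with ⟨rfl, rfl⟩ | ⟨rfl, rfl⟩ | ⟨rfl, rfl⟩
  · exact ⟨0, by simp [offX, offY]⟩
  · exact ⟨1, by simp [offX, offY]⟩
  · exact ⟨2, by simp [offX, offY]⟩

/-- The vertices of the triangles of the next level in a triangle are its vertices and the
midpoints of its sides. -/
lemma mem_of_mem_sub {D Δ : Finset Pt} (hΔ : Δ ∈ sub D) {x : Pt} (hx : x ∈ Δ) :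
    x ∈ D ∨ ∃ c ∈ D, ∃ d ∈ D, c ≠ d ∧ x = contr c d := by
  obtain ⟨c, hc, rfl⟩ := mem_sub.1 hΔ
  obtain ⟨d, hd, rfl⟩ := mem_image.1 hx
  by_cases h : c = d
  · subst h; left; rwa [contr_self]
  · exact inr ⟨c, hc, d, hd, h, rfl⟩

lemma mem_cell_of_mem_vertV {N : ℕ} {D Δ : Finset Pt} (hD : D ∈ cellsV N) (hΔ : Δ ∈ sub D)
    {x : Pt} (hx : x ∈ Δ) (hx' : x ∈ vertV N) : x ∈ D := by
  rcases mem_of_mem_sub hΔ hx with h | ⟨c, hc, d, hd, hcd, rfl⟩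
  · exact h
  · exact absurd hx' (contr_notMem_vertV hD hc hd hcd)

lemma parent_eq {N : ℕ} {D D' Δ Δ' : Finset Pt} (hD : D ∈ cellsV N) (hD' : D' ∈ cellsV N)
    (hΔ : Δ ∈ sub D) (hΔ' : Δ' ∈ sub D') {x : Pt} (hx : x ∈ Δ) (hx' : x ∈ Δ')
    (h : x ∉ vertV N) : D = D' := by
  rcases mem_of_mem_sub hΔ hx with h1 | ⟨c, hc, d, hd, hcd, rfl⟩
  · exact absurd (mem_vertV.2 ⟨D, hD, h1⟩) h
  rcases mem_of_mem_sub hΔ' hx' with h1 | ⟨c', hc', d', hd', hcd', he⟩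
  · exact absurd (mem_vertV.2 ⟨D', hD', h1⟩) h
  exact cell_eq_of_contr_eq hD hD' hc hd hcd hc' hd' hcd' he

lemma sub_eq_of_mem {N : ℕ} {D Δ : Finset Pt} (hD : D ∈ cellsV N) (hΔ : Δ ∈ sub D)
    {x : Pt} (hx : x ∈ Δ) (hxD : x ∈ D) : Δ = D.image (contr x) := by
  obtain ⟨c, hc, rfl⟩ := mem_sub.1 hΔ
  obtain ⟨d, hd, h⟩ := mem_image.1 hx
  by_cases hcd : c = d
  · rw [← hcd, contr_self] at h; rw [h]
  · exact absurd (mem_vertV.2 ⟨D, hD, h ▸ hxD⟩) (contr_notMem_vertV hD hc hd hcd)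

lemma image_contr_inj {N : ℕ} {D D' : Finset Pt} (hD : D ∈ cellsV N) (hD' : D' ∈ cellsV N)
    {x x' : Pt} (hx : x ∈ D) (hx' : x' ∈ D')
    (h : D.image (contr x) = D'.image (contr x')) : D = D' ∧ x = x' := by
  have hDD : D = D' := by
    obtain ⟨y, z, hyx, -, -, hDe⟩ := exists_other hD hx
    have hy : y ∈ D := by rw [hDe]; simp
    have h1 : contr x y ∈ D'.image (contr x') := h ▸ mem_image_of_mem _ hy
    exact parent_eq hD hD' (mem_sub.2 ⟨x, hx, rfl⟩) (mem_sub.2 ⟨x', hx', rfl⟩)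
      (mem_image_of_mem _ hy) h1 (contr_notMem_vertV hD hx hy hyx.symm)
  subst hDD
  refine ⟨rfl, ?_⟩
  have h1 : x ∈ D.image (contr x') := h ▸ mem_image_contr hx
  obtain ⟨d, hd, h2⟩ := mem_image.1 h1
  by_cases hcd : x' = d
  · rw [← hcd, contr_self] at h2; exact h2.symm
  · exact absurd (mem_vertV.2 ⟨D, hD, h2 ▸ hx⟩) (contr_notMem_vertV hD hx' hd hcd)

/-- `x` is a vertex of exactly two triangles of level `N`. -/
def Inner (N : ℕ) (x : Pt) : Prop :=
  ∃ D ∈ cellsV N, ∃ D' ∈ cellsV N, D ≠ D' ∧ x ∈ D ∧ x ∈ D' ∧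
    ∀ E ∈ cellsV N, x ∈ E → E = D ∨ E = D'

lemma Inner.exists_other {N : ℕ} {x : Pt} (h : Inner N x) {D : Finset Pt} (hD : D ∈ cellsV N)
    (hx : x ∈ D) : ∃ D' ∈ cellsV N, D ≠ D' ∧ x ∈ D' ∧ ∀ E ∈ cellsV N, x ∈ E → E = D ∨ E = D' := by
  obtain ⟨D₁, h1, D₂, h2, hne, hx1, hx2, hall⟩ := h
  rcases hall D hD hx with rfl | rfl
  · exact ⟨D₂, h2, hne, hx2, hall⟩
  · exact ⟨D₁, h1, hne.symm, hx1, fun E hE hxE => (hall E hE hxE).symm⟩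

lemma inner_succ_of_inner {N : ℕ} {x : Pt} (h : Inner N x) : Inner (N + 1) x := by
  obtain ⟨D, hD, D', hD', hne, hx, hx', hall⟩ := h
  refine ⟨_, mem_subcell hD (mem_sub.2 ⟨x, hx, rfl⟩), _, mem_subcell hD' (mem_sub.2 ⟨x, hx', rfl⟩),
    fun h => hne (image_contr_inj hD hD' hx hx' h).1, mem_image_contr hx, mem_image_contr hx', ?_⟩
  intro E hE hxE
  obtain ⟨F, hF, hEF⟩ := mem_cellsV_succ.1 hE
  have hxF : x ∈ F := mem_cell_of_mem_vertV hF hEF hxE (mem_vertV.2 ⟨D, hD, hx⟩)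
  rcases hall F hF hxF with rfl | rfl
  · exact inl (sub_eq_of_mem hF hEF hxE hxF)
  · exact inr (sub_eq_of_mem hF hEF hxE hxF)

lemma inner_succ_of_notMem {N : ℕ} {x : Pt} (hx : x ∈ vertV (N + 1)) (hx' : x ∉ vertV N) :
    Inner (N + 1) x := by
  obtain ⟨Δ, hΔ, hxΔ⟩ := mem_vertV.1 hx
  obtain ⟨D, hD, hΔD⟩ := mem_cellsV_succ.1 hΔ
  rcases mem_of_mem_sub hΔD hxΔ with h | ⟨c, hc, d, hd, hcd, rfl⟩
  · exact absurd (mem_vertV.2 ⟨D, hD, h⟩) hx'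
  refine ⟨_, mem_subcell hD (mem_sub.2 ⟨c, hc, rfl⟩), _, mem_subcell hD (mem_sub.2 ⟨d, hd, rfl⟩),
    fun h => hcd (image_contr_inj hD hD hc hd h).2, mem_image_of_mem _ hd,
    contr_comm c d ▸ mem_image_of_mem _ hc, ?_⟩
  intro E hE hxE
  obtain ⟨F, hF, hEF⟩ := mem_cellsV_succ.1 hE
  have hFD := parent_eq hF hD hEF hΔD hxE hxΔ hx'
  subst hFD
  obtain ⟨e, he, rfl⟩ := mem_sub.1 hEF
  obtain ⟨f, hf, hef⟩ := mem_image.1 hxE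
  obtain ⟨z, hzc, hzd, hDz⟩ := exists_third hF hc hd hcd
  by_cases h1 : e = c
  · left; rw [h1]
  by_cases h2 : e = d
  · right; rw [h2]
  exfalso
  have hez : e = z := by rw [hDz] at he; simp at he; tauto
  subst hez
  rw [hDz] at hf
  simp only [mem_insert, mem_singleton] at hf
  rcases hf with rfl | rfl | rfl
  · rw [contr_comm, contr_inj] at hef; exact hzd hef
  · rw [contr_comm, contr_comm c, contr_inj] at hef; exact hzc hef
  · rw [contr_self] at hef; exact hx' (mem_vertV.2 ⟨F, hF, hef ▸ he⟩)

lemma cells'_zero : cells' 0 = {lcell 0 0 0} := by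
  rw [cells']
  congr 1
  rw [lcell, vO, va, vb]
  ext x; simp [pt]; tauto

lemma cells_zero : cells 0 = {lcell 0 0 0, lcell 0 (-1) 0} := by
  rw [cells, cells'_zero, image_singleton, mirror_lcell]; rfl

lemma cellsV_zero : cellsV 0 = {lcell 0 0 0, lcell 0 (-1) 0, lcell 0 1 0} := by
  rw [cellsV, cells_zero, cells'_zero, image_singleton, shift_lcell]
  ext D; simp

lemma vO_eq : vO = pt 0 0 0 := by simp [vO, pt]
lemma va_eq : va = pt 0 0 1 := by simp [va, pt]
lemma vb_eq : vb = pt 0 1 0 := by simp [vb, pt]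

lemma lcell_zero_ne : lcell 0 0 0 ≠ lcell 0 (-1) 0 ∧ lcell 0 0 0 ≠ lcell 0 1 0 := by
  constructor <;> intro h
  · have : pt 0 1 0 ∈ lcell 0 (-1) 0 := h ▸ mem_lcell.2 (by simp)
    rw [mem_lcell] at this; omega
  · have : pt 0 0 0 ∈ lcell 0 1 0 := h ▸ mem_lcell.2 (by simp)
    rw [mem_lcell] at this; omega

lemma inner_zero {x : Pt} (h : x = vO ∨ x = vb) : Inner 0 x := by
  rcases h with rfl | rfl
  · refine ⟨lcell 0 0 0, by simp [cellsV_zero], lcell 0 (-1) 0, by simp [cellsV_zero],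
      lcell_zero_ne.1, ?_, ?_, ?_⟩ <;> simp [cellsV_zero, vO_eq, mem_lcell]
  · refine ⟨lcell 0 0 0, by simp [cellsV_zero], lcell 0 1 0, by simp [cellsV_zero],
      lcell_zero_ne.2, ?_, ?_, ?_⟩ <;> simp [cellsV_zero, vb_eq, mem_lcell]

lemma inner_of_mem {N : ℕ} {x : Pt} (hx : x ∈ vertV N) (h : x ∈ vertV 0 → x = vO ∨ x = vb) :
    Inner N x := by
  induction N with
  | zero => exact inner_zero (h hx)
  | succ N ih =>
    by_cases hx' : x ∈ vertV N
    · exact inner_succ_of_inner (ih hx')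
    · exact inner_succ_of_notMem hx hx'

lemma mem_cells_of_mem_vert {N : ℕ} {Δ : Finset Pt} (hΔ : Δ ∈ cellsV N) {x : Pt} (hx : x ∈ Δ)
    (hxN : x ∈ vert N) (hxb : x ≠ vb) : Δ ∈ cells N := by
  rw [cellsV, mem_union, mem_image] at hΔ
  rcases hΔ with h | ⟨D, h, rfl⟩
  · exact h
  exfalso
  obtain ⟨i, j, rfl, h0, h1, h2⟩ := cells'_spec h
  rw [shift_lcell] at hx
  obtain ⟨E, hE, hxE⟩ := mem_vert.1 hxN
  obtain ⟨k, l, rfl, h3, h4⟩ := cells_spec hE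
  obtain ⟨a, b, rfl, h5⟩ := exists_of_mem_lcell hx
  rw [mem_lcell] at hxE
  refine hxb ?_
  have ha : a = 2 ^ N ∧ b = 0 := by omega
  rw [ha.1, ha.2, vb, pt]
  simp

lemma mem_vert_zero_of_mem_vertV {N : ℕ} {x : Pt} (hx : x ∈ vert N) (h : x ∈ vertV 0) :
    x ∈ vert 0 := by
  obtain ⟨D, hD, hxD⟩ := mem_vertV.1 h
  rw [cellsV, mem_union, mem_image] at hD
  rcases hD with hD | ⟨D', h', rfl⟩
  · exact mem_vert.2 ⟨D, hD, hxD⟩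
  rw [cells'_zero, mem_singleton] at h'
  rw [h', shift_lcell] at hxD
  obtain ⟨E, hE, hxE⟩ := mem_vert.1 hx
  obtain ⟨k, l, rfl, h3, h4⟩ := cells_spec hE
  obtain ⟨a, b, rfl, h5⟩ := exists_of_mem_lcell hxD
  obtain ⟨c, d, hcd, h6⟩ := exists_of_mem_lcell hxE
  have hp : (0 : ℚ) < 2 ^ N := by positivity
  simp only [pt, Prod.mk.injEq, pow_zero, div_one, eq_div_iff hp.ne'] at hcd
  have e1 : a * 2 ^ N = c := by exact_mod_cast hcd.1
  have e2 : b * 2 ^ N = d := by exact_mod_cast hcd.2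
  have hp' : (0 : ℤ) < 2 ^ N := by positivity
  have h7 : a = 1 ∧ b = 0 := by
    grind
  rw [h7.1, h7.2]
  exact mem_vert.2 ⟨lcell 0 0 0, by simp [cells_zero], mem_lcell.2 (by simp)⟩

/-! ### Loop erasure on lists of segments -/

lemma triangleOf_eq (M : ℕ) (s : List Pt) : triangleOf M s = tri M (src₀ s) (tgt₀ s) := rfl

lemma tri_eq {M : ℕ} {D : Finset Pt} (hD : D ∈ cellsV M) {x y : Pt} (hxy : x ≠ y) (hx : x ∈ D)
    (hy : y ∈ D) : tri M x y = D := by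
  have : ((cellsV M).filter fun D => x ∈ D ∧ y ∈ D) = {D} := by
    ext E
    simp only [Finset.mem_filter, mem_singleton]
    constructor
    · rintro ⟨hE, h1, h2⟩; exact cell_eq hE hD hxy h1 h2 hx hy
    · rintro rfl; exact ⟨hD, hx, hy⟩
  rw [tri, this, Finset.sup_singleton, id]

lemma IsSeg.of_mem {S : Finset Pt} {L : List (List (List Pt))} {ss : List (List Pt)}
    (hss : ∀ s ∈ ss, IsSeg S s) (hL : L.flatten ⊆ ss) {g : List (List Pt)} (hg : g ∈ L) :
    ∀ s ∈ g, IsSeg S s := fun s hs => hss s (hL (mem_flatten.2 ⟨g, hg, hs⟩))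

lemma glue_src {S : Finset Pt} {g : List (List Pt)} (hg : ∀ s ∈ g, IsSeg S s) (hne : g ≠ [])
    (h : IsTrail src₀ tgt₀ (gsrc src₀ g) g (gtgt tgt₀ g)) :
    glue g ≠ [] ∧ src₀ (glue g) = gsrc src₀ g ∧ tgt₀ (glue g) = gtgt tgt₀ g := by
  rw [glue_eq_gl (fun s hs => (hg s hs).ne_nil) hne h]
  exact ⟨gl_ne_nil _ _, rfl, tgt₀_gl hg h⟩

lemma runs_glue {j : ℕ} {ss : List (List Pt)} {x y : Pt} (hss : ∀ s ∈ ss, IsSeg (vertV j) s)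
    (h : IsTrail src₀ tgt₀ x ss y) : runs j (glue ss) =
      (triRuns j (gsrc src₀) (gtgt tgt₀) (group (vertV j) src₀ tgt₀ ss)).map (List.map glue) := by
  rw [runs, split_glue hss h]
  have hspec := (group_spec (S := vertV j) h).1
  rw [← triRuns_map (src := gsrc src₀) (tgt := gtgt tgt₀) (src' := src₀) (tgt' := tgt₀) glue j]
  · rfl
  all_goals
    intro g hg
    have := glue_src (IsSeg.of_mem hss (group_flatten _ _ _ _).subset hg) (group_ne_nil hg)
      (hspec g hg).1
  · exact this.2.1
  · exact this.2.2

lemma eraseLoops_map_glue {S : Finset Pt} {L : List (List (List Pt))}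
    (hne : ∀ g ∈ L, g ≠ []) (hL : ∀ g ∈ L, ∀ s ∈ g, IsSeg S s)
    (htr : ∀ g ∈ L, IsTrail src₀ tgt₀ (gsrc src₀ g) g (gtgt tgt₀ g)) :
    eraseLoops (L.map glue) = (eraseK (gsrc src₀) (gtgt tgt₀) L).map glue := by
  rw [eraseLoops_eq]
  refine eraseK_map glue L fun s hs t ht => ?_
  obtain ⟨a1, a2, a3⟩ := glue_src (hL s hs) (hne s hs) (htr s hs)
  obtain ⟨b1, b2, b3⟩ := glue_src (hL t ht) (hne t ht) (htr t ht)
  rw [head?_eq_src₀ b1, getLast?_eq_tgt₀ a1, a3, b2, Option.some_inj]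

/-- A part of a trail is a trail. -/
lemma isTrail_of_infix {α : Type*} {src tgt : α → Pt} {x y : Pt} {l g : List α}
    (h : IsTrail src tgt x l y) (hg : g <:+: l) (hne : g ≠ []) :
    IsTrail src tgt (gsrc src g) g (gtgt tgt g) := by
  obtain ⟨a, b, rfl⟩ := hg
  rw [isTrail_append, ] at h
  obtain ⟨z, h, -⟩ := h
  rw [isTrail_append] at h
  obtain ⟨w, -, h⟩ := h
  rwa [h.gsrc_eq hne, h.gtgt_eq hne]

lemma infix_flatten {α : Type*} {L : List (List α)} {r : List α} (h : r ∈ L) :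
    r <:+: L.flatten := by
  obtain ⟨a, b, rfl⟩ := List.append_of_mem h
  exact ⟨a.flatten, b.flatten, by simp⟩

lemma infix_flatten' {α : Type*} {L : List α} {l : List (List α)} {G : List (List α)}
    (h : l.flatten = L) {r : List (List α)} (hr : r <:+: l) (_ : G = l) : r.flatten <:+: L := by
  obtain ⟨a, b, rfl⟩ := hr
  exact ⟨a.flatten, b.flatten, by rw [← h]; simp⟩

section StageTrail
variable {α : Type*} {src tgt : α → Pt}

/-- The parts of the path in the triangles of the skeleton. -/
lemma stage_run_spec {j : ℕ} {l : List α} {x y : Pt} (h : IsTrail src tgt x l y)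
    (hx : x ∈ vertV j) {r : List (List α)}
    (hr : r ∈ triRuns j (gsrc src) (gtgt tgt) (group (vertV j) src tgt l)) :
    r ≠ [] ∧ r.flatten <:+: l ∧
    IsTrail src tgt (gsrc (gsrc src) r) r.flatten (gtgt (gtgt tgt) r) ∧
    (group (vertV (j + 1)) src tgt r.flatten).flatten = r.flatten := by
  have hspec := group_spec (S := vertV j) h
  have hr0 : r ≠ [] := List.ne_nil_of_mem_splitBy hr
  have hinf : r <:+: group (vertV j) src tgt l := by
    have := infix_flatten hr
    rwa [triRuns_flatten] at this
  obtain ⟨z, hz⟩ := hspec.2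
  have htr := isTrail_of_infix hz hinf hr0
  have hrf : r.flatten <:+: l :=
    (infix_flatten' rfl hinf rfl).trans (group_flatten (vertV j) src tgt l).isInfix
  have hmem : ∀ g ∈ r, g ∈ group (vertV j) src tgt l := fun g hg => hinf.subset hg
  have htr' : IsTrail src tgt (gsrc (gsrc src) r) r.flatten (gtgt (gtgt tgt) r) :=
    (isTrail_flatten (fun g hg => group_ne_nil (hmem g hg))
      fun g hg => (hspec.1 g (hmem g hg)).1).2 htr
  refine ⟨hr0, hrf, htr', ?_⟩
  -- split off the last group
  rcases eq_nil_or_concat r with rfl | ⟨L, g, rfl⟩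
  · exact absurd rfl hr0
  rw [concat_eq_append] at hmem htr' ⊢
  have hg := hmem g (by simp)
  obtain ⟨h1, h2, h3, h4, h5⟩ := hspec.1 g hg
  rw [List.flatten_append, List.flatten_singleton] at htr' ⊢
  obtain ⟨w, hw, hw'⟩ := isTrail_append.1 htr'
  have e1 := hw'.gsrc_eq (group_ne_nil hg)
  have e2 := hw'.gtgt_eq (group_ne_nil hg)
  have hgS : gsrc src g ∈ vertV j := by
    rcases h5 with h5 | h5
    · rw [h5]; exact hx
    · exact h5
  have hyS : gtgt (gtgt tgt) (L ++ [g]) ∈ vertV j := by rw [← e2]; exact h2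
  refine group_flatten_eq' hw hw' (group_ne_nil hg) (vertV_mono_succ j (e1 ▸ hgS))
    (vertV_mono_succ j hyS) ?_
  intro s hs hsy
  have := h4 s hs (hsy ▸ hyS)
  rw [hsy, ← e2] at this
  exact h3 this

lemma isTrail_flatMap {γ : Type*} {f : γ → List α} {x y : Pt} {l : List γ} {s t : γ → Pt}
    (h : IsTrail s t x l y) (hf : ∀ r ∈ l, IsTrail src tgt (s r) (f r) (t r)) :
    IsTrail src tgt x (l.flatMap f) y := by
  induction l generalizing x with
  | nil => exact h
  | cons a l ih =>
    rw [flatMap_cons, isTrail_append]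
    exact ⟨_, h.1 ▸ hf a (by simp), ih h.2 fun r hr => hf r (by simp [hr])⟩

lemma isTrail_stage {j : ℕ} {l : List α} {x y : Pt} (h : IsTrail src tgt x l y)
    (hx : x ∈ vertV j) (hy : y ∈ vertV j) (hsrc : ∀ s ∈ l, src s ≠ y) :
    IsTrail src tgt x (stage src tgt j l) y := by
  have hspec := group_spec (S := vertV j) h
  have hfl := group_flatten_eq (S := vertV j) h hy hsrc
  have hG : IsTrail (gsrc src) (gtgt tgt) x (group (vertV j) src tgt l) y :=
    (isTrail_flatten (fun g hg => group_ne_nil hg) fun g hg => (hspec.1 g hg).1).1 (by rwa [hfl])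
  have hR : IsTrail (gsrc (gsrc src)) (gtgt (gtgt tgt)) x
      (triRuns j (gsrc src) (gtgt tgt) (group (vertV j) src tgt l)) y := by
    have hr0 : ∀ r ∈ triRuns j (gsrc src) (gtgt tgt) (group (vertV j) src tgt l), r ≠ [] :=
      fun r hr => List.ne_nil_of_mem_splitBy hr
    refine (isTrail_flatten hr0 fun r hr => ?_).1 (by rwa [triRuns_flatten])
    have hinf := infix_flatten hr
    rw [triRuns_flatten] at hinf
    exact isTrail_of_infix hG hinf (hr0 r hr)
  have key : stage src tgt j l = (triRuns j (gsrc src) (gtgt tgt)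
      (group (vertV j) src tgt l)).flatMap fun r => (eraseK (gsrc src) (gtgt tgt)
        (group (vertV (j + 1)) src tgt r.flatten)).flatten := by
    rw [stage, flatMap_def, flatten_flatten, List.map_map, ← flatMap_def]; rfl
  rw [key]
  refine isTrail_flatMap hR fun r hr => ?_
  obtain ⟨h1, h2, h3, h4⟩ := stage_run_spec h hx hr
  have hsp := group_spec (S := vertV (j + 1)) h3
  have hT : IsTrail (gsrc src) (gtgt tgt) (gsrc (gsrc src) r)
      (group (vertV (j + 1)) src tgt r.flatten) (gtgt (gtgt tgt) r) :=
    (isTrail_flatten (fun g hg => group_ne_nil hg) fun g hg => (hsp.1 g hg).1).1 (by rwa [h4])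
  have hsub := (eraseK_sublist (gsrc src) (gtgt tgt)
    (group (vertV (j + 1)) src tgt r.flatten)).subset
  exact (isTrail_flatten (fun g hg => group_ne_nil (hsub hg))
    fun g hg => (hsp.1 g (hsub hg)).1).2 hT.eraseK.1

lemma isTrail_stages {j : ℕ} {l : List α} {x y : Pt} (h : IsTrail src tgt x l y)
    (hx : x ∈ vertV 0) (hy : y ∈ vertV 0) (hsrc : ∀ s ∈ l, src s ≠ y) :
    IsTrail src tgt x (stages src tgt j l) y := by
  induction j with
  | zero => exact h
  | succ j ih =>
    exact isTrail_stage ih (vertV_mono (Nat.zero_le j) hx) (vertV_mono (Nat.zero_le j) hy)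
      fun s hs => hsrc s ((stages_sublist src tgt j l).subset hs)

end StageTrail

lemma flatMap_congr' {α β : Type*} {l : List α} {f g : α → List β} (h : ∀ a ∈ l, f a = g a) :
    l.flatMap f = l.flatMap g := by
  rw [flatMap_def, flatMap_def, map_congr_left h]

lemma eraseStage_glue {j : ℕ} {ss : List (List Pt)} {x y : Pt}
    (hss : ∀ s ∈ ss, IsSeg (vertV (j + 1)) s) (h : IsTrail src₀ tgt₀ x ss y)
    (hx : x ∈ vertV j) : eraseStage j (glue ss) = glue (stage src₀ tgt₀ j ss) := by
  have hss' : ∀ s ∈ ss, IsSeg (vertV j) s := fun s hs => (hss s hs).mono (vertV_mono_succ j)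
  rw [eraseStage, runs_glue hss' h, flatMap_map]
  have hstep : ∀ r ∈ triRuns j (gsrc src₀) (gtgt tgt₀) (group (vertV j) src₀ tgt₀ ss),
      eraseLoops (split (vertV (j + 1)) (glue (r.map glue))) =
        (eraseK (gsrc src₀) (gtgt tgt₀)
          (group (vertV (j + 1)) src₀ tgt₀ r.flatten)).map glue := by
    intro r hr
    obtain ⟨h1, h2, h3, h4⟩ := stage_run_spec h hx hr
    have hrs : ∀ s ∈ r.flatten, IsSeg (vertV (j + 1)) s := fun s hs => hss s (h2.subset hs)
    have hne : ∀ g ∈ r, g ≠ [] := fun g hg => group_ne_nil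
      (l := ss) (S := vertV j) (src := src₀) (tgt := tgt₀) (mem_of_mem_triRuns hr hg)
    rw [glue_map_glue hne fun g hg s hs => (hrs s (mem_flatten.2 ⟨g, hg, hs⟩)).ne_nil,
      split_glue hrs h3]
    exact eraseLoops_map_glue (fun g hg => group_ne_nil hg)
      (fun g hg => IsSeg.of_mem hrs (group_flatten _ _ _ _).subset hg)
      fun g hg => ((group_spec h3).1 g hg).1
  rw [flatMap_congr' hstep, stage, ← List.map_flatMap, glue_map_glue]
  · intro g hg
    obtain ⟨r, hr, hg⟩ := mem_flatMap.1 hg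
    exact group_ne_nil ((eraseK_sublist _ _ _).subset hg)
  · intro g hg s hs
    have : s ∈ stage src₀ tgt₀ j ss := mem_flatten.2 ⟨g, hg, hs⟩
    exact (hss s ((stage_sublist _ _ _ _).subset this)).ne_nil

lemma erased_glue {K j : ℕ} (hj : j ≤ K) {ss : List (List Pt)} {x y : Pt}
    (hss : ∀ s ∈ ss, IsSeg (vertV K) s) (h : IsTrail src₀ tgt₀ x ss y)
    (hx : x ∈ vertV 0) (hy : y ∈ vertV 0) (hsrc : ∀ s ∈ ss, src₀ s ≠ y) :
    erased j (glue ss) = glue (stages src₀ tgt₀ j ss) := by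
  induction j with
  | zero => rfl
  | succ j ih =>
    rw [erased, ih (by omega), stages]
    refine eraseStage_glue (fun s hs => ?_) (isTrail_stages h hx hy hsrc)
      (vertV_mono (Nat.zero_le j) hx)
    exact (hss s ((stages_sublist _ _ _ _).subset hs)).mono (vertV_mono hj)

/-- The steps of a path. -/
def edges {α : Type*} : List α → List (α × α)
  | x :: y :: t => (x, y) :: edges (y :: t)
  | _ => []

/-- The path segment that consists of one step. -/
def toSeg (e : Step) : List Pt := [e.1, e.2]

lemma isSeg_toSeg (S : Finset Pt) (e : Step) : IsSeg S (toSeg e) :=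
  ⟨e.1, [], e.2, rfl, by simp⟩

lemma src₀_toSeg (e : Step) : src₀ (toSeg e) = e.1 := rfl
lemma tgt₀_toSeg (e : Step) : tgt₀ (toSeg e) = e.2 := rfl

lemma verts_edges (x : Pt) (l : List Pt) : verts snd x (edges (x :: l)) = x :: l := by
  induction l generalizing x with
  | nil => rfl
  | cons y l ih => simp only [verts, edges, map_cons] at ih ⊢; rw [ih y]

lemma edges_verts {l : Steps} {x y : Pt} (h : IsTrail fst snd x l y) :
    edges (verts snd x l) = l := by
  induction l generalizing x with
  | nil => rfl
  | cons e l ih =>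
    have := ih h.2
    simp only [verts, map_cons, edges] at this ⊢
    rw [this, ← h.1]

lemma isTrail_map {α β : Type*} {src tgt : α → Pt} {src' tgt' : β → Pt} (f : α → β)
    (hs : ∀ s, src' (f s) = src s) (ht : ∀ s, tgt' (f s) = tgt s) {x y : Pt} {l : List α} :
    IsTrail src' tgt' x (l.map f) y ↔ IsTrail src tgt x l y := by
  induction l generalizing x with
  | nil => rfl
  | cons s t ih => simp only [map_cons, IsTrail, hs, ht, ih]

lemma gl_map_toSeg (x : Pt) (l : Steps) : gl x (l.map toSeg) = verts snd x l := by
  simp only [gl, verts, flatMap_map, toSeg, List.tail_cons]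
  congr 1
  induction l with
  | nil => rfl
  | cons e l ih => simp [ih]

lemma glue_map_toSeg {l : Steps} {x y : Pt} (h : IsTrail fst snd x l y)
    (hl : l ≠ []) : glue (l.map toSeg) = verts snd x l := by
  rw [← gl_map_toSeg, glue_eq_gl]
  · intro s hs
    obtain ⟨e, _, rfl⟩ := List.mem_map.1 hs
    simp [toSeg]
  · simpa using hl
  · exact (isTrail_map toSeg src₀_toSeg tgt₀_toSeg).2 h

/-- The end points of a path segment. -/
def ends (s : List Pt) : Step := (src₀ s, tgt₀ s)

lemma verts_map_ends (x : Pt) (ss : List (List Pt)) :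
    verts snd x (ss.map ends) = verts tgt₀ x ss := by
  simp [verts, ends, comp_def]

lemma edges_verts_seg {ss : List (List Pt)} {x y : Pt} (h : IsTrail src₀ tgt₀ x ss y) :
    edges (verts tgt₀ x ss) = ss.map ends := by
  rw [← verts_map_ends]
  exact edges_verts ((isTrail_map ends (fun _ => rfl) fun _ => rfl).2 h)

lemma coarse_verts {M : ℕ} {ss : List (List Pt)} {x y : Pt} (hx : x ∈ vertV M)
    (h : IsTrail src₀ tgt₀ x ss y)
    (ht : ∀ s ∈ ss, tgt₀ s ∈ vertV M) (hne : ∀ s ∈ ss, src₀ s ≠ tgt₀ s) :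
    coarse M (verts tgt₀ x ss) = verts tgt₀ x ss := by
  refine coarse_of_isChain ?_ ?_
  · intro q hq
    rcases mem_cons.1 hq with rfl | hq
    · exact hx
    · obtain ⟨s, hs, rfl⟩ := List.mem_map.1 hq; exact ht s hs
  · induction ss generalizing x with
    | nil => simp [verts]
    | cons s t ih =>
      rw [verts, map_cons, isChain_cons_cons]
      exact ⟨h.1 ▸ hne s (by simp), ih (ht s (by simp)) h.2 (fun s hs => ht s (by simp [hs]))
        fun s hs => hne s (by simp [hs])⟩

/-- The loop-erased coarse paths of the levels up to `K` depend only on the coarse path of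
level `K`. -/
lemma Qhat_glue {K j : ℕ} (hj : j ≤ K) {ss : List (List Pt)} {x y : Pt} (hne : ss ≠ [])
    (hss : ∀ s ∈ ss, IsSeg (vertV K) s) (h : IsTrail src₀ tgt₀ x ss y)
    (hx : x ∈ vertV 0) (hy : y ∈ vertV 0) (hxy : x ≠ y) (hsrc : ∀ s ∈ ss, src₀ s ≠ y) :
    Qhat j (glue ss) = Qhat j (verts tgt₀ x ss) := by
  have hE : IsTrail fst snd x (ss.map ends) y :=
    (isTrail_map ends (fun _ => rfl) fun _ => rfl).2 h
  have h1 : verts tgt₀ x ss = glue ((ss.map ends).map toSeg) := by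
    rw [glue_map_toSeg hE (by simpa using hne), verts_map_ends]
  have hseg : ∀ s ∈ (ss.map ends).map toSeg, IsSeg (vertV K) s := by
    intro s hs
    obtain ⟨e, _, rfl⟩ := List.mem_map.1 hs
    exact isSeg_toSeg _ _
  have hT2 : IsTrail src₀ tgt₀ x ((ss.map ends).map toSeg) y :=
    (isTrail_map toSeg src₀_toSeg tgt₀_toSeg).2 hE
  have hsrc2 : ∀ s ∈ (ss.map ends).map toSeg, src₀ s ≠ y := by
    intro s hs
    simp only [List.map_map, List.mem_map] at hs
    obtain ⟨e, he, rfl⟩ := hs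
    exact hsrc e he
  have h2 : stages src₀ tgt₀ j ((ss.map ends).map toSeg) =
      (stages src₀ tgt₀ j ss).map (toSeg ∘ ends) := by
    rw [List.map_map]
    exact stages_map (toSeg ∘ ends) j (fun _ _ => rfl) fun _ _ => rfl
  have hT := isTrail_stages (j := j) h hx hy hsrc
  have hT' := isTrail_stages (j := j) hT2 hx hy hsrc2
  have hsub := (stages_sublist src₀ tgt₀ j ss).subset
  have hsub2 := (stages_sublist src₀ tgt₀ j ((ss.map ends).map toSeg)).subset
  have hn : stages src₀ tgt₀ j ss ≠ [] := by
    intro h0; rw [h0] at hT; exact hxy hT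
  have hn2 : stages src₀ tgt₀ j ((ss.map ends).map toSeg) ≠ [] := by
    intro h0; rw [h0] at hT'; exact hxy hT'
  have hxj := vertV_mono (Nat.zero_le j) hx
  rw [Qhat, Qhat, erased_glue hj hss h hx hy hsrc, h1, erased_glue hj hseg hT2 hx hy hsrc2,
    glue_eq_gl (fun s hs => (hss s (hsub hs)).ne_nil) hn hT,
    glue_eq_gl (fun s hs => (hseg s (hsub2 hs)).ne_nil) hn2 hT',
    coarse_gl hxj (fun s hs => (hss s (hsub hs)).mono (vertV_mono hj)) hT,
    coarse_gl hxj (fun s hs => (hseg s (hsub2 hs)).mono (vertV_mono hj)) hT', h2]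
  congr 1
  simp [verts, comp_def, ends, tgt₀_toSeg]

section

set_option synthInstance.maxHeartbeats 200000
set_option synthInstance.maxSize 2000

/-! ### Letters for the vertices near an edge -/

/-- The letters stand for the vertices of level `N + 1` near an edge from `x` to `y` of level `N`
in the triangle `D = {x, y, z}`: `0, 1, 2` are `x, y, z`, then come the midpoints of `D`, those
of the other triangle at `x`, and those of the other triangle at `y`. -/
abbrev Letter : Type := Fin 12

/-- The small triangles near an edge. -/
def inc : Fin 9 → List Letter :=
  ![[0, 3, 4], [1, 3, 5], [2, 4, 5], [0, 6, 7], [6, 8], [7, 8], [1, 9, 10], [9, 11], [10, 11]]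

/-- Adjacency of letters. -/
def adjL (i j : Letter) : Prop := i ≠ j ∧ ∃ c, i ∈ inc c ∧ j ∈ inc c

instance (i j : Letter) : Decidable (adjL i j) := by unfold adjL; infer_instance

/-- The small triangle with the given side. -/
def cellL (i j : Letter) : Fin 9 :=
  ((List.finRange 9).find? fun c => decide (i ∈ inc c ∧ j ∈ inc c)).getD 0

/-- A configuration: the positions of `x` and `y` in their triangle, and those of `x` and `y`
in their other triangles. -/
structure Cfg where
  kx : Fin 3
  ky : Fin 3
  kx' : Fin 3
  ky' : Fin 3

/-- The positions in a configuration are distinct. -/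
def Cfg.Good (κ : Cfg) : Prop := κ.kx ≠ κ.ky ∧ κ.kx' ≠ κ.kx ∧ κ.ky' ≠ κ.ky

/-- Corner offsets. -/
def offT (k : Fin 3) : ℤ × ℤ := (offX k, offY k)

/-- The offsets of `x, y, z` and of the remaining vertices of the other triangles. -/
def Cfg.base (κ : Cfg) : Fin 7 → ℤ × ℤ :=
  ![offT κ.kx, offT κ.ky, offT (-(κ.kx + κ.ky)),
    offT κ.kx - offT κ.kx' + offT (κ.kx' + 1), offT κ.kx - offT κ.kx' + offT (κ.kx' + 2),
    offT κ.ky - offT κ.ky' + offT (κ.ky' + 1), offT κ.ky - offT κ.ky' + offT (κ.ky' + 2)]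

/-- A letter is the midpoint of two base points. -/
def letterPair : Letter → Fin 7 × Fin 7 :=
  ![(0, 0), (1, 1), (2, 2), (0, 1), (0, 2), (1, 2), (0, 3), (0, 4), (3, 4), (1, 5), (1, 6), (5, 6)]

/-- The offset of a letter. -/
def Cfg.off (κ : Cfg) (l : Letter) : ℤ × ℤ :=
  κ.base (letterPair l).1 + κ.base (letterPair l).2

/-- The offset of a small triangle. -/
def Cfg.cellOff (κ : Cfg) : Fin 9 → ℤ × ℤ :=
  let o := offT κ.kx - offT κ.kx'
  let o' := offT κ.ky - offT κ.ky'
  ![offT κ.kx, offT κ.ky, offT (-(κ.kx + κ.ky)),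
    o + o + offT κ.kx', o + o + offT (κ.kx' + 1), o + o + offT (κ.kx' + 2),
    o' + o' + offT κ.ky', o' + o' + offT (κ.ky' + 1), o' + o' + offT (κ.ky' + 2)]

lemma cfg_forall {p : Cfg → Prop}
    (h : ∀ kx ky kx' ky', (⟨kx, ky, kx', ky'⟩ : Cfg).Good → p ⟨kx, ky, kx', ky'⟩) (κ : Cfg)
    (hκ : κ.Good) : p κ := h _ _ _ _ hκ

instance (κ : Cfg) : Decidable κ.Good := by unfold Cfg.Good; infer_instance

lemma Cfg.off_inj : ∀ κ : Cfg, κ.Good → ∀ i j, κ.off i = κ.off j → i = j :=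
  cfg_forall (by decide +kernel)

lemma Cfg.off_cell : ∀ κ : Cfg, κ.Good → ∀ c, ∀ i ∈ inc c, ∃ k, κ.off i = κ.cellOff c + offT k :=
  cfg_forall (by decide +kernel)

lemma Cfg.cellOff_inj : ∀ κ : Cfg, κ.Good → ∀ c d, κ.cellOff c = κ.cellOff d → c = d :=
  cfg_forall (by decide +kernel)

lemma Cfg.off_even : ∀ κ : Cfg, κ.Good → ∀ i, (κ.off i).1 % 2 = 0 → (κ.off i).2 % 2 = 0 →
    i = 0 ∨ i = 1 ∨ i = 2 :=
  cfg_forall (by decide +kernel)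

/-- The integer quadratic form that corresponds to `2 * dot`. -/
def qdot (p q : ℤ × ℤ) : ℤ := 2 * (p.1 * q.1 + p.2 * q.2) + (p.1 * q.2 + p.2 * q.1)

lemma Cfg.qdot_off : ∀ κ : Cfg, κ.Good → ∀ a b c, adjL a b → adjL b c → ¬ (b = 0 ∨ b = 1 ∨ b = 2) →
    (qdot (κ.off b - κ.off a) (κ.off c - κ.off b) < 0 ↔ a = c ∨ adjL a c) :=
  cfg_forall (by decide +kernel)

/-- Two vertices of one of the small triangles of `D`. -/
lemma Cfg.closure : ∀ κ : Cfg, κ.Good → ∀ i : Letter, ∀ k m n,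
    (3 ≤ i ∧ i < 6 ∨ (i = 0 ∧ k = κ.kx)) → κ.off i = offT k + offT m → n ≠ m →
      ∃ j, adjL i j ∧ κ.off j = offT k + offT n :=
  cfg_forall (by decide +kernel)

/-- The offset of the other triangle at `x`. -/
def Cfg.org (κ : Cfg) : ℤ × ℤ := offT κ.kx - offT κ.kx'

/-- Two vertices of one of the small triangles of the other triangle at `x`. -/
lemma Cfg.closure' : ∀ κ : Cfg, κ.Good → ∀ i : Letter, i < 9 → ∀ k m n,
    6 ≤ i ∨ (i = 0 ∧ k = κ.kx') →
      κ.off i = (κ.org + κ.org) + (offT k + offT m) → n ≠ m →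
      (∃ j, adjL i j ∧ κ.off j = (κ.org + κ.org) + (offT k + offT n)) ∨
      k = n ∧ (κ.org + κ.org) + (offT k + offT n) ≠ κ.off 0 ∧
      (κ.org + κ.org) + (offT k + offT n) ≠ κ.off 1 :=
  cfg_forall (by decide +kernel)

/-- The second step of a triangle, as seen from the first. -/
def rot : Letter → Letter := ![1, 2, 0, 5, 3, 4, 9, 10, 11, 6, 7, 8]

/-- The configuration of the second step. -/
def Cfg.next (κ : Cfg) : Cfg := ⟨κ.ky, -(κ.kx + κ.ky), κ.ky', κ.ky⟩

lemma Cfg.next_spec : ∀ κ : Cfg, κ.Good → κ.next.Good ∧ ∀ l < 9, κ.next.off l = κ.off (rot l) :=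
  cfg_forall (by decide +kernel)

end

/-! ### Charts -/

/-- The point of level `N + 1` of a letter, for a configuration in the triangle `lcell N i j`. -/
def psi (κ : Cfg) (N : ℕ) (i j : ℤ) (l : Letter) : Pt :=
  pt (N + 1) (2 * i + (κ.off l).1) (2 * j + (κ.off l).2)

/-- The small triangle of a letter cell. -/
def pcell (κ : Cfg) (N : ℕ) (i j : ℤ) (c : Fin 9) : Finset Pt :=
  lcell (N + 1) (2 * i + (κ.cellOff c).1) (2 * j + (κ.cellOff c).2)

lemma mem_lcell_off {N : ℕ} {i j : ℤ} {x : Pt} :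
    x ∈ lcell N i j ↔ ∃ k, x = pt N (i + (offT k).1) (j + (offT k).2) := by
  constructor
  · exact exists_off
  · rintro ⟨k, rfl⟩
    rw [mem_lcell]
    fin_cases k <;> simp [offT, offX, offY]

lemma mem_sub_lcell {N : ℕ} {i j : ℤ} {Δ : Finset Pt} : Δ ∈ sub (lcell N i j) ↔
    ∃ k, Δ = lcell (N + 1) (2 * i + (offT k).1) (2 * j + (offT k).2) := by
  have key : ∀ k, (lcell N i j).image (contr (pt N (i + (offT k).1) (j + (offT k).2))) =
      lcell (N + 1) (2 * i + (offT k).1) (2 * j + (offT k).2) := by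
    intro k
    simp only [lcell, image_insert, image_singleton, contr_pt]
    congr 2 <;> ring_nf
  rw [mem_sub]
  constructor
  · rintro ⟨c, hc, rfl⟩
    obtain ⟨k, rfl⟩ := mem_lcell_off.1 hc
    exact ⟨k, key k⟩
  · rintro ⟨k, rfl⟩
    exact ⟨_, mem_lcell_off.2 ⟨k, rfl⟩, (key k).symm⟩

/-- `κ` describes the vertices near the edge from `psi 0` to `psi 1`, for a starting point that
lies in exactly two triangles. -/
structure Chart (κ : Cfg) (N : ℕ) (i j : ℤ) : Prop where
  good : κ.Good
  memD : lcell N i j ∈ cellsV N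
  memL : lcell N (i + κ.org.1) (j + κ.org.2) ∈ cellsV N
  inner : ∀ E ∈ cellsV N, psi κ N i j 0 ∈ E →
    E = lcell N i j ∨ E = lcell N (i + κ.org.1) (j + κ.org.2)

/-- The end point of the edge lies in a second triangle as well. -/
def Right (κ : Cfg) (N : ℕ) (i j : ℤ) : Prop :=
  lcell N (i + (offT κ.ky - offT κ.ky').1) (j + (offT κ.ky - offT κ.ky').2) ∈ cellsV N

section

variable {κ : Cfg} {N : ℕ} {i j : ℤ}

lemma Chart.inj (h : Chart κ N i j) : Injective (psi κ N i j) := by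
  intro a b hab
  rw [psi, psi, pt_inj] at hab
  exact Cfg.off_inj κ h.good _ _ (Prod.ext (by omega) (by omega))

lemma psi_corner (κ : Cfg) (N : ℕ) (i j : ℤ) :
    psi κ N i j 0 = pt N (i + (offT κ.kx).1) (j + (offT κ.kx).2) ∧
    psi κ N i j 1 = pt N (i + (offT κ.ky).1) (j + (offT κ.ky).2) ∧
    psi κ N i j 2 = pt N (i + (offT (-(κ.kx + κ.ky))).1) (j + (offT (-(κ.kx + κ.ky))).2) := by
  refine ⟨?_, ?_, ?_⟩ <;> rw [pt_succ, psi] <;> congr 1 <;>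
    simp [Cfg.off, letterPair, Cfg.base] <;> ring

lemma psi_mem (κ : Cfg) (N : ℕ) (i j : ℤ) : psi κ N i j 0 ∈ lcell N i j ∧
    psi κ N i j 1 ∈ lcell N i j ∧ psi κ N i j 2 ∈ lcell N i j := by
  obtain ⟨h0, h1, h2⟩ := psi_corner κ N i j
  exact ⟨mem_lcell_off.2 ⟨_, h0⟩, mem_lcell_off.2 ⟨_, h1⟩, mem_lcell_off.2 ⟨_, h2⟩⟩

lemma Chart.mem_vertV (h : Chart κ N i j) {l : Letter} :
    psi κ N i j l ∈ vertV N ↔ l = 0 ∨ l = 1 ∨ l = 2 := by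
  constructor
  · intro hl
    obtain ⟨a, b, hab⟩ := exists_pt_of_mem_vertV hl
    rw [pt_succ, psi, pt_inj] at hab
    exact Cfg.off_even κ h.good l (by omega) (by omega)
  · obtain ⟨h0, h1, h2⟩ := psi_mem κ N i j
    rintro (rfl | rfl | rfl) <;> exact Gasket.mem_vertV.2 ⟨_, h.memD, by assumption⟩

lemma mem_pcell (h : κ.Good) {c : Fin 9} {l : Letter} (hl : l ∈ inc c) :
    psi κ N i j l ∈ pcell κ N i j c := by
  obtain ⟨k, hk⟩ := Cfg.off_cell κ h c l hl
  rw [psi, pcell, hk, mem_lcell_off]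
  exact ⟨k, by simp [add_assoc]⟩

lemma Chart.pcell_mem (h : Chart κ N i j) {c : Fin 9} (hc : c < 6 ∨ Right κ N i j) :
    pcell κ N i j c ∈ cellsV (N + 1) := by
  have hD : ∀ k, lcell (N + 1) (2 * i + (offT k).1) (2 * j + (offT k).2) ∈ cellsV (N + 1) :=
    fun k => mem_subcell h.memD (mem_sub_lcell.2 ⟨k, rfl⟩)
  have hL : ∀ k, lcell (N + 1) (2 * i + (κ.org + κ.org + offT k).1)
      (2 * j + (κ.org + κ.org + offT k).2) ∈ cellsV (N + 1) := by
    intro k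
    refine mem_subcell h.memL (mem_sub_lcell.2 ⟨k, ?_⟩)
    congr 1 <;> simp only [fst_add, snd_add] <;> ring
  have hR : Right κ N i j → ∀ k, lcell (N + 1)
      (2 * i + (offT κ.ky - offT κ.ky' + (offT κ.ky - offT κ.ky') + offT k).1)
      (2 * j + (offT κ.ky - offT κ.ky' + (offT κ.ky - offT κ.ky') + offT k).2) ∈
        cellsV (N + 1) := by
    intro hr k
    refine mem_subcell hr (mem_sub_lcell.2 ⟨k, ?_⟩)
    congr 1 <;> simp only [fst_add, snd_add] <;> ring
  fin_cases c
  · exact hD _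
  · exact hD _
  · exact hD _
  · exact hL _
  · exact hL _
  · exact hL _
  all_goals exact hR (hc.resolve_left (by decide)) _

lemma inc_cellL : ∀ a b, adjL a b → a ∈ inc (cellL a b) ∧ b ∈ inc (cellL a b) := by
  decide +kernel

lemma cellL_lt : ∀ a b : Letter, a < 9 → b < 9 → adjL a b → cellL a b < 6 := by
  decide +kernel

lemma Chart.tri_eq (h : Chart κ N i j) {a b : Letter} (hab : adjL a b)
    (hc : cellL a b < 6 ∨ Right κ N i j) :
    tri (N + 1) (psi κ N i j a) (psi κ N i j b) = pcell κ N i j (cellL a b) :=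
  Gasket.tri_eq (h.pcell_mem hc) (h.inj.ne hab.1) (mem_pcell h.good (inc_cellL a b hab).1)
    (mem_pcell h.good (inc_cellL a b hab).2)

lemma Chart.adj (h : Chart κ N i j) {a b : Letter} (hab : adjL a b)
    (hc : cellL a b < 6 ∨ Right κ N i j) : AdjV (N + 1) (psi κ N i j a) (psi κ N i j b) :=
  ⟨h.inj.ne hab.1, _, h.pcell_mem hc, mem_pcell h.good (inc_cellL a b hab).1,
    mem_pcell h.good (inc_cellL a b hab).2⟩

lemma Chart.pcell_inj (h : Chart κ N i j) {c d : Fin 9}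
    (hcd : pcell κ N i j c = pcell κ N i j d) : c = d := by
  have h1 : pt (N + 1) (2 * i + (κ.cellOff c).1) (2 * j + (κ.cellOff c).2) ∈ pcell κ N i j d :=
    hcd ▸ mem_lcell.2 (by simp)
  have h2 : pt (N + 1) (2 * i + (κ.cellOff d).1) (2 * j + (κ.cellOff d).2) ∈ pcell κ N i j c :=
    hcd ▸ mem_lcell.2 (by simp)
  rw [pcell, mem_lcell] at h1 h2
  exact Cfg.cellOff_inj κ h.good _ _ (Prod.ext (by omega) (by omega))

lemma Cfg.cellOff_spec : ∀ κ : Cfg, κ.Good → ∀ c : Fin 9,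
    (c < 3 → ∃ k, κ.cellOff c = offT k) ∧
    (3 ≤ c → c < 6 → ∃ k, κ.cellOff c = κ.org + κ.org + offT k) :=
  cfg_forall (by decide +kernel)

lemma Chart.closure_left (h : Chart κ N i j) {l : Letter} (hl : l < 9) {q : Pt} {Δ : Finset Pt}
    (hΔE : Δ ∈ sub (lcell N (i + κ.org.1) (j + κ.org.2))) (hl' : psi κ N i j l ∈ Δ) (hq' : q ∈ Δ)
    (hne : psi κ N i j l ≠ q) (hll : 6 ≤ l ∨ l = 0) :
    (∃ m, adjL l m ∧ q = psi κ N i j m) ∨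
      q ∈ vertV N ∧ q ≠ psi κ N i j 0 ∧ q ≠ psi κ N i j 1 := by
  obtain ⟨k, rfl⟩ := mem_sub_lcell.1 hΔE
  obtain ⟨m, hm⟩ := mem_lcell_off.1 hl'
  obtain ⟨n, rfl⟩ := mem_lcell_off.1 hq'
  have hoff : κ.off l = (κ.org + κ.org) + (offT k + offT m) := by
    rw [psi, pt_inj] at hm
    ext <;> simp only [fst_add, snd_add] <;> omega
  have hnm : n ≠ m := by
    rintro rfl; exact hne hm
  have hll' : 6 ≤ l ∨ (l = 0 ∧ k = κ.kx') := by
    rcases hll with hll | rfl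
    · exact inl hll
    · right
      refine ⟨rfl, ?_⟩
      have : κ.off 0 = offT κ.kx + offT κ.kx := rfl
      have h2 : offT κ.kx' + offT κ.kx' = offT k + offT m := by
        rw [hoff, Cfg.org] at this
        ext <;> simp [Prod.ext_iff] at this ⊢ <;> omega
      revert h2
      generalize κ.kx' = a
      clear * -
      revert k m a
      decide
  rcases Cfg.closure' κ h.good l hl k m n hll' hoff hnm with ⟨p, hp, hpo⟩ | ⟨rfl, h0, h1⟩
  · left
    refine ⟨p, hp, ?_⟩
    rw [psi, hpo, pt_inj]
    simp only [fst_add, snd_add]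
    constructor <;> ring
  · right
    refine ⟨?_, ?_, ?_⟩
    · refine Gasket.mem_vertV.2 ⟨_, h.memL, mem_lcell_off.2 ⟨k, ?_⟩⟩
      rw [pt_succ N, pt_inj]
      constructor <;> ring
    · intro he
      rw [psi, pt_inj] at he
      refine h0 (Prod.ext ?_ ?_) <;> simp only [fst_add, snd_add] <;> omega
    · intro he
      rw [psi, pt_inj] at he
      refine h1 (Prod.ext ?_ ?_) <;> simp only [fst_add, snd_add] <;> omega

lemma Chart.closure (h : Chart κ N i j) {l : Letter} (hl : l < 9) (h1 : l ≠ 1) (h2 : l ≠ 2)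
    {q : Pt} (hq : AdjV (N + 1) (psi κ N i j l) q) :
    (∃ m, adjL l m ∧ q = psi κ N i j m) ∨
      q ∈ vertV N ∧ q ≠ psi κ N i j 0 ∧ q ≠ psi κ N i j 1 := by
  obtain ⟨hne, Δ, hΔ, hl', hq'⟩ := hq
  obtain ⟨E, hE, hΔE⟩ := mem_cellsV_succ.1 hΔ
  have hcase : (E = lcell N i j ∧ (3 ≤ l ∧ l < 6)) ∨
      (E = lcell N (i + κ.org.1) (j + κ.org.2) ∧ 6 ≤ l) ∨
      (l = 0 ∧ (E = lcell N i j ∨ E = lcell N (i + κ.org.1) (j + κ.org.2))) := by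
    by_cases h0 : l = 0
    · subst h0
      exact inr (inr ⟨rfl, h.inner E hE (mem_cell_of_mem_vertV hE hΔE hl'
        (h.mem_vertV.2 (by simp)))⟩)
    have hnm : psi κ N i j l ∉ vertV N := by rw [h.mem_vertV]; tauto
    have key : ∀ c : Fin 9, l ∈ inc c → (c < 3 ∨ 3 ≤ c ∧ c < 6) →
        (c < 3 → E = lcell N i j) ∧ (3 ≤ c → E = lcell N (i + κ.org.1) (j + κ.org.2)) := by
      intro c hlc hc
      have hm := mem_pcell (N := N) (i := i) (j := j) h.good hlc
      constructor
      · intro hc3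
        refine parent_eq hE h.memD hΔE ?_ hl' hm hnm
        obtain ⟨k, hk⟩ := (Cfg.cellOff_spec κ h.good c).1 hc3
        rw [mem_sub_lcell, pcell, hk]
        exact ⟨k, rfl⟩
      · intro hc3
        refine parent_eq hE h.memL hΔE ?_ hl' hm hnm
        obtain ⟨k, hk⟩ := (Cfg.cellOff_spec κ h.good c).2 hc3 (hc.resolve_left (not_lt.2 hc3)).2
        rw [mem_sub_lcell, pcell, hk]
        refine ⟨k, ?_⟩
        congr 1 <;> simp only [fst_add, snd_add] <;> ring
    have hex : ∀ l : Letter, l < 9 → l ≠ 0 → l ≠ 1 → l ≠ 2 →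
        ∃ c, l ∈ inc c ∧ ((3 ≤ l ∧ l < 6 ∧ c < 3) ∨ (6 ≤ l ∧ 3 ≤ c ∧ c < 6)) := by decide +kernel
    obtain ⟨c, hlc, hc⟩ := hex l hl h0 h1 h2
    rcases hc with ⟨h3, h4, h5⟩ | ⟨h3, h4, h5⟩
    · exact inl ⟨(key c hlc (inl h5)).1 h5, h3, h4⟩
    · exact inr (inl ⟨(key c hlc (inr ⟨h4, h5⟩)).2 h4, h3⟩)
  have hA : E = lcell N i j → (3 ≤ l ∧ l < 6) ∨ l = 0 → ∃ m, adjL l m ∧ q = psi κ N i j m := by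
    rintro rfl hll
    obtain ⟨k, rfl⟩ := mem_sub_lcell.1 hΔE
    obtain ⟨m, hm⟩ := mem_lcell_off.1 hl'
    obtain ⟨n, rfl⟩ := mem_lcell_off.1 hq'
    have hoff : κ.off l = offT k + offT m := by
      rw [psi, pt_inj] at hm
      ext <;> simp only [fst_add, snd_add] <;> omega
    have hnm : n ≠ m := by
      rintro rfl; exact hne hm
    have hll' : (3 ≤ l ∧ l < 6) ∨ (l = 0 ∧ k = κ.kx) := by
      rcases hll with hll | rfl
      · exact inl hll
      · right
        refine ⟨rfl, ?_⟩
        have : κ.off 0 = offT κ.kx + offT κ.kx := rfl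
        rw [hoff] at this
        revert this
        generalize κ.kx = a
        clear * -
        revert k m a
        decide
    obtain ⟨p, hp, hpo⟩ := Cfg.closure κ h.good l k m n hll' hoff hnm
    refine ⟨p, hp, ?_⟩
    rw [psi, hpo, pt_inj]
    simp only [fst_add, snd_add]
    constructor <;> ring
  rcases hcase with ⟨hE', hl3⟩ | ⟨rfl, hl6⟩ | ⟨hl0, hE' | rfl⟩
  · exact inl (hA hE' (inl hl3))
  · exact h.closure_left hl hΔE hl' hq' hne (inl hl6)
  · exact inl (hA hE' (inr hl0))
  · exact h.closure_left hl hΔE hl' hq' hne (inr hl0)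

end

section

/-! ### Path segments as words -/

variable {κ : Cfg} {N : ℕ} {i j : ℤ}

/-- The path segments on level `N + 1` that lead from `x` to `y`. -/
def Seg (N : ℕ) (x y : Pt) : Set (List Pt) :=
  {s | s.IsChain (AdjV (N + 1)) ∧ s.head? = some x ∧ s.getLast? = some y ∧
    ∀ p ∈ s.dropLast, p ∈ vertV N → p = x}

/-- The words of path segments. -/
def SegL : Set (List Letter) :=
  {l | l.IsChain adjL ∧ l.head? = some 0 ∧ l.getLast? = some 1 ∧
    ∀ p ∈ l.dropLast, p ≠ 1 ∧ p ≠ 2}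

instance : DecidablePred (· ∈ SegL) := fun l => by unfold SegL; simp only [Set.mem_ofPred_eq]; infer_instance

/-- The number of sharp turns and backtracks of a word. -/
def turnL : List Letter → ℕ
  | a :: b :: c :: t =>
    (if ¬ (b = 0 ∨ b = 1 ∨ b = 2) ∧ (a = c ∨ adjL a c) then 1 else 0) + turnL (b :: c :: t)
  | _ => 0

/-- The penalty of a word. -/
def penL (l : List Letter) : ℕ := turnL l + l.tail.count 0

lemma adjL_lt : ∀ a b : Letter, a < 9 → a ≠ 1 → adjL a b → b < 9 := by decide +kernel

lemma segL_cont_lt {a : Letter} {l : List Letter} (ha : a < 9) (h : (a :: l).IsChain adjL)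
    (hav : ∀ p ∈ (a :: l).dropLast, p ≠ 1 ∧ p ≠ 2) : ∀ p ∈ a :: l, p < 9 := by
  induction l generalizing a with
  | nil => simpa using ha
  | cons b t ih =>
    rw [isChain_cons_cons] at h
    rw [dropLast_cons_cons] at hav
    have hb : b < 9 := adjL_lt a b ha (hav a (by simp)).1 h.1
    intro p hp
    rcases mem_cons.1 hp with rfl | hp
    · exact ha
    · exact ih hb h.2 (fun p hp => hav p (mem_cons_of_mem _ hp)) p hp

lemma SegL.exists_cons {l : List Letter} (h : l ∈ SegL) : ∃ t, l = 0 :: t ∧ t ≠ [] := by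
  obtain ⟨-, h0, h1, -⟩ := h
  cases l with
  | nil => simp at h0
  | cons a t =>
    grind

lemma SegL.lt {l : List Letter} (h : l ∈ SegL) : ∀ p ∈ l, p < 9 := by
  obtain ⟨t, rfl, -⟩ := SegL.exists_cons h
  exact segL_cont_lt (by decide) h.1 h.2.2.2

lemma Chart.exists_word (h : Chart κ N i j) {a : Letter} (ha : a < 9) (h1 : a ≠ 1) (h2 : a ≠ 2)
    {t : List Pt} (hc : (psi κ N i j a :: t).IsChain (AdjV (N + 1)))
    (hl : (psi κ N i j a :: t).getLast? = some (psi κ N i j 1))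
    (hav : ∀ p ∈ (psi κ N i j a :: t).dropLast, p ∈ vertV N → p = psi κ N i j 0) :
    ∃ l : List Letter, t = l.map (psi κ N i j) ∧ (a :: l).IsChain adjL ∧
      (a :: l).getLast? = some 1 ∧ ∀ p ∈ (a :: l).dropLast, p ≠ 1 ∧ p ≠ 2 := by
  induction t generalizing a with
  | nil => exact absurd (h.inj (by simpa using hl)) h1
  | cons q t ih =>
    rw [isChain_cons_cons] at hc
    rw [dropLast_cons_cons] at hav
    rw [getLast?_cons_cons] at hl
    have hend : q ∈ vertV N → q = psi κ N i j 0 ∨ (q = psi κ N i j 1 ∧ t = []) := by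
      intro hq
      cases t with
      | nil => exact inr ⟨by simpa using hl, rfl⟩
      | cons r t => exact inl (hav q (by simp) hq)
    rcases h.closure ha h1 h2 hc.1 with ⟨m, hm, rfl⟩ | ⟨hq, h0, h1'⟩
    · have hmv := hend ∘ h.mem_vertV.2
      have hm9 := adjL_lt a m ha h1 hm
      by_cases hm1 : m = 1
      · subst hm1
        have ht : t = [] := by
          rcases hmv (by simp) with he | he
          · exact absurd (h.inj he) (by decide)
          · exact he.2
        subst ht
        exact ⟨[1], rfl, by simpa using hm, rfl, by simpa using ⟨h1, h2⟩⟩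
      have hm2 : m ≠ 2 := by
        rintro rfl
        rcases hmv (by simp) with he | he
        · exact absurd (h.inj he) (by decide)
        · exact absurd (h.inj he.1) (by decide)
      obtain ⟨l, rfl, hl1, hl2, hl3⟩ := ih hm9 hm1 hm2 hc.2 hl
        (fun p hp => hav p (mem_cons_of_mem _ hp))
      refine ⟨m :: l, rfl, isChain_cons_cons.2 ⟨hm, hl1⟩, by rwa [getLast?_cons_cons],
        ?_⟩
      rw [dropLast_cons_cons]
      intro p hp
      rcases mem_cons.1 hp with rfl | hp
      · exact ⟨h1, h2⟩
      · exact hl3 p hp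
    · rcases hend hq with he | he
      · exact absurd he h0
      · exact absurd he.1 h1'

lemma isChain_map_psi (h : Chart κ N i j) {l : List Letter} (hl : ∀ p ∈ l, p < 9)
    (hc : l.IsChain adjL) : (l.map (psi κ N i j)).IsChain (AdjV (N + 1)) := by
  induction l with
  | nil => simp
  | cons a t ih =>
    cases t with
    | nil => simp
    | cons b t =>
      rw [isChain_cons_cons] at hc
      exact isChain_cons_cons.2 ⟨h.adj hc.1 (inl (cellL_lt a b (hl a (by simp))
        (hl b (by simp)) hc.1)), ih (fun p hp => hl p (mem_cons_of_mem _ hp)) hc.2⟩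

lemma Chart.mem_Seg (h : Chart κ N i j) {s : List Pt} :
    s ∈ Seg N (psi κ N i j 0) (psi κ N i j 1) ↔ ∃ l ∈ SegL, s = l.map (psi κ N i j) := by
  constructor
  · rintro ⟨h1, h2, h3, h4⟩
    cases s with
    | nil => simp at h2
    | cons x t =>
      obtain rfl : x = psi κ N i j 0 := by simpa using h2
      obtain ⟨l, rfl, h5, h6, h7⟩ := h.exists_word (by decide) (by decide) (by decide) h1 h3 h4
      exact ⟨0 :: l, ⟨h5, rfl, h6, h7⟩, rfl⟩
  · rintro ⟨l, hl, rfl⟩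
    have hlt := SegL.lt hl
    obtain ⟨h1, h2, h3, h4⟩ := hl
    refine ⟨isChain_map_psi h hlt h1, by rw [List.head?_map, h2]; rfl,
      by rw [List.getLast?_map, h3]; rfl, ?_⟩
    intro p hp hpv
    rw [← List.map_dropLast] at hp
    obtain ⟨a, ha, rfl⟩ := List.mem_map.1 hp
    rcases h.mem_vertV.1 hpv with rfl | rfl | rfl
    · rfl
    · exact absurd rfl (h4 _ ha).1
    · exact absurd rfl (h4 _ ha).2

lemma dot_pt (N : ℕ) (a b c d e f g k : ℤ) :
    dot (pt N a b - pt N c d) (pt N e f - pt N g k) =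
      (qdot (a - c, b - d) (e - g, f - k) : ℚ) / (2 * (2 ^ N * 2 ^ N)) := by
  have h : (2 : ℚ) ^ N ≠ 0 := by positivity
  simp only [dot, pt, qdot, Prod.fst_sub, Prod.snd_sub]
  push_cast
  field_simp

lemma dot_psi_neg (a b c : Letter) :
    dot (psi κ N i j b - psi κ N i j a) (psi κ N i j c - psi κ N i j b) < 0 ↔
      qdot (κ.off b - κ.off a) (κ.off c - κ.off b) < 0 := by
  have hp : (0 : ℚ) < 2 * (2 ^ (N + 1) * 2 ^ (N + 1)) := by positivity
  rw [psi, psi, psi, dot_pt, div_lt_iff₀ hp, zero_mul, Int.cast_lt_zero]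
  simp only [add_sub_add_left_eq_sub]
  rfl

lemma Chart.turnCount_map (h : Chart κ N i j) {l : List Letter} (hc : l.IsChain adjL) :
    turnCount (vertV N) (l.map (psi κ N i j)) = turnL l := by
  match l, hc with
  | [], _ => rfl
  | [_], _ => rfl
  | [_, _], _ => rfl
  | a :: b :: c :: t, hc =>
    rw [isChain_cons_cons] at hc
    have ih := h.turnCount_map hc.2
    have hc' := hc.2
    rw [isChain_cons_cons] at hc'
    simp only [map_cons] at ih ⊢
    rw [turnCount, turnL, ih]
    congr 1
    refine if_congr ?_ rfl rfl
    rw [dot_psi_neg, h.mem_vertV, and_comm]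
    exact and_congr_right fun hb => Cfg.qdot_off κ h.good a b c hc.1 hc'.1 hb

lemma Chart.penalty_map (h : Chart κ N i j) {l : List Letter} (hl : l ∈ SegL) :
    penalty N (l.map (psi κ N i j)) = penL l := by
  rw [penalty, penL, h.turnCount_map hl.1, returnCount]
  obtain ⟨t, rfl, -⟩ := SegL.exists_cons hl
  simp only [map_cons, List.tail_cons, headD_cons]
  rw [List.count_map_of_injective _ _ h.inj]

lemma Chart.psi_next (h : Chart κ N i j) {l : Letter} (hl : l < 9) :
    psi κ.next N i j l = psi κ N i j (rot l) := by
  rw [psi, psi, (Cfg.next_spec κ h.good).2 l hl]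

lemma Chart.next (h : Chart κ N i j) (hR : Right κ N i j) (hI : Inner N (psi κ N i j 1)) :
    Chart κ.next N i j := by
  refine ⟨(Cfg.next_spec κ h.good).1, h.memD, hR, ?_⟩
  rw [h.psi_next (by decide)]
  intro E hE hmem
  have hne : lcell N i j ≠ lcell N (i + (offT κ.ky - offT κ.ky').1)
      (j + (offT κ.ky - offT κ.ky').2) := by
    intro he
    have h1 : pt N i j ∈ lcell N (i + (offT κ.ky - offT κ.ky').1)
      (j + (offT κ.ky - offT κ.ky').2) := he ▸ mem_lcell.2 (by simp)
    have h2 : pt N (i + (offT κ.ky - offT κ.ky').1) (j + (offT κ.ky - offT κ.ky').2) ∈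
      lcell N i j := he ▸ mem_lcell.2 (by simp)
    rw [mem_lcell] at h1 h2
    have h3 : ∀ a b : Fin 3, (offT a - offT b).1 = 0 → (offT a - offT b).2 = 0 → a = b := by decide
    exact h.good.2.2 (h3 _ _ (by omega) (by omega)).symm
  have hmem' : psi κ N i j 1 ∈ lcell N (i + (offT κ.ky - offT κ.ky').1)
      (j + (offT κ.ky - offT κ.ky').2) := by
    rw [(psi_corner κ N i j).2.1, mem_lcell_off]
    refine ⟨κ.ky', ?_⟩
    rw [pt_inj]; simp only [Prod.fst_sub, Prod.snd_sub]; constructor <;> ring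
  obtain ⟨D', hD', hne', -, hall⟩ := hI.exists_other h.memD (psi_mem κ N i j).2.1
  rcases hall _ hR hmem' with he | he
  · exact absurd he.symm hne
  · have := hall E hE hmem
    rwa [← he] at this

lemma exists_off_of_ne {N : ℕ} {i j : ℤ} {x : Pt} {k : Fin 3}
    (hx : x = pt N (i + (offT k).1) (j + (offT k).2)) {D : Finset Pt} (hD : D ∈ cellsV N)
    (hne : lcell N i j ≠ D) (hxD : x ∈ D) : ∃ k' ≠ k,
      D = lcell N (i + (offT k - offT k').1) (j + (offT k - offT k').2) := by
  obtain ⟨i', j', rfl⟩ := cellsV_spec hD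
  obtain ⟨k', hk'⟩ := mem_lcell_off.1 hxD
  rw [hx, pt_inj] at hk'
  have hi : i' = i + (offT k - offT k').1 := by rw [Prod.fst_sub]; omega
  have hj : j' = j + (offT k - offT k').2 := by rw [Prod.snd_sub]; omega
  refine ⟨k', ?_, by rw [hi, hj]⟩
  rintro rfl
  exact hne (by rw [hi, hj]; simp)

lemma exists_chart {D : Finset Pt} (hD : D ∈ cellsV N) {x y : Pt} (hxy : x ≠ y) (hx : x ∈ D)
    (hy : y ∈ D) (hI : Inner N x) : ∃ κ i j, D = lcell N i j ∧ Chart κ N i j ∧ psi κ N i j 0 = x ∧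
      psi κ N i j 1 = y ∧ (Inner N y → Right κ N i j) := by
  obtain ⟨i, j, rfl⟩ := cellsV_spec hD
  obtain ⟨kx, hkx⟩ := mem_lcell_off.1 hx
  obtain ⟨ky, hky⟩ := mem_lcell_off.1 hy
  have hk : kx ≠ ky := by rintro rfl; exact hxy (hkx.trans hky.symm)
  obtain ⟨D', hD', hne, hxD', hall⟩ := hI.exists_other hD hx
  obtain ⟨kx', hkx', rfl⟩ := exists_off_of_ne hkx hD' hne hxD'
  have main : ∀ ky', ky' ≠ ky → Chart ⟨kx, ky, kx', ky'⟩ N i j ∧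
      psi ⟨kx, ky, kx', ky'⟩ N i j 0 = x ∧ psi ⟨kx, ky, kx', ky'⟩ N i j 1 = y := by
    intro ky' hky'
    have h0 : psi ⟨kx, ky, kx', ky'⟩ N i j 0 = x := by rw [(psi_corner _ _ _ _).1, hkx]
    have h1 : psi ⟨kx, ky, kx', ky'⟩ N i j 1 = y := by rw [(psi_corner _ _ _ _).2.1, hky]
    exact ⟨⟨⟨hk, hkx', hky'⟩, hD, hD', by rw [h0]; exact hall⟩, h0, h1⟩
  by_cases hIy : Inner N y
  · obtain ⟨D'', hD'', hne', hyD'', -⟩ := hIy.exists_other hD hy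
    obtain ⟨ky', hky', rfl⟩ := exists_off_of_ne hky hD'' hne' hyD''
    obtain ⟨h1, h2, h3⟩ := main ky' hky'
    exact ⟨_, i, j, rfl, h1, h2, h3, fun _ => hD''⟩
  · obtain ⟨h1, h2, h3⟩ := main kx hk
    exact ⟨_, i, j, rfl, h1, h2, h3, fun h => absurd h hIy⟩

lemma Chart.psi_two (h : Chart κ N i j) {z : Pt} (hz : z ∈ lcell N i j)
    (h0 : z ≠ psi κ N i j 0) (h1 : z ≠ psi κ N i j 1) : z = psi κ N i j 2 := by
  obtain ⟨k, hk⟩ := mem_lcell_off.1 hz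
  obtain ⟨e0, e1, e2⟩ := psi_corner κ N i j
  have hk0 : k ≠ κ.kx := by rintro rfl; exact h0 (hk.trans e0.symm)
  have hk1 : k ≠ κ.ky := by rintro rfl; exact h1 (hk.trans e1.symm)
  have : ∀ a b c : Fin 3, a ≠ b → c ≠ a → c ≠ b → c = -(a + b) := by decide
  rw [e2, hk, this _ _ _ h.good.1 hk0 hk1]

end

/-! ### Generating functions of finite transfer matrices -/

section Transfer

open Matrix

variable {S : Type*} [Fintype S] [DecidableEq S] {A : Matrix S S ℝ} {f : S → ℝ}

lemma pow_nonneg_entry (hA : ∀ s t, 0 ≤ A s t) (n : ℕ) (s t : S) : 0 ≤ (A ^ n) s t := by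
  induction n generalizing s t with
  | zero => rw [pow_zero, one_apply]; split_ifs <;> norm_num
  | succ n ih =>
    rw [pow_succ, mul_apply]
    exact sum_nonneg fun r _ => mul_nonneg (ih s r) (hA r t)

lemma pow_mulVec_nonneg (hA : ∀ s t, 0 ≤ A s t) (hf : ∀ s, 0 ≤ f s) (n : ℕ) (s : S) :
    0 ≤ ((A ^ n) *ᵥ f) s :=
  sum_nonneg fun t _ => mul_nonneg (pow_nonneg_entry hA n s t) (hf t)

lemma pow_succ_mulVec (n : ℕ) (s : S) :
    ((A ^ (n + 1)) *ᵥ f) s = ∑ t, A s t * ((A ^ n) *ᵥ f) t := by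
  rw [pow_succ', ← mulVec_mulVec]; rfl

lemma sum_range_pow_mulVec (x : ℝ) (n : ℕ) (s : S) :
    ∑ k ∈ range (n + 1), ((A ^ k) *ᵥ f) s * x ^ k =
      f s + x * ∑ t, A s t * ∑ k ∈ range n, ((A ^ k) *ᵥ f) t * x ^ k := by
  rw [Finset.sum_range_succ', pow_zero, pow_zero, one_mulVec, mul_one, add_comm]
  simp only [pow_succ_mulVec, Finset.mul_sum, Finset.sum_mul]
  rw [Finset.sum_comm]
  congr! 3
  ring

/-- A nonnegative supersolution of `w = f + x A w` bounds the generating function. -/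
lemma summable_of_supersolution (hA : ∀ s t, 0 ≤ A s t) (hf : ∀ s, 0 ≤ f s) {x : ℝ} (hx : 0 ≤ x)
    {y : S → ℝ} (hy0 : ∀ s, 0 ≤ y s) (hy : ∀ s, f s + x * ∑ t, A s t * y t ≤ y s) (s : S) :
    Summable fun n => ((A ^ n) *ᵥ f) s * x ^ n := by
  have : ∀ n s, ∑ k ∈ range n, ((A ^ k) *ᵥ f) s * x ^ k ≤ y s := by
    intro n
    induction n with
    | zero => simpa using hy0
    | succ n ih =>
      intro s
      rw [sum_range_pow_mulVec]
      refine le_trans ?_ (hy s)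
      gcongr with t
      exacts [hA s t, ih t]
  exact summable_of_sum_range_le (fun n => mul_nonneg (pow_mulVec_nonneg hA hf n s)
    (pow_nonneg hx n)) (this · s)

lemma exists_summable_pos (hA : ∀ s t, 0 ≤ A s t) (hf : ∀ s, 0 ≤ f s) (s : S) :
    ∃ R > 0, Summable fun n => ((A ^ n) *ᵥ f) s * R ^ n := by
  set K := ∑ s, ∑ t, A s t
  have hK : 0 ≤ K := sum_nonneg fun s _ => sum_nonneg fun t _ => hA s t
  have hc : 0 ≤ ∑ t, f t := sum_nonneg fun t _ => hf t
  refine ⟨1 / (K + 1), by positivity, summable_of_supersolution hA hf (by positivity)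
    (y := fun _ => (∑ t, f t) * (K + 1)) (fun _ => by positivity) (fun s => ?_) s⟩
  have h1 : f s ≤ ∑ t, f t := single_le_sum (fun t _ => hf t) (mem_univ s)
  have h2 : ∑ t, A s t ≤ K := single_le_sum (f := fun s => ∑ t, A s t)
    (fun s _ => sum_nonneg fun t _ => hA s t) (mem_univ s)
  rw [← Finset.sum_mul]
  have h3 : 1 / (K + 1) * ((∑ t, A s t) * ((∑ t, f t) * (K + 1))) = (∑ t, A s t) * ∑ t, f t := by
    field_simp
  rw [h3]
  nlinarith

/-- The set of points where the generating functions converge is open, if they are positive. -/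
lemma exists_summable_gt_of_pos (hA : ∀ s t, 0 ≤ A s t) (hf : ∀ s, 0 ≤ f s) {R : ℝ} (hR : 0 < R)
    (h : ∀ s, Summable fun n => ((A ^ n) *ᵥ f) s * R ^ n) (hpos : ∀ s, ∃ n, 0 < ((A ^ n) *ᵥ f) s) :
    ∃ R' > R, ∀ s, Summable fun n => ((A ^ n) *ᵥ f) s * R' ^ n := by
  set w : S → ℝ := fun s => ∑' n, ((A ^ n) *ᵥ f) s * R ^ n with hw
  have hn : ∀ s n, 0 ≤ ((A ^ n) *ᵥ f) s * R ^ n := fun s n =>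
    mul_nonneg (pow_mulVec_nonneg hA hf n s) (pow_nonneg hR.le n)
  have hw0 : ∀ s, 0 < w s := fun s => by
    obtain ⟨n, hn'⟩ := hpos s
    exact (h s).tsum_pos (hn s) n (by positivity)
  have hlim : ∀ s, Tendsto (fun n => ∑ k ∈ range n, ((A ^ k) *ᵥ f) s * R ^ k) atTop
    (𝓝 (w s)) := fun s => (h s).hasSum.tendsto_sum_nat
  have hweq : ∀ s, w s = f s + R * ∑ t, A s t * w t := fun s =>
    tendsto_nhds_unique ((hlim s).comp (tendsto_add_atTop_nat 1)) (by
      simp only [comp_def, sum_range_pow_mulVec]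
      exact ((tendsto_finsetSum _ fun t _ => (hlim t).const_mul _).const_mul R).const_add _)
  have hmul : ∀ (x : ℝ) (v : S → ℝ) s, ((1 - x • A) *ᵥ v) s = v s - x * ∑ t, A s t * v t := by
    intro x v s
    rw [sub_mulVec, one_mulVec, smul_mulVec]; rfl
  have hdet : (1 - R • A).det ≠ 0 := by
    intro h0
    obtain ⟨v, hv0, hv⟩ := exists_mulVec_eq_zero_iff.2 h0
    have hv' : ∀ s, v s = R * ∑ t, A s t * v t := fun s => by
      linarith [hmul R v s, congrFun hv s, Pi.zero_apply (M := fun _ => ℝ) s]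
    obtain ⟨c, hc⟩ : ∃ c, ∀ s, |v s| ≤ c * w s := ⟨∑ t, |v t| / w t, fun s => by
      rw [← div_le_iff₀ (hw0 s)]
      exact single_le_sum (f := fun t => |v t| / w t)
        (fun t _ => div_nonneg (abs_nonneg _) (hw0 t).le) (mem_univ s)⟩
    have hb : ∀ n s, |v s| ≤ c * (w s - ∑ k ∈ range n, ((A ^ k) *ᵥ f) s * R ^ k) := by
      intro n
      induction n with
      | zero => simpa using hc
      | succ n ih =>
        intro s
        calc |v s| ≤ R * ∑ t, A s t * |v t| := by
              rw [hv' s, abs_mul, abs_of_pos hR]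
              gcongr
              refine (Finset.abs_sum_le_sum_abs _ _).trans (le_of_eq ?_)
              simp only [abs_mul, abs_of_nonneg (hA _ _)]
          _ ≤ R * ∑ t, A s t *
              (c * (w t - ∑ k ∈ range n, ((A ^ k) *ᵥ f) t * R ^ k)) := by
              gcongr with t
              exacts [hA s t, ih t]
          _ = _ := by
              rw [sum_range_pow_mulVec, hweq s]
              simp only [mul_sub, Finset.sum_sub_distrib, mul_left_comm _ c, ← Finset.mul_sum]
              ring
    refine hv0 (funext fun s => abs_nonpos_iff.1 ?_)
    have := ((hlim s).const_sub (w s)).const_mul c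
    rw [sub_self, mul_zero] at this
    exact ge_of_tendsto' this fun n => hb n s
  have hwR : w = (1 - R • A)⁻¹ *ᵥ f := by
    have : (1 - R • A) *ᵥ w = f := funext fun s => by rw [hmul]; linarith [hweq s]
    rw [← this, mulVec_mulVec, nonsing_inv_mul _ hdet.isUnit, one_mulVec]
  have hc : Continuous fun x : ℝ => 1 - x • A := by fun_prop
  have hcont : ∀ s, ContinuousAt (fun x : ℝ => ((1 - x • A)⁻¹ *ᵥ f) s) R := fun s => by
    have : ∀ x : ℝ, ((1 - x • A)⁻¹ *ᵥ f) s =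
        (1 - x • A).det⁻¹ * ((1 - x • A).adjugate *ᵥ f) s := fun x => by
      rw [inv_def, Ring.inverse_eq_inv', smul_mulVec]; rfl
    simp only [this]
    exact (hc.matrix_det.continuousAt.inv₀ hdet).mul
      ((continuous_apply s).comp (hc.matrix_adjugate.matrix_mulVec continuous_const)).continuousAt
  have hev := (hc.matrix_det.continuousAt.eventually_ne hdet).and (eventually_all.2 fun s =>
    (hcont s).eventually_const_lt (u := 0) (by simpa only [← hwR] using hw0 s))
  obtain ⟨R', ⟨hd, hp⟩, hR'⟩ := ((hev.filter_mono nhdsWithin_le_nhds).and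
    (eventually_mem_nhdsWithin (a := R) (s := Ioi R))).exists
  refine ⟨R', hR', summable_of_supersolution hA hf (hR.trans hR').le (fun s => (hp s).le)
    fun s => ?_⟩
  have : ((1 - R' • A) *ᵥ ((1 - R' • A)⁻¹ *ᵥ f)) s = f s := by
    rw [mulVec_mulVec, mul_nonsing_inv _ (isUnit_iff_ne_zero.2 hd), one_mulVec]
  rw [hmul] at this
  linarith

lemma exists_summable_gt (hA : ∀ s t, 0 ≤ A s t) (hf : ∀ s, 0 ≤ f s) (s₀ : S) {R : ℝ}
    (hR : 0 ≤ R) (h : Summable fun n => ((A ^ n) *ᵥ f) s₀ * R ^ n) :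
    ∃ R' > R, Summable fun n => ((A ^ n) *ᵥ f) s₀ * R' ^ n := by
  classical
  rcases hR.eq_or_lt with rfl | hR0
  · exact exists_summable_pos hA hf s₀
  let V : S → Prop := fun s => (∃ k, 0 < (A ^ k) s₀ s) ∧ ∃ k, 0 < ((A ^ k) *ᵥ f) s
  have hCz : ∀ t n, (¬ ∃ k, 0 < ((A ^ k) *ᵥ f) t) → ((A ^ n) *ᵥ f) t = 0 := fun t n ht =>
    le_antisymm (not_lt.1 fun hlt => ht ⟨n, hlt⟩) (pow_mulVec_nonneg hA hf n t)
  let B : Matrix (Subtype V) (Subtype V) ℝ := fun s t => A s t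
  have hAB : ∀ n (s : Subtype V), ((B ^ n) *ᵥ fun s : Subtype V => f s) s =
      ((A ^ n) *ᵥ f) (s : S) := by
    intro n
    induction n with
    | zero => simp
    | succ n ih =>
      intro s
      rw [pow_succ_mulVec, pow_succ_mulVec]
      simp only [ih]
      change ∑ t : Subtype V, A s t * ((A ^ n) *ᵥ f) t = _
      rw [← Finset.sum_subtype (univ.filter V) (p := V) (by simp)
        fun t => A s t * ((A ^ n) *ᵥ f) t]
      refine Finset.sum_filter_of_ne fun t _ ht => ⟨?_, not_not.1 fun hn => ?_⟩
      · obtain ⟨k, hk⟩ := s.2.1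
        refine ⟨k + 1, ?_⟩
        rw [pow_succ, mul_apply]
        exact lt_of_lt_of_le (mul_pos hk (lt_of_le_of_ne (hA s t) (left_ne_zero_of_mul ht).symm))
          (single_le_sum (f := fun q => (A ^ k) s₀ q * A q t)
          (fun q _ => mul_nonneg (pow_nonneg_entry hA _ _ _) (hA _ _)) (mem_univ _))
      · exact right_ne_zero_of_mul ht (hCz t n hn)
  by_cases hC0 : ∃ k, 0 < ((A ^ k) *ᵥ f) s₀
  swap
  · refine ⟨R + 1, by linarith, ?_⟩
    simp only [hCz s₀ _ hC0, zero_mul]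
    exact summable_zero
  have hsum : ∀ s : Subtype V,
      Summable fun n => ((B ^ n) *ᵥ fun s : Subtype V => f s) s * R ^ n := fun s => by
    obtain ⟨k, hk⟩ := s.2.1
    simp only [hAB]
    refine Summable.of_nonneg_of_le (fun n => mul_nonneg (pow_mulVec_nonneg hA hf n s)
      (pow_nonneg hR n)) (fun n => ?_) (((summable_nat_add_iff k).2 h).mul_left
      (((A ^ k) s₀ s * R ^ k)⁻¹))
    rw [inv_mul_eq_div, le_div_iff₀ (by positivity), add_comm n k, pow_add A, ← mulVec_mulVec,
      pow_add R, mul_mul_mul_comm, mul_comm (((A ^ n) *ᵥ f) s), mul_comm (R ^ n)]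
    exact mul_le_mul_of_nonneg_right (single_le_sum
      (f := fun q => (A ^ k) s₀ q * ((A ^ n) *ᵥ f) q) (fun q _ => mul_nonneg
      (pow_nonneg_entry hA _ _ _) (pow_mulVec_nonneg hA hf _ _)) (mem_univ _)) (by positivity)
  obtain ⟨R', hR', h'⟩ := exists_summable_gt_of_pos (A := B) (f := fun s => f s)
    (fun s t => hA s t) (fun s => hf s) hR0 hsum fun s => by simpa only [hAB] using s.2.2
  exact ⟨R', hR', by simpa only [hAB] using h' ⟨s₀, ⟨0, by simp⟩, hC0⟩⟩

end Transfer

/-- A power series with nonnegative coefficients that starts with a linear term and diverges at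
the boundary of its disc of convergence takes the value `1` exactly once. -/
lemma existsUnique_hasSum_one {a : ℕ → ℝ} (ha : ∀ n, 0 ≤ a n) (h0 : a 0 = 0) (h1 : 0 < a 1)
    (hP : ∀ R : ℝ, 0 ≤ R → Summable (fun n => a n * R ^ n) →
      ∃ R' > R, Summable fun n => a n * R' ^ n) :
    ∃! x : ℝ, 0 < x ∧ HasSum (fun n => a n * x ^ n) 1 := by
  have hn : ∀ {x : ℝ}, 0 ≤ x → ∀ n, 0 ≤ a n * x ^ n := fun hx n =>
    mul_nonneg (ha n) (pow_nonneg hx n)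
  have hle : ∀ {x y : ℝ}, 0 ≤ x → x ≤ y → ∀ n, a n * x ^ n ≤ a n * y ^ n := fun hx hxy n =>
    mul_le_mul_of_nonneg_left (pow_le_pow_left₀ hx hxy n) (ha n)
  refine existsUnique_of_exists_of_unique ?_ ?_
  · let D : Set ℝ := {x | 0 ≤ x ∧ ∀ k, ∑ n ∈ range k, a n * x ^ n ≤ 1}
    have h0D : (0 : ℝ) ∈ D := ⟨le_rfl, fun k => by
      refine (Finset.sum_nonpos fun n _ => ?_).trans zero_le_one
      rcases n with _ | n <;> simp [h0]⟩
    have hbdd : BddAbove D := by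
      refine ⟨1 / a 1, fun x hx => ?_⟩
      have h3 := hx.2 2
      simp only [Finset.sum_range_succ, Finset.sum_range_zero, h0] at h3
      rw [le_div_iff₀ h1]
      linarith
    set s := sSup D
    have hs0 : 0 ≤ s := le_csSup hbdd h0D
    have hsk : ∀ k, ∑ n ∈ range k, a n * s ^ n ≤ 1 := fun k =>
      closure_minimal (t := {x : ℝ | ∑ n ∈ range k, a n * x ^ n ≤ 1}) (fun x hx => hx.2 k)
        (isClosed_le (by fun_prop) continuous_const) (csSup_mem_closure ⟨0, h0D⟩ hbdd)
    have hss := summable_of_sum_range_le (hn hs0) hsk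
    have he : ∑' n, a n * s ^ n = 1 := by
      refine (hss.tsum_le_of_sum_range_le hsk).eq_or_lt.resolve_right fun hlt => ?_
      obtain ⟨R', hR', hs'⟩ := hP s hs0 hss
      have hcont : ContinuousOn (fun x => ∑' n, a n * x ^ n) (Icc 0 R') := by
        refine continuousOn_tsum (fun n => by fun_prop) hs' fun n x hx => ?_
        rw [Real.norm_of_nonneg (hn hx.1 n)]
        exact hle hx.1 hx.2 n
      have hev := ((hcont s ⟨hs0, hR'.le⟩).mono fun y (hy : y ∈ Set.Ioc s R') =>
        ⟨hs0.trans hy.1.le, hy.2⟩).eventually_lt_const hlt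
      have : (𝓝[Set.Ioc s R'] s).NeBot := by rw [nhdsWithin_Ioc_eq_nhdsGT hR']; infer_instance
      obtain ⟨y, hy, hys, hyR⟩ := (hev.and eventually_mem_nhdsWithin).exists
      have hy0 : 0 ≤ y := hs0.trans hys.le
      have hsy := Summable.of_nonneg_of_le (hn hy0) (hle hy0 hyR) hs'
      exact absurd (le_csSup hbdd (⟨hy0, fun k => (hsy.sum_le_tsum _ fun n _ => hn hy0 n).trans
        hy.le⟩ : y ∈ D)) (not_le.2 hys)
    refine ⟨s, hs0.lt_of_ne ?_, hss.hasSum_iff.2 he⟩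
    intro hz
    rw [← hz, tsum_eq_single 0 fun n hn => by simp [hn]] at he
    simp [h0] at he
  · have key : ∀ x y : ℝ, 0 < x → x < y → HasSum (fun n => a n * x ^ n) 1 →
        HasSum (fun n => a n * y ^ n) 1 → False := fun x y hx hxy hsx hsy => by
      have h3 : a 1 * x ^ 1 < a 1 * y ^ 1 := by simpa using mul_lt_mul_of_pos_left hxy h1
      exact lt_irrefl _ (hasSum_lt (hle hx.le hxy.le) h3 hsx hsy)
    rintro x y ⟨hx, hsx⟩ ⟨hy, hsy⟩
    rcases lt_trichotomy x y with h | h | h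
    · exact (key x y hx h hsx hsy).elim
    · exact h
    · exact (key y x hy h hsy hsx).elim

section

/-! ### The fixed point -/

lemma tsum_list {α : Type*} (f : List α → ℝ≥0∞) :
    ∑' l, f l = f [] + ∑' a, ∑' l, f (a :: l) := by
  classical
  rw [ENNReal.tsum_eq_add_tsum_ite [], ← ENNReal.tsum_prod (f := fun a l => f (a :: l))]
  congr 1
  have hinj : Injective fun p : α × List α => p.1 :: p.2 := by
    rintro ⟨a, l⟩ ⟨b, m⟩ h
    simpa using h
  rw [← hinj.tsum_eq (f := fun l => @ite _ (l = []) (Classical.propDecidable _) 0 (f l))]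
  · simp
  · intro l hl
    cases l with
    | nil => simp at hl
    | cons a l => exact ⟨(a, l), rfl⟩

lemma hasSum_iff_tsum_ofReal {α : Type*} {f : α → ℝ} {c : ℝ} (hf : ∀ a, 0 ≤ f a) (hc : 0 ≤ c) :
    HasSum f c ↔ ∑' a, ofReal (f a) = ofReal c := by
  constructor
  · intro h
    rw [← ENNReal.ofReal_tsum_of_nonneg hf h.summable, h.tsum_eq]
  · intro h
    have h1 : ∑' a, ((Real.toNNReal (f a) : NNReal) : ℝ≥0∞) ≠ ⊤ := by
      simpa [ofReal] using h ▸ ofReal_ne_top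
    have hs : Summable f := by
      have := ENNReal.tsum_coe_ne_top_iff_summable.1 h1
      have h2 := NNReal.summable_coe.2 this
      exact h2.congr fun a => Real.coe_toNNReal _ (hf a)
    rw [← ENNReal.ofReal_tsum_of_nonneg hf hs] at h
    exact hs.hasSum_iff.2 ((ENNReal.ofReal_eq_ofReal_iff (tsum_nonneg hf) hc).1 h)

/-- The weight of a step of a word. -/
def stepW (u : ℝ) (a b c : Letter) : ℝ :=
  if adjL b c ∧ b ≠ 1 ∧ b ≠ 2 then
    u ^ ((if ¬ (b = 0 ∨ b = 1 ∨ b = 2) ∧ (a = c ∨ adjL a c) then 1 else 0) +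
      if c = 0 then 1 else 0)
  else 0

/-- The transfer matrix of words. -/
def transfer (u : ℝ) : Matrix (Letter × Letter) (Letter × Letter) ℝ :=
  fun s t => if t.1 = s.2 then stepW u s.1 s.2 t.2 else 0

/-- The indicator of the final states. -/
def finalV (s : Letter × Letter) : ℝ := if s.2 = 1 then 1 else 0

/-- The weight of the continuations of a word. -/
def contW (u : ℝ) : Letter → Letter → List Letter → ℝ
  | a, b, [] => finalV (a, b)
  | a, b, c :: l => stepW u a b c * contW u b c l

variable {u : ℝ}

lemma stepW_nonneg (hu : 0 ≤ u) (a b c : Letter) : 0 ≤ stepW u a b c := by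
  unfold stepW; split_ifs <;> positivity

lemma finalV_nonneg (s : Letter × Letter) : 0 ≤ finalV s := by
  unfold finalV; split_ifs <;> norm_num

lemma transfer_nonneg (hu : 0 ≤ u) (s t : Letter × Letter) : 0 ≤ transfer u s t := by
  unfold transfer; split_ifs <;> [exact stepW_nonneg hu _ _ _; exact le_rfl]

lemma contW_eq (u : ℝ) (a b : Letter) (l : List Letter) : contW u a b l =
    if (b :: l).IsChain adjL ∧ (b :: l).getLast? = some 1 ∧
      ∀ p ∈ (b :: l).dropLast, p ≠ 1 ∧ p ≠ 2 then u ^ (turnL (a :: b :: l) + l.count 0) else 0 := by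
  induction l generalizing a b with
  | nil => simp [contW, finalV, turnL]
  | cons c l ih =>
    rw [contW, ih b c, stepW, turnL, List.count_cons]
    simp only [isChain_cons_cons, getLast?_cons_cons, dropLast_cons_cons,
      mem_cons, forall_eq_or_imp]
    by_cases h1 : adjL b c ∧ b ≠ 1 ∧ b ≠ 2
    swap
    · rw [if_neg h1, zero_mul, if_neg]
      tauto
    rw [if_pos h1]
    by_cases h2 : (c :: l).IsChain adjL ∧ (c :: l).getLast? = some 1 ∧
      ∀ p ∈ (c :: l).dropLast, p ≠ 1 ∧ p ≠ 2
    · grind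
    · rw [if_neg h2, mul_zero, if_neg]
      tauto

lemma tsum_contW (hu : 0 ≤ u) (n : ℕ) (a b : Letter) :
    ∑' l : List Letter, (if l.length = n then ofReal (contW u a b l) else 0) =
      ofReal (((transfer u ^ n).mulVec finalV) (a, b)) := by
  induction n generalizing a b with
  | zero =>
    rw [tsum_list]
    simp [contW]
  | succ n ih =>
    rw [tsum_list, pow_succ_mulVec, Fintype.sum_prod_type]
    simp only [List.length_nil, length_cons, Nat.add_right_cancel_iff, transfer]
    rw [if_neg (by omega), zero_add, tsum_fintype, Finset.sum_comm]
    rw [ENNReal.ofReal_sum_of_nonneg]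
    swap
    · intro c _
      refine sum_nonneg fun b' _ => ?_
      refine mul_nonneg ?_ (pow_mulVec_nonneg (transfer_nonneg hu) finalV_nonneg _ _)
      split_ifs <;> [exact stepW_nonneg hu _ _ _; exact le_rfl]
    refine sum_congr rfl fun c _ => ?_
    rw [Finset.sum_eq_single b (fun b' _ hb' => by rw [if_neg hb', zero_mul]) (by simp),
      if_pos rfl, ofReal_mul (stepW_nonneg hu _ _ _), ← ih b c, ← ENNReal.tsum_mul_left]
    refine tsum_congr fun l => ?_
    split_ifs
    · rw [contW, ofReal_mul (stepW_nonneg hu _ _ _)]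
    · rw [mul_zero]

/-- The coefficients of the generating function of words. -/
def wordCoeff (u : ℝ) (n : ℕ) : ℝ := ((transfer u ^ n).mulVec finalV) (0, 0)

lemma wordCoeff_nonneg (hu : 0 ≤ u) (n : ℕ) : 0 ≤ wordCoeff u n :=
  pow_mulVec_nonneg (transfer_nonneg hu) finalV_nonneg _ _

lemma turnL_zero_cons (t : List Letter) : turnL (0 :: 0 :: t) = turnL (0 :: t) := by
  cases t <;> simp [turnL]

lemma contW_zero (t : List Letter) :
    contW u 0 0 t = if (0 :: t) ∈ SegL then u ^ penL (0 :: t) else 0 := by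
  rw [contW_eq, turnL_zero_cons]
  refine if_congr ?_ rfl rfl
  simp [SegL]

lemma tsum_segL (f : List Letter → ℝ≥0∞) :
    ∑' l : SegL, f l = ∑' t, if (0 :: t) ∈ SegL then f (0 :: t) else 0 := by
  rw [tsum_subtype SegL f, tsum_list, tsum_eq_single (0 : Letter)]
  · rw [indicator_of_notMem, zero_add]
    · exact tsum_congr fun t => by by_cases h : (0 :: t) ∈ SegL <;> simp [h]
    · rintro ⟨-, h, -⟩; simp at h
  · intro a ha
    refine tsum_eq_zero.2 fun l => indicator_of_notMem ?_ _
    rintro ⟨-, h, -⟩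
    exact ha (by simpa using h)

lemma hasSum_word_iff (hu : 0 ≤ u) {x c : ℝ} (hx : 0 ≤ x) (hc : 0 ≤ c) :
    HasSum (fun l : SegL => u ^ penL (l : List Letter) * x ^ ((l : List Letter).length - 1)) c ↔
      HasSum (fun n => wordCoeff u n * x ^ n) c := by
  rw [hasSum_iff_tsum_ofReal (fun l => by positivity) hc,
    hasSum_iff_tsum_ofReal (fun n => mul_nonneg (wordCoeff_nonneg hu n) (pow_nonneg hx n)) hc,
    tsum_segL fun l => ofReal (u ^ penL l * x ^ (l.length - 1))]
  have e : ∀ t : List Letter, (if (0 :: t) ∈ SegL then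
      ofReal (u ^ penL (0 :: t) * x ^ ((0 :: t : List Letter).length - 1)) else 0) =
      ∑' n, (if t.length = n then ofReal (contW u 0 0 t) else 0) *
        ofReal (x ^ n) := by
    intro t
    rw [tsum_eq_single t.length (fun n hn => by rw [if_neg hn.symm, zero_mul]), if_pos rfl,
      contW_zero, ← ofReal_mul]
    · split_ifs <;> simp
    · split_ifs <;> positivity
  simp only [e]
  rw [tsum_comm]
  have e2 : ∀ n, ∑' t : List Letter, (if t.length = n then ofReal (contW u 0 0 t) else 0) *
      ofReal (x ^ n) = ofReal (wordCoeff u n * x ^ n) := by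
    intro n
    rw [ENNReal.tsum_mul_right, tsum_contW hu, ofReal_mul (wordCoeff_nonneg hu n)]
    rfl
  simp only [e2]

lemma wordCoeff_le (hu : 0 ≤ u) {l : List Letter} (hl : l ∈ SegL) :
    u ^ penL l ≤ wordCoeff u (l.length - 1) := by
  obtain ⟨t, rfl, -⟩ := SegL.exists_cons hl
  have h := tsum_contW hu t.length 0 0
  have h2 := ENNReal.le_tsum (f := fun l : List Letter =>
    if l.length = t.length then ofReal (contW u 0 0 l) else 0) t
  rw [h] at h2
  simp only [if_true] at h2
  rw [contW_zero, if_pos hl] at h2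
  exact (ENNReal.ofReal_le_ofReal_iff (wordCoeff_nonneg hu _)).1 h2

lemma wordCoeff_zero (u : ℝ) : wordCoeff u 0 = 0 := by
  simp [wordCoeff, finalV]

lemma wordCoeff_one (u : ℝ) : wordCoeff u 1 = 0 := by
  rw [wordCoeff, pow_one, Matrix.mulVec, dotProduct, Fintype.sum_prod_type]
  refine Finset.sum_eq_zero fun a _ => Finset.sum_eq_zero fun b _ => ?_
  by_cases hb : b = 1
  · subst hb
    have : ¬ adjL 0 1 := by decide
    simp [transfer, stepW, this]
  · simp [finalV, hb]

lemma mem_segL_short : [0, 3, 1] ∈ SegL := by decide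

lemma existsUnique_word_fixedPt (hu : 0 ≤ u) : ∃! x : ℝ, 0 < x ∧
    HasSum (fun l : SegL => u ^ penL (l : List Letter) * x ^ ((l : List Letter).length - 1)) x := by
  have h := existsUnique_hasSum_one (a := fun n => wordCoeff u (n + 1))
    (fun n => wordCoeff_nonneg hu _) (wordCoeff_one u) ?_ ?_
  · refine (existsUnique_congr fun x => and_congr_right fun hx => ?_).1 h
    rw [hasSum_word_iff hu hx.le hx.le,
      ← hasSum_nat_add_iff' (f := fun n => wordCoeff u n * x ^ n) 1, ← hasSum_mul_left_iff hx.ne']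
    simp [wordCoeff_zero, pow_succ, mul_assoc, mul_comm x]
  · have := wordCoeff_le hu mem_segL_short
    have e : penL [0, 3, 1] = 0 := by decide
    rw [e, pow_zero] at this
    exact zero_lt_one.trans_le this
  · have e : ∀ n, wordCoeff u (n + 1) =
        ((transfer u ^ n).mulVec ((transfer u).mulVec finalV)) (0, 0) := fun n => by
      rw [wordCoeff, pow_succ, Matrix.mulVec_mulVec]
    simp only [e]
    have hf := pow_mulVec_nonneg (transfer_nonneg hu) finalV_nonneg 1
    rw [pow_one] at hf
    exact fun R hR hs => exists_summable_gt (transfer_nonneg hu) hf (0, 0) hR hs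

/-! ### The path spaces -/

lemma getLast?_mem_vert {N : ℕ} {x : Pt} {l : List Pt} (hx : x ∈ vert N)
    (h : (x :: l).IsChain (Adj N)) : ∀ p ∈ x :: l, p ∈ vert N := by
  induction l generalizing x with
  | nil => simpa using hx
  | cons y t ih =>
    rw [isChain_cons_cons] at h
    obtain ⟨-, D, hD, -, hy⟩ := h.1
    intro p hp
    rcases mem_cons.1 hp with rfl | hp
    · exact hx
    · exact ih (mem_vert.2 ⟨D, hD, hy⟩) h.2 p hp

lemma vO_mem_vert (N : ℕ) : vO ∈ vert N := by
  induction N with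
  | zero => exact mem_vert.2 ⟨lcell 0 0 0, by simp [cells_zero], by rw [vO_eq, mem_lcell]; simp⟩
  | succ N ih =>
    obtain ⟨D, hD, h⟩ := mem_vert.1 ih
    refine mem_vert.2 ⟨D.image (contr vO), ?_, mem_image_contr h⟩
    rw [cells_succ]
    exact mem_biUnion.2 ⟨D, hD, mem_sub.2 ⟨vO, h, rfl⟩⟩

lemma vb_mem_vertV_zero : vb ∈ vertV 0 :=
  mem_vertV.2 ⟨lcell 0 0 0, by simp [cellsV_zero], by rw [vb_eq, mem_lcell]; simp⟩

lemma vO_ne : vO ≠ va ∧ vO ≠ vb ∧ vb ≠ va := by decide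

lemma adj_chain {N : ℕ} {x : Pt} {l : List Pt} (hx : x ∈ vert N)
    (h : (x :: l).IsChain (AdjV N)) (hb : ∀ p ∈ (x :: l).dropLast, p ≠ vb) :
    (x :: l).IsChain (Adj N) := by
  induction l generalizing x with
  | nil => simp
  | cons y t ih =>
    rw [isChain_cons_cons] at h ⊢
    rw [dropLast_cons_cons] at hb
    obtain ⟨hxy, D, hD, hxD, hyD⟩ := h.1
    have hD' := mem_cells_of_mem_vert hD hxD hx (hb x (by simp))
    exact ⟨⟨hxy, D, hD', hxD, hyD⟩, ih (mem_vert.2 ⟨D, hD', hyD⟩) h.2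
      fun p hp => hb p (mem_cons_of_mem _ hp)⟩

lemma mem_W_iff {N : ℕ} {w : List Pt} : w ∈ W N ↔ w.IsChain (AdjV N) ∧ w.head? = some vO ∧
    w.getLast? = some va ∧ ∀ p ∈ w.dropLast, p ∈ vertV 0 → p = vO := by
  constructor
  · rintro ⟨h1, h2, h3, h4⟩
    refine ⟨h1.imp fun x y hxy => ⟨hxy.1, hxy.2.imp fun D hD => ⟨cells_subset N hD.1, hD.2⟩⟩,
      h2, h3, fun p hp hpv => h4 p hp ?_⟩
    cases w with
    | nil => simp at h2
    | cons x t =>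
      obtain rfl : x = vO := by simpa using h2
      exact mem_vert_zero_of_mem_vertV (getLast?_mem_vert (vO_mem_vert N) h1 p
        (List.mem_of_mem_dropLast hp)) hpv
  · rintro ⟨h1, h2, h3, h4⟩
    refine ⟨?_, h2, h3, fun p hp hpv => h4 p hp ?_⟩
    · cases w with
      | nil => simp at h2
      | cons x t =>
        obtain rfl : x = vO := by simpa using h2
        refine adj_chain (vO_mem_vert N) h1 fun p hp hpb => ?_
        exact vO_ne.2.1 ((h4 p hp (hpb ▸ vb_mem_vertV_zero)).symm.trans hpb)
    · obtain ⟨D, hD, hpD⟩ := mem_vert.1 hpv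
      exact mem_vertV.2 ⟨D, cells_subset 0 hD, hpD⟩

lemma W_one : W 1 = Seg 0 vO va := by
  ext w; exact mem_W_iff

lemma exists_chart_zero : ∃ κ i j, Chart κ 0 i j ∧ psi κ 0 i j 0 = vO ∧ psi κ 0 i j 1 = va := by
  obtain ⟨κ, i, j, -, h, h0, h1, -⟩ := exists_chart (N := 0) (D := lcell 0 0 0) (x := vO) (y := va)
    (by simp [cellsV_zero]) vO_ne.1 (by rw [vO_eq, mem_lcell]; simp)
    (by rw [va_eq, mem_lcell]; simp) (inner_zero (inl rfl))
  exact ⟨κ, i, j, h, h0, h1⟩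

/-- Words and path segments correspond to each other. -/
def Chart.segEquiv {κ : Cfg} {N : ℕ} {i j : ℤ} (h : Chart κ N i j) :
    SegL ≃ Seg N (psi κ N i j 0) (psi κ N i j 1) :=
  Equiv.ofBijective (fun l => ⟨(l : List Letter).map (psi κ N i j), h.mem_Seg.2 ⟨l, l.2, rfl⟩⟩) <| by
    constructor
    · rintro ⟨l, hl⟩ ⟨m, hm⟩ hlm
      exact Subtype.ext (List.map_injective_iff.2 h.inj (congrArg Subtype.val hlm))
    · rintro ⟨s, hs⟩
      obtain ⟨l, hl, rfl⟩ := h.mem_Seg.1 hs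
      exact ⟨⟨l, hl⟩, rfl⟩

lemma Chart.segEquiv_apply {κ : Cfg} {N : ℕ} {i j : ℤ} (h : Chart κ N i j) (l : SegL) :
    (h.segEquiv l : List Pt) = (l : List Letter).map (psi κ N i j) := rfl

lemma fixedPt_spec (hu : 0 ≤ u) : 0 < fixedPt u ∧ HasSum (fun l : SegL =>
    u ^ penL (l : List Letter) * fixedPt u ^ ((l : List Letter).length - 1)) (fixedPt u) := by
  obtain ⟨κ, i, j, h, h0, h1⟩ := exists_chart_zero
  have hW : ∀ x : ℝ, HasSum (fun w : W 1 => u ^ penalty 0 (w : List Pt) *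
      x ^ ((w : List Pt).length - 1)) x ↔ HasSum (fun l : SegL =>
      u ^ penL (l : List Letter) * x ^ ((l : List Letter).length - 1)) x := by
    intro x
    rw [W_one, ← h0, ← h1, ← h.segEquiv.hasSum_iff]
    refine Eq.to_iff (congrArg (fun f => HasSum f x) (funext fun l => ?_))
    rw [Function.comp, h.segEquiv_apply, h.penalty_map l.2, length_map]
  obtain ⟨x, hx, hx'⟩ := existsUnique_word_fixedPt hu
  have : {x : ℝ | 0 < x ∧ HasSum (fun w : W 1 => u ^ penalty 0 (w : List Pt) *
      x ^ ((w : List Pt).length - 1)) x} = {x} := by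
    ext y
    rw [Set.mem_ofPred_eq, Set.mem_singleton_iff, hW]
    exact ⟨hx' y, fun he => he ▸ hx⟩
  have he : fixedPt u = x := by rw [fixedPt, this, csInf_singleton]
  rw [he]
  exact hx

/-- The probability of a word. -/
def wordProb (u : ℝ) (l : List Letter) : ℝ := u ^ penL l * fixedPt u ^ (l.length - 2)

lemma wordProb_nonneg (hu : 0 ≤ u) (l : List Letter) : 0 ≤ wordProb u l :=
  mul_nonneg (pow_nonneg hu _) (pow_nonneg (fixedPt_spec hu).1.le _)

lemma hasSum_wordProb (hu : 0 ≤ u) : HasSum (fun l : SegL => wordProb u l) 1 := by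
  obtain ⟨h0, h⟩ := fixedPt_spec hu
  have := h.mul_left (fixedPt u)⁻¹
  rw [inv_mul_cancel₀ h0.ne'] at this
  have e : (fun l : SegL => wordProb u l) = fun l : SegL => (fixedPt u)⁻¹ *
      (u ^ penL (l : List Letter) * fixedPt u ^ ((l : List Letter).length - 1)) := funext fun l => ?_
  · rw [e]; exact this
  obtain ⟨t, ht, hne⟩ := SegL.exists_cons l.2
  obtain ⟨a, t, rfl⟩ := exists_cons_of_ne_nil hne
  rw [wordProb, ht]
  simp only [length_cons, Nat.add_sub_cancel]
  rw [pow_succ, show t.length + 1 + 1 - 2 = t.length by omega]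
  field_simp

/-- The probability mass function `f`, if its sum is `1`. -/
def pmfOf {α : Type*} (f : α → ℝ≥0∞) (d : PMF α) : PMF α :=
  if h : ∑' a, f a = 1 then ⟨f, h ▸ ENNReal.summable.hasSum⟩ else d

lemma pmfOf_apply {α : Type*} {f : α → ℝ≥0∞} (d : PMF α) (h : ∑' a, f a = 1) (a : α) :
    pmfOf f d a = f a := by
  have e : pmfOf f d = (⟨f, h ▸ ENNReal.summable.hasSum⟩ : PMF α) := dif_pos h
  rw [e]; rfl

/-- The law of a word. -/
def wordPMF (u : ℝ) : PMF (List Letter) :=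
  pmfOf (SegL.indicator fun l => ofReal (wordProb u l)) (PMF.pure [])

/-- The law of a path segment along an edge of level `N`. -/
def segPMF (u : ℝ) (N : ℕ) (e : Step) : PMF (List Pt) :=
  pmfOf ((Seg N e.1 e.2).indicator fun s => ofReal (stepProb u N s)) (PMF.pure [])

lemma wordPMF_apply (hu : 0 ≤ u) (l : List Letter) :
    wordPMF u l = SegL.indicator (fun l => ofReal (wordProb u l)) l := by
  refine pmfOf_apply _ ?_ l
  rw [← tsum_subtype SegL fun l => ofReal (wordProb u l),
    (hasSum_iff_tsum_ofReal (fun l => wordProb_nonneg hu _) zero_le_one).1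
    (hasSum_wordProb hu), ofReal_one]

lemma Chart.stepProb_map {κ : Cfg} {N : ℕ} {i j : ℤ} (h : Chart κ N i j) {l : List Letter}
    (hl : l ∈ SegL) : stepProb u N (l.map (psi κ N i j)) = wordProb u l := by
  rw [stepProb, wordProb, h.penalty_map hl, length_map]

lemma Chart.map_wordPMF {κ : Cfg} {N : ℕ} {i j : ℤ} (h : Chart κ N i j) (hu : 0 ≤ u)
    (s : List Pt) : (wordPMF u).map (List.map (psi κ N i j)) s =
      (Seg N (psi κ N i j 0) (psi κ N i j 1)).indicator
        (fun s => ofReal (stepProb u N s)) s := by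
  rw [PMF.map_apply]
  by_cases hs : s ∈ Seg N (psi κ N i j 0) (psi κ N i j 1)
  · obtain ⟨l, hl, rfl⟩ := h.mem_Seg.1 hs
    rw [indicator_of_mem hs, h.stepProb_map hl, tsum_eq_single l, if_pos rfl,
      wordPMF_apply hu, indicator_of_mem hl]
    intro m hm
    rw [if_neg fun he => hm (List.map_injective_iff.2 h.inj he).symm]
  · rw [indicator_of_notMem hs]
    refine tsum_eq_zero.2 fun l => ?_
    split_ifs with he
    · rw [wordPMF_apply hu, indicator_of_notMem]
      exact fun hl => hs (h.mem_Seg.2 ⟨l, hl, he⟩)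
    · rfl

lemma Chart.segPMF_eq {κ : Cfg} {N : ℕ} {i j : ℤ} (h : Chart κ N i j) (hu : 0 ≤ u) :
    segPMF u N (psi κ N i j 0, psi κ N i j 1) = (wordPMF u).map (List.map (psi κ N i j)) := by
  have h1 : ∑' s, (Seg N (psi κ N i j 0) (psi κ N i j 1)).indicator
      (fun s => ofReal (stepProb u N s)) s = 1 := by
    simp only [← h.map_wordPMF hu]
    exact PMF.tsum_coe _
  ext s
  rw [segPMF, pmfOf_apply _ h1, h.map_wordPMF hu s]

lemma mem_support_wordPMF (hu : 0 ≤ u) {l : List Letter} (h : l ∈ (wordPMF u).support) :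
    l ∈ SegL := by
  rw [mem_support_iff, wordPMF_apply hu] at h
  exact Set.mem_of_indicator_ne_zero h

end

section

/-! ### The erased words -/

/-- The maximal groups of steps in one small triangle. -/
def runsL (es : List (Letter × Letter)) : List (List (Letter × Letter)) :=
  es.splitBy fun e f => decide (cellL e.1 e.2 = cellL f.1 f.2)

/-- The numbers of groups of length one and two. -/
def counts {α : Type*} (rs : List (List α)) : ℕ × ℕ :=
  (rs.countP fun r => r.length == 1, rs.countP fun r => r.length == 2)

/-- A group of one or two steps in one triangle. -/
def RunOK {α : Type*} : List (α × α) → Prop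
  | [e] => e.1 ≠ e.2
  | [e, f] => e.1 ≠ e.2 ∧ f.1 ≠ f.2 ∧ e.2 = f.1 ∧ e.1 ≠ f.2
  | _ => False

instance {α : Type*} [DecidableEq α] : DecidablePred (RunOK (α := α))
  | [] => inferInstanceAs (Decidable False)
  | [e] => inferInstanceAs (Decidable (e.1 ≠ e.2))
  | [e, f] => inferInstanceAs (Decidable (e.1 ≠ e.2 ∧ f.1 ≠ f.2 ∧ e.2 = f.1 ∧ e.1 ≠ f.2))
  | _ :: _ :: _ :: _ => inferInstanceAs (Decidable False)

/-- The properties of the loop-erased words that are used. -/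
def WordOK (es : List (Letter × Letter)) : Prop :=
  (∀ e ∈ es, cellL e.1 e.2 < 3 ∧ adjL e.1 e.2 ∧ e.1 < 6 ∧ e.2 < 6) ∧
  ((runsL es).map fun r => cellL (r.headD (0, 0)).1 (r.headD (0, 0)).2).Nodup ∧
  (∀ r ∈ runsL es, RunOK r ∧
    ∀ e ∈ r, cellL e.1 e.2 = cellL (r.headD (0, 0)).1 (r.headD (0, 0)).2) ∧
  ((counts (runsL es)).1 + (counts (runsL es)).2 = 2 ∨
    (counts (runsL es)).1 + (counts (runsL es)).2 = 3) ∧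
  (counts (runsL es)).1 + 2 * (counts (runsL es)).2 ≤ 5

instance (es : List (Letter × Letter)) : Decidable (WordOK es) := by
  unfold WordOK; infer_instance

/-- Depth first search for a word that ends at `e` and is not good; the second argument is the
reversed word. -/
def search (e : Letter) : ℕ → List Letter → Bool
  | 0, _ => false
  | _ + 1, [] => false
  | n + 1, c :: vis =>
    if c = e then decide (WordOK (edges (c :: vis).reverse))
    else (List.finRange 12).all fun d =>
      !decide (adjL c d ∧ d ∉ c :: vis) || search e n (d :: c :: vis)

lemma search_one : search 1 13 [0] = true := by decide +kernel

lemma search_two : search 2 13 [0] = true := by decide +kernel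

lemma search_sound {e : Letter} {n : ℕ} {c : Letter} {vis t : List Letter}
    (h : search e n (c :: vis) = true) (hc : (c :: t).IsChain adjL)
    (hn : (vis.reverse ++ c :: t).Nodup) (hl : (c :: t).getLast? = some e) :
    WordOK (edges (vis.reverse ++ c :: t)) := by
  induction n generalizing c vis t with
  | zero => simp [search] at h
  | succ n ih =>
    rw [search] at h
    split_ifs at h with hce
    · subst hce
      have ht : t = [] := by
        by_contra ht
        obtain ⟨b, t, rfl⟩ := exists_cons_of_ne_nil ht
        rw [getLast?_cons_cons] at hl
        have hm := List.mem_of_getLast? hl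
        rw [nodup_append] at hn
        exact (nodup_cons.1 hn.2.1).1 hm
      subst ht
      simpa using h
    · cases t with
      | nil => exact absurd (by simpa using hl) hce
      | cons d t =>
        rw [isChain_cons_cons] at hc
        rw [getLast?_cons_cons] at hl
        have hd : d ∉ c :: vis := by
          intro hd
          rw [nodup_append] at hn
          rcases mem_cons.1 hd with rfl | hd
          · exact (nodup_cons.1 hn.2.1).1 (by simp)
          · exact hn.2.2 d (List.mem_reverse.2 hd) d (by simp) rfl
        have h1 := List.all_eq_true.1 h d (List.mem_finRange d)
        have h2 : search e n (d :: c :: vis) = true := by simpa [hc.1, hd] using h1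
        have := ih (t := t) h2 hc.2 (by simpa using hn) hl
        simpa using this

lemma edges_trail {α : Type*} {x y : α} {l : List (α × α)} (h : IsTrail fst snd x l y) :
    l = edges (l.map fst ++ [y]) ∧ (l.map fst ++ [y]).head? = some x := by
  induction l generalizing x with
  | nil => exact ⟨rfl, by simpa using h.symm⟩
  | cons e l ih =>
    obtain ⟨h1, h2⟩ := h
    obtain ⟨h3, h4⟩ := ih h2
    refine ⟨?_, by simpa using h1⟩
    obtain ⟨b, t, hbt⟩ := exists_cons_of_ne_nil
      (show l.map fst ++ [y] ≠ [] by simp)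
    rw [hbt] at h3 h4
    rw [map_cons, cons_append, hbt, edges, ← h3]
    obtain rfl : b = e.2 := by simpa using h4
    rfl

lemma chain_trail {α : Type*} {r : α → α → Prop} {x y : α} {l : List (α × α)}
    (h : IsTrail fst snd x l y) (hr : ∀ e ∈ l, r e.1 e.2) :
    (l.map fst ++ [y]).IsChain r := by
  induction l generalizing x with
  | nil => simp
  | cons e l ih =>
    obtain ⟨h1, h2⟩ := h
    have h3 := ih h2 fun f hf => hr f (mem_cons_of_mem _ hf)
    have h4 := (edges_trail h2).2
    obtain ⟨b, t, hbt⟩ := exists_cons_of_ne_nil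
      (show l.map fst ++ [y] ≠ [] by simp)
    rw [hbt] at h3 h4
    rw [map_cons, cons_append, hbt, isChain_cons_cons]
    obtain rfl : b = e.2 := by simpa using h4
    exact ⟨hr e (by simp), h3⟩

lemma wordOK_of_trail {e : Letter} (he : e = 1 ∨ e = 2) {es : List (Letter × Letter)}
    (h : IsTrail fst snd 0 es e) (hadj : ∀ p ∈ es, adjL p.1 p.2)
    (hn : (es.map fst ++ [e]).Nodup) : WordOK es := by
  obtain ⟨h1, h2⟩ := edges_trail h
  have h3 := chain_trail h hadj
  obtain ⟨c, t, hct⟩ := exists_cons_of_ne_nil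
      (show es.map fst ++ [e] ≠ [] by simp)
  rw [hct] at h1 h2 h3 hn
  obtain rfl : c = 0 := by simpa using h2
  have hl : (0 :: t).getLast? = some e := by rw [← hct]; simp
  have hs : search e 13 [0] = true := by rcases he with rfl | rfl <;> [exact search_one; exact search_two]
  have := search_sound (vis := []) hs h3 hn hl
  rw [h1]
  exact this

lemma mem_edges_chain {α : Type*} {r : α → α → Prop} {l : List α} (h : l.IsChain r) :
    ∀ e ∈ edges l, r e.1 e.2 ∧ e.1 ∈ l.dropLast ∧ e.2 ∈ l.tail := by
  induction l with
  | nil => simp [edges]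
  | cons x t ih =>
    cases t with
    | nil => simp [edges]
    | cons y t =>
      grind [dropLast_cons_cons, edges]

lemma trail_edges {α : Type*} {x y : α} {l : List α} (hx : l.head? = some x)
    (hy : l.getLast? = some y) : IsTrail fst snd x (edges l) y := by
  induction l generalizing x with
  | nil => simp at hx
  | cons a t ih =>
    obtain rfl : a = x := by simpa using hx
    cases t with
    | nil => simpa [edges, IsTrail] using hy
    | cons b t =>
      rw [getLast?_cons_cons] at hy
      exact ⟨rfl, ih rfl hy⟩

/-- The steps of the words in a triangle, before the loop erasure. -/
def wordSteps (ls : List (List Letter)) : List (Letter × Letter) :=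
  match ls with
  | [l] => edges l
  | [l, l'] => edges l ++ (edges l').map (Prod.map rot rot)
  | _ => []

/-- The loop erasure of the words in a triangle. -/
def wordErased (ls : List (List Letter)) : List (Letter × Letter) :=
  eraseK fst snd (wordSteps ls)

lemma rot_adjL : ∀ a b : Letter, a < 9 → b < 9 → adjL a b → adjL (rot a) (rot b) := by decide +kernel

lemma rot_eq : ∀ a : Letter, (rot a = 0 ↔ a = 2) ∧ (rot a = 1 ↔ a = 0) ∧ (rot a = 2 ↔ a = 1) := by
  decide +kernel

lemma isTrail_prodMap {α β : Type*} (f : α → β) {x y : α} {l : List (α × α)}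
    (h : IsTrail fst snd x l y) :
    IsTrail fst snd (f x) (l.map (Prod.map f f)) (f y) := by
  induction l generalizing x with
  | nil => exact congrArg f h
  | cons e l ih => exact ⟨congrArg f h.1, ih h.2⟩

lemma wordSteps_one {l : List Letter} (hl : l ∈ SegL) :
    IsTrail fst snd 0 (wordSteps [l]) 1 ∧
      ∀ e ∈ wordSteps [l], adjL e.1 e.2 ∧ e.1 < 9 ∧ e.2 < 9 ∧ e.1 ≠ 1 ∧ e.1 ≠ 2 := by
  refine ⟨trail_edges hl.2.1 hl.2.2.1, fun e he => ?_⟩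
  obtain ⟨h1, h2, h3⟩ := mem_edges_chain hl.1 e he
  exact ⟨h1, SegL.lt hl _ (List.mem_of_mem_dropLast h2), SegL.lt hl _ (List.mem_of_mem_tail h3), hl.2.2.2 _ h2⟩

lemma wordSteps_two {l l' : List Letter} (hl : l ∈ SegL) (hl' : l' ∈ SegL) :
    IsTrail fst snd 0 (wordSteps [l, l']) 2 ∧
      ∀ e ∈ wordSteps [l, l'], adjL e.1 e.2 ∧ e.1 ≠ 2 := by
  refine ⟨isTrail_append.2 ⟨1, (wordSteps_one hl).1, isTrail_prodMap rot (wordSteps_one hl').1⟩,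
    fun e he => ?_⟩
  rcases List.mem_append.1 he with he | he
  · obtain ⟨h1, -, -, -, h2⟩ := (wordSteps_one hl).2 e he
    exact ⟨h1, h2⟩
  · obtain ⟨f, hf, rfl⟩ := List.mem_map.1 he
    obtain ⟨h1, h3, h4, h2, -⟩ := (wordSteps_one hl').2 f hf
    exact ⟨rot_adjL _ _ h3 h4 h1, fun h => h2 ((rot_eq _).2.2.1 h)⟩

/-- The last letter of the words in a triangle. -/
def lastL (ls : List (List Letter)) : Letter := if ls.length = 1 then 1 else 2

lemma wordErased_spec {ls : List (List Letter)} (hls : ∀ l ∈ ls, l ∈ SegL)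
    (hlen : ls.length = 1 ∨ ls.length = 2) :
    IsTrail fst snd 0 (wordErased ls) (lastL ls) ∧ WordOK (wordErased ls) ∧
      ∀ e ∈ wordErased ls, e.1 ≠ 2 ∧ e.1 ≠ lastL ls := by
  have main : IsTrail fst snd 0 (wordSteps ls) (lastL ls) →
      (∀ e ∈ wordSteps ls, adjL e.1 e.2 ∧ e.1 ≠ 2) → IsTrail fst snd 0 (wordErased ls)
      (lastL ls) ∧ WordOK (wordErased ls) ∧ ∀ e ∈ wordErased ls, e.1 ≠ 2 ∧ e.1 ≠ lastL ls := by
    intro h1 h2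
    obtain ⟨h3, h4, -⟩ := IsTrail.eraseK h1
    have hsub := (eraseK_sublist fst snd (wordSteps ls)).subset
    refine ⟨h3, wordOK_of_trail (by unfold lastL; split_ifs <;> simp) h3
      (fun e he => (h2 e (hsub he)).1) h4, fun e he => ⟨(h2 e (hsub he)).2, ?_⟩⟩
    intro he'
    rw [nodup_append] at h4
    exact h4.2.2 e.1 (mem_map_of_mem he) _ (by simp) he'
  match ls, hlen with
  | [l], _ =>
    obtain ⟨h1, h2⟩ := wordSteps_one (hls l (by simp))
    exact main h1 fun e he => ⟨(h2 e he).1, (h2 e he).2.2.2.2⟩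
  | [l, l'], _ =>
    obtain ⟨h1, h2⟩ := wordSteps_two (hls l (by simp)) (hls l' (by simp))
    exact main h1 h2
  | [], h => simp at h
  | _ :: _ :: _ :: _, h => simp at h

/-- The law of the words in a triangle of type `j + 1`. -/
def wordsPMF (u : ℝ) (n : ℕ) : PMF (List (List Letter)) := seqPMF (replicate n (wordPMF u))

variable {u : ℝ}

lemma forall₂_replicate {α β : Type*} {R : α → β → Prop} {a : α} {n : ℕ} {l : List β} :
    Forall₂ R (replicate n a) l ↔ l.length = n ∧ ∀ b ∈ l, R a b := by
  induction n generalizing l with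
  | zero => cases l <;> simp
  | succ n ih => cases l <;> simp [List.replicate_succ, ih, and_left_comm]

lemma mem_support_wordsPMF {n : ℕ} {ls : List (List Letter)} :
    ls ∈ (wordsPMF u n).support ↔ ls.length = n ∧ ∀ l ∈ ls, l ∈ (wordPMF u).support := by
  rw [wordsPMF, mem_support_seqPMF, forall₂_replicate]

lemma segL_of_mem_support (hu : 0 ≤ u) {n : ℕ} {ls : List (List Letter)}
    (h : ls ∈ (wordsPMF u n).support) : ls.length = n ∧ ∀ l ∈ ls, l ∈ SegL := by
  obtain ⟨h1, h2⟩ := mem_support_wordsPMF.1 h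
  exact ⟨h1, fun l hl => mem_support_wordPMF hu (h2 l hl)⟩

/-- The offspring law of a triangle of type `n`: the numbers of triangles of the next level of
type `1` and `2`. -/
def offspring (u : ℝ) (n : ℕ) : PMF (ℕ × ℕ) :=
  (wordsPMF u n).map fun ls => counts (runsL (wordErased ls))

lemma mem_support_offspring (hu : 0 ≤ u) {n : ℕ} (hn : n = 1 ∨ n = 2) {z : ℕ × ℕ}
    (h : z ∈ (offspring u n).support) : (z.1 + z.2 = 2 ∨ z.1 + z.2 = 3) ∧ z.1 + 2 * z.2 ≤ 5 := by
  rw [offspring, mem_support_map_iff] at h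
  obtain ⟨ls, hls, rfl⟩ := h
  obtain ⟨h1, h2⟩ := segL_of_mem_support hu hls
  exact (wordErased_spec h2 (h1 ▸ hn)).2.1.2.2.2

lemma offspring_pos {ls : List (List Letter)} {n : ℕ}
    (h : ∀ l ∈ ls, l ∈ (wordPMF u).support) (hn : ls.length = n) {z : ℕ × ℕ}
    (hz : counts (runsL (wordErased ls)) = z) : z ∈ (offspring u n).support := by
  rw [offspring, mem_support_map_iff]
  exact ⟨ls, mem_support_wordsPMF.2 ⟨hn, h⟩, hz⟩

lemma mem_support_wordPMF_of (hu : 0 ≤ u) {l : List Letter} (hl : l ∈ SegL)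
    (h : 0 < u ∨ penL l = 0) : l ∈ (wordPMF u).support := by
  rw [mem_support_iff, wordPMF_apply hu, indicator_of_mem hl]
  have h1 : 0 < u ^ penL l := by
    rcases h with h | h
    · positivity
    · rw [h, pow_zero]; exact one_pos
  have h2 := (fixedPt_spec hu).1
  exact (ENNReal.ofReal_pos.2 (by unfold wordProb; positivity)).ne'

lemma offspring_values (hu : 0 ≤ u) : (2, 0) ∈ (offspring u 1).support ∧
    (3, 0) ∈ (offspring u 1).support ∧ (0 < u → (1, 1) ∈ (offspring u 1).support) ∧
    (2, 1) ∈ (offspring u 2).support ∧ (1, 1) ∈ (offspring u 2).support := by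
  have a := mem_support_wordPMF_of (l := [0, 3, 1]) hu (by decide) (inr (by decide))
  have b := mem_support_wordPMF_of (l := [0, 4, 5, 1]) hu (by decide) (inr (by decide))
  have c : 0 < u → [0, 4, 3, 1] ∈ (wordPMF u).support :=
    fun h => mem_support_wordPMF_of hu (by decide) (inl h)
  refine ⟨offspring_pos (ls := [[0, 3, 1]]) (by simpa using a) rfl ?_,
    offspring_pos (ls := [[0, 4, 5, 1]]) (by simpa using b) rfl ?_,
    fun h => offspring_pos (ls := [[0, 4, 3, 1]]) (by simpa using c h) rfl ?_,
    offspring_pos (ls := [[0, 3, 1], [0, 3, 1]]) (by simpa using a) rfl ?_,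
    offspring_pos (ls := [[0, 3, 1], [0, 4, 5, 1]]) (by simpa using ⟨a, b⟩) rfl ?_⟩ <;>
  decide +kernel

end

section

/-! ### The children of a triangle of the skeleton -/

/-- The triangle of a group of steps. -/
def cellOf (N : ℕ) (ρ : Steps) : Finset Pt :=
  tri N (ρ.headD (vO, vO)).1 (ρ.headD (vO, vO)).2

/-- A group of one or two steps of level `N` in one triangle, from vertices that lie in two
triangles. -/
structure ValidRun (N : ℕ) (ρ : Steps) : Prop where
  cell : cellOf N ρ ∈ cellsV N
  ok : RunOK ρ
  mem : ∀ e ∈ ρ, e.1 ∈ cellOf N ρ ∧ e.2 ∈ cellOf N ρ ∧ Inner N e.1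

lemma runOK_cases {α : Type*} {ρ : List (α × α)} (h : RunOK ρ) :
    (∃ x y, ρ = [(x, y)] ∧ x ≠ y) ∨
      ∃ x y z, ρ = [(x, y), (y, z)] ∧ x ≠ y ∧ y ≠ z ∧ x ≠ z := by
  match ρ, h with
  | [e], h => exact inl ⟨e.1, e.2, rfl, h⟩
  | [e, f], h =>
    obtain ⟨h1, h2, h3, h4⟩ := h
    exact inr ⟨e.1, e.2, f.2, congrArg (fun p => [e, p]) (Prod.ext h3.symm rfl), h1, h3 ▸ h2, h4⟩

/-- The first and the last vertex of a group of steps. -/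
def runSrc (ρ : Steps) : Pt := gsrc fst ρ

/-- The last vertex of a group of steps. -/
def runTgt (ρ : Steps) : Pt := gtgt snd ρ

/-- The chart of a group of steps. -/
def RunChart (κ : Cfg) (N : ℕ) (i j : ℤ) (ρ : Steps) : Prop :=
  Chart κ N i j ∧ cellOf N ρ = lcell N i j ∧ Inner N (psi κ N i j 0) ∧
    (ρ = [(psi κ N i j 0, psi κ N i j 1)] ∨
      ρ = [(psi κ N i j 0, psi κ N i j 1), (psi κ N i j 1, psi κ N i j 2)] ∧
        Right κ N i j ∧ Inner N (psi κ N i j 1))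

variable {N : ℕ} {ρ : Steps}

lemma ValidRun.exists_chart (h : ValidRun N ρ) : ∃ κ i j, RunChart κ N i j ρ := by
  obtain ⟨hc, hok, hm⟩ := h
  rcases runOK_cases hok with ⟨x, y, rfl, hxy⟩ | ⟨x, y, z, rfl, hxy, hyz, hxz⟩
  · obtain ⟨hx, hy, hI⟩ := hm (x, y) (by simp)
    obtain ⟨κ, i, j, hD, hch, h0, h1, -⟩ := Gasket.exists_chart hc hxy hx hy hI
    exact ⟨κ, i, j, hch, hD, h0 ▸ hI, inl (by rw [h0, h1])⟩
  · obtain ⟨hx, hy, hI⟩ := hm (x, y) (by simp)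
    obtain ⟨-, hz, hIy⟩ := hm (y, z) (by simp)
    obtain ⟨κ, i, j, hD, hch, h0, h1, hR⟩ := Gasket.exists_chart hc hxy hx hy hI
    have h2 : z = psi κ N i j 2 := hch.psi_two (hD ▸ hz) (h0 ▸ hxz.symm) (h1 ▸ hyz.symm)
    exact ⟨κ, i, j, hch, hD, h0 ▸ hI, inr ⟨by rw [h0, h1, h2], hR hIy, h1 ▸ hIy⟩⟩

/-- The law of the path segments of a group of steps. -/
def segsPMF (u : ℝ) (N : ℕ) (ρ : Steps) : PMF (List (List Pt)) :=
  seqPMF (ρ.map (segPMF u N))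

/-- The steps that remain after the loop erasure in a triangle. -/
def erasedRun (tt : List (List Pt)) : Steps :=
  eraseK fst snd (tt.flatMap edges)

/-- The law of the groups of steps of level `N + 1` in a triangle of level `N`. -/
def runPMF (u : ℝ) (N : ℕ) (ρ : Steps) : PMF (List Steps) :=
  (segsPMF u N ρ).map fun tt => triRuns (N + 1) fst snd (erasedRun tt)

/-- The path segments of the words in a triangle. -/
def wordSegs (ψ : Letter → Pt) : List (List Letter) → List (List Pt)
  | [l] => [l.map ψ]
  | [l, l'] => [l.map ψ, (l'.map rot).map ψ]
  | _ => []

lemma pmf_map_congr {α β : Type*} {p : PMF α} {f g : α → β} (h : ∀ a ∈ p.support, f a = g a) :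
    p.map f = p.map g := by
  ext b
  rw [PMF.map_apply, PMF.map_apply]
  refine tsum_congr fun a => ?_
  by_cases ha : a ∈ p.support
  · rw [h a ha]
  · rw [mem_support_iff, not_not] at ha
    simp [ha]

lemma seqPMF_one {β : Type*} (p : PMF β) : seqPMF [p] = p.map fun a => [a] := by
  simp [seqPMF, PMF.map, comp_def]

lemma seqPMF_two {β : Type*} (p q : PMF β) :
    seqPMF [p, q] = p.bind fun a => q.map fun b => [a, b] := by
  rw [seqPMF, seqPMF_one]
  simp only [map_comp, comp_def]

variable {u : ℝ} {κ : Cfg} {i j : ℤ}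

lemma RunChart.segsPMF_eq (h : RunChart κ N i j ρ) (hu : 0 ≤ u) :
    segsPMF u N ρ = (wordsPMF u ρ.length).map (wordSegs (psi κ N i j)) := by
  obtain ⟨hch, -, -, rfl | ⟨rfl, hR, hI⟩⟩ := h
  · rw [segsPMF, map_singleton, seqPMF_one, hch.segPMF_eq hu, wordsPMF]
    simp only [List.length_singleton, List.replicate_one, seqPMF_one, map_comp,
      comp_def, wordSegs]
  · have hn := (hch.next hR hI).segPMF_eq hu
    rw [hch.psi_next (by decide), hch.psi_next (by decide)] at hn
    have e : (wordPMF u).map (List.map (psi κ.next N i j)) =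
        (wordPMF u).map fun l => (l.map rot).map (psi κ N i j) := by
      refine pmf_map_congr fun l hl => ?_
      rw [List.map_map]
      exact map_congr_left fun a ha =>
        hch.psi_next (SegL.lt (mem_support_wordPMF hu hl) a ha)
    rw [segsPMF, map_cons, map_singleton, seqPMF_two, hch.segPMF_eq hu]
    rw [show segPMF u N (psi κ N i j 1, psi κ N i j 2) = _ from hn, e]
    rw [wordsPMF]
    simp only [length_cons, List.length_nil, List.replicate_succ, List.replicate_zero,
      seqPMF_two, PMF.map_bind, PMF.bind_map, map_comp, comp_def, wordSegs]

lemma edges_map {α β : Type*} (f : α → β) (l : List α) :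
    edges (l.map f) = (edges l).map (Prod.map f f) := by
  induction l with
  | nil => rfl
  | cons a t ih =>
    cases t with
    | nil => rfl
    | cons b t => simp only [map_cons, edges] at ih ⊢; rw [ih]; rfl

lemma flatMap_edges_wordSegs (ψ : Letter → Pt) (ls : List (List Letter)) :
    (wordSegs ψ ls).flatMap edges = (wordSteps ls).map (Prod.map ψ ψ) := by
  match ls with
  | [] => rfl
  | [l] => simp [wordSegs, wordSteps, edges_map]
  | [l, l'] => simp [wordSegs, wordSteps, edges_map]
  | _ :: _ :: _ :: _ => rfl

lemma Chart.erasedRun_wordSegs (h : Chart κ N i j) (ls : List (List Letter)) :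
    erasedRun (wordSegs (psi κ N i j) ls) =
      (wordErased ls).map (Prod.map (psi κ N i j) (psi κ N i j)) := by
  rw [erasedRun, flatMap_edges_wordSegs, wordErased]
  exact eraseK_map _ _ fun s _ t _ => h.inj.eq_iff

lemma Chart.triRuns_map (h : Chart κ N i j) {es : List (Letter × Letter)} (hes : WordOK es) :
    triRuns (N + 1) fst snd (es.map (Prod.map (psi κ N i j) (psi κ N i j))) =
      (runsL es).map (List.map (Prod.map (psi κ N i j) (psi κ N i j))) := by
  have key : ∀ e ∈ es, tri (N + 1) (psi κ N i j e.1) (psi κ N i j e.2) =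
      pcell κ N i j (cellL e.1 e.2) := fun e he => h.tri_eq (hes.1 e he).2.1
    (inl ((hes.1 e he).1.trans (by decide)))
  rw [triRuns, splitBy_map, runsL]
  congr 1
  refine splitBy_congr fun e he f hf => ?_
  rw [decide_eq_decide]
  simp only [Prod.map_fst, Prod.map_snd]
  rw [key e he, key f hf]
  exact ⟨h.pcell_inj, fun hc => by rw [hc]⟩

/-- The children in a chart. -/
def childRuns (ψ : Letter → Pt) (ls : List (List Letter)) : List Steps :=
  (runsL (wordErased ls)).map (List.map (Prod.map ψ ψ))

lemma RunChart.length (h : RunChart κ N i j ρ) : ρ.length = 1 ∨ ρ.length = 2 := by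
  obtain ⟨-, -, -, rfl | ⟨rfl, -⟩⟩ := h <;> simp

lemma RunChart.runPMF_eq (h : RunChart κ N i j ρ) (hu : 0 ≤ u) :
    runPMF u N ρ = (wordsPMF u ρ.length).map (childRuns (psi κ N i j)) := by
  rw [runPMF, h.segsPMF_eq hu, map_comp]
  refine pmf_map_congr fun ls hls => ?_
  obtain ⟨h1, h2⟩ := segL_of_mem_support hu hls
  rw [Function.comp, h.1.erasedRun_wordSegs, h.1.triRuns_map
    (wordErased_spec h2 (h1 ▸ h.length)).2.1]
  rfl

lemma counts_map {α β : Type*} (f : List α → List β) (hf : ∀ r, (f r).length = r.length)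
    (rs : List (List α)) : counts (rs.map f) = counts rs := by
  simp [counts, List.countP_map, comp_def, hf]

lemma ValidRun.map_counts (h : ValidRun N ρ) (hu : 0 ≤ u) :
    (runPMF u N ρ).map counts = offspring u ρ.length := by
  obtain ⟨κ, i, j, hc⟩ := h.exists_chart
  rw [hc.runPMF_eq hu, map_comp, offspring]
  congr 1
  funext ls
  exact counts_map _ (fun r => length_map _) _

lemma runOK_map {α β : Type*} {f : α → β} (hf : Injective f) {r : List (α × α)}
    (h : RunOK r) : RunOK (r.map (Prod.map f f)) := by
  match r, h with
  | [e], h => exact hf.ne h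
  | [e, g], h => exact ⟨hf.ne h.1, hf.ne h.2.1, congrArg f h.2.2.1, hf.ne h.2.2.2⟩

lemma RunOK.ne_nil {α : Type*} {r : List (α × α)} (h : RunOK r) : r ≠ [] := by
  rintro rfl; exact h

lemma RunChart.ends (h : RunChart κ N i j ρ) : runSrc ρ = psi κ N i j 0 ∧
    runTgt ρ = psi κ N i j (if ρ.length = 1 then 1 else 2) := by
  obtain ⟨-, -, -, rfl | ⟨rfl, -⟩⟩ := h <;> exact ⟨rfl, rfl⟩

lemma Chart.pcell_mem_sub (h : Chart κ N i j) {c : Fin 9} (hc : c < 3) :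
    pcell κ N i j c ∈ sub (lcell N i j) := by
  obtain ⟨k, hk⟩ := (Cfg.cellOff_spec κ h.good c).1 hc
  rw [mem_sub_lcell, pcell, hk]
  exact ⟨k, rfl⟩

/-- The properties of the children of a group of steps. -/
structure Children (N : ℕ) (ρ : Steps) (rs : List Steps) : Prop where
  valid : ∀ r ∈ rs, ValidRun (N + 1) r ∧ cellOf (N + 1) r ∈ sub (cellOf N ρ)
  nodup : (rs.map (cellOf (N + 1))).Nodup
  trail : IsTrail fst snd (runSrc ρ) rs.flatten (runTgt ρ)
  src : ∀ e ∈ rs.flatten, e.1 ≠ runTgt ρ ∧ (e.1 ∈ vertV N → e.1 ∈ ρ.map fst)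

lemma ValidRun.children (h : ValidRun N ρ) (hu : 0 ≤ u) {rs : List Steps}
    (hrs : rs ∈ (runPMF u N ρ).support) : Children N ρ rs := by
  obtain ⟨κ, i, j, hc⟩ := h.exists_chart
  rw [hc.runPMF_eq hu, mem_support_map_iff] at hrs
  obtain ⟨ls, hls, rfl⟩ := hrs
  obtain ⟨h1, h2⟩ := segL_of_mem_support hu hls
  obtain ⟨h3, h4, h5⟩ := wordErased_spec h2 (h1 ▸ hc.length)
  have hlast : lastL ls = if ρ.length = 1 then 1 else 2 := by rw [lastL, h1]
  set es := wordErased ls with hes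
  set ψ := psi κ N i j with hψ
  have hch := hc.1
  have hfl : (childRuns ψ ls).flatten = es.map (Prod.map ψ ψ) := by
    rw [childRuns, ← map_flatten, runsL, List.flatten_splitBy]
  have hmem : ∀ r ∈ runsL es, ∀ e ∈ r, e ∈ es := by
    intro r hr e he
    rw [← List.flatten_splitBy (fun e f => decide (cellL e.1 e.2 = cellL f.1 f.2)) es]
    exact mem_flatten.2 ⟨r, hr, he⟩
  have htri : ∀ e ∈ es, tri (N + 1) (ψ e.1) (ψ e.2) = pcell κ N i j (cellL e.1 e.2) :=
    fun e he => hch.tri_eq (h4.1 e he).2.1 (inl ((h4.1 e he).1.trans (by decide)))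
  have hcell : ∀ r ∈ runsL es, cellOf (N + 1) (r.map (Prod.map ψ ψ)) =
      pcell κ N i j (cellL (r.headD (0, 0)).1 (r.headD (0, 0)).2) := by
    intro r hr
    obtain ⟨e, t, rfl⟩ := exists_cons_of_ne_nil (h4.2.2.1 r hr).1.ne_nil
    exact htri e (hmem _ hr e (by simp))
  have hsrc : ∀ e ∈ es, ψ e.1 ∈ vertV N → ψ e.1 ∈ ρ.map fst := by
    intro e he hv
    obtain ⟨h6, h7⟩ := h5 e he
    rcases hch.mem_vertV.1 hv with h8 | h8 | h8
    · rcases hc.2.2.2 with h9 | ⟨h9, -⟩ <;> rw [h9, h8] <;> simp [hψ]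
    · rcases hc.2.2.2 with h9 | ⟨h9, -⟩
      · rw [hlast, h9] at h7; exact absurd h8 h7
      · rw [h9, h8]; simp [hψ]
    · exact absurd h8 h6
  have hinner : ∀ e ∈ es, Inner (N + 1) (ψ e.1) := by
    intro e he
    by_cases hv : ψ e.1 ∈ vertV N
    · obtain ⟨f, hf, hfe⟩ := List.mem_map.1 (hsrc e he hv)
      exact hfe ▸ inner_succ_of_inner (h.mem f hf).2.2
    · refine inner_succ_of_notMem ?_ hv
      obtain ⟨-, D, hD, hx, -⟩ := hch.adj (h4.1 e he).2.1
        (inl ((h4.1 e he).1.trans (by decide)))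
      exact Gasket.mem_vertV.2 ⟨D, hD, hx⟩
  refine ⟨?_, ?_, ?_, ?_⟩
  · intro r' hr'
    obtain ⟨r, hr, rfl⟩ := List.mem_map.1 hr'
    have hr0 := h4.2.2.1 r hr
    obtain ⟨e, t, het⟩ := exists_cons_of_ne_nil hr0.1.ne_nil
    have hlt : cellL (r.headD (0, 0)).1 (r.headD (0, 0)).2 < 3 := by
      rw [het]; exact (h4.1 e (hmem r hr e (by simp [het]))).1
    refine ⟨⟨?_, runOK_map hch.inj hr0.1, ?_⟩, ?_⟩
    · rw [hcell r hr]; exact hch.pcell_mem (inl (hlt.trans (by decide)))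
    · rw [hcell r hr]
      intro f' hf'
      obtain ⟨f, hf, rfl⟩ := List.mem_map.1 hf'
      have hfe := hmem r hr f hf
      have hin := inc_cellL _ _ (h4.1 f hfe).2.1
      rw [hr0.2 f hf] at hin
      exact ⟨mem_pcell hch.good hin.1, mem_pcell hch.good hin.2, hinner f hfe⟩
    · rw [hcell r hr, hc.2.1]; exact hch.pcell_mem_sub hlt
  · have e1 : (childRuns ψ ls).map (cellOf (N + 1)) = ((runsL es).map fun r =>
        cellL (r.headD (0, 0)).1 (r.headD (0, 0)).2).map (pcell κ N i j) := by
      rw [childRuns, List.map_map, List.map_map]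
      exact map_congr_left hcell
    rw [e1]
    exact h4.2.1.map fun c d hcd => hch.pcell_inj hcd
  · rw [hfl, hc.ends.1, hc.ends.2, ← hlast]
    exact isTrail_prodMap ψ h3
  · rw [hfl]
    intro e' he'
    obtain ⟨e, he, rfl⟩ := List.mem_map.1 he'
    refine ⟨?_, hsrc e he⟩
    rw [hc.ends.2, ← hlast]
    exact hch.inj.ne (h5 e he).2

end

section

/-! ### Paths and the groups of their steps -/

section

variable {α : Type*} {src tgt : α → Pt}

lemma triRuns_flatten_of_cells {j : ℕ} {L : List (List α)} (c : List α → Finset Pt)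
    (h : ∀ g ∈ L, g ≠ [] ∧ ∀ e ∈ g, tri j (src e) (tgt e) = c g) (hn : (L.map c).Nodup) :
    triRuns j src tgt L.flatten = L := by
  refine List.splitBy_flatten (fun hm => (h _ hm).1 rfl) (fun m hm => ?_) ?_
  · refine List.Pairwise.isChain (List.pairwise_of_forall_mem_list fun a ha b hb => ?_)
    simp [(h m hm).2 a ha, (h m hm).2 b hb]
  · have h1 : L.Pairwise fun a b => c a ≠ c b := by
      rwa [List.Nodup, List.pairwise_map] at hn
    refine (List.Pairwise.imp_of_mem (fun {a b} ha hb hab => ?_) h1).isChain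
    refine ⟨(h a ha).1, (h b hb).1, ?_⟩
    simp [(h a ha).2 _ (List.getLast_mem _), (h b hb).2 _ (List.head_mem _), hab]

lemma groupAux_append {S : Finset Pt} {p y : Pt} {acc l l' : List α}
    (h : (groupAux S tgt p acc l).flatten = acc ++ l) (hl : l ≠ []) (hy : gtgt tgt l = y)
    (hl' : l' ≠ []) (hs : ∀ e ∈ l'.head?, src e = y) :
    groupAux S tgt p acc (l ++ l') = groupAux S tgt p acc l ++ group S src tgt l' := by
  induction l generalizing p acc with
  | nil => exact absurd rfl hl
  | cons s t ih =>
    rw [cons_append, groupAux]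
    rw [groupAux] at h
    rw [groupAux]
    split_ifs at h ⊢ with hc
    · by_cases ht : t = []
      · subst ht
        obtain ⟨e, t', rfl⟩ := exists_cons_of_ne_nil hl'
        have h1 : src e = tgt s := (hs e rfl).trans hy.symm
        simp [groupAux, group, h1]
      · rw [ih (by simpa using h) ht (by
          obtain ⟨a, t, rfl⟩ := exists_cons_of_ne_nil ht
          simpa [gtgt] using hy)]
        rfl
    · grind [groupAux, gtgt]

lemma group_append {S : Finset Pt} {l l' : List α} (h : (group S src tgt l).flatten = l)
    (hl : l ≠ []) (hl' : l' ≠ []) (hs : gsrc src l' = gtgt tgt l) :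
    group S src tgt (l ++ l') = group S src tgt l ++ group S src tgt l' := by
  obtain ⟨a, t, rfl⟩ := exists_cons_of_ne_nil hl
  rw [cons_append]
  refine groupAux_append (by simpa [group] using h) hl rfl hl' ?_
  intro e he
  obtain ⟨b, t', rfl⟩ := exists_cons_of_ne_nil hl'
  obtain rfl : b = e := by simpa using he
  exact hs

lemma group_flatten_append {S : Finset Pt} {L : List (List α)} {x y : Pt}
    (h : ∀ l ∈ L, l ≠ [] ∧ (group S src tgt l).flatten = l)
    (htr : IsTrail (gsrc src) (gtgt tgt) x L y) :
    group S src tgt L.flatten = L.flatMap (group S src tgt) := by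
  induction L generalizing x with
  | nil => rfl
  | cons l L ih =>
    have ih' := ih (fun l hl => h l (mem_cons_of_mem _ hl)) htr.2
    rw [flatten_cons, flatMap_cons, ← ih']
    cases L with
    | nil => simp [group]
    | cons l' L =>
      have h' := h l' (by simp)
      refine group_append (h l (by simp)).2 (h l (by simp)).1 (by simp [h'.1]) ?_
      have e : gsrc src (l' :: L).flatten = gsrc src l' := by
        obtain ⟨b, t', rfl⟩ := exists_cons_of_ne_nil h'.1
        rfl
      rw [e]
      exact htr.2.1

lemma group_eq_map_singleton {S : Finset Pt} {x y : Pt} {l : List α}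
    (htr : IsTrail src tgt x l y) (h : ∀ e ∈ l, tgt e ∈ S ∧ src e ≠ tgt e) :
    group S src tgt l = l.map fun e => [e] := by
  induction l generalizing x with
  | nil => rfl
  | cons e l ih =>
    have ih' := ih htr.2 fun f hf => h f (mem_cons_of_mem _ hf)
    obtain ⟨h1, h2⟩ := h e (by simp)
    rw [map_cons, ← ih', group, groupAux, if_pos ⟨h1, h2.symm⟩]
    cases l with
    | nil => rfl
    | cons f l =>
      have : src f = tgt e := htr.2.1
      rw [group, this]; rfl

end

lemma runs_path {j : ℕ} {es : Steps} {x y : Pt} (h : IsTrail fst snd x es y)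
    (hne : es ≠ []) : runs j (verts snd x es) =
      (triRuns j (gsrc fst) (gtgt snd) (group (vertV j) fst snd es)).map
        (List.map fun g => glue (g.map toSeg)) := by
  have h' : IsTrail src₀ tgt₀ x (es.map toSeg) y :=
    (isTrail_map toSeg (fun _ => rfl) fun _ => rfl).2 h
  rw [← glue_map_toSeg h hne, runs_glue (fun s hs => ?_) h',
    group_map (src := fst) (tgt := snd) _ toSeg (fun _ _ => rfl) (fun _ _ => rfl),
    triRuns_map (src := gsrc fst) (tgt := gtgt snd) (List.map toSeg) j
      (fun g _ => gsrc_map toSeg fun _ _ => rfl) (fun g _ => gtgt_map toSeg fun _ _ => rfl),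
    List.map_map]
  · congr 1
    funext r
    simp
  · obtain ⟨e, -, rfl⟩ := List.mem_map.1 hs
    exact isSeg_toSeg _ _

lemma RunOK.trail {ρ : Steps} (h : RunOK ρ) :
    IsTrail fst snd (runSrc ρ) ρ (runTgt ρ) := by
  rcases runOK_cases h with ⟨x, y, rfl, -⟩ | ⟨x, y, z, rfl, -⟩
  · exact ⟨rfl, rfl⟩
  · exact ⟨rfl, rfl, rfl⟩

/-- The groups of steps of a loopless path of level `N` from `x` to `y`. -/
structure Good (N : ℕ) (x y : Pt) (ρs : List Steps) : Prop where
  valid : ∀ ρ ∈ ρs, ValidRun N ρ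
  nodup : (ρs.map (cellOf N)).Nodup
  trail : IsTrail runSrc runTgt x ρs y
  ne_nil : ρs ≠ []

variable {M N : ℕ} {x y : Pt} {ρs : List Steps}

lemma isTrail_runs_iff (h : ∀ ρ ∈ ρs, ValidRun N ρ) :
    IsTrail fst snd x ρs.flatten y ↔ IsTrail runSrc runTgt x ρs y :=
  isTrail_flatten (fun ρ hρ => (h ρ hρ).ok.ne_nil) fun ρ hρ => (h ρ hρ).ok.trail

lemma Good.edges_trail (h : Good N x y ρs) : IsTrail fst snd x ρs.flatten y :=
  (isTrail_runs_iff h.valid).2 h.trail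

lemma flatten_ne_nil (h : ∀ ρ ∈ ρs, ValidRun N ρ) (hne : ρs ≠ []) : ρs.flatten ≠ [] := by
  obtain ⟨ρ, t, rfl⟩ := exists_cons_of_ne_nil hne
  simp [(h ρ (by simp)).ok.ne_nil]

lemma ValidRun.ne {ρ : Steps} (h : ValidRun N ρ) : ∀ e ∈ ρ, e.1 ≠ e.2 := by
  rcases runOK_cases h.ok with ⟨x, y, rfl, h1⟩ | ⟨x, y, z, rfl, h1, h2, -⟩
  · simpa using h1
  · simpa using ⟨h1, h2⟩

lemma ValidRun.tri_eq {ρ : Steps} (h : ValidRun N ρ) :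
    ∀ e ∈ ρ, tri N e.1 e.2 = cellOf N ρ := fun e he =>
  Gasket.tri_eq h.cell (h.ne e he) (h.mem e he).1 (h.mem e he).2.1

lemma triRuns_good (h : ∀ ρ ∈ ρs, ValidRun N ρ) (hn : (ρs.map (cellOf N)).Nodup) :
    triRuns N fst snd ρs.flatten = ρs :=
  triRuns_flatten_of_cells (cellOf N) (fun ρ hρ => ⟨(h ρ hρ).ok.ne_nil, (h ρ hρ).tri_eq⟩) hn

lemma Good.runs_eq (h : Good N x y ρs) :
    runs N (verts snd x ρs.flatten) = ρs.map (List.map toSeg) := by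
  rw [runs_path h.edges_trail (flatten_ne_nil h.valid h.ne_nil),
    group_eq_map_singleton h.edges_trail]
  · rw [triRuns_map (src := fst) (tgt := snd) (fun e => [e]) N (fun _ _ => rfl)
      (fun _ _ => rfl), triRuns_good h.valid h.nodup, List.map_map]
    refine map_congr_left fun ρ _ => ?_
    simp [glue]
  · intro e he
    obtain ⟨ρ, hρ, he⟩ := mem_flatten.1 he
    exact ⟨mem_vertV.2 ⟨_, (h.valid ρ hρ).cell, ((h.valid ρ hρ).mem e he).2.1⟩,
      (h.valid ρ hρ).ne e he⟩

lemma Good.typeCount_eq (h : Good N x y ρs) (j : ℕ) :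
    typeCount N (verts snd x ρs.flatten) j = ρs.countP fun r => r.length == j := by
  rw [typeCount, h.runs_eq, List.countP_map]
  congr 1
  funext r
  simp

lemma triangleOf_headD {ρ : Steps} (h : ρ ≠ []) :
    triangleOf N ((ρ.map toSeg).headD []) = cellOf N ρ := by
  obtain ⟨e, t, rfl⟩ := exists_cons_of_ne_nil h
  rfl

lemma Good.skeleton_eq (h : Good N x y ρs) :
    skeleton N (verts snd x ρs.flatten) = ρs.map (cellOf N) := by
  rw [skeleton, h.runs_eq, List.map_map]
  exact map_congr_left fun ρ hρ => triangleOf_headD (h.valid ρ hρ).ok.ne_nil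

lemma find?_of_nodup {α β : Type*} [DecidableEq β] {f : α → β} {l : List α}
    (h : (l.map f).Nodup) {a : α} (ha : a ∈ l) : (l.find? fun b => decide (f b = f a)) = some a := by
  induction l <;> grind

lemma Good.typeIn_eq (h : Good N x y ρs) {ρ : Steps} (hρ : ρ ∈ ρs) :
    typeIn N (verts snd x ρs.flatten) (cellOf N ρ) = ρ.length := by
  have h1 := h.skeleton_eq
  rw [skeleton] at h1
  rw [typeIn, runIn]
  have h2 := find?_of_nodup (f := fun r => triangleOf N (r.headD []))
    (l := runs N (verts snd x ρs.flatten)) (by rw [h1]; exact h.nodup) (a := ρ.map toSeg)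
    (by rw [h.runs_eq]; exact mem_map_of_mem hρ)
  rw [triangleOf_headD (h.valid ρ hρ).ok.ne_nil] at h2
  rw [h2]
  simp

/-! ### One step of the construction -/

/-- The law of the groups of the next level. -/
def stepPMF (u : ℝ) (N : ℕ) (ρs : List Steps) : PMF (List Steps) :=
  (seqPMF (ρs.map (runPMF u N))).map List.flatten

variable {u : ℝ}

lemma mem_support_stepPMF (hu : 0 ≤ u) (h : ∀ ρ ∈ ρs, ValidRun N ρ)
    {rs : List Steps} (hrs : rs ∈ (stepPMF u N ρs).support) :
    ∃ rss, Forall₂ (Children N) ρs rss ∧ rs = rss.flatten := by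
  rw [stepPMF, mem_support_map_iff] at hrs
  obtain ⟨rss, hrss, rfl⟩ := hrs
  rw [mem_support_seqPMF, List.forall₂_map_left_iff] at hrss
  refine ⟨rss, ?_, rfl⟩
  induction hrss with
  | nil => exact .nil
  | cons h1 _ ih =>
    refine Forall₂.cons ?_ (ih fun ρ hρ => h ρ (mem_cons_of_mem _ hρ))
    exact (h _ (by simp)).children hu h1

lemma forall₂_children_valid {rss : List (List Steps)}
    (h : Forall₂ (Children N) ρs rss) {r : Steps} (hr : r ∈ rss.flatten) :
    ∃ ρ ∈ ρs, ValidRun (N + 1) r ∧ cellOf (N + 1) r ∈ sub (cellOf N ρ) ∧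
      ∀ e ∈ r, e.1 ≠ runTgt ρ ∧ (e.1 ∈ vertV N → e.1 ∈ ρ.map fst) := by
  induction h with
  | nil => simp at hr
  | @cons ρ rs ρs rss h1 _ ih =>
    rw [flatten_cons, List.mem_append] at hr
    rcases hr with hr | hr
    · obtain ⟨h3, h4⟩ := h1.valid r hr
      exact ⟨ρ, by simp, h3, h4, fun e he => h1.src e (mem_flatten.2 ⟨r, hr, he⟩)⟩
    · obtain ⟨ρ', h2, h3⟩ := ih hr
      exact ⟨ρ', by simp [h2], h3⟩

lemma sub_disjoint {D D' Δ : Finset Pt} (hD : D ∈ cellsV N) (hD' : D' ∈ cellsV N)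
    (h : Δ ∈ sub D) (h' : Δ ∈ sub D') : D = D' := by
  obtain ⟨c, hc, rfl⟩ := mem_sub.1 h
  obtain ⟨c', hc', he⟩ := mem_sub.1 h'
  exact (image_contr_inj hD hD' hc hc' he).1

lemma isTrail_children {rss : List (List Steps)}
    (h : Forall₂ (Children N) ρs rss) (htr : IsTrail runSrc runTgt x ρs y) :
    IsTrail runSrc runTgt x rss.flatten y := by
  induction h generalizing x with
  | nil => exact htr
  | @cons ρ rs ρs rss h1 _ ih =>
    rw [flatten_cons, isTrail_append]
    refine ⟨runTgt ρ, ?_, ih htr.2⟩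
    rw [← htr.1]
    exact (isTrail_runs_iff fun r hr => (h1.valid r hr).1).1 h1.trail

lemma nodup_children {rss : List (List Steps)} (hv : ∀ ρ ∈ ρs, ValidRun N ρ)
    (h : Forall₂ (Children N) ρs rss) (hn : (ρs.map (cellOf N)).Nodup) :
    (rss.flatten.map (cellOf (N + 1))).Nodup := by
  induction h with
  | nil => simp
  | @cons ρ rs ρs rss h1 h2 ih =>
    rw [map_cons, nodup_cons] at hn
    rw [flatten_cons, List.map_append, nodup_append]
    refine ⟨h1.nodup, ih (fun ρ hρ => hv ρ (mem_cons_of_mem _ hρ)) hn.2, ?_⟩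
    rintro a ha b hb rfl
    obtain ⟨r, hr, rfl⟩ := List.mem_map.1 ha
    obtain ⟨r', hr', he⟩ := List.mem_map.1 hb
    obtain ⟨ρ', hρ', -, h4, -⟩ := forall₂_children_valid h2 hr'
    rw [he] at h4
    have := sub_disjoint (hv ρ (by simp)).cell (hv ρ' (by simp [hρ'])).cell (h1.valid r hr).2 h4
    exact hn.1 (this ▸ mem_map_of_mem hρ')

lemma Good.step (h : Good N x y ρs) (hxy : x ≠ y) (hu : 0 ≤ u) {rs : List Steps}
    (hrs : rs ∈ (stepPMF u N ρs).support) : Good (N + 1) x y rs := by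
  obtain ⟨rss, h1, rfl⟩ := mem_support_stepPMF hu h.valid hrs
  refine ⟨fun r hr => ?_, nodup_children h.valid h1 h.nodup, isTrail_children h1 h.trail, ?_⟩
  · obtain ⟨-, -, h2, -⟩ := forall₂_children_valid h1 hr
    exact h2
  · intro he
    have := isTrail_children h1 h.trail
    rw [he] at this
    exact hxy this

lemma stepPMF_counts (hu : 0 ≤ u) (h : ∀ ρ ∈ ρs, ValidRun N ρ) :
    (seqPMF (ρs.map (runPMF u N))).map (List.map counts) =
      seqPMF (ρs.map fun ρ => offspring u ρ.length) := by
  rw [← seqPMF_map, List.map_map]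
  congr 1
  exact map_congr_left fun ρ hρ => (h ρ hρ).map_counts hu

/-! ### Descendants -/

/-- `H` is a possible list of descendants of the group `ρ` of level `M`. -/
structure Desc (M : ℕ) (ρ : Steps) (H : List Steps) : Prop where
  trail : IsTrail runSrc runTgt (runSrc ρ) H (runTgt ρ)
  src : ∀ e ∈ H.flatten, e.1 ≠ runTgt ρ ∧ (e.1 ∈ vertV M → e.1 ∈ ρ.map fst)

lemma ValidRun.tgt_mem {ρ : Steps} (h : ValidRun N ρ) : runTgt ρ ∈ cellOf N ρ := by
  have hm := h.mem
  rcases runOK_cases h.ok with ⟨x, y, rfl, -⟩ | ⟨x, y, z, rfl, -⟩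
  · exact (hm (x, y) (by simp)).2.1
  · exact (hm (y, z) (by simp)).2.1

lemma ValidRun.src_ne_tgt {ρ : Steps} (h : ValidRun N ρ) : runSrc ρ ≠ runTgt ρ := by
  rcases runOK_cases h.ok with ⟨x, y, rfl, h1⟩ | ⟨x, y, z, rfl, -, -, h1⟩ <;> exact h1

lemma Desc.self {ρ : Steps} (h : ValidRun M ρ) : Desc M ρ [ρ] := by
  refine ⟨⟨rfl, rfl⟩, fun e he => ?_⟩
  rw [List.flatten_singleton] at he
  refine ⟨?_, fun _ => mem_map_of_mem he⟩
  rcases runOK_cases h.ok with ⟨x, y, rfl, h1⟩ | ⟨x, y, z, rfl, h1, h2, h3⟩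
  · obtain rfl : e = (x, y) := by simpa using he
    exact h1
  · have : e = (x, y) ∨ e = (y, z) := by simpa using he
    rcases this with rfl | rfl
    · exact h3
    · exact h2

lemma Desc.step {ρ : Steps} {H H' : List Steps} (hMN : M ≤ N)
    (h : Desc M ρ H) (hρ : ValidRun M ρ) (hv : ∀ r ∈ H, ValidRun N r) (hu : 0 ≤ u)
    (hH : H' ∈ (stepPMF u N H).support) : Desc M ρ H' := by
  obtain ⟨rss, h1, rfl⟩ := mem_support_stepPMF hu hv hH
  refine ⟨isTrail_children h1 h.trail, fun e he => ?_⟩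
  obtain ⟨r, hr, he⟩ := mem_flatten.1 he
  obtain ⟨ρ', hρ', -, -, h2⟩ := forall₂_children_valid h1 hr
  have h3 : e.1 ∈ vertV N → ∃ f ∈ H.flatten, f.1 = e.1 := by
    intro hev
    obtain ⟨f, hf, hfe⟩ := List.mem_map.1 ((h2 e he).2 hev)
    exact ⟨f, mem_flatten.2 ⟨ρ', hρ', hf⟩, hfe⟩
  constructor
  · intro hey
    obtain ⟨f, hf, hfe⟩ := h3 (hey ▸ vertV_mono hMN (mem_vertV.2 ⟨_, hρ.cell, hρ.tgt_mem⟩))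
    exact (h.src f hf).1 (hfe.trans hey)
  · intro hev
    obtain ⟨f, hf, hfe⟩ := h3 (vertV_mono hMN hev)
    exact hfe ▸ (h.src f hf).2 (hfe ▸ hev)

lemma isTrail_tgt {es : Steps} (h : IsTrail fst snd x es y) :
    ∀ e ∈ es, e.2 = y ∨ ∃ f ∈ es, f.1 = e.2 := by
  induction es generalizing x with
  | nil => simp
  | cons a es ih =>
    intro e he
    rcases mem_cons.1 he with rfl | he
    · cases es with
      | nil => exact inl h.2
      | cons b es => exact inr ⟨b, by simp, h.2.1⟩
    · rcases ih h.2 e he with h1 | ⟨f, hf, h1⟩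
      · exact inl h1
      · exact inr ⟨f, by simp [hf], h1⟩

lemma Desc.group_spec {ρ : Steps} {H : List Steps} (h : Desc M ρ H)
    (hρ : ValidRun M ρ) (hv : ∀ r ∈ H, ValidRun N r) :
    (group (vertV M) fst snd H.flatten).flatten = H.flatten ∧ H.flatten ≠ [] ∧
    ∀ g ∈ group (vertV M) fst snd H.flatten,
      tri M (gsrc fst g) (gtgt snd g) = cellOf M ρ := by
  have htr := (isTrail_runs_iff hv).2 h.trail
  have hyv : runTgt ρ ∈ vertV M := mem_vertV.2 ⟨_, hρ.cell, hρ.tgt_mem⟩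
  have hfl := group_flatten_eq htr hyv fun e he => (h.src e he).1
  refine ⟨hfl, fun he => ?_, fun g hg => ?_⟩
  · rw [he] at htr
    exact hρ.src_ne_tgt htr
  have hsrcD : ∀ e ∈ H.flatten, e.1 ∈ vertV M → e.1 ∈ cellOf M ρ := by
    intro e he hev
    obtain ⟨f, hf, hfe⟩ := List.mem_map.1 ((h.src e he).2 hev)
    exact hfe ▸ (hρ.mem f hf).1
  obtain ⟨hg1, hg2, hg3, -, hg5⟩ := (Gasket.group_spec (S := vertV M) htr).1 g hg
  have hgne := group_ne_nil hg
  have hmem : ∀ e ∈ g, e ∈ H.flatten := fun e he => mem_of_mem_group hg he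
  have hsv : runSrc ρ ∈ vertV M := by
    obtain ⟨e, t, rfl⟩ := exists_cons_of_ne_nil hρ.ok.ne_nil
    exact mem_vertV.2 ⟨_, hρ.cell, (hρ.mem e (by simp)).1⟩
  refine Gasket.tri_eq hρ.cell hg3.symm ?_ ?_
  · have : gsrc fst g ∈ vertV M := by
      rcases hg5 with h5 | h5
      · rw [h5]; exact hsv
      · exact h5
    obtain ⟨e, t, rfl⟩ := exists_cons_of_ne_nil hgne
    exact hsrcD e (hmem e (by simp)) this
  · obtain ⟨t, e, rfl⟩ := (eq_nil_or_concat g).resolve_left hgne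
    rw [concat_eq_append, gtgt_concat] at hg2 ⊢
    rcases isTrail_tgt htr e (hmem e (by simp)) with h1 | ⟨f, hf, h1⟩
    · rw [h1]; exact hρ.tgt_mem
    · rw [← h1] at hg2 ⊢; exact hsrcD f hf hg2

/-- The descendants of the groups of level `M`, at level `N`. -/
structure DescState (M N : ℕ) (x y : Pt) (ρs : List Steps)
    (Hs : List (List Steps)) : Prop where
  good : Good N x y Hs.flatten
  desc : Forall₂ (Desc M) ρs Hs

lemma forall₂_iff_zip' {α β : Type*} {R : α → β → Prop} {l : List α} {m : List β}
    (h : Forall₂ R l m) {a : α} {b : β} (hab : (a, b) ∈ l.zip m) : R a b :=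
  (List.forall₂_iff_zip.1 h).2 hab

lemma flatten_map_singleton {α : Type*} (l : List α) : (l.map fun a => [a]).flatten = l := by
  induction l with
  | nil => rfl
  | cons a l ih => rw [map_cons, flatten_cons, ih]; rfl

lemma DescState.self (h : Good M x y ρs) : DescState M M x y ρs (ρs.map fun ρ => [ρ]) := by
  refine ⟨by rwa [flatten_map_singleton], ?_⟩
  rw [List.forall₂_map_right_iff, List.forall₂_same]
  exact fun ρ hρ => Desc.self (h.valid ρ hρ)

/-- The law of the descendants at the next level. -/
def groupsPMF (u : ℝ) (N : ℕ) (Hs : List (List Steps)) :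
    PMF (List (List Steps)) := seqPMF (Hs.map (stepPMF u N))

lemma groupsPMF_flatten (Hs : List (List Steps)) :
    (groupsPMF u N Hs).map List.flatten = stepPMF u N Hs.flatten := by
  rw [stepPMF, map_flatten, seqPMF_flatten, List.map_map, groupsPMF]
  have : Hs.map (stepPMF u N) = (Hs.map (seqPMF ∘ List.map (runPMF u N))).map
      (PMF.map List.flatten) := by rw [List.map_map]; rfl
  rw [this, seqPMF_map, map_comp, map_comp]
  congr 1
  funext L
  simp [flatten_flatten]

lemma DescState.step {Hs Hs' : List (List Steps)} (hMN : M ≤ N)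
    (h : DescState M N x y ρs Hs) (hρ : Good M x y ρs) (hxy : x ≠ y) (hu : 0 ≤ u)
    (hH : Hs' ∈ (groupsPMF u N Hs).support) : DescState M (N + 1) x y ρs Hs' := by
  refine ⟨h.good.step hxy hu ?_, ?_⟩
  · rw [← groupsPMF_flatten, mem_support_map_iff]
    exact ⟨Hs', hH, rfl⟩
  · rw [groupsPMF, mem_support_seqPMF, List.forall₂_map_left_iff] at hH
    have hv : ∀ H ∈ Hs, ∀ r ∈ H, ValidRun N r := fun H hH r hr =>
      h.good.valid r (mem_flatten.2 ⟨H, hH, hr⟩)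
    have hv' := hρ.valid
    have hd := h.desc
    clear h hρ
    induction hd generalizing Hs' with
    | nil => cases hH; exact .nil
    | cons h1 _ ih =>
      cases hH with
      | cons h2 h3 =>
        refine Forall₂.cons ?_ (ih h3 (fun H hH => hv H (mem_cons_of_mem _ hH))
          fun ρ hρ => hv' ρ (mem_cons_of_mem _ hρ))
        exact h1.step hMN (hv' _ (by simp)) (hv _ (by simp)) hu h2

lemma DescState.runs_eq {Hs : List (List Steps)} (h : DescState M N x y ρs Hs)
    (hρ : Good M x y ρs) : runs M (verts snd x Hs.flatten.flatten) =
      Hs.map fun H => (group (vertV M) fst snd H.flatten).map fun g =>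
        glue (g.map toSeg) := by
  have hv : ∀ H ∈ Hs, ∀ r ∈ H, ValidRun N r := fun H hH r hr =>
    h.good.valid r (mem_flatten.2 ⟨H, hH, hr⟩)
  have hspec : ∀ H ∈ Hs, ∃ ρ ∈ ρs, (ρ, H) ∈ ρs.zip Hs := by
    intro H hH
    have hlen := h.desc.length_eq
    obtain ⟨i, hi, rfl⟩ := mem_iff_getElem.1 hH
    refine ⟨ρs[i], getElem_mem _, ?_⟩
    rw [mem_iff_getElem]
    exact ⟨i, by simp [hi, hlen], by simp⟩
  have hgs : ∀ ρ H, (ρ, H) ∈ ρs.zip Hs → _ := fun ρ H hz =>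
    (forall₂_iff_zip' h.desc hz).group_spec (hρ.valid ρ (of_mem_zip hz).1)
      (hv H (of_mem_zip hz).2)
  rw [runs_path h.good.edges_trail (flatten_ne_nil h.good.valid h.good.ne_nil),
    flatten_flatten]
  have htr : IsTrail (gsrc fst) (gtgt snd) x (Hs.map List.flatten) y := by
    rw [← isTrail_flatten (src := fst) (tgt := snd), ← flatten_flatten]
    · exact h.good.edges_trail
    · grind
    · intro l hl
      obtain ⟨H, hH, rfl⟩ := List.mem_map.1 hl
      obtain ⟨ρ, -, hz⟩ := hspec H hH
      have ht := (isTrail_runs_iff (hv H hH)).2 (forall₂_iff_zip' h.desc hz).trail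
      rwa [ht.gsrc_eq (hgs ρ H hz).2.1, ht.gtgt_eq (hgs ρ H hz).2.1]
  rw [group_flatten_append ?_ htr]
  · have e : (Hs.map List.flatten).flatMap (group (vertV M) fst snd) =
        (Hs.map fun H => group (vertV M) fst snd H.flatten).flatten := by
      rw [flatMap_map]; rfl
    rw [e, triRuns_flatten_of_cells
      (fun G => tri M (gsrc fst (G.headD [])) (gtgt snd (G.headD []))), List.map_map]
    · rfl
    · intro G hG
      obtain ⟨H, hH, rfl⟩ := List.mem_map.1 hG
      obtain ⟨ρ, -, hz⟩ := hspec H hH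
      obtain ⟨h1, h2, h3⟩ := hgs ρ H hz
      have hne : group (vertV M) fst snd H.flatten ≠ [] := by
        intro he; rw [he] at h1; exact h2 h1.symm
      refine ⟨hne, fun g hg => ?_⟩
      obtain ⟨g₀, t, hgt⟩ := exists_cons_of_ne_nil hne
      rw [h3 g hg, hgt, headD_cons, h3 g₀ (by simp [hgt])]
    · have e2 : ∀ (ρs : List Steps) (Hs : List (List Steps)),
          ρs.length = Hs.length →
          (∀ ρ H, (ρ, H) ∈ ρs.zip Hs → tri M
            (gsrc fst ((group (vertV M) fst snd H.flatten).headD []))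
            (gtgt snd ((group (vertV M) fst snd H.flatten).headD [])) =
              cellOf M ρ) →
          ((Hs.map fun H => group (vertV M) fst snd H.flatten).map fun G =>
            tri M (gsrc fst (G.headD [])) (gtgt snd (G.headD []))) =
            ρs.map (cellOf M) := by
        intro ρs
        induction ρs with
        | nil => intro Hs hl _; cases Hs <;> simp at hl ⊢
        | cons ρ ρs ih =>
          intro Hs hl hz
          cases Hs with
          | nil => simp at hl
          | cons H Hs =>
            grind
      rw [e2 ρs Hs h.desc.length_eq fun ρ H hz => ?_]
      · exact hρ.nodup
      · obtain ⟨h1, h2, h3⟩ := hgs ρ H hz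
        have hne : group (vertV M) fst snd H.flatten ≠ [] := by
          intro he; rw [he] at h1; exact h2 h1.symm
        obtain ⟨g₀, t, hgt⟩ := exists_cons_of_ne_nil hne
        rw [hgt, headD_cons, h3 g₀ (by simp [hgt])]
  · grind

lemma DescState.segmentIn_eq {Hs : List (List Steps)} (h : DescState M N x y ρs Hs)
    (hρ : Good M x y ρs) {ρ : Steps} {H : List Steps}
    (hz : (ρ, H) ∈ ρs.zip Hs) :
    segmentIn M (verts snd x Hs.flatten.flatten) (cellOf M ρ) =
      verts snd (runSrc ρ) H.flatten := by
  have hv : ∀ H ∈ Hs, ∀ r ∈ H, ValidRun N r := fun H hH r hr =>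
    h.good.valid r (mem_flatten.2 ⟨H, hH, hr⟩)
  let G : List Steps → List (List Pt) := fun H =>
    (group (vertV M) fst snd H.flatten).map fun g => glue (g.map toSeg)
  have hlab : ∀ ρ H, (ρ, H) ∈ ρs.zip Hs → triangleOf M ((G H).headD []) = cellOf M ρ ∧
      glue (G H) = verts snd (runSrc ρ) H.flatten := by
    intro ρ H hz
    have hd := forall₂_iff_zip' h.desc hz
    have hHv := hv H (of_mem_zip hz).2
    obtain ⟨h1, h2, h3⟩ := hd.group_spec (hρ.valid ρ (of_mem_zip hz).1) hHv
    have htr := (isTrail_runs_iff hHv).2 hd.trail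
    have hgs := (Gasket.group_spec (S := vertV M) htr).1
    constructor
    · have hne : group (vertV M) fst snd H.flatten ≠ [] := by
        intro he; rw [he] at h1; exact h2 h1.symm
      obtain ⟨g₀, t, hgt⟩ := exists_cons_of_ne_nil hne
      have hg₀ : g₀ ∈ group (vertV M) fst snd H.flatten := by simp [hgt]
      have hG : (G H).headD [] = glue (g₀.map toSeg) := by simp [G, hgt]
      rw [hG, triangleOf_eq, ← h3 g₀ hg₀]
      obtain ⟨-, a, b⟩ := glue_src (S := ∅) (g := g₀.map toSeg)
        (fun s hs => by obtain ⟨e, -, rfl⟩ := List.mem_map.1 hs; exact isSeg_toSeg _ _)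
        (by simpa using group_ne_nil hg₀) (by
          rw [gsrc_map (src := fst) toSeg fun _ _ => rfl,
            gtgt_map (tgt := snd) toSeg fun _ _ => rfl]
          exact (isTrail_map toSeg (fun _ => rfl) fun _ => rfl).2 (hgs g₀ hg₀).1)
      rw [a, b, gsrc_map (src := fst) toSeg fun _ _ => rfl,
        gtgt_map (tgt := snd) toSeg fun _ _ => rfl]
    · rw [← glue_map_toSeg htr h2]
      have e : G H = ((group (vertV M) fst snd H.flatten).map (List.map toSeg)).map
        glue := by rw [List.map_map]; rfl
      rw [e, glue_map_glue, ← map_flatten, h1]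
      · intro g hg
        obtain ⟨g', hg', rfl⟩ := List.mem_map.1 hg
        simpa using group_ne_nil hg'
      · grind [toSeg]
  have hruns : runs M (verts snd x Hs.flatten.flatten) = Hs.map G := h.runs_eq hρ
  have hlabs : ∀ (ρs : List Steps) (Hs : List (List Steps)),
      ρs.length = Hs.length →
      (∀ ρ H, (ρ, H) ∈ ρs.zip Hs → triangleOf M ((G H).headD []) = cellOf M ρ) →
      (Hs.map G).map (fun r => triangleOf M (r.headD [])) = ρs.map (cellOf M) := by
    intro ρs
    induction ρs with
    | nil => intro Hs hl _; cases Hs <;> simp at hl ⊢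
    | cons ρ ρs ih =>
      intro Hs hl hz
      cases Hs with
      | nil => simp at hl
      | cons H Hs =>
        grind
  have hl2 := hlabs ρs Hs h.desc.length_eq fun ρ H hz => (hlab ρ H hz).1
  have hf := find?_of_nodup (f := fun r => triangleOf M (r.headD [])) (l := Hs.map G)
    (by rw [hl2]; exact hρ.nodup) (a := G H) (mem_map_of_mem (of_mem_zip hz).2)
  rw [(hlab ρ H hz).1] at hf
  rw [segmentIn, runIn, hruns, hf, Option.getD_some, (hlab ρ H hz).2]

/-- The vector of two natural numbers. -/
def toVec (z : ℕ × ℕ) : Fin 2 → ℝ := ![(z.1 : ℝ), (z.2 : ℝ)]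

lemma Good.typeVec_eq (h : Good N x y ρs) :
    typeVec N (verts snd x ρs.flatten) = toVec (counts ρs) := by
  rw [typeVec, h.typeCount_eq, h.typeCount_eq]; rfl

lemma DescState.typeVec_segmentIn {Hs : List (List Steps)}
    (h : DescState M N x y ρs Hs) (hρ : Good M x y ρs) {ρ : Steps}
    {H : List Steps} (hz : (ρ, H) ∈ ρs.zip Hs) :
    typeVec N (segmentIn M (verts snd x Hs.flatten.flatten) (cellOf M ρ)) =
      toVec (counts H) := by
  rw [h.segmentIn_eq hρ hz]
  have hd := forall₂_iff_zip' h.desc hz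
  obtain ⟨hzρ, hzH⟩ := of_mem_zip hz
  refine Good.typeVec_eq (y := runTgt ρ) ⟨fun r hr => h.good.valid r
    (mem_flatten.2 ⟨H, hzH, hr⟩), ?_, hd.trail, ?_⟩
  · refine List.Nodup.sublist ?_ h.good.nodup
    exact (List.sublist_flatten_of_mem hzH).map _
  · rintro rfl
    exact (hρ.valid ρ hzρ).src_ne_tgt hd.trail

/-! ### The law of the numbers of descendants -/

/-- The sum of independent offspring numbers of `z.1` triangles of type `1` and `z.2` of
type `2`. -/
def offs (u : ℝ) (z : ℕ × ℕ) : PMF (ℕ × ℕ) :=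
  (seqPMF (replicate z.1 (offspring u 1) ++ replicate z.2 (offspring u 2))).map List.sum

end

section Offs

variable {u : ℝ}

/-- The law of the sum of independent random vectors. -/
def sumPMF {A : Type*} [AddCommMonoid A] (ps : List (PMF A)) : PMF A := (seqPMF ps).map List.sum

lemma sumPMF_cons {A : Type*} [AddCommMonoid A] (p : PMF A) (ps : List (PMF A)) :
    sumPMF (p :: ps) = p.bind fun a => (sumPMF ps).map (a + ·) := by
  rw [sumPMF, seqPMF, PMF.map_bind]
  simp only [sumPMF, map_comp, comp_def, List.sum_cons]

lemma sumPMF_perm {A : Type*} [AddCommMonoid A] {ps qs : List (PMF A)} (h : ps.Perm qs) :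
    sumPMF ps = sumPMF qs := by
  induction h with
  | nil => rfl
  | cons p _ ih => rw [sumPMF_cons, sumPMF_cons, ih]
  | swap p q l =>
    simp only [sumPMF_cons, PMF.map_bind, map_comp, comp_def]
    rw [PMF.bind_comm]
    simp only [add_left_comm]
  | trans _ _ ih₁ ih₂ => rw [ih₁, ih₂]

lemma offs_eq (z : ℕ × ℕ) : offs u z =
    sumPMF (replicate z.1 (offspring u 1) ++ replicate z.2 (offspring u 2)) := rfl

lemma counts_flatten {α : Type*} (L : List (List (List α))) :
    counts L.flatten = (L.map counts).sum := by
  induction L with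
  | nil => rfl
  | cons l L ih =>
    rw [flatten_cons, map_cons, List.sum_cons, ← ih]
    simp [counts, List.countP_append]

lemma perm_offspring {α : Type*} {H : List (List α)}
    (h : ∀ r ∈ H, r.length = 1 ∨ r.length = 2) : (H.map fun r => offspring u r.length).Perm
    (replicate (counts H).1 (offspring u 1) ++
      replicate (counts H).2 (offspring u 2)) := by
  induction H with
  | nil => exact .nil
  | cons r H ih =>
    have ih' := ih fun r hr => h r (mem_cons_of_mem _ hr)
    rcases h r (by simp) with h1 | h1
    · simp_all [cons_append, map_cons, List.replicate_succ, counts]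
    · have : counts (r :: H) = ((counts H).1, (counts H).2 + 1) := by simp [counts, h1]
      rw [this, map_cons, h1, List.replicate_succ]
      exact (ih'.cons _).trans List.perm_middle.symm

lemma stepPMF_map_counts (hu : 0 ≤ u) {N : ℕ} {H : List Steps}
    (h : ∀ r ∈ H, ValidRun N r) : (stepPMF u N H).map counts = offs u (counts H) := by
  rw [stepPMF, map_comp]
  have e : (counts ∘ List.flatten : List (List Steps) → ℕ × ℕ) =
      List.sum ∘ List.map counts := funext fun L => counts_flatten L
  rw [e, ← map_comp, stepPMF_counts hu h]
  change sumPMF _ = _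
  rw [sumPMF_perm (perm_offspring fun r hr => ?_), offs_eq]
  rcases runOK_cases (h r hr).ok with ⟨x, y, rfl, -⟩ | ⟨x, y, z, rfl, -⟩ <;> simp

lemma groupsPMF_map_counts (hu : 0 ≤ u) {N : ℕ} {Hs : List (List Steps)}
    (h : ∀ H ∈ Hs, ∀ r ∈ H, ValidRun N r) :
    (groupsPMF u N Hs).map (List.map counts) = seqPMF ((Hs.map counts).map (offs u)) := by
  rw [groupsPMF, ← seqPMF_map, List.map_map, List.map_map]
  congr 1
  exact map_congr_left fun H hH => stepPMF_map_counts hu (h H hH)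

end Offs

/-! ### Refinements of paths -/

section Refine

variable {N : ℕ}

lemma glue_cons_eq {s : List Pt} {rest : List (List Pt)} {x y : Pt} (hs : s ≠ [])
    (hr : ∀ t ∈ rest, t ≠ []) (hne : rest ≠ []) (h : IsTrail src₀ tgt₀ x (s :: rest) y) :
    glue (s :: rest) = s.dropLast ++ glue rest := by
  have h1 := glue_eq_gl hr hne h.2
  have h2 : s = s.dropLast ++ [tgt₀ s] := by
    conv_lhs => rw [← List.dropLast_append_getLast hs]
    rw [tgt₀, List.getLastD_eq_getLast?, List.getLast?_eq_getLast_of_ne_nil hs]; rfl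
  rw [glue, h1, gl, List.tail_cons]
  conv_lhs => rw [h2]
  simp

lemma dropLast_glue {tt : List (List Pt)} {x y : Pt} (ht : ∀ t ∈ tt, t ≠ [])
    (h : IsTrail src₀ tgt₀ x tt y) : (glue tt).dropLast = tt.flatMap List.dropLast := by
  induction tt generalizing x with
  | nil => rfl
  | cons s rest ih =>
    have ht' : ∀ t ∈ rest, t ≠ [] := fun t h => ht t (mem_cons_of_mem _ h)
    cases rest with
    | nil => simp [glue]
    | cons r rest =>
      rw [glue_cons_eq (ht s (by simp)) ht' (by simp) h, List.dropLast_append_of_ne_nil, ih ht' h.2,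
        flatMap_cons (x := s)]
      rw [glue_eq_gl ht' (by simp) h.2]
      simp [gl]

lemma isChain_glue {R : Pt → Pt → Prop} {tt : List (List Pt)} {x y : Pt} (ht : ∀ t ∈ tt, t ≠ [])
    (hc : ∀ t ∈ tt, t.IsChain R) (h : IsTrail src₀ tgt₀ x tt y) : (glue tt).IsChain R := by
  induction tt generalizing x with
  | nil => simp [glue]
  | cons s rest ih =>
    have ht' : ∀ t ∈ rest, t ≠ [] := fun t h => ht t (mem_cons_of_mem _ h)
    have ih' := ih ht' (fun t h => hc t (mem_cons_of_mem _ h)) h.2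
    have hs := ht s (by simp)
    cases rest with
    | nil => simpa [glue] using hc s (by simp)
    | cons r rest =>
      have h1 := glue_eq_gl ht' (by simp) h.2
      rw [h1, gl] at ih'
      rw [glue, h1, gl, List.tail_cons]
      rw [List.isChain_append]
      refine ⟨hc s (by simp), ih'.tail, fun a ha b hb => ?_⟩
      rw [getLast?_eq_tgt₀ hs] at ha
      obtain rfl : tgt₀ s = a := by simpa using ha
      obtain ⟨c, l, hcl⟩ := exists_cons_of_ne_nil (l := flatMap tail (r :: rest))
        (by intro he; rw [he] at hb; simp at hb)
      rw [hcl] at hb ih'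
      obtain rfl : c = b := by simpa using hb
      exact (isChain_cons_cons.1 ih').1

/-- The decompositions into path segments that refine the path `x` of level `N`. -/
def Fib (N : ℕ) (x : List Pt) : Set (List (List Pt)) :=
  {tt | Forall₂ (fun e t => t ∈ Seg N e.1 e.2) (edges x) tt}

lemma Seg.ends {x y : Pt} {s : List Pt} (h : s ∈ Seg N x y) :
    src₀ s = x ∧ tgt₀ s = y ∧ s ≠ [] := by
  obtain ⟨-, h1, h2, -⟩ := h
  refine ⟨src₀_eq_of_head? h1, ?_, by rintro rfl; simp at h1⟩
  rw [tgt₀, List.getLastD_eq_getLast?, h2]; rfl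

lemma Seg.isSeg {x y : Pt} {s : List Pt} (h : s ∈ Seg N x y) (hxy : x ≠ y) :
    IsSeg (vertV N) s := by
  obtain ⟨-, h1, h2, h3⟩ := h
  cases s with
  | nil => simp at h1
  | cons a t =>
    obtain rfl : a = x := by simpa using h1
    have ht : t ≠ [] := by
      rintro rfl
      exact hxy (by simpa using h2)
    refine ⟨a, t.dropLast, t.getLast ht, ?_, fun p hp hpv => ?_⟩
    · rw [List.dropLast_append_getLast ht]
    · refine h3 p ?_ hpv
      obtain ⟨b, t, rfl⟩ := exists_cons_of_ne_nil ht
      rw [dropLast_cons_cons]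
      exact mem_cons_of_mem _ hp

lemma Fib.ends_eq {x : List Pt} {tt : List (List Pt)} (h : tt ∈ Fib N x) :
    tt.map ends = edges x := by
  have h' : Forall₂ (fun e t => t ∈ Seg N e.1 e.2) (edges x) tt := h
  clear h
  generalize edges x = es at h'
  induction h' with
  | nil => rfl
  | cons h1 _ ih =>
    obtain ⟨a, b, -⟩ := Seg.ends h1
    rw [map_cons, ih, Gasket.ends, a, b]

lemma Fib.trail {p y : Pt} {x : List Pt} {tt : List (List Pt)} (h : tt ∈ Fib N x)
    (hp : x.head? = some p) (hy : x.getLast? = some y) : IsTrail src₀ tgt₀ p tt y := by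
  have := trail_edges hp hy
  rw [← Fib.ends_eq h] at this
  exact (isTrail_map Gasket.ends (fun _ => rfl) fun _ => rfl).1 this

lemma Fib.mem {x : List Pt} {tt : List (List Pt)} (h : tt ∈ Fib N x) :
    ∀ t ∈ tt, t ∈ Seg N (src₀ t) (tgt₀ t) ∧ (src₀ t, tgt₀ t) ∈ edges x := by
  intro t ht
  have he : (src₀ t, tgt₀ t) ∈ edges x := (Fib.ends_eq h) ▸ mem_map_of_mem (f := Gasket.ends) ht
  refine ⟨?_, he⟩
  obtain ⟨i, hi, rfl⟩ := mem_iff_getElem.1 ht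
  have h' : Forall₂ (fun e t => t ∈ Seg N e.1 e.2) (edges x) tt := h
  have := h'.get (i := i) (by rw [h'.length_eq]; exact hi) hi
  simp only [List.get_eq_getElem] at this
  obtain ⟨a, b, -⟩ := Seg.ends this
  rwa [a, b]

lemma edges_ne_nil {α : Type*} {x : List α} {p y : α} (hp : x.head? = some p)
    (hy : x.getLast? = some y) (hpy : p ≠ y) : edges x ≠ [] := by
  match x with
  | [] => simp at hp
  | [a] => simp at hp hy; exact absurd (hp.symm.trans hy) hpy
  | a :: b :: t => simp [edges]

/-- A refinement of a path of level `N`. -/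
lemma Fib.glue_spec {p y : Pt} {x : List Pt} {tt : List (List Pt)} (h : tt ∈ Fib N x)
    (hp : x.head? = some p) (hy : x.getLast? = some y) (hpy : p ≠ y) (hc : x.IsChain (AdjV N)) :
    (glue tt).IsChain (AdjV (N + 1)) ∧ (glue tt).head? = some p ∧ (glue tt).getLast? = some y ∧
    (∀ q ∈ (glue tt).dropLast, q ∈ vertV N → q ∈ x.dropLast) ∧ coarse N (glue tt) = x ∧
    split (vertV N) (glue tt) = tt := by
  have htr := Fib.trail h hp hy
  have hadj : ∀ t ∈ tt, AdjV N (src₀ t) (tgt₀ t) ∧ src₀ t ∈ x.dropLast := fun t ht =>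
    have := mem_edges_chain hc _ (Fib.mem h t ht).2
    ⟨this.1, this.2.1⟩
  have hne : ∀ t ∈ tt, t ≠ [] := fun t ht => (Seg.ends (Fib.mem h t ht).1).2.2
  have htt : tt ≠ [] := by
    rintro rfl
    exact edges_ne_nil hp hy hpy (Fib.ends_eq h).symm
  have hseg : ∀ t ∈ tt, IsSeg (vertV N) t := fun t ht => Seg.isSeg (Fib.mem h t ht).1 (hadj t ht).1.1
  have htgt : ∀ t ∈ tt, tgt₀ t ∈ vertV N := fun t ht => by
    obtain ⟨-, D, hD, -, h1⟩ := (hadj t ht).1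
    exact mem_vertV.2 ⟨D, hD, h1⟩
  have hpv : p ∈ vertV N := by
    obtain ⟨t, tt', rfl⟩ := exists_cons_of_ne_nil htt
    obtain ⟨-, D, hD, h1, -⟩ := (hadj t (by simp)).1
    rw [← htr.1]
    exact mem_vertV.2 ⟨D, hD, h1⟩
  have hgl := glue_eq_gl hne htt htr
  have hgne : glue tt ≠ [] := by rw [hgl]; exact gl_ne_nil _ _
  refine ⟨isChain_glue hne (fun t ht => (Fib.mem h t ht).1.1) htr, by rw [hgl]; rfl, ?_, ?_, ?_, ?_⟩
  · rw [getLast?_eq_tgt₀ hgne, hgl, tgt₀_gl hseg htr]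
  · rw [dropLast_glue hne htr]
    intro q hq hqv
    obtain ⟨t, ht, hqt⟩ := mem_flatMap.1 hq
    rw [(Fib.mem h t ht).1.2.2.2 q hqt hqv]
    exact (hadj t ht).2
  · rw [hgl, coarse_gl hpv hseg htr, coarse_verts hpv htr htgt fun t ht => (hadj t ht).1.1,
      ← verts_map_ends, (Fib.ends_eq h)]
    cases x with
    | nil => simp at hp
    | cons a x =>
      obtain rfl : a = p := by simpa using hp
      exact verts_edges a x
  · rw [split_glue hseg htr, group_eq_map_singleton htr fun t ht => ⟨htgt t ht, (hadj t ht).1.1⟩,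
      List.map_map]
    conv_rhs => rw [← List.map_id tt]
    exact map_congr_left fun t _ => by simp [glue]

lemma splitAux_spec {p r y : Pt} {acc l : List Pt} (hp : p ∈ vertV N)
    (hacc : acc.IsChain (AdjV (N + 1))) (h0 : acc.head? = some p) (h1 : acc.getLast? = some r)
    (h2 : ∀ q ∈ acc, q ∈ vertV N → q = p) (hr : ∃ D ∈ cellsV N, p ∈ D ∧ ∃ Δ ∈ sub D, r ∈ Δ)
    (hl : (r :: l).IsChain (AdjV (N + 1))) (hy : (r :: l).getLast? = some y) (hyv : y ∈ vertV N)
    (hyn : y ∉ (r :: l).dropLast) (hpy : p ≠ y) :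
    IsTrail src₀ tgt₀ p (splitAux (vertV N) p acc l) y ∧
    (∀ t ∈ splitAux (vertV N) p acc l, t ∈ Seg N (src₀ t) (tgt₀ t) ∧ AdjV N (src₀ t) (tgt₀ t)) ∧
    glue (splitAux (vertV N) p acc l) = acc ++ l ∧ splitAux (vertV N) p acc l ≠ [] := by
  induction l generalizing p r acc with
  | nil =>
    grind
  | cons q l ih =>
    rw [isChain_cons_cons] at hl
    rw [getLast?_cons_cons] at hy
    rw [dropLast_cons_cons] at hyn
    have hyn' : y ∉ (q :: l).dropLast := fun h => hyn (mem_cons_of_mem _ h)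
    have haccne : acc ≠ [] := by rintro rfl; simp at h0
    have hchain : (acc ++ [q]).IsChain (AdjV (N + 1)) := by
      grind [List.isChain_append]
    have hhead : (acc ++ [q]).head? = some p := by
      rw [List.head?_append_of_ne_nil _ haccne, h0]
    have hrq : ∃ D ∈ cellsV N, p ∈ D ∧ ∃ Δ ∈ sub D, q ∈ Δ := by
      obtain ⟨-, Δ, hΔ, hrΔ, hqΔ⟩ := hl.1
      obtain ⟨E, hE, hΔE⟩ := mem_cellsV_succ.1 hΔ
      by_cases hrv : r ∈ vertV N
      · obtain rfl := h2 r (List.mem_of_getLast? h1) hrv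
        exact ⟨E, hE, mem_cell_of_mem_vertV hE hΔE hrΔ hrv, Δ, hΔE, hqΔ⟩
      · obtain ⟨D, hD, hpD, Δ', hΔ', hrΔ'⟩ := hr
        obtain rfl := parent_eq hE hD hΔE hΔ' hrΔ hrΔ' hrv
        exact ⟨E, hE, hpD, Δ, hΔE, hqΔ⟩
    rw [splitAux]
    split_ifs with hq
    · obtain ⟨D, hD, hpD, Δ, hΔ, hqΔ⟩ := hrq
      have hqD := mem_cell_of_mem_vertV hD hΔ hqΔ hq.1
      have hs : src₀ (acc ++ [q]) = p := src₀_eq_of_head? hhead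
      have ht : tgt₀ (acc ++ [q]) = q := tgt₀_concat _ _
      have hseg : acc ++ [q] ∈ Seg N (src₀ (acc ++ [q])) (tgt₀ (acc ++ [q])) ∧
          AdjV N (src₀ (acc ++ [q])) (tgt₀ (acc ++ [q])) := by
        rw [hs, ht]
        exact ⟨⟨hchain, hhead, by simp, by simpa using h2⟩, hq.2.symm, D, hD, hpD, hqD⟩
      cases l with
      | nil =>
        obtain rfl : q = y := by simpa using hy
        rw [splitAux]
        exact ⟨⟨hs, ht⟩, by simpa using hseg, by simp [glue], by simp⟩
      | cons q' l =>
        have hqy : q ≠ y := fun h => hyn' (by simp [h])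
        obtain ⟨i1, i2, i3, i4⟩ := ih hq.1 (acc := [q]) (r := q) (by simp) rfl rfl (by simp)
          ⟨D, hD, hqD, _, mem_sub.2 ⟨q, hqD, rfl⟩, mem_image_contr hqD⟩ hl.2 hy hyn' hqy
        refine ⟨⟨hs, by rw [ht]; exact i1⟩, ?_, ?_, by simp⟩
        · grind
        · rw [glue, i3]; simp
    · have h2' : ∀ q' ∈ acc ++ [q], q' ∈ vertV N → q' = p := by
        grind
      obtain ⟨i1, i2, i3, i4⟩ := ih hp hchain hhead (by simp) h2' hrq hl.2 hy hyn' hpy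
      exact ⟨i1, i2, by rw [i3]; simp, i4⟩

/-- The decomposition of a path of level `N + 1`. -/
lemma split_spec {p y : Pt} {w : List Pt} (hp : p ∈ vertV N) (hc : w.IsChain (AdjV (N + 1)))
    (h0 : w.head? = some p) (hy : w.getLast? = some y) (hyv : y ∈ vertV N)
    (hyn : y ∉ w.dropLast) (hpy : p ≠ y) :
    (coarse N w).IsChain (AdjV N) ∧ (coarse N w).head? = some p ∧
    (coarse N w).getLast? = some y ∧ (∀ q ∈ (coarse N w).dropLast, q ∈ w.dropLast) ∧
    split (vertV N) w ∈ Fib N (coarse N w) ∧ glue (split (vertV N) w) = w := by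
  cases w with
  | nil => simp at h0
  | cons a w =>
    obtain rfl : a = p := by simpa using h0
    obtain ⟨D, hD, haD⟩ := mem_vertV.1 hp
    obtain ⟨h1, h2, h3, h4⟩ := splitAux_spec (acc := [a]) hp (by simp) rfl rfl (by simp)
      ⟨D, hD, haD, _, mem_sub.2 ⟨a, haD, rfl⟩, mem_image_contr haD⟩ hc hy hyv hyn hpy
    change IsTrail src₀ tgt₀ a (split (vertV N) (a :: w)) y at h1
    change ∀ t ∈ split (vertV N) (a :: w), _ at h2
    change glue (split (vertV N) (a :: w)) = a :: w at h3
    change split (vertV N) (a :: w) ≠ [] at h4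
    set tt := split (vertV N) (a :: w)
    have hne : ∀ t ∈ tt, t ≠ [] := fun t ht => (Seg.ends (h2 t ht).1).2.2
    have hseg : ∀ t ∈ tt, IsSeg (vertV N) t := fun t ht => Seg.isSeg (h2 t ht).1 (h2 t ht).2.1
    have htgt : ∀ t ∈ tt, tgt₀ t ∈ vertV N := fun t ht => by
      obtain ⟨-, D, hD, -, h1⟩ := (h2 t ht).2
      exact mem_vertV.2 ⟨D, hD, h1⟩
    have hco : coarse N (a :: w) = verts tgt₀ a tt := by
      rw [← h3, glue_eq_gl hne h4 h1, coarse_gl hp hseg h1,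
        coarse_verts hp h1 htgt fun t ht => (h2 t ht).2.1]
    have hed : edges (coarse N (a :: w)) = tt.map ends := by rw [hco, edges_verts_seg h1]
    have htr : IsTrail fst snd a (tt.map ends) y :=
      (isTrail_map ends (fun _ => rfl) fun _ => rfl).2 h1
    have hcv := (edges_trail htr)
    have hcv2 : coarse N (a :: w) = (tt.map ends).map fst ++ [y] := by
      rw [hco, ← verts_map_ends]
      clear * - htr
      generalize tt.map ends = es at htr
      induction es generalizing a with
      | nil => rw [show a = y from htr]; rfl
      | cons e es ih =>
        have := ih _ htr.2
        rw [verts] at this ⊢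
        rw [map_cons, this, map_cons, htr.1]; rfl
    refine ⟨?_, by rw [hco]; rfl, by rw [hcv2]; simp, ?_, ?_, h3⟩
    · rw [hcv2]
      refine chain_trail htr fun e he => ?_
      obtain ⟨t, ht, rfl⟩ := List.mem_map.1 he
      exact (h2 t ht).2
    · intro q hq
      rw [hcv2, List.dropLast_concat] at hq
      obtain ⟨e, he, rfl⟩ := List.mem_map.1 hq
      obtain ⟨t, ht, rfl⟩ := List.mem_map.1 he
      rw [← h3, dropLast_glue hne h1]
      refine mem_flatMap.2 ⟨t, ht, ?_⟩
      obtain ⟨b, t', hbt⟩ := exists_cons_of_ne_nil (hne t ht)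
      have := (hseg t ht).tail_ne_nil
      rw [hbt] at this ⊢
      obtain ⟨b', t'', rfl⟩ := exists_cons_of_ne_nil (show t' ≠ [] from this)
      rw [dropLast_cons_cons]
      simp [Gasket.ends, src₀]
    · change Forall₂ _ _ _
      rw [hed, List.forall₂_map_left_iff, List.forall₂_same]
      exact fun t ht => (h2 t ht).1

end Refine

/-! ### The laws of the walks -/

section Walk

variable {N : ℕ} {u : ℝ} {p y : Pt} {x : List Pt}

/-- A path of level `N` from `p` to `y` whose steps start at vertices that lie in two
triangles. -/
structure InnerPath (N : ℕ) (p y : Pt) (x : List Pt) : Prop where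
  chain : x.IsChain (AdjV N)
  head : x.head? = some p
  last : x.getLast? = some y
  inner : ∀ q ∈ x.dropLast, Inner N q

lemma segPMF_apply {e : Step} (he : AdjV N e.1 e.2) (hI : Inner N e.1) (hu : 0 ≤ u)
    (s : List Pt) : segPMF u N e s =
      (Seg N e.1 e.2).indicator (fun s => ofReal (stepProb u N s)) s := by
  obtain ⟨hne, D, hD, h1, h2⟩ := he
  obtain ⟨κ, i, j, -, h, h3, h4, -⟩ := exists_chart hD hne h1 h2 hI
  have h5 : ∑' s, (Seg N (psi κ N i j 0) (psi κ N i j 1)).indicator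
      (fun s => ofReal (stepProb u N s)) s = 1 := by
    simp only [← h.map_wordPMF hu]
    exact PMF.tsum_coe _
  rw [h3, h4] at h5
  exact pmfOf_apply _ h5 s

lemma stepProb_nonneg (hu : 0 ≤ u) (s : List Pt) : 0 ≤ stepProb u N s :=
  mul_nonneg (pow_nonneg hu _) (pow_nonneg (fixedPt_spec hu).1.le _)

lemma seqPMF_segPMF_apply (hu : 0 ≤ u) {es : Steps}
    (hes : ∀ e ∈ es, AdjV N e.1 e.2 ∧ Inner N e.1) {tt : List (List Pt)}
    (h : Forall₂ (fun e t => t ∈ Seg N e.1 e.2) es tt) :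
    seqPMF (es.map (segPMF u N)) tt = ofReal (tt.map (stepProb u N)).prod := by
  induction h with
  | nil => simp [seqPMF]
  | @cons e t es tt h1 _ ih =>
    obtain ⟨h2, h3⟩ := hes e (by simp)
    rw [map_cons, seqPMF_cons_apply, ih fun e he => hes e (mem_cons_of_mem _ he),
      segPMF_apply h2 h3 hu, indicator_of_mem h1, ← ofReal_mul (stepProb_nonneg hu t)]
    simp

lemma mem_support_segPMF (hu : 0 ≤ u) {es : Steps}
    (hes : ∀ e ∈ es, AdjV N e.1 e.2 ∧ Inner N e.1) {tt : List (List Pt)}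
    (h : tt ∈ (seqPMF (es.map (segPMF u N))).support) :
    Forall₂ (fun e t => t ∈ Seg N e.1 e.2) es tt := by
  rw [mem_support_seqPMF, List.forall₂_map_left_iff] at h
  induction h with
  | nil => exact .nil
  | @cons e t es tt h1 _ ih =>
    obtain ⟨h2, h3⟩ := hes e (by simp)
    refine .cons ?_ (ih fun e he => hes e (mem_cons_of_mem _ he))
    rw [mem_support_iff, segPMF_apply h2 h3 hu] at h1
    exact Set.mem_of_indicator_ne_zero h1

lemma InnerPath.edges (h : InnerPath N p y x) :
    ∀ e ∈ Gasket.edges x, AdjV N e.1 e.2 ∧ Inner N e.1 := fun e he =>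
  have := mem_edges_chain h.chain e he
  ⟨this.1, h.inner _ this.2.1⟩

/-- The law of the refinement of a random path of level `N`. -/
def refinePMF (u : ℝ) (N : ℕ) (P : PMF (List Pt)) : PMF (List Pt) :=
  P.bind fun x => (seqPMF ((edges x).map (segPMF u N))).map glue

lemma mem_support_refinePMF (hu : 0 ≤ u) {P : PMF (List Pt)}
    (hP : ∀ x ∈ P.support, InnerPath N p y x) {w : List Pt}
    (hw : w ∈ (refinePMF u N P).support) : ∃ x ∈ P.support, ∃ tt ∈ Fib N x, w = glue tt := by
  simp only [refinePMF, PMF.mem_support_bind_iff, mem_support_map_iff] at hw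
  obtain ⟨x, hx, tt, htt, rfl⟩ := hw
  exact ⟨x, hx, tt, mem_support_segPMF hu (hP x hx).edges htt, rfl⟩

lemma refinePMF_apply (hu : 0 ≤ u) {P : PMF (List Pt)}
    (hP : ∀ x ∈ P.support, InnerPath N p y x) (hpy : p ≠ y) {w : List Pt}
    (h1 : split (vertV N) w ∈ Fib N (coarse N w)) (h2 : glue (split (vertV N) w) = w) :
    refinePMF u N P w = P (coarse N w) *
      ofReal ((split (vertV N) w).map (stepProb u N)).prod := by
  have key : ∀ x ∈ P.support, ∀ tt ∈ (seqPMF ((edges x).map (segPMF u N))).support, glue tt = w →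
      coarse N w = x ∧ split (vertV N) w = tt := by
    rintro x hx tt htt rfl
    have hi := hP x hx
    exact (Fib.glue_spec (mem_support_segPMF hu hi.edges htt) hi.head hi.last hpy hi.chain).2.2.2.2
  rw [refinePMF, bind_apply, tsum_eq_single (coarse N w)]
  · by_cases h0 : coarse N w ∈ P.support
    · rw [← seqPMF_segPMF_apply hu (hP _ h0).edges h1, PMF.map_apply,
        tsum_eq_single (split (vertV N) w), if_pos h2.symm]
      intro tt htt
      by_contra hne
      by_cases hw : w = glue tt
      · rw [if_pos hw] at hne
        exact htt (key _ h0 tt ((mem_support_iff _ _).2 hne) hw.symm).2.symm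
      · exact hne (if_neg hw)
    · rw [mem_support_iff, not_not] at h0
      rw [h0, zero_mul, zero_mul]
  · intro x hx
    by_contra hne
    have h3 := left_ne_zero_of_mul hne
    have h4 := right_ne_zero_of_mul hne
    rw [← mem_support_iff, mem_support_map_iff] at h4
    obtain ⟨tt, h5, h6⟩ := h4
    exact hx (key x ((mem_support_iff _ _).2 h3) tt h5 h6).1.symm

/-- The self-repelling walk, constructed by successive refinements. -/
def walkPMF (u : ℝ) : ℕ → PMF (List Pt)
  | 0 => PMF.pure [vO, va]
  | N + 1 => refinePMF u N (walkPMF u N)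

lemma va_mem_vertV_zero : va ∈ vertV 0 :=
  mem_vertV.2 ⟨lcell 0 0 0, by simp [cellsV_zero], by rw [va_eq, mem_lcell]; simp⟩

lemma vO_mem_vertV_zero : vO ∈ vertV 0 :=
  mem_vertV.2 ⟨lcell 0 0 0, by simp [cellsV_zero], by rw [vO_eq, mem_lcell]; simp⟩

lemma vO_adj_va : AdjV 0 vO va :=
  ⟨vO_ne.1, lcell 0 0 0, by simp [cellsV_zero], by rw [vO_eq, mem_lcell]; simp,
    by rw [va_eq, mem_lcell]; simp⟩

lemma mem_vertV_of_adj {q r : Pt} (h : AdjV N q r) : q ∈ vertV N ∧ r ∈ vertV N :=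
  have ⟨_, D, hD, h1, h2⟩ := h
  ⟨mem_vertV.2 ⟨D, hD, h1⟩, mem_vertV.2 ⟨D, hD, h2⟩⟩

lemma mem_vertV_of_mem_dropLast {l : List Pt} (h : l.IsChain (AdjV N)) {q : Pt}
    (hq : q ∈ l.dropLast) : q ∈ vertV N := by
  induction l with
  | nil => simp at hq
  | cons a t ih =>
    cases t with
    | nil => simp at hq
    | cons b t =>
      rw [isChain_cons_cons] at h
      rw [dropLast_cons_cons] at hq
      rcases mem_cons.1 hq with rfl | hq
      · exact (mem_vertV_of_adj h.1).1
      · exact ih h.2 hq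

lemma innerPath_of_mem_W {w : List Pt} (h : w ∈ W N) : InnerPath N vO va w := by
  obtain ⟨h1, h2, h3, h4⟩ := mem_W_iff.1 h
  exact ⟨h1, h2, h3, fun q hq => inner_of_mem (mem_vertV_of_mem_dropLast h1 hq)
    fun h0 => inl (h4 q hq h0)⟩

lemma mem_W_zero {w : List Pt} : w ∈ W 0 ↔ w = [vO, va] := by
  rw [mem_W_iff]
  constructor
  · rintro ⟨h1, h2, h3, h4⟩
    match w with
    | [] => simp at h2
    | [q] => simp at h2 h3; exact absurd (h2.symm.trans h3) vO_ne.1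
    | [q, r] => simp at h2 h3; rw [h2, h3]
    | q :: r :: s :: t =>
      exfalso
      rw [isChain_cons_cons] at h1
      have hr := h4 r (by simp) (mem_vertV_of_adj h1.1).2
      have hq := h4 q (by simp) (mem_vertV_of_adj h1.1).1
      exact h1.1.1 (hq.trans hr.symm)
  · rintro rfl
    refine ⟨by simpa using vO_adj_va, rfl, rfl, by simp⟩

lemma walkPMF_apply (hu : 0 ≤ u) (w : List Pt) :
    walkPMF u N w = (W N).indicator (fun w => ofReal (pathProb u N w)) w := by
  induction N generalizing w with
  | zero =>
    rw [walkPMF, PMF.pure_apply]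
    by_cases h : w = [vO, va]
    · rw [if_pos h, indicator_of_mem (mem_W_zero.2 h), pathProb, ofReal_one]
    · rw [if_neg h, indicator_of_notMem (mt mem_W_zero.1 h)]
  | succ N ih =>
    have hP : ∀ x ∈ (walkPMF u N).support, x ∈ W N := fun x hx => by
      rw [mem_support_iff, ih] at hx
      exact Set.mem_of_indicator_ne_zero hx
    have hP' := fun x hx => innerPath_of_mem_W (hP x hx)
    have hv := vertV_mono (Nat.zero_le N)
    by_cases hw : w ∈ W (N + 1)
    · obtain ⟨h1, h2, h3, h4⟩ := mem_W_iff.1 hw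
      have hn : va ∉ w.dropLast := fun h => vO_ne.1 (h4 va h va_mem_vertV_zero).symm
      obtain ⟨a, b, c, d, e, f⟩ := split_spec (hv vO_mem_vertV_zero) h1 h2 h3
        (hv va_mem_vertV_zero) hn vO_ne.1
      have hc : coarse N w ∈ W N := mem_W_iff.2 ⟨a, b, c, fun q hq => h4 q (d q hq)⟩
      rw [walkPMF, refinePMF_apply hu hP' vO_ne.1 e f, ih, indicator_of_mem hc,
        indicator_of_mem hw, pathProb, ENNReal.ofReal_mul' (List.prod_nonneg fun r hr => ?_)]
      obtain ⟨s, -, rfl⟩ := List.mem_map.1 hr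
      exact stepProb_nonneg hu s
    · rw [indicator_of_notMem hw, PMF.apply_eq_zero_iff]
      intro hw'
      obtain ⟨x, hx, tt, htt, rfl⟩ := mem_support_refinePMF hu hP' hw'
      have hi := hP' x hx
      obtain ⟨a, b, c, d, -⟩ := Fib.glue_spec htt hi.head hi.last vO_ne.1 hi.chain
      refine hw (mem_W_iff.2 ⟨a, b, c, fun q hq h0 => ?_⟩)
      exact (mem_W_iff.1 (hP x hx)).2.2.2 q (d q hq (hv h0)) h0

lemma mem_W_of_mem_support (hu : 0 ≤ u) {w : List Pt} (h : w ∈ (walkPMF u N).support) :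
    w ∈ W N := by
  rw [mem_support_iff, walkPMF_apply hu] at h
  exact Set.mem_of_indicator_ne_zero h

lemma sum_dirac_singleton {α : Type*} [MeasurableSpace α] [MeasurableSingletonClass α]
    (A : Set α) (f : α → ℝ≥0∞) (a : α) :
    Measure.sum (fun w : A => f w • Measure.dirac (w : α)) {a} = A.indicator f a := by
  rw [Measure.sum_apply _ (measurableSet_singleton a)]
  have : ∀ w : A, (f w • Measure.dirac (w : α)) {a} = ({a} : Set α).indicator f w := by
    intro w
    rw [Measure.smul_apply, Measure.dirac_apply, smul_eq_mul]
    by_cases h : (w : α) = a <;> simp [h]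
  simp only [this]
  rw [tsum_subtype A (({a} : Set α).indicator f), tsum_eq_single a]
  · by_cases h : a ∈ A <;> simp [h]
  · intro b hb
    simp [Set.indicator, hb]

instance : DiscreteMeasurableSpace (List Pt) := ⟨fun _ => trivial⟩

lemma walkLaw_eq (hu : 0 ≤ u) : walkLaw u N = (walkPMF u N).toMeasure := by
  refine Measure.ext_of_singleton fun w => ?_
  rw [walkLaw, sum_dirac_singleton (W N) fun w => ofReal (pathProb u N w),
    PMF.toMeasure_apply_singleton _ _ (measurableSet_singleton w), walkPMF_apply hu]

lemma vO_adj_vb : AdjV 0 vO vb :=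
  ⟨vO_ne.2.1, lcell 0 0 0, by simp [cellsV_zero], by rw [vO_eq, mem_lcell]; simp,
    by rw [vb_eq, mem_lcell]; simp⟩

lemma vb_adj_va : AdjV 0 vb va :=
  ⟨vO_ne.2.2, lcell 0 0 0, by simp [cellsV_zero], by rw [vb_eq, mem_lcell]; simp,
    by rw [va_eq, mem_lcell]; simp⟩

lemma innerPath_vb : InnerPath 0 vO va [vO, vb, va] := by
  refine ⟨by simpa using ⟨vO_adj_vb, vb_adj_va⟩, rfl, rfl, fun q hq => ?_⟩
  have : q = vO ∨ q = vb := by simpa using hq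
  exact inner_zero this

lemma pathProb_one {q r : Pt} (h : AdjV 0 q r) {s : List Pt} (hs : s ∈ Seg 0 q r) :
    pathProb u 1 s = stepProb u 0 s := by
  have hF : [s] ∈ Fib 0 [q, r] := by simpa [Fib, edges] using hs
  have := (Fib.glue_spec hF rfl rfl h.1 (by simpa using h)).2.2.2.2.2
  simp only [glue, List.tail_nil, List.append_nil] at this
  rw [pathProb, pathProb, this]
  simp

lemma walkLaw'_eq (hu : 0 ≤ u) :
    walkLaw' u 1 = (refinePMF u 0 (PMF.pure [vO, vb, va])).toMeasure := by
  have hP : ∀ x ∈ (PMF.pure [vO, vb, va]).support, InnerPath 0 vO va x := by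
    intro x hx
    rw [PMF.support_pure, Set.mem_singleton_iff] at hx
    exact hx ▸ innerPath_vb
  refine Measure.ext_of_singleton fun w => ?_
  rw [walkLaw', sum_dirac_singleton (V 1) fun w =>
    ofReal ((split (vertV 0) w).map (pathProb u 1)).prod,
    PMF.toMeasure_apply_singleton _ _ (measurableSet_singleton w)]
  by_cases hw : w ∈ V 1
  · obtain ⟨h1, h2, h3, h4, h5⟩ := hw
    obtain ⟨a, b, c, d, e, f⟩ := split_spec vO_mem_vertV_zero h1 h2 h3 va_mem_vertV_zero
      (fun h => h4 va h rfl) vO_ne.1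
    rw [refinePMF_apply hu hP vO_ne.1 e f, h5, PMF.pure_apply, if_pos rfl, one_mul,
      indicator_of_mem (show w ∈ V 1 from ⟨h1, h2, h3, h4, h5⟩)]
    congr 2
    refine map_congr_left fun s hs => ?_
    obtain ⟨h6, h7⟩ := Fib.mem e s hs
    exact pathProb_one (mem_edges_chain a _ h7).1 h6
  · rw [indicator_of_notMem hw, eq_comm, PMF.apply_eq_zero_iff]
    intro hw'
    obtain ⟨x, hx, tt, htt, rfl⟩ := mem_support_refinePMF hu hP hw'
    have hi := hP x hx
    rw [PMF.support_pure, Set.mem_singleton_iff] at hx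
    obtain ⟨a, b, c, d, e, -⟩ := Fib.glue_spec htt hi.head hi.last vO_ne.1 hi.chain
    refine hw ⟨a, b, c, fun q hq h => ?_, e.trans hx⟩
    have := d q hq (h ▸ va_mem_vertV_zero)
    rw [hx, h] at this
    have h6 : va = vO ∨ va = vb := by simpa using this
    rcases h6 with h6 | h6
    · exact vO_ne.1 h6.symm
    · exact vO_ne.2.2 h6.symm

end Walk

/-! ### The chain of the loop-erased paths -/

/-- The law of the first `N + 1` states of a Markov chain with the transition kernels `κ`. -/
def hist {X : Type*} (κ : ℕ → X → PMF X) (x : X) : (N : ℕ) → PMF (Fin (N + 1) → X)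
  | 0 => PMF.pure fun _ => x
  | N + 1 => (hist κ x N).bind fun h =>
    (κ N (h (Fin.last N))).map (Fin.snoc (α := fun _ => X) h)

/-- The transition kernel of the loop-erased paths. -/
def pathKernel (u : ℝ) (N : ℕ) (y : List Pt) : PMF (List Pt) :=
  (seqPMF ((edges y).map (segPMF u N))).map fun tt => coarse (N + 1) (eraseStage N (glue tt))

section

variable {N : ℕ} {u : ℝ} {x y : Pt}

lemma verts_map_toSeg (x : Pt) (es : Steps) :
    verts tgt₀ x (es.map toSeg) = verts snd x es := by
  simp only [verts, List.map_map]; rfl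

lemma coarse_verts_edges {es : Steps} (hx : x ∈ vertV N)
    (h : IsTrail fst snd x es y) (hes : ∀ e ∈ es, AdjV N e.1 e.2) :
    coarse N (verts snd x es) = verts snd x es := by
  have h' : IsTrail src₀ tgt₀ x (es.map toSeg) y :=
    (isTrail_map toSeg (fun _ => rfl) fun _ => rfl).2 h
  have := coarse_verts hx h' (fun s hs => ?_) fun s hs => ?_
  · rwa [verts_map_toSeg] at this
  · obtain ⟨e, he, rfl⟩ := List.mem_map.1 hs
    exact (mem_vertV_of_adj (hes e he)).2
  · obtain ⟨e, he, rfl⟩ := List.mem_map.1 hs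
    exact (hes e he).1

lemma isSeg_map_toSeg {S : Finset Pt} {es : Steps} :
    ∀ s ∈ es.map toSeg, IsSeg S s := by
  intro s hs
  obtain ⟨e, -, rfl⟩ := List.mem_map.1 hs
  exact isSeg_toSeg S e

/-- The steps of a path in `W_N`. -/
lemma edges_of_mem_W {w : List Pt} (h : w ∈ W N) :
    IsTrail fst snd vO (edges w) va ∧ verts snd vO (edges w) = w ∧
      (∀ e ∈ edges w, e.1 ≠ va) ∧ ∀ e ∈ edges w, AdjV N e.1 e.2 := by
  obtain ⟨h1, h2, h3, h4⟩ := mem_W_iff.1 h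
  refine ⟨trail_edges h2 h3, ?_, fun e he hv => ?_, fun e he => (mem_edges_chain h1 e he).1⟩
  · cases w with
    | nil => simp at h2
    | cons a w =>
      obtain rfl : a = vO := by simpa using h2
      exact verts_edges _ _
  · exact vO_ne.1 ((h4 _ (mem_edges_chain h1 e he).2.1 (hv ▸ va_mem_vertV_zero)).symm.trans hv)

lemma trail_ne_nil {α : Type*} {src tgt : α → Pt} {l : List α} (h : IsTrail src tgt x l y)
    (hxy : x ≠ y) : l ≠ [] := by
  rintro rfl
  exact hxy h

lemma edges_Qhat {w : List Pt} (h : w ∈ W N) :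
    edges (Qhat N w) = stages fst snd N (edges w) := by
  obtain ⟨h1, h2, h3, h4⟩ := edges_of_mem_W h
  have h5 := isTrail_stages (j := N) h1 vO_mem_vertV_zero va_mem_vertV_zero h3
  have h6 : Qhat N w = verts snd vO (stages fst snd N (edges w)) := by
    rw [Qhat]
    conv_lhs => rw [← h2, ← glue_map_toSeg h1 (trail_ne_nil h1 vO_ne.1)]
    rw [erased_glue le_rfl isSeg_map_toSeg
      ((isTrail_map toSeg (fun _ => rfl) fun _ => rfl).2 h1) vO_mem_vertV_zero va_mem_vertV_zero,
      stages_map (src := fst) (tgt := snd) toSeg N (fun _ _ => rfl) fun _ _ => rfl,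
      glue_map_toSeg h5 (trail_ne_nil h5 vO_ne.1), coarse_verts_edges
        (vertV_mono (Nat.zero_le N) vO_mem_vertV_zero) h5 fun e he =>
          h4 e ((stages_sublist fst snd N _).subset he)]
    intro s hs
    obtain ⟨e, he, rfl⟩ := List.mem_map.1 hs
    exact h3 e he
  rw [h6, edges_verts h5]

/-- The loop erasure selects steps, irrespective of their fine structure. -/
lemma exists_mask_stages (N : ℕ) (es : Steps) : ∃ m : List Bool,
    stages fst snd N es = mask m es ∧
    ∀ tt : List (List Pt), tt.map ends = es → stages src₀ tgt₀ N tt = mask m tt := by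
  set f : ℕ → Step := fun i => es.getD i (ends []) with hf
  obtain ⟨m, hm⟩ := exists_mask (stages_sublist (fun i => (f i).1) (fun i => (f i).2) N
    (List.range es.length))
  have hr : ∀ {β : Type} (l : List β) (d : β), (List.range l.length).map (fun i => l.getD i d) = l := by
    intro β l d
    refine List.ext_getElem (by simp) fun i h1 h2 => by simp [h2]
  refine ⟨m, ?_, fun tt htt => ?_⟩
  · conv_lhs => rw [← hr es (ends [])]
    conv_rhs => rw [← hr es (ends [])]
    rw [stages_map (src := fun i => (f i).1) (tgt := fun i => (f i).2) _ N (fun _ _ => rfl)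
      fun _ _ => rfl, hm]
  · have hl : es.length = tt.length := by rw [← htt, length_map]
    have hg : ∀ i, ends (tt.getD i []) = f i := fun i => by
      rw [hf, ← htt]; simp [List.getD_eq_getElem?_getD, List.getElem?_map]
    conv_lhs => rw [← hr tt []]
    conv_rhs => rw [← hr tt []]
    rw [← hl, stages_map (src := fun i => (f i).1) (tgt := fun i => (f i).2) _ N
      (fun i _ => by rw [← hg]; rfl) fun i _ => by rw [← hg]; rfl, hm]

lemma map_mask {α β : Type*} (m : List Bool) (f : α → β) (l : List α) :
    (mask m l).map f = mask m (l.map f) := by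
  induction l generalizing m with
  | nil => rcases m with - | ⟨- | -, m⟩ <;> rfl
  | cons a l ih => rcases m with - | ⟨- | -, m⟩ <;> simp [mask, ih]

lemma pmf_bind_congr {α β : Type*} {P : PMF α} {f g : α → PMF β}
    (h : ∀ a ∈ P.support, f a = g a) : P.bind f = P.bind g := by
  ext b
  rw [bind_apply, bind_apply]
  refine tsum_congr fun a => ?_
  by_cases ha : a ∈ P.support
  · rw [h a ha]
  · rw [mem_support_iff, not_not] at ha
    rw [ha, zero_mul, zero_mul]

lemma walkPMF_hist (hu : 0 ≤ u) :
    (walkPMF u N).map (fun w (i : Fin (N + 1)) => Qhat i w) = hist (pathKernel u) [vO, va] N := by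
  induction N with
  | zero =>
    rw [walkPMF, pure_map, hist]
    congr 1
    funext i
    obtain rfl := Fin.fin_one_eq_zero i
    exact coarse_verts_edges (N := 0) (es := [(vO, va)]) (y := va) vO_mem_vertV_zero ⟨rfl, rfl⟩
      (by simpa using vO_adj_va)
  | succ N ih =>
    rw [hist, ← ih, walkPMF, refinePMF, PMF.map_bind, PMF.bind_map]
    refine pmf_bind_congr fun x hx => ?_
    have hxW := mem_W_of_mem_support hu hx
    obtain ⟨h1, h2, h3, h4⟩ := edges_of_mem_W hxW
    have hi := innerPath_of_mem_W hxW
    obtain ⟨m, hm1, hm2⟩ := exists_mask_stages N (edges x)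
    simp only [Function.comp_apply, Fin.val_last, pathKernel]
    have hmm : ∀ l : Steps, (mask m l).map (segPMF u N) = mask m (l.map (segPMF u N)) :=
      fun l => (map_mask m (segPMF u N) l)
    rw [edges_Qhat hxW, hm1, hmm, ← seqPMF_mask, map_comp, map_comp, map_comp]
    refine pmf_map_congr fun tt htt => ?_
    have hF := mem_support_segPMF hu hi.edges htt
    have htr := Fib.trail hF hi.head hi.last
    have hadj : ∀ t ∈ tt, AdjV N (src₀ t) (tgt₀ t) ∧ src₀ t ≠ va := fun t ht =>
      ⟨h4 _ (Fib.mem hF t ht).2, h3 _ (Fib.mem hF t ht).2⟩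
    have hseg : ∀ t ∈ tt, IsSeg (vertV N) t := fun t ht =>
      Seg.isSeg (Fib.mem hF t ht).1 (hadj t ht).1.1
    have hv : verts tgt₀ vO tt = x := by rw [← verts_map_ends, Fib.ends_eq hF, h2]
    funext i
    refine Fin.lastCases ?_ (fun i => ?_) i
    · simp only [Function.comp_apply, Fin.snoc_last, Fin.val_last]
      rw [Qhat, erased, erased_glue le_rfl hseg htr vO_mem_vertV_zero va_mem_vertV_zero
        fun t ht => (hadj t ht).2, hm2 tt (Fib.ends_eq hF)]
    · simp only [Function.comp_apply, Fin.snoc_castSucc, Fin.val_castSucc]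
      rw [Qhat_glue (Nat.lt_succ_iff.1 i.2) (trail_ne_nil htr vO_ne.1) hseg htr vO_mem_vertV_zero
        va_mem_vertV_zero vO_ne.1 fun t ht => (hadj t ht).2, hv]

end

/-! ### The kernel of the loop-erased paths in terms of groups of steps -/

section

variable {N : ℕ} {u : ℝ} {x y : Pt} {ρs : List Steps}

/-- The path with the given groups of steps. -/
def pathOf (x : Pt) (ρs : List Steps) : List Pt := verts snd x ρs.flatten

lemma ValidRun.adj {ρ : Steps} (h : ValidRun N ρ) :
    ∀ e ∈ ρ, AdjV N e.1 e.2 ∧ Inner N e.1 := fun e he =>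
  ⟨⟨h.ne e he, _, h.cell, (h.mem e he).1, (h.mem e he).2.1⟩, (h.mem e he).2.2⟩

lemma Good.adj (h : Good N x y ρs) : ∀ e ∈ ρs.flatten, AdjV N e.1 e.2 ∧ Inner N e.1 := by
  intro e he
  obtain ⟨ρ, hρ, he⟩ := mem_flatten.1 he
  exact (h.valid ρ hρ).adj e he

lemma Good.mem_vertV (h : Good N x y ρs) : x ∈ vertV N := by
  have h1 := h.edges_trail
  have h2 := h.adj
  obtain ⟨e, t, he⟩ := exists_cons_of_ne_nil (flatten_ne_nil h.valid h.ne_nil)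
  rw [he] at h1 h2
  rw [← h1.1]
  exact (mem_vertV_of_adj (h2 e (by simp)).1).1

lemma Seg.edges {x y : Pt} {t : List Pt} (h : t ∈ Seg N x y) (hxy : x ≠ y) :
    IsTrail fst snd x (edges t) y ∧ Gasket.edges t ≠ [] ∧
      glue ((Gasket.edges t).map toSeg) = t ∧ (∀ e ∈ Gasket.edges t, AdjV (N + 1) e.1 e.2) ∧
      gsrc fst (Gasket.edges t) = x ∧ gtgt snd (Gasket.edges t) = y := by
  obtain ⟨h1, h2, h3, -⟩ := h
  have htr := trail_edges h2 h3
  have hne := edges_ne_nil h2 h3 hxy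
  refine ⟨htr, hne, ?_, fun e he => (mem_edges_chain h1 e he).1, htr.gsrc_eq hne, htr.gtgt_eq hne⟩
  rw [glue_map_toSeg htr hne]
  cases t with
  | nil => simp at h2
  | cons a t =>
    obtain rfl : a = x := by simpa using h2
    exact verts_edges _ _

/-- The path segments that refine a list of steps. -/
abbrev Refines (N : ℕ) : Steps → List (List Pt) → Prop :=
  Forall₂ fun e t => t ∈ Seg N e.1 e.2

lemma Refines.trail {es : Steps} {tt : List (List Pt)} (h : Refines N es tt)
    (hes : ∀ e ∈ es, e.1 ≠ e.2) (htr : IsTrail fst snd x es y) :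
    IsTrail src₀ tgt₀ x tt y ∧ IsTrail fst snd x (tt.flatMap edges) y := by
  induction h generalizing x with
  | nil => exact ⟨htr, htr⟩
  | @cons e t es tt h1 _ ih =>
    obtain ⟨a, b⟩ := ih (fun e he => hes e (mem_cons_of_mem _ he)) htr.2
    obtain ⟨c, d, -⟩ := Seg.ends h1
    refine ⟨⟨c.trans htr.1, d ▸ a⟩, ?_⟩
    rw [flatMap_cons, isTrail_append]
    exact ⟨e.2, htr.1 ▸ (Seg.edges h1 (hes e (by simp))).1, b⟩

lemma Refines.glue_eq {es : Steps} {tt : List (List Pt)} (h : Refines N es tt)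
    (hes : ∀ e ∈ es, e.1 ≠ e.2) : glue tt = glue ((tt.flatMap edges).map toSeg) := by
  have hmem : ∀ t ∈ tt, Gasket.edges t ≠ [] ∧ glue ((Gasket.edges t).map toSeg) = t := by
    intro t ht
    induction h with
    | nil => simp at ht
    | @cons e s es tt h1 _ ih =>
      rcases mem_cons.1 ht with rfl | ht
      · obtain ⟨-, a, b, -⟩ := Seg.edges h1 (hes e (by simp))
        exact ⟨a, b⟩
      · exact ih (fun e he => hes e (mem_cons_of_mem _ he)) ht
  have e1 : tt = (tt.map fun t => (Gasket.edges t).map toSeg).map glue := by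
    rw [List.map_map]
    conv_lhs => rw [← List.map_id tt]
    exact map_congr_left fun t ht => (hmem t ht).2.symm
  conv_lhs => rw [e1]
  rw [glue_map_glue, flatMap, map_flatten, List.map_map]
  · rfl
  · intro g hg
    obtain ⟨t, ht, rfl⟩ := List.mem_map.1 hg
    simpa using (hmem t ht).1
  · intro g hg s hs
    obtain ⟨t, ht, rfl⟩ := List.mem_map.1 hg
    obtain ⟨e, -, rfl⟩ := List.mem_map.1 hs
    simp [toSeg]

lemma Refines.flatten {tts : List (List (List Pt))} (h : Forall₂ (Refines N) ρs tts) :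
    Refines N ρs.flatten tts.flatten := by
  induction h with
  | nil => exact .nil
  | cons h1 _ ih =>
    rw [flatten_cons, flatten_cons]
    exact List.rel_append h1 ih

/-- The level `N` decomposition of the refinement. -/
lemma group_refines {es : Steps} {tt : List (List Pt)} (h : Refines N es tt)
    (hes : ∀ e ∈ es, AdjV N e.1 e.2) (htr : IsTrail fst snd x es y) (hxy : x ≠ y) :
    group (vertV N) fst snd (tt.flatMap edges) = tt.map edges := by
  have hne : ∀ e ∈ es, e.1 ≠ e.2 := fun e he => (hes e he).1
  obtain ⟨h1, h2⟩ := Refines.trail h hne htr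
  obtain ⟨h3, h4⟩ := edges_trail htr
  have hF : tt ∈ Fib N (es.map fst ++ [y]) := by
    change Forall₂ _ (edges _) _
    rwa [← h3]
  have hs := (Fib.glue_spec hF h4 (by simp) hxy (chain_trail htr hes)).2.2.2.2.2
  have h2' : IsTrail src₀ tgt₀ x ((tt.flatMap edges).map toSeg) y :=
    (isTrail_map toSeg (fun _ => rfl) fun _ => rfl).2 h2
  rw [Refines.glue_eq h hne, split_glue isSeg_map_toSeg h2',
    group_map (src := fst) (tgt := snd) _ toSeg (fun _ _ => rfl) (fun _ _ => rfl)] at hs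
  conv_rhs => rw [← hs]
  rw [List.map_map, List.map_map]
  conv_lhs => rw [← List.map_id (group _ _ _ _)]
  refine map_congr_left fun g hg => ?_
  have h5 := ((Gasket.group_spec (S := vertV N) h2).1 g hg).1
  simp only [id, Function.comp_apply]
  rw [glue_map_toSeg h5 (group_ne_nil hg), edges_verts h5]

lemma stage_refines {tts : List (List (List Pt))} (h : Good N x y ρs) (hxy : x ≠ y)
    (ht : Forall₂ (Refines N) ρs tts) :
    stage fst snd N (tts.flatten.flatMap edges) = tts.flatMap erasedRun := by
  have hadj := h.adj
  rw [stage, group_refines (Refines.flatten ht) (fun e he => (hadj e he).1) h.edges_trail hxy,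
    map_flatten]
  have key : ∀ tt ∈ tts, ∃ ρ ∈ ρs, Refines N ρ tt := by
    intro tt htt
    obtain ⟨i, hi, rfl⟩ := mem_iff_getElem.1 htt
    have hi' : i < ρs.length := ht.length_eq ▸ hi
    exact ⟨ρs[i], getElem_mem _, ht.get hi' hi⟩
  have hcell : ∀ ρ ∈ ρs, ∀ tt, Refines N ρ tt → tt.map edges ≠ [] ∧ ∀ g ∈ tt.map edges,
      tri N (gsrc fst g) (gtgt snd g) = cellOf N ρ := by
    intro ρ hρ tt htt
    refine ⟨fun he => (h.valid ρ hρ).ok.ne_nil ?_, fun g hg => ?_⟩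
    · rw [List.map_eq_nil_iff] at he
      subst he
      exact List.forall₂_nil_right_iff.1 htt
    · obtain ⟨t, ht, rfl⟩ := List.mem_map.1 hg
      obtain ⟨i, hi, rfl⟩ := mem_iff_getElem.1 ht
      have hi' : i < ρ.length := htt.length_eq ▸ hi
      have he : ρ[i] ∈ ρ := getElem_mem _
      obtain ⟨-, -, -, -, a, b⟩ := Seg.edges (htt.get hi' hi) ((h.valid ρ hρ).ne _ he)
      simp only [List.get_eq_getElem] at a b
      rw [a, b]
      exact (h.valid ρ hρ).tri_eq _ he
  rw [triRuns_flatten_of_cells fun G : List Steps =>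
    tri N (gsrc fst (G.headD [])) (gtgt snd (G.headD []))]
  · rw [flatMap_map, flatMap, flatMap, flatten_flatten, List.map_map]
    congr 1
    refine map_congr_left fun tt htt => ?_
    obtain ⟨ρ, hρ, hr⟩ := key tt htt
    have hv := h.valid ρ hρ
    have htr := (Refines.trail hr hv.ne hv.ok.trail).2
    have hadj' : ∀ e ∈ tt.flatMap edges, AdjV (N + 1) e.1 e.2 := by
      intro e he
      obtain ⟨t, ht', he⟩ := mem_flatMap.1 he
      obtain ⟨i, hi, rfl⟩ := mem_iff_getElem.1 ht'
      have hi' : i < ρ.length := hr.length_eq ▸ hi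
      exact (Seg.edges (hr.get hi' hi) (hv.ne _ (getElem_mem _))).2.2.2.1 e he
    simp only [Function.comp_apply]
    rw [← flatMap, group_eq_map_singleton htr fun e he =>
      ⟨(mem_vertV_of_adj (hadj' e he)).2, (hadj' e he).1⟩,
      eraseK_map (hd := fst) (lst := snd) (fun e => [e]) _ fun _ _ _ _ => Iff.rfl,
      flatten_map_singleton, erasedRun]
  · intro G hG
    obtain ⟨tt, htt, rfl⟩ := List.mem_map.1 hG
    obtain ⟨ρ, hρ, hr⟩ := key tt htt
    obtain ⟨h1, h2⟩ := hcell ρ hρ tt hr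
    refine ⟨h1, fun g hg => ?_⟩
    obtain ⟨g₀, t, hgt⟩ := exists_cons_of_ne_nil h1
    rw [h2 g hg, hgt, headD_cons, h2 g₀ (by simp [hgt])]
  · have : (tts.map (List.map edges)).map (fun G : List Steps =>
        tri N (gsrc fst (G.headD [])) (gtgt snd (G.headD []))) = ρs.map (cellOf N) := by
      clear key
      have hn := h.valid
      clear h hadj
      induction ht with
      | nil => rfl
      | @cons ρ tt ρs tts h1 _ ih =>
        obtain ⟨h2, h3⟩ := hcell ρ (by simp) tt h1
        rw [map_cons, map_cons, map_cons,
          ih (fun ρ hρ => hcell ρ (by simp [hρ])) fun ρ hρ => hn ρ (by simp [hρ])]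
        obtain ⟨g₀, t, hgt⟩ := exists_cons_of_ne_nil h2
        rw [hgt, headD_cons, h3 g₀ (by simp [hgt])]
    rw [this]
    exact h.nodup

lemma stepPMF_eq (u : ℝ) (N : ℕ) (ρs : List Steps) : stepPMF u N ρs =
    (seqPMF (ρs.map (segsPMF u N))).map fun tts =>
      (tts.map fun tt => triRuns (N + 1) fst snd (erasedRun tt)).flatten := by
  have : ρs.map (runPMF u N) = (ρs.map (segsPMF u N)).map (PMF.map fun tt =>
      triRuns (N + 1) fst snd (erasedRun tt)) := by rw [List.map_map]; rfl
  rw [stepPMF, this, seqPMF_map, map_comp]; rfl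

/-- The kernel of the loop-erased paths. -/
lemma Good.pathKernel_eq (h : Good N x y ρs) (hxy : x ≠ y) (hu : 0 ≤ u) :
    pathKernel u N (pathOf x ρs) = (stepPMF u N ρs).map (pathOf x) := by
  have e1 : ρs.flatten.map (segPMF u N) = (ρs.map (List.map (segPMF u N))).flatten :=
    map_flatten
  have e2 : (ρs.map (List.map (segPMF u N))).map seqPMF = ρs.map (segsPMF u N) := by
    rw [List.map_map]; rfl
  have hadj := h.adj
  rw [pathKernel, pathOf, edges_verts h.edges_trail, e1, seqPMF_flatten, e2, stepPMF_eq,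
    map_comp, map_comp]
  refine pmf_map_congr fun tts htts => ?_
  simp only [Function.comp_apply]
  have hrs : (tts.map fun tt => triRuns (N + 1) fst snd (erasedRun tt)).flatten ∈
      (stepPMF u N ρs).support := by
    rw [stepPMF_eq, mem_support_map_iff]
    exact ⟨tts, htts, rfl⟩
  have hG := h.step hxy hu hrs
  have hfl : (tts.map fun tt => triRuns (N + 1) fst snd (erasedRun tt)).flatten.flatten =
      tts.flatMap erasedRun := by
    rw [flatten_flatten, List.map_map, flatMap]
    congr 1
    exact map_congr_left fun tt _ => triRuns_flatten _ _ _ _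
  have ht : Forall₂ (Refines N) ρs tts := by
    rw [mem_support_seqPMF, List.forall₂_map_left_iff] at htts
    have hv := h.valid
    clear h hG hfl hrs e1 e2 hadj
    induction htts with
    | nil => exact .nil
    | cons h1 _ ih =>
      exact .cons (mem_support_segPMF hu (hv _ (by simp)).adj h1)
        (ih fun ρ hρ => hv ρ (by simp [hρ]))
  have hne : ∀ e ∈ ρs.flatten, e.1 ≠ e.2 := fun e he => (hadj e he).1.1
  have htr := (Refines.trail (Refines.flatten ht) hne h.edges_trail).2
  have hG' := hG.edges_trail
  have hne' := flatten_ne_nil hG.valid hG.ne_nil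
  have hadj' := hG.adj
  rw [hfl] at hG' hne' hadj'
  rw [Refines.glue_eq (Refines.flatten ht) hne,
    eraseStage_glue isSeg_map_toSeg ((isTrail_map toSeg (fun _ => rfl) fun _ => rfl).2 htr)
      h.mem_vertV, stage_map (src := fst) (tgt := snd) toSeg N (fun _ _ => rfl)
      fun _ _ => rfl, stage_refines h hxy ht, glue_map_toSeg hG' hne', pathOf, hfl]
  exact coarse_verts_edges hG.mem_vertV hG' fun e he => (hadj' e he).1

end

/-! ### The generating functions -/

section

variable {u : ℝ}

/-- The groups of steps of the path `(O, a)`. -/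
def stepsW : List Steps := [[(vO, va)]]

/-- The groups of steps of the path `(O, b, a)`. -/
def stepsV : List Steps := [[(vO, vb), (vb, va)]]

lemma vO_mem_lcell : vO ∈ lcell 0 0 0 := by rw [vO_eq, mem_lcell]; simp
lemma va_mem_lcell : va ∈ lcell 0 0 0 := by rw [va_eq, mem_lcell]; simp
lemma vb_mem_lcell : vb ∈ lcell 0 0 0 := by rw [vb_eq, mem_lcell]; simp

lemma good_stepsW : Good 0 vO va stepsW := by
  have hD : lcell 0 0 0 ∈ cellsV 0 := by simp [cellsV_zero]
  have hc : cellOf 0 [(vO, va)] = lcell 0 0 0 := tri_eq hD vO_ne.1 vO_mem_lcell va_mem_lcell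
  refine ⟨fun ρ hρ => ?_, by simp [stepsW], ⟨rfl, rfl⟩, by simp [stepsW]⟩
  obtain rfl := List.mem_singleton.1 hρ
  refine ⟨hc ▸ hD, vO_ne.1, fun e he => ?_⟩
  obtain rfl := List.mem_singleton.1 he
  exact hc ▸ ⟨vO_mem_lcell, va_mem_lcell, inner_zero (inl rfl)⟩

lemma good_stepsV : Good 0 vO va stepsV := by
  have hD : lcell 0 0 0 ∈ cellsV 0 := by simp [cellsV_zero]
  have hc : cellOf 0 [(vO, vb), (vb, va)] = lcell 0 0 0 :=
    tri_eq hD vO_ne.2.1 vO_mem_lcell vb_mem_lcell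
  refine ⟨fun ρ hρ => ?_, by simp [stepsV], ⟨rfl, rfl⟩, by simp [stepsV]⟩
  obtain rfl := List.mem_singleton.1 hρ
  refine ⟨hc ▸ hD, ⟨vO_ne.2.1, vO_ne.2.2, rfl, vO_ne.1⟩, fun e he => ?_⟩
  rw [hc]
  rcases List.mem_pair.1 he with rfl | rfl
  · exact ⟨vO_mem_lcell, vb_mem_lcell, inner_zero (inl rfl)⟩
  · exact ⟨vb_mem_lcell, va_mem_lcell, inner_zero (inr rfl)⟩

lemma refinePMF_pure_map (x : List Pt) :
    (refinePMF u 0 (PMF.pure x)).map (Qhat 1) = pathKernel u 0 x := by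
  rw [refinePMF, PMF.pure_bind, map_comp]; rfl

lemma erasedLaw_eq (hu : 0 ≤ u) :
    erasedLaw u 1 = ((stepPMF u 0 stepsW).map (pathOf vO)).toMeasure := by
  rw [erasedLaw, walkLaw_eq hu, PMF.toMeasure_map (hf := .of_discrete), ← good_stepsW.pathKernel_eq vO_ne.1 hu]
  exact congrArg _ (refinePMF_pure_map _)

lemma erasedLaw'_eq (hu : 0 ≤ u) :
    erasedLaw' u 1 = ((stepPMF u 0 stepsV).map (pathOf vO)).toMeasure := by
  rw [erasedLaw', walkLaw'_eq hu, PMF.toMeasure_map (hf := .of_discrete),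
    ← good_stepsV.pathKernel_eq vO_ne.1 hu]
  exact congrArg _ (refinePMF_pure_map _)

lemma verts_eq {x y : Pt} {es : Steps} (h : IsTrail fst snd x es y) :
    verts snd x es = es.map fst ++ [y] := by
  obtain ⟨h1, h2⟩ := edges_trail h
  set l := es.map fst ++ [y]
  cases hl : l with
  | nil => rw [hl] at h2; simp at h2
  | cons a l' =>
    rw [hl] at h1 h2
    obtain rfl : a = x := by simpa using h2
    rw [h1, verts_edges]

lemma mem_loopless (hu : 0 ≤ u) {ρ : Steps} (hρ : Good 0 vO va [ρ])
    (hs : ∀ e ∈ ρ, e.1 = vO ∨ e.1 = vb) {w : List Pt}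
    (hw : w ∈ ((stepPMF u 0 [ρ]).map (pathOf vO)).support) : w ∈ Loopless 1 := by
  rw [mem_support_map_iff] at hw
  obtain ⟨rs, hrs, rfl⟩ := hw
  have hG := hρ.step vO_ne.1 hu hrs
  rw [stepPMF_eq, mem_support_map_iff] at hrs
  obtain ⟨tts, htts, hrs⟩ := hrs
  have hv := hρ.valid ρ (by simp)
  rw [map_singleton, seqPMF_one, mem_support_map_iff] at htts
  obtain ⟨tt, htt, rfl⟩ := htts
  have hrt := mem_support_segPMF hu hv.adj htt
  have htr : IsTrail fst snd vO ρ va := by simpa using hρ.edges_trail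
  have h1 := (Refines.trail hrt hv.ne htr).2.eraseK
  have h2 : rs.flatten = eraseK fst snd (tt.flatMap edges) := by
    rw [← hrs, map_singleton, List.flatten_singleton, triRuns_flatten, erasedRun]
  have h3 := h1.2.1
  rw [← h2] at h3
  have h4 := hG.edges_trail
  have h5 : pathOf vO rs = rs.flatten.map fst ++ [va] := verts_eq h4
  have h6 : ∀ e ∈ rs.flatten, e.1 ∈ vertV 0 → e.1 = vO ∨ e.1 = vb := by
    intro e he h0
    have hc : Children 0 ρ rs := hv.children hu (by
      rw [runPMF, mem_support_map_iff]
      exact ⟨tt, htt, by rw [← hrs]; simp⟩)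
    obtain ⟨f, hf, hfe⟩ := List.mem_map.1 ((hc.src e he).2 h0)
    exact hfe ▸ hs f hf
  have hch : (pathOf vO rs).IsChain (AdjV 1) := h5 ▸ chain_trail h4 fun e he => (hG.adj e he).1
  have hdl : (pathOf vO rs).dropLast = rs.flatten.map fst := by rw [h5, List.dropLast_concat]
  have h7 : ∀ q ∈ rs.flatten.map fst, q ∈ vertV 0 → q = vO ∨ q = vb := by
    intro q hq h0
    obtain ⟨e, he, rfl⟩ := List.mem_map.1 hq
    exact h6 e he h0
  have hlast : (pathOf vO rs).getLast? = some va := by rw [h5]; simp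
  have hva : va ∉ rs.flatten.map fst := by
    grind
  refine ⟨?_, h5 ▸ h3⟩
  by_cases hb : vb ∈ rs.flatten.map fst
  · refine inr ⟨hch, rfl, hlast, fun q hq hqa => hva (hqa ▸ hdl ▸ hq), ?_⟩
    have h8 : (rs.flatten.map fst).filter (· ∈ vertV 0) = [vO, vb] := by
      set l := rs.flatten.map fst
      obtain ⟨e, t, het⟩ := exists_cons_of_ne_nil (flatten_ne_nil hG.valid hG.ne_nil)
      have hl : l = vO :: t.map fst := by
        rw [het] at h4
        simp only [l, het, map_cons, h4.1]
      have hn : l.Nodup := (nodup_append.1 h3).1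
      rw [hl] at hb h7 hn ⊢
      have hb' : vb ∈ t.map fst := by
        rcases mem_cons.1 hb with h | h
        · exact absurd h.symm vO_ne.2.1
        · exact h
      rw [nodup_cons] at hn
      rw [List.filter_cons_of_pos (by simpa using vO_mem_vertV_zero)]
      congr 1
      have h9 : ∀ q ∈ (t.map fst).filter (· ∈ vertV 0), q = vb := by
        grind
      have h10 : vb ∈ (t.map fst).filter (· ∈ vertV 0) :=
        List.mem_filter.2 ⟨hb', by simpa using vb_mem_vertV_zero⟩
      have h11 := hn.2.filter (· ∈ vertV 0)
      match h12 : (t.map fst).filter (· ∈ vertV 0) with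
      | [] => rw [h12] at h10; simp at h10
      | [q] => rw [h9 q (by rw [h12]; simp)]
      | q :: q' :: t' =>
        simp_all
    have hne := vO_ne
    rw [coarse, h5, List.filter_append, h8]
    simp [va_mem_vertV_zero, hne.2.1, hne.2.2]
  · refine inl (mem_W_iff.2 ⟨hch, rfl, hlast, fun q hq h0 => ?_⟩)
    rw [hdl] at hq
    exact (h7 q hq h0).resolve_right fun h => hb (h ▸ hq)

/-- A box that contains the numbers of children. -/
def box : Finset (ℕ × ℕ) := range 4 ×ˢ range 4

lemma mem_box_of_mem_support (hu : 0 ≤ u) {n : ℕ} (hn : n = 1 ∨ n = 2) {z : ℕ × ℕ}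
    (hz : z ∈ (offspring u n).support) : z ∈ box := by
  obtain ⟨h1, -⟩ := mem_support_offspring hu hn hz
  simp only [box, Finset.mem_product, Finset.mem_range]
  omega

lemma integral_of_support {E : Type*} [NormedAddCommGroup E] [NormedSpace ℝ E] [CompleteSpace E]
    {p : PMF (ℕ × ℕ)} (hp : ∀ z ∈ p.support, z ∈ box) (f : ℕ × ℕ → E) :
    Integrable f p.toMeasure ∧ ∫ z, f z ∂p.toMeasure = ∑ z ∈ box, (p z).toReal • f z := by
  have hi : Integrable f p.toMeasure := by
    refine Integrable.of_bound (StronglyMeasurable.of_discrete.aestronglyMeasurable) (∑ z ∈ box, ‖f z‖) ?_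
    rw [ae_iff, PMF.toMeasure_apply_eq_zero_iff _ .of_discrete, Set.disjoint_left]
    intro z hz hz'
    exact hz' (single_le_sum (f := fun z => ‖f z‖) (fun _ _ => norm_nonneg _) (hp z hz))
  refine ⟨hi, ?_⟩
  rw [PMF.integral_eq_tsum _ _ hi, tsum_eq_sum fun z hz => ?_]
  have : p z = 0 := by
    by_contra h
    exact hz (hp z ((mem_support_iff _ _).2 h))
  rw [this, ENNReal.toReal_zero, zero_smul]

/-- The generating function of a random pair of numbers. -/
def gen {𝕜 : Type*} [RCLike 𝕜] (p : PMF (ℕ × ℕ)) (x y : 𝕜) : 𝕜 :=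
  ∑ z ∈ box, ((p z).toReal : 𝕜) * x ^ z.1 * y ^ z.2

lemma genFun_eq {𝕜 : Type*} [RCLike 𝕜] {p : PMF (List Pt)} {q : PMF (ℕ × ℕ)}
    (hp : ∀ w ∈ p.support, w ∈ Loopless 1)
    (hq : p.map (fun w => (typeCount 1 w 1, typeCount 1 w 2)) = q)
    (hb : ∀ z ∈ q.support, z ∈ box) (x y : 𝕜) : genFun p.toMeasure x y = gen q x y := by
  set T : List Pt → ℕ × ℕ := fun w => (typeCount 1 w 1, typeCount 1 w 2)
  have hT : Measurable T := .of_discrete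
  obtain ⟨h1, h2⟩ := integral_of_support hb fun z => x ^ z.1 * y ^ z.2
  rw [← hq, ← PMF.toMeasure_map (hf := hT)] at h1 h2
  rw [integrable_map_measure StronglyMeasurable.of_discrete.aestronglyMeasurable hT.aemeasurable] at h1
  rw [integral_map hT.aemeasurable StronglyMeasurable.of_discrete.aestronglyMeasurable,
    show (∫ w, x ^ (T w).1 * y ^ (T w).2 ∂p.toMeasure) = ∑' w, _ from PMF.integral_eq_tsum _ _ h1,
    hq] at h2
  rw [genFun, gen, tsum_subtype (Loopless 1) fun w => ((p.toMeasure.real {w} : ℝ) : 𝕜) *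
    x ^ typeCount 1 w 1 * y ^ typeCount 1 w 2]
  trans ∑ z ∈ box, (q z).toReal • (x ^ z.1 * y ^ z.2)
  · rw [← h2]
    refine tsum_congr fun w => ?_
    by_cases hw : w ∈ Loopless 1
    · rw [indicator_of_mem hw, measureReal_def, PMF.toMeasure_apply_singleton _ _ (measurableSet_singleton w),
        RCLike.real_smul_eq_coe_mul, mul_assoc]
    · rw [indicator_of_notMem hw, (PMF.apply_eq_zero_iff _ _).2 fun h => hw (hp w h)]
      simp
  · refine sum_congr rfl fun z _ => ?_
    rw [RCLike.real_smul_eq_coe_mul, mul_assoc]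

lemma offs_one : offs u (1, 0) = offspring u 1 ∧ offs u (0, 1) = offspring u 2 := by
  have h : ∀ p : PMF (ℕ × ℕ), (seqPMF [p]).map List.sum = p := by
    intro p
    rw [seqPMF_one, map_comp]
    convert PMF.map_id p using 2
    funext a
    simp
  exact ⟨h _, h _⟩

lemma genFun_step {𝕜 : Type*} [RCLike 𝕜] (hu : 0 ≤ u) {ρ : Steps}
    (hρ : Good 0 vO va [ρ]) (hs : ∀ e ∈ ρ, e.1 = vO ∨ e.1 = vb) (x y : 𝕜) :
    genFun ((stepPMF u 0 [ρ]).map (pathOf vO)).toMeasure x y = gen (offspring u ρ.length) x y := by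
  have hc := stepPMF_map_counts hu hρ.valid
  have hn : ρ.length = 1 ∨ ρ.length = 2 := by
    rcases runOK_cases (hρ.valid ρ (by simp)).ok with ⟨x, y, rfl, -⟩ | ⟨x, y, z, rfl, -⟩ <;> simp
  have he : offs u (counts [ρ]) = offspring u ρ.length := by
    grind [counts, offs_one.1, offs_one.2]
  refine genFun_eq (fun w hw => mem_loopless hu hρ hs hw) ?_
    (fun z hz => mem_box_of_mem_support hu hn hz) x y
  rw [← he, ← hc, map_comp]
  refine pmf_map_congr fun rs hrs => ?_
  have hG := hρ.step vO_ne.1 hu hrs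
  exact Prod.ext (hG.typeCount_eq 1) (hG.typeCount_eq 2)

lemma genPhi_eq {𝕜 : Type*} [RCLike 𝕜] (hu : 0 ≤ u) (x y : 𝕜) :
    genPhi u x y = gen (offspring u 1) x y := by
  rw [genPhi, erasedLaw_eq hu]
  exact genFun_step hu good_stepsW (by simp) x y

lemma genTheta_eq {𝕜 : Type*} [RCLike 𝕜] (hu : 0 ≤ u) (x y : 𝕜) :
    genTheta u x y = gen (offspring u 2) x y := by
  rw [genTheta, erasedLaw'_eq hu]
  exact genFun_step hu good_stepsV (by simp) x y

end

/-! ### Markov chains on a countable set -/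

section Markov

variable {X : Type*} {κ : ℕ → X → PMF X} {x : X}

lemma hist_apply [DecidableEq X] (N : ℕ) (z : Fin (N + 1) → X) : hist κ x N z =
    (if z 0 = x then 1 else 0) * ∏ i : Fin N, κ i (z i.castSucc) (z i.succ) := by
  classical
  induction N with
  | zero =>
    rw [hist, PMF.pure_apply]
    have : (z = fun _ => x) ↔ z 0 = x := by
      constructor
      · rintro rfl; rfl
      · intro h; funext i; rw [Fin.fin_one_eq_zero i, h]
    simp [this]
  | succ N ih =>
    rw [hist, bind_apply, tsum_eq_single (init z)]
    · rw [ih, PMF.map_apply, tsum_eq_single (z (Fin.last (N + 1))), if_pos (Fin.snoc_init_self z).symm,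
        Fin.prod_univ_castSucc, mul_assoc]
      · rfl
      · intro b hb
        rw [if_neg]
        intro h
        exact hb (by rw [h, Fin.snoc_last])
    · intro h hh
      refine mul_eq_zero_of_right _ ?_
      rw [PMF.apply_eq_zero_iff, mem_support_map_iff]
      rintro ⟨b, -, rfl⟩
      exact hh (Fin.init_snoc (α := fun _ => X) b h).symm

lemma hist_lump {X' : Type*} {κ' : ℕ → X' → PMF X'} (f : ℕ → X → X') (A : ℕ → Set X)
    (hx : x ∈ A 0) (hA : ∀ n, ∀ a ∈ A n, ∀ b ∈ (κ n a).support, b ∈ A (n + 1))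
    (hf : ∀ n, ∀ a ∈ A n, κ' n (f n a) = (κ n a).map (f (n + 1))) (N : ℕ) :
    hist κ' (f 0 x) N = (hist κ x N).map (fun h (i : Fin (N + 1)) => f i (h i)) ∧
      ∀ h ∈ (hist κ x N).support, ∀ i : Fin (N + 1), h i ∈ A i := by
  induction N with
  | zero =>
    grind [pure_map, PMF.support_pure, hist]
  | succ N ih =>
    obtain ⟨ih1, ih2⟩ := ih
    constructor
    · rw [hist, ih1, hist, PMF.bind_map, PMF.map_bind]
      refine pmf_bind_congr fun h hh => ?_
      have := hf N (h (Fin.last N)) (ih2 h hh (Fin.last N))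
      simp only [Function.comp_apply, Fin.val_last]
      rw [this, map_comp, map_comp]
      congr 1
      funext b i
      refine Fin.lastCases ?_ (fun i => ?_) i <;> simp
    · intro h hh i
      rw [hist, PMF.mem_support_bind_iff] at hh
      obtain ⟨h', hh', hm⟩ := hh
      rw [mem_support_map_iff] at hm
      obtain ⟨b, hb, rfl⟩ := hm
      refine Fin.lastCases ?_ (fun i => ?_) i
      · simpa using hA N _ (ih2 h' hh' (Fin.last N)) b hb
      · simpa using ih2 h' hh' i

variable [MeasurableSpace X]

/-- `P` is the law of the Markov chain with the transition kernels `κ` started at `x`. -/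
def IsMC (κ : ℕ → X → PMF X) (x : X) (P : Measure (ℕ → X)) : Prop :=
  ∀ N : ℕ, P.map (fun ω (i : Fin (N + 1)) => ω i) = (hist κ x N).toMeasure

lemma measurable_restr (N : ℕ) : Measurable fun (ω : ℕ → X) (i : Fin (N + 1)) => ω i := by
  fun_prop

lemma IsMC.unique {P P' : Measure (ℕ → X)} [IsFiniteMeasure P] (h : IsMC κ x P)
    (h' : IsMC κ x P') : P = P' := by
  have hP : IsProjectiveLimit (α := fun _ => X) P fun I => P.map I.restrict := fun I => rfl
  have : ∀ I : Finset ℕ, IsFiniteMeasure (P.map (I.restrict (π := fun _ => X))) := fun I => inferInstance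
  refine IsProjectiveLimit.unique hP fun I => ?_
  have hI : (I.restrict : (ℕ → X) → _) = (fun (h : Fin (I.sup id + 1) → X) (i : I) =>
      h ⟨i, Nat.lt_succ_of_le (Finset.le_sup (f := id) i.2)⟩) ∘ fun ω i => ω i := rfl
  rw [hI, ← Measure.map_map (by fun_prop) (measurable_restr _),
    ← Measure.map_map (by fun_prop) (measurable_restr _), h, h']

variable [Countable X] [DiscreteMeasurableSpace X]

lemma isMC_iff {P : Measure (ℕ → X)} : IsMC κ x P ↔ ∀ (N : ℕ) (z : Fin (N + 1) → X),
    P {ω | ∀ i : Fin (N + 1), ω i = z i} = hist κ x N z := by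
  have key : ∀ (N : ℕ) (z : Fin (N + 1) → X), P.map (fun ω (i : Fin (N + 1)) => ω i) {z} =
      P {ω | ∀ i : Fin (N + 1), ω i = z i} := by
    intro N z
    rw [Measure.map_apply (measurable_restr N) (measurableSet_singleton z)]
    congr 1
    ext ω
    simp [funext_iff]
  constructor
  · intro h N z
    rw [← key, h N, PMF.toMeasure_apply_singleton _ _ (measurableSet_singleton z)]
  · intro h N
    refine Measure.ext_of_singleton fun z => ?_
    rw [key, h, PMF.toMeasure_apply_singleton _ _ (measurableSet_singleton z)]

lemma exists_isMC (κ : ℕ → X → PMF X) (x : X) :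
    ∃ P : Measure (ℕ → X), IsProbabilityMeasure P ∧ IsMC κ x P := by
  classical
  let μ : ℕ × X → Measure X := fun p => (κ p.1 p.2).toMeasure
  have : ∀ p, IsProbabilityMeasure (μ p) := fun p => inferInstance
  let Y : (ℕ × X → X) → ℕ → X := fun U n => Nat.rec x (fun n y => U (n, y)) n
  have hY : Measurable Y := by
    refine measurable_pi_iff.2 fun n => ?_
    induction n with
    | zero => exact measurable_const
    | succ n ih =>
      refine measurable_to_countable' fun b => ?_
      have : (fun U => Y U (n + 1)) ⁻¹' {b} =
          ⋃ a : X, (fun U => Y U n) ⁻¹' {a} ∩ (fun U => U (n, a)) ⁻¹' {b} := by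
        ext U
        simp [Y]
      rw [this]
      exact MeasurableSet.iUnion fun a => (ih (measurableSet_singleton a)).inter
        (measurable_pi_apply _ (measurableSet_singleton b))
  refine ⟨(Measure.infinitePi μ).map Y, Measure.isProbabilityMeasure_map hY.aemeasurable, ?_⟩
  rw [isMC_iff]
  intro N z
  have hmz : MeasurableSet {ω : ℕ → X | ∀ i : Fin (N + 1), ω i = z i} := by
    rw [Set.ofPred_forall]
    exact MeasurableSet.iInter fun i =>
      (measurableSet_singleton (z i)).preimage (measurable_pi_apply (i : ℕ))
  rw [hist_apply, Measure.map_apply hY hmz]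
  · have hset : ∀ U, U ∈ Y ⁻¹' {ω | ∀ i : Fin (N + 1), ω i = z i} ↔
        z 0 = x ∧ ∀ i : Fin N, U (i, z i.castSucc) = z i.succ := by
      intro U
      change (∀ i : Fin (N + 1), Y U i = z i) ↔ _
      constructor
      · intro h
        refine ⟨(h 0).symm, fun i => ?_⟩
        have h1 := h i.succ
        have h2 := h i.castSucc
        rw [← h1, ← h2]; rfl
      · rintro ⟨h0, h⟩ i
        refine Fin.induction h0.symm (fun i hi => ?_) i
        rw [← h i, ← hi]; rfl
    by_cases h0 : z 0 = x
    · have hinj : Injective fun i : Fin N => ((i : ℕ), z i.castSucc) := by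
        intro i j hij
        exact Fin.ext (congrArg fst hij)
      let t : ℕ × X → Set X := fun p => {b | ∃ i : Fin N, p.1 = i ∧ b = z i.succ}
      have : Y ⁻¹' {ω | ∀ i : Fin (N + 1), ω i = z i} =
          Set.pi (univ.image fun i : Fin N => ((i : ℕ), z i.castSucc)) t := by
        ext U
        rw [hset]
        simp only [h0, true_and, Set.mem_pi, Finset.coe_image, Finset.coe_univ, Set.image_univ,
          Set.mem_range, forall_exists_index, forall_apply_eq_imp_iff]
        refine forall_congr' fun i => ⟨fun h => ⟨i, rfl, h⟩, ?_⟩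
        rintro ⟨j, hj, h⟩
        rw [h, Fin.ext hj]
      rw [this, Measure.infinitePi_pi _ (fun _ _ => .of_discrete),
        Finset.prod_image fun i _ j _ h => hinj h, if_pos h0, one_mul]
      refine Finset.prod_congr rfl fun i _ => ?_
      have ht : t ((i : ℕ), z i.castSucc) = {z i.succ} := by
        grind
      rw [ht, PMF.toMeasure_apply_singleton _ _ (measurableSet_singleton _)]
    · have : Y ⁻¹' {ω | ∀ i : Fin (N + 1), ω i = z i} = ∅ := by
        ext U
        rw [hset]
        simp [h0]
      rw [this, measure_empty, if_neg h0, zero_mul]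

lemma IsMC.step {P : Measure (ℕ → X)} (h : IsMC κ x P) (n : ℕ) (B : Set (Fin (n + 1) → X))
    {a : X} (hB : ∀ z ∈ B, z (Fin.last n) = a) (b : X) :
    P {ω | (fun i : Fin (n + 1) => ω i) ∈ B ∧ ω (n + 1) = b} =
      P {ω | (fun i : Fin (n + 1) => ω i) ∈ B} * κ n a b := by
  classical
  have h1 : P {ω | (fun i : Fin (n + 1) => ω i) ∈ B} = (hist κ x n).toMeasure B := by
    rw [← h n, Measure.map_apply (measurable_restr n) .of_discrete]; rfl
  have h2 : P {ω | (fun i : Fin (n + 1) => ω i) ∈ B ∧ ω (n + 1) = b} =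
      (hist κ x (n + 1)).toMeasure {z | init z ∈ B ∧ z (Fin.last (n + 1)) = b} := by
    rw [← h (n + 1), Measure.map_apply (measurable_restr (n + 1)) .of_discrete]; rfl
  rw [h1, h2, PMF.toMeasure_apply _ .of_discrete, PMF.toMeasure_apply _ .of_discrete,
    ← ENNReal.tsum_mul_right]
  have hinj : Injective fun z : Fin (n + 1) → X => (Fin.snoc (α := fun _ => X) z b) := by
    intro z z' hz
    have := congrArg init hz
    simpa using this
  rw [← hinj.tsum_eq]
  · refine tsum_congr fun z => ?_
    by_cases hz : z ∈ B
    · rw [indicator_of_mem (by simpa using hz), indicator_of_mem hz, hist_apply, hist_apply,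
        Fin.prod_univ_castSucc, ← hB z hz, ← mul_assoc]
      congr 1
      · congr 1
        · refine Finset.prod_congr rfl fun i _ => ?_
          rw [Fin.snoc_castSucc, Fin.succ_castSucc, Fin.snoc_castSucc]; rfl
      · rw [Fin.snoc_castSucc, Fin.succ_last, Fin.snoc_last]; rfl
    · rw [indicator_of_notMem (by simpa using hz), indicator_of_notMem hz, zero_mul]
  · intro z hz
    have := (Set.indicator_apply_ne_zero.1 hz).1
    exact ⟨init z, by
      have h3 : z (Fin.last (n + 1)) = b := this.2
      change Fin.snoc (α := fun _ => X) (init z) b = z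
      rw [← h3, Fin.snoc_init_self]⟩

/-- The Markov property at a fixed time. -/
lemma IsMC.cond_shift {P : Measure (ℕ → X)} [IsFiniteMeasure P] (h : IsMC κ x P) (M : ℕ) {v : X}
    (hv : P {ω | ω M = v} ≠ 0) :
    IsMC (fun n => κ (M + n)) v ((P[|{ω | ω M = v}]).map fun ω n => ω (M + n)) := by
  classical
  have hm : ∀ (n : ℕ) (b : X), MeasurableSet {ω : ℕ → X | ω n = b} := fun n b =>
    (measurableSet_singleton b).preimage (measurable_pi_apply n)
  rw [isMC_iff]
  intro N z
  have hmc : MeasurableSet {ω : ℕ → X | ∀ i : Fin (N + 1), ω i = z i} := by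
    rw [Set.ofPred_forall]
    exact MeasurableSet.iInter fun i => hm _ _
  rw [Measure.map_apply (by fun_prop) hmc, cond_apply (hm M v)]
  have key : P ({ω | ω M = v} ∩ (fun (ω : ℕ → X) n => ω (M + n)) ⁻¹'
      {ω | ∀ i : Fin (N + 1), ω i = z i}) = P {ω | ω M = v} * hist (fun n => κ (M + n)) v N z := by
    clear hmc
    induction N with
    | zero =>
      rw [hist_apply]
      by_cases h0 : z 0 = v
      · simp_all
      · rw [if_neg h0]
        simp only [zero_mul, mul_zero]
        convert measure_empty (μ := P)
        ext ω
        simp only [Set.mem_inter_iff, Set.mem_preimage, Set.mem_empty_iff_false, iff_false, not_and]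
        intro h1 h2
        exact h0 ((h2 0).symm.trans h1)
    | succ N ih =>
      have h1 := h.step (M + N) {y | y ⟨M, by omega⟩ = v ∧ ∀ i : Fin (N + 1),
        y ⟨M + i, by omega⟩ = z i.castSucc} (a := z (Fin.last N).castSucc)
        (fun y hy => by simpa [Fin.last] using hy.2 (Fin.last N)) (z (Fin.last (N + 1)))
      have h2 := ih fun i => z i.castSucc
      have e1 : {ω : ℕ → X | ω M = v} ∩ (fun (ω : ℕ → X) n => ω (M + n)) ⁻¹'
          {ω | ∀ i : Fin (N + 1), ω i = z i.castSucc} =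
          {ω | (fun i : Fin (M + N + 1) => ω i) ∈ {y : Fin (M + N + 1) → X | y ⟨M, by omega⟩ = v ∧
            ∀ i : Fin (N + 1), y ⟨M + i, by omega⟩ = z i.castSucc}} := rfl
      have e2 : {ω : ℕ → X | ω M = v} ∩ (fun (ω : ℕ → X) n => ω (M + n)) ⁻¹'
          {ω | ∀ i : Fin (N + 1 + 1), ω i = z i} =
          {ω | (fun i : Fin (M + N + 1) => ω i) ∈ {y : Fin (M + N + 1) → X | y ⟨M, by omega⟩ = v ∧
            ∀ i : Fin (N + 1), y ⟨M + i, by omega⟩ = z i.castSucc} ∧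
            ω (M + N + 1) = z (Fin.last (N + 1))} := by
        ext ω
        change (ω M = v ∧ ∀ i : Fin (N + 1 + 1), ω (M + i) = z i) ↔
          (ω M = v ∧ ∀ i : Fin (N + 1), ω (M + i) = z i.castSucc) ∧ _
        rw [Fin.forall_fin_succ', and_assoc]; rfl
      rw [e2, h1, ← e1, h2, hist_apply, hist_apply, Fin.prod_univ_castSucc]
      simp only [mul_assoc]
      rfl
  rw [key, ← mul_assoc, ENNReal.inv_mul_cancel hv (measure_ne_top P _), one_mul]

end Markov

/-! ### The joint law of the numbers of descendants -/

section Joint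

variable {u : ℝ} {M : ℕ}

lemma isCoupledLaw_iff (hu : 0 ≤ u) {P : Measure (ℕ → List Pt)} :
    IsCoupledLaw u P ↔ IsMC (pathKernel u) [vO, va] P := by
  refine forall_congr' fun N => ?_
  rw [walkLaw_eq hu, PMF.toMeasure_map (hf := .of_discrete), walkPMF_hist hu]

lemma exists_good (hu : 0 ≤ u) {P : Measure (ℕ → List Pt)} (hP : IsMC (pathKernel u) [vO, va] P)
    {v : List Pt} (hv : P {ω | ω M = v} ≠ 0) : ∃ ρs, Good M vO va ρs ∧ v = pathOf vO ρs := by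
  obtain ⟨h1, h2⟩ := hist_lump (κ := stepPMF u) (κ' := pathKernel u) (fun _ => pathOf vO)
    (fun n => {ρs | Good n vO va ρs}) good_stepsW
    (fun n ρs hρ rs hrs => Good.step hρ vO_ne.1 hu hrs)
    (fun n ρs hρ => Good.pathKernel_eq hρ vO_ne.1 hu) M
  have h3 : P {ω | ω M = v} = (hist (pathKernel u) [vO, va] M).toMeasure
      {z | z (Fin.last M) = v} := by
    rw [← hP M, Measure.map_apply (measurable_restr M) .of_discrete]; rfl
  rw [h3, Ne, PMF.toMeasure_apply_eq_zero_iff _ .of_discrete, Set.not_disjoint_iff] at hv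
  obtain ⟨z, hz, hzv⟩ := hv
  rw [show [vO, va] = pathOf vO stepsW from rfl, h1, mem_support_map_iff] at hz
  obtain ⟨h, hh, rfl⟩ := hz
  exact ⟨h (Fin.last M), h2 h hh (Fin.last M), Eq.symm hzv⟩

/-- The entries of a list. -/
def toFn (k : ℕ) (l : List (ℕ × ℕ)) : Fin k → ℕ × ℕ := fun i => l.getD i 0

lemma toFn_ofFn {k : ℕ} {l : List (ℕ × ℕ)} (h : l.length = k) : ofFn (toFn k l) = l := by
  subst h
  refine List.ext_getElem (by simp) fun i h1 h2 => by simp [toFn, h2]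

/-- The transition kernel of `k` independent branching processes. -/
def piKernel (u : ℝ) (k : ℕ) (z : Fin k → ℕ × ℕ) : PMF (Fin k → ℕ × ℕ) :=
  (seqPMF (ofFn fun i => offs u (z i))).map (toFn k)

lemma seqPMF_ofFn {α : Type*} {k : ℕ} (p : Fin k → PMF α) (z : Fin k → α) :
    seqPMF (ofFn p) (ofFn z) = ∏ i, p i (z i) := by
  induction k with
  | zero => simp [seqPMF]
  | succ k ih => rw [List.ofFn_succ, List.ofFn_succ, seqPMF_cons_apply, ih, Fin.prod_univ_succ]

lemma piKernel_apply (k : ℕ) (z z' : Fin k → ℕ × ℕ) :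
    piKernel u k z z' = ∏ i, offs u (z i) (z' i) := by
  have hz' : toFn k (ofFn z') = z' := by funext i; simp [toFn]
  rw [← seqPMF_ofFn, piKernel, PMF.map_apply, tsum_eq_single (ofFn z'), if_pos hz'.symm]
  intro l hl
  by_cases h : z' = toFn k l
  · rw [if_pos h, PMF.apply_eq_zero_iff, mem_support_seqPMF]
    intro h2
    refine hl ?_
    rw [h, toFn_ofFn]
    rw [← h2.length_eq, List.length_ofFn]
  · rw [if_neg h]

/-- The unit vectors. -/
def unitVec (j : Fin 2) : ℕ × ℕ := if j = 0 then (1, 0) else (0, 1)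

/-- The law of the branching process that starts with one triangle of type `j + 1`. -/
def branchLaw (u : ℝ) (j : Fin 2) : Measure (ℕ → ℕ × ℕ) :=
  (exists_isMC (fun _ => offs u) (unitVec j)).choose

instance (j : Fin 2) : IsProbabilityMeasure (branchLaw u j) :=
  (exists_isMC (fun _ => offs u) (unitVec j)).choose_spec.1

lemma isMC_branchLaw (u : ℝ) (j : Fin 2) : IsMC (fun _ => offs u) (unitVec j) (branchLaw u j) :=
  (exists_isMC (fun _ => offs u) (unitVec j)).choose_spec.2

lemma isMC_pi {k : ℕ} (j : Fin k → Fin 2) :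
    IsMC (fun _ => piKernel u k) (fun i => unitVec (j i))
      ((Measure.pi fun i => branchLaw u (j i)).map fun ζ n i => ζ i n) := by
  rw [isMC_iff]
  intro N z
  have hm : Measurable fun (ζ : Fin k → ℕ → ℕ × ℕ) n i => ζ i n := by fun_prop
  have hmz : MeasurableSet {ω : ℕ → Fin k → ℕ × ℕ | ∀ i : Fin (N + 1), ω i = z i} := by
    rw [Set.ofPred_forall]
    exact MeasurableSet.iInter fun i =>
      (measurableSet_singleton (z i)).preimage (measurable_pi_apply (i : ℕ))
  rw [Measure.map_apply hm hmz]
  have : (fun (ζ : Fin k → ℕ → ℕ × ℕ) n i => ζ i n) ⁻¹' {ω | ∀ i : Fin (N + 1), ω i = z i} =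
      Set.pi Set.univ fun i => {ω | ∀ n : Fin (N + 1), ω n = z n i} := by
    ext ζ
    simp only [Set.mem_preimage, Set.mem_ofPred_eq, Set.mem_pi, Set.mem_univ, true_imp_iff,
      funext_iff]
    exact forall_comm
  rw [this, Measure.pi_pi, hist_apply]
  simp only [isMC_iff.1 (isMC_branchLaw u _), hist_apply, piKernel_apply]
  rw [Finset.prod_mul_distrib, Finset.prod_comm]
  congr 1
  by_cases h : z 0 = fun i => unitVec (j i)
  · rw [if_pos h]
    exact Finset.prod_eq_one fun i _ => if_pos (congrFun h i)
  · rw [if_neg h]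
    obtain ⟨i, hi⟩ := Function.ne_iff.1 h
    exact Finset.prod_eq_zero (mem_univ i) (if_neg hi)

/-- The numbers of triangles of both types in the segment of `y` in the `i`-th triangle of the
skeleton of `v`. -/
def segCounts (M : ℕ) (v : List Pt) (n : ℕ) (y : List Pt) :
    Fin (skeleton M v).length → ℕ × ℕ := fun i =>
  (typeCount (M + n) (segmentIn M y ((skeleton M v).get i)) 1,
    typeCount (M + n) (segmentIn M y ((skeleton M v).get i)) 2)

lemma DescState.segCounts_eq {ρs : List Steps} (hρ : Good M vO va ρs) {n : ℕ}
    {Hs : List (List Steps)} (h : DescState M (M + n) vO va ρs Hs) :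
    segCounts M (pathOf vO ρs) n (pathOf vO Hs.flatten) = toFn _ (Hs.map counts) := by
  funext i
  have hsk := hρ.skeleton_eq
  have hlen : (skeleton M (pathOf vO ρs)).length = ρs.length := by
    rw [pathOf, hsk, length_map]
  have hi : (i : ℕ) < ρs.length := hlen ▸ i.2
  have hi' : (i : ℕ) < Hs.length := h.desc.length_eq ▸ hi
  have hD : (skeleton M (pathOf vO ρs)).get i = cellOf M ρs[(i : ℕ)] :=
    (List.get_of_eq hsk i).trans (by simp)
  have hz : (ρs[(i : ℕ)], Hs[(i : ℕ)]) ∈ ρs.zip Hs :=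
    mem_iff_getElem.2 ⟨i, by simp [hi, hi'], by simp⟩
  have h1 := h.typeVec_segmentIn hρ hz
  have h2 := congrFun h1 0
  have h3 := congrFun h1 1
  simp only [typeVec, toVec, Matrix.cons_val_zero, Matrix.cons_val_one, Nat.cast_inj] at h2 h3
  rw [segCounts, hD]
  have h4 : toFn (skeleton M (pathOf vO ρs)).length (Hs.map counts) i = counts Hs[(i : ℕ)] := by
    simp [toFn, List.getD_eq_getElem?_getD, hi']
  rw [h4]
  exact Prod.ext h2 h3

lemma hist_segCounts (hu : 0 ≤ u) {ρs : List Steps} (hρ : Good M vO va ρs) (N : ℕ) :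
    hist (fun _ => piKernel u (skeleton M (pathOf vO ρs)).length)
      (segCounts M (pathOf vO ρs) 0 (pathOf vO ρs)) N =
    (hist (fun n => pathKernel u (M + n)) (pathOf vO ρs) N).map fun h (i : Fin (N + 1)) =>
      segCounts M (pathOf vO ρs) i (h i) := by
  set k := (skeleton M (pathOf vO ρs)).length with hk
  have hlen : k = ρs.length := by rw [hk, pathOf, hρ.skeleton_eq, length_map]
  let A : ℕ → Set (List (List Steps)) := fun n => {Hs | DescState M (M + n) vO va ρs Hs}
  have hA0 : (ρs.map fun ρ => [ρ]) ∈ A 0 := DescState.self hρ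
  have hA : ∀ n, ∀ Hs ∈ A n, ∀ Hs' ∈ (groupsPMF u (M + n) Hs).support, Hs' ∈ A (n + 1) :=
    fun n Hs h Hs' h' => DescState.step (Nat.le_add_right M n) h hρ vO_ne.1 hu h'
  obtain ⟨h1, h2⟩ := hist_lump (κ := fun n => groupsPMF u (M + n))
    (κ' := fun n => pathKernel u (M + n)) (fun _ Hs => pathOf vO Hs.flatten) A hA0 hA
    (fun n Hs h => by
      rw [DescState.good h |>.pathKernel_eq vO_ne.1 hu, ← groupsPMF_flatten, map_comp]; rfl) N
  obtain ⟨h3, -⟩ := hist_lump (κ := fun n => groupsPMF u (M + n))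
    (κ' := fun _ => piKernel u k) (fun _ Hs => toFn k (Hs.map counts)) A hA0 hA
    (fun n Hs h => by
      have hl : (Hs.map counts).length = k := by
        rw [length_map, hlen, (DescState.desc h).length_eq]
      have h4 := groupsPMF_map_counts hu (N := M + n) (Hs := Hs) fun H hH r hr =>
        (DescState.good h).valid r (mem_flatten.2 ⟨H, hH, hr⟩)
      have h5 : (ofFn fun i => offs u (toFn k (Hs.map counts) i)) =
          (Hs.map counts).map (offs u) := by
        conv_rhs => rw [← toFn_ofFn hl]
        rw [List.map_ofFn]; rfl
      rw [piKernel, h5, ← h4, map_comp]; rfl) N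
  have h0 : segCounts M (pathOf vO ρs) 0 (pathOf vO ρs) =
      toFn k ((ρs.map fun ρ => [ρ]).map counts) := by
    have := DescState.segCounts_eq (n := 0) hρ (DescState.self hρ)
    rwa [flatten_map_singleton] at this
  rw [flatten_map_singleton] at h1
  rw [h0, h3, h1, map_comp]
  refine pmf_map_congr fun h hh => ?_
  funext i
  exact (DescState.segCounts_eq hρ (h2 h hh i)).symm

/-- Given the path of level `M`, the numbers of descendants of its triangles are independent
branching processes. -/
lemma map_segCounts (hu : 0 ≤ u) {P : Measure (ℕ → List Pt)} [IsFiniteMeasure P]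
    (hP : IsCoupledLaw u P) {v : List Pt} (hv : P {ω | ω M = v} ≠ 0) :
    ∃ j : Fin (skeleton M v).length → Fin 2,
      (∀ i, typeIn M v ((skeleton M v).get i) = (j i : ℕ) + 1) ∧
      (P[|{ω | ω M = v}]).map (fun ω i n => segCounts M v n (ω (M + n)) i) =
        Measure.pi fun i => branchLaw u (j i) := by
  rw [isCoupledLaw_iff hu] at hP
  obtain ⟨ρs, hρ, rfl⟩ := exists_good hu hP hv
  have hsk := hρ.skeleton_eq
  have hty : ∀ i, ∃ j : Fin 2, typeIn M (pathOf vO ρs) ((skeleton M (pathOf vO ρs)).get i) =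
      (j : ℕ) + 1 ∧ segCounts M (pathOf vO ρs) 0 (pathOf vO ρs) i = unitVec j := by
    intro i
    have hi : (i : ℕ) < ρs.length := by
      have := i.2
      simpa [pathOf, hsk] using this
    have hD : (skeleton M (pathOf vO ρs)).get i = cellOf M ρs[(i : ℕ)] :=
      (List.get_of_eq hsk i).trans (by simp)
    have h0 := congrFun (DescState.segCounts_eq (n := 0) hρ (DescState.self hρ)) i
    rw [flatten_map_singleton] at h0
    have h4 : toFn (skeleton M (pathOf vO ρs)).length ((ρs.map fun ρ => [ρ]).map counts) i =
        counts [ρs[(i : ℕ)]] := by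
      simp [toFn, List.getD_eq_getElem?_getD, hi]
    have h5 : typeIn M (pathOf vO ρs) (cellOf M ρs[(i : ℕ)]) = ρs[(i : ℕ)].length :=
      hρ.typeIn_eq (getElem_mem hi)
    rw [hD, h0, h4, h5]
    rcases runOK_cases (hρ.valid _ (getElem_mem hi)).ok with ⟨x, y, h, -⟩ | ⟨x, y, z, h, -⟩
    · exact ⟨0, by rw [h]; rfl, by rw [h]; rfl⟩
    · exact ⟨1, by rw [h]; rfl, by rw [h]; rfl⟩
  choose j hj1 hj2 using hty
  refine ⟨j, hj1, ?_⟩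
  set μ := P[|{ω | ω M = (pathOf vO ρs)}]
  have hseg : ∀ n, Measurable (segCounts M (pathOf vO ρs) n) := fun n => .of_discrete
  have hT : Measurable fun (ω : ℕ → List Pt) n => segCounts M (pathOf vO ρs) n (ω n) :=
    measurable_pi_iff.2 fun n => (hseg n).comp (measurable_pi_apply n)
  have h1 := hP.cond_shift M hv
  have h2 : IsMC (fun _ => piKernel u (skeleton M (pathOf vO ρs)).length) (fun i => unitVec (j i))
      ((μ.map fun ω n => ω (M + n)).map fun ω n => segCounts M (pathOf vO ρs) n (ω n)) := by
    intro N
    rw [Measure.map_map (measurable_restr N) hT,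
      show (fun (ω : ℕ → Fin (skeleton M (pathOf vO ρs)).length → ℕ × ℕ) (i : Fin (N + 1)) => ω i) ∘
        (fun (ω : ℕ → List Pt) n => segCounts M (pathOf vO ρs) n (ω n)) =
        (fun h (i : Fin (N + 1)) => segCounts M (pathOf vO ρs) i (h i)) ∘ fun (ω : ℕ → List Pt) (i : Fin (N + 1)) => ω i from rfl,
      ← Measure.map_map .of_discrete (measurable_restr N), h1 N,
      PMF.toMeasure_map (hf := .of_discrete), ← hist_segCounts hu hρ N]
    congr 2
    exact funext fun i => hj2 i
  have h3 : IsFiniteMeasure μ := inferInstance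
  have h4 := h2.unique (isMC_pi j)
  have hsw : Measurable fun (ω : ℕ → Fin (skeleton M (pathOf vO ρs)).length → ℕ × ℕ) i n => ω n i := by fun_prop
  have h5 := congrArg (Measure.map fun ω i n => ω n i) h4
  rw [Measure.map_map hsw hT, Measure.map_map (hsw.comp hT) (by fun_prop),
    Measure.map_map hsw (by fun_prop)] at h5
  rw [show (fun (ω : ℕ → Fin (skeleton M (pathOf vO ρs)).length → ℕ × ℕ) i n => ω n i) ∘
    (fun ζ n i => ζ i n) = id from rfl, Measure.map_id] at h5
  exact h5

end Joint

/-! ### The mean matrix -/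

section Mean

variable {u : ℝ}

/-- The law of the numbers of children of a triangle of type `j + 1`. -/
def off (u : ℝ) (j : Fin 2) : PMF (ℕ × ℕ) := offspring u (j + 1)

lemma mem_support_off (hu : 0 ≤ u) {j : Fin 2} {z : ℕ × ℕ} (h : z ∈ (off u j).support) :
    (z.1 + z.2 = 2 ∨ z.1 + z.2 = 3) ∧ z.1 + 2 * z.2 ≤ 5 := by
  refine mem_support_offspring hu (n := j + 1) ?_ h
  fin_cases j <;> simp

lemma box_of_mem_support (hu : 0 ≤ u) {j : Fin 2} {z : ℕ × ℕ} (h : z ∈ (off u j).support) :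
    z ∈ box := by
  obtain ⟨h1, -⟩ := mem_support_off hu h
  simp only [box, Finset.mem_product, Finset.mem_range]
  omega

/-- The expectation of a function of the numbers of children. -/
def expec (u : ℝ) (j : Fin 2) (f : ℕ × ℕ → ℝ) : ℝ := ∑ z ∈ box, (off u j z).toReal * f z

lemma expec_integral (hu : 0 ≤ u) (j : Fin 2) (f : ℕ × ℕ → ℝ) :
    ∫ z, f z ∂(off u j).toMeasure = expec u j f :=
  (integral_of_support (fun _ hz => box_of_mem_support hu hz) f).2

lemma expec_const (hu : 0 ≤ u) (j : Fin 2) (c : ℝ) : expec u j (fun _ => c) = c := by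
  rw [← expec_integral hu]; simp

lemma expec_le {j : Fin 2} {f g : ℕ × ℕ → ℝ}
    (h : ∀ z ∈ (off u j).support, f z ≤ g z) : expec u j f ≤ expec u j g := by
  refine Finset.sum_le_sum fun z _ => ?_
  by_cases hz : z ∈ (off u j).support
  · exact mul_le_mul_of_nonneg_left (h z hz) toReal_nonneg
  · rw [mem_support_iff, not_not] at hz
    simp [hz]

lemma off_pos {j : Fin 2} {z : ℕ × ℕ} (h : z ∈ (off u j).support) : 0 < (off u j z).toReal :=
  ENNReal.toReal_pos ((mem_support_iff _ _).1 h) (PMF.apply_ne_top _ _)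

lemma expec_lt (hu : 0 ≤ u) {j : Fin 2} {f g : ℕ × ℕ → ℝ}
    (h : ∀ z ∈ (off u j).support, f z ≤ g z) {z : ℕ × ℕ} (hz : z ∈ (off u j).support)
    (hlt : f z < g z) : expec u j f < expec u j g := by
  refine Finset.sum_lt_sum (fun z _ => ?_) ⟨z, box_of_mem_support hu hz,
    mul_lt_mul_of_pos_left hlt (off_pos hz)⟩
  by_cases hz : z ∈ (off u j).support
  · exact mul_le_mul_of_nonneg_left (h z hz) toReal_nonneg
  · rw [mem_support_iff, not_not] at hz
    simp [hz]

/-- The mean numbers of children. -/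
def mean (u : ℝ) : Matrix (Fin 2) (Fin 2) ℝ := fun j k => expec u j fun z => toVec z k

lemma hasDerivAt_gen (p : PMF (ℕ × ℕ)) :
    HasDerivAt (fun x : ℝ => gen p x 1) (∑ z ∈ box, (p z).toReal * z.1) 1 ∧
    HasDerivAt (fun y : ℝ => gen p 1 y) (∑ z ∈ box, (p z).toReal * z.2) 1 := by
  constructor
  · refine HasDerivAt.fun_sum fun z _ => ?_
    simpa using ((hasDerivAt_pow z.1 (1 : ℝ)).const_mul (p z).toReal).mul_const (1 ^ z.2)
  · refine HasDerivAt.fun_sum fun z _ => ?_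
    simpa using (hasDerivAt_pow z.2 (1 : ℝ)).const_mul ((p z).toReal * 1 ^ z.1)

lemma meanMatrix_eq (hu : 0 ≤ u) : meanMatrix u = mean u := by
  rw [meanMatrix]
  simp only [genPhi_eq hu, genTheta_eq hu, (hasDerivAt_gen _).1.deriv, (hasDerivAt_gen _).2.deriv]
  ext i j
  fin_cases i <;> fin_cases j <;> rfl

lemma mean_nonneg (u : ℝ) (j k : Fin 2) : 0 ≤ mean u j k := by
  rw [mean, expec]
  refine sum_nonneg fun z _ => mul_nonneg toReal_nonneg ?_
  fin_cases k <;> simp [toVec]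

lemma expec_add (j : Fin 2) (f g : ℕ × ℕ → ℝ) :
    expec u j (fun z => f z + g z) = expec u j f + expec u j g := by
  simp only [expec, mul_add, Finset.sum_add_distrib]

lemma mean_row (hu : 0 ≤ u) (j : Fin 2) :
    2 < mean u j 0 + mean u j 1 ∧ mean u j 0 + mean u j 1 < 3 := by
  have e : mean u j 0 + mean u j 1 = expec u j fun z => ((z.1 + z.2 : ℕ) : ℝ) := by
    rw [mean, mean, ← expec_add]
    simp [toVec]
  obtain ⟨h1, h2, -, h3, h4⟩ := offspring_values hu
  have hs : ∀ z ∈ (off u j).support, 2 ≤ z.1 + z.2 ∧ z.1 + z.2 ≤ 3 := fun z hz => by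
    have := (mem_support_off hu hz).1
    omega
  have key : ∃ z ∈ (off u j).support, ∃ z' ∈ (off u j).support, z.1 + z.2 = 3 ∧ z'.1 + z'.2 = 2 := by
    fin_cases j
    · exact ⟨_, h2, _, h1, rfl, rfl⟩
    · exact ⟨_, h3, _, h4, rfl, rfl⟩
  obtain ⟨z, hz, z', hz', h5, h6⟩ := key
  rw [e]
  constructor
  · rw [← expec_const hu j 2]
    refine expec_lt hu (fun z hz => by exact_mod_cast (hs z hz).1) hz ?_
    rw [h5]; norm_num
  · rw [← expec_const hu j 3]
    refine expec_lt hu (fun z hz => by exact_mod_cast (hs z hz).2) hz' ?_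
    rw [h6]; norm_num

lemma mean_pos (hu : 0 ≤ u) {j k : Fin 2} {z : ℕ × ℕ} (hz : z ∈ (off u j).support)
    (h : 0 < toVec z k) : 0 < mean u j k := by
  rw [← expec_const hu j 0]
  refine expec_lt hu (fun z _ => ?_) hz h
  fin_cases k <;> simp [toVec]

lemma mean_facts (hu : 0 ≤ u) : 0 < mean u 0 0 ∧ 0 < mean u 1 0 ∧ (0 < u → 0 < mean u 0 1) ∧
    mean u 1 1 ≤ 2 := by
  obtain ⟨h1, h2, h0, h3, h4⟩ := offspring_values hu
  refine ⟨mean_pos hu (j := 0) h1 (by norm_num [toVec]), mean_pos hu (j := 1) h3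
    (by norm_num [toVec]), fun hu' => mean_pos hu (j := 0) (h0 hu') (by norm_num [toVec]), ?_⟩
  rw [← expec_const hu 1 2]
  refine expec_le fun z hz => ?_
  have := mem_support_off hu hz
  have h5 : z.2 ≤ 2 := by omega
  have h6 : (z.2 : ℝ) ≤ 2 := by exact_mod_cast h5
  simpa [toVec] using h6

/-- The eigenvector equations. -/
lemma IsPerronTriple.eqs {A : Matrix (Fin 2) (Fin 2) ℝ} {lam : ℝ} {r l : Fin 2 → ℝ}
    (h : IsPerronTriple A lam r l) :
    (∀ j, A j 0 * r 0 + A j 1 * r 1 = lam * r j) ∧ (∀ k, l 0 * A 0 k + l 1 * A 1 k = lam * l k) ∧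
      r 0 * l 0 + r 1 * l 1 = 1 ∧ r 0 + r 1 = 1 := by
  refine ⟨fun j => ?_, fun k => ?_, by simpa using h.dot_eq, by simpa using h.sum_eq⟩
  · have := congrFun h.right_eq j
    simpa [Matrix.mulVec, dotProduct] using this
  · have := congrFun h.left_eq k
    simpa [Matrix.vecMul, dotProduct] using this

lemma exists_perronTriple_of_matrix {a b c d : ℝ} (hb : 0 ≤ b) (hc : 0 < c) (hda : b = 0 → d < a) :
    ∃ (lam : ℝ) (r l : Fin 2 → ℝ), IsPerronTriple !![a, b; c, d] lam r l ∧
      (0 < b → ∀ j, 0 < l j) := by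
  have hD : 0 ≤ (a - d) ^ 2 + 4 * b * c := by positivity
  set s := √((a - d) ^ 2 + 4 * b * c) with hs
  have hs2 : s ^ 2 = (a - d) ^ 2 + 4 * b * c := Real.sq_sqrt hD
  have hs0 : 0 ≤ s := Real.sqrt_nonneg _
  have hsa : |a - d| ≤ s := Real.abs_le_sqrt (by nlinarith [mul_nonneg hb hc.le])
  obtain ⟨hs1, hs3⟩ := abs_le.1 hsa
  set lam := (a + d + s) / 2 with hlam
  have hq : lam ^ 2 - (a + d) * lam + a * d - b * c = 0 := by rw [hlam]; nlinarith
  have e0 : a * (lam - d) + b * c = lam * (lam - d) := by linear_combination -hq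
  have hla : a ≤ lam := by rw [hlam]; linarith
  have hld : d < lam := by
    rcases hb.eq_or_lt with h0 | h0
    · linarith [hda h0.symm]
    · have : (d - a) < s := by
        refine lt_of_pow_lt_pow_left₀ 2 hs0 ?_
        nlinarith [mul_pos h0 hc]
      rw [hlam]; linarith
  have hl2 : 0 < b → a < lam := by
    intro h0
    have : (a - d) < s := by
      refine lt_of_pow_lt_pow_left₀ 2 hs0 ?_
      nlinarith [mul_pos h0 hc]
    rw [hlam]; linarith
  have hR : 0 < lam - d + c := by linarith
  set R := lam - d + c with hRdef
  have hdet : 0 < (lam - d) * c + c * (lam - a) := by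
    have : 0 < (lam - d) * c := mul_pos (by linarith) hc
    nlinarith
  set K := ((lam - d) * c + c * (lam - a)) / R with hK
  have hKpos : 0 < K := div_pos hdet hR
  refine ⟨lam, ![(lam - d) / R, c / R], ![c / K, (lam - a) / K], ⟨⟨?_, ?_⟩, ?_, ?_, ?_, ?_, ?_, ?_⟩,
    ?_⟩
  · rw [Set.mem_ofPred_eq, Module.End.hasEigenvalue_iff]
    intro hbot
    have : ![lam - d, c] ∈ Module.End.eigenspace (Matrix.toLin' !![a, b; c, d]) lam := by
      rw [Module.End.mem_eigenspace_iff, Matrix.toLin'_apply]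
      ext i
      fin_cases i <;> simp [Matrix.mulVec, dotProduct]
      · exact e0
      · ring
    rw [hbot, Submodule.mem_bot] at this
    have h1 := congrFun this 1
    simp at h1
    linarith
  · intro μ hμ
    obtain ⟨v, hv⟩ := Module.End.HasEigenvalue.exists_hasEigenvector hμ
    have h1 := hv.apply_eq_smul
    rw [Matrix.toLin'_apply] at h1
    have h2 := congrFun h1 0
    have h3 := congrFun h1 1
    simp [Matrix.mulVec, dotProduct] at h2 h3
    have h4 : (μ - lam) * (μ - (a + d - lam)) = 0 := by
      have e : (μ - lam) * (μ - (a + d - lam)) = (a - μ) * (d - μ) - b * c := by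
        linear_combination -hq
      rw [e]
      by_contra hne
      refine hv.2 (funext fun i => ?_)
      have e0 : ((a - μ) * (d - μ) - b * c) * v 0 = 0 := by
        linear_combination (d - μ) * h2 - b * h3
      have e1 : ((a - μ) * (d - μ) - b * c) * v 1 = 0 := by
        linear_combination (a - μ) * h3 - c * h2
      fin_cases i
      · exact (mul_eq_zero.1 e0).resolve_left hne
      · exact (mul_eq_zero.1 e1).resolve_left hne
    rcases mul_eq_zero.1 h4 with h5 | h5
    · linarith
    · linarith
  · ext i
    fin_cases i <;> simp [Matrix.mulVec, dotProduct]
    · linear_combination (1 / R) * e0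
    · ring
  · ext i
    fin_cases i <;> simp [Matrix.vecMul, dotProduct]
    · ring
    · linear_combination (-1 / K) * hq
  · intro j
    fin_cases j
    · exact div_pos (by linarith) hR
    · exact div_pos hc hR
  · intro j
    fin_cases j
    · exact (div_pos hc hKpos).le
    · exact div_nonneg (by linarith) hKpos.le
  · grind [Fin.sum_univ_two, Matrix.cons_val_one, Matrix.cons_val_zero]
  · grind [Fin.sum_univ_two, Matrix.cons_val_one, Matrix.cons_val_zero, add_div]
  · simp_all

lemma exists_perronTriple (hu : 0 ≤ u) : ∃ (lam : ℝ) (r l : Fin 2 → ℝ),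
    IsPerronTriple (mean u) lam r l ∧ (0 < u → ∀ j, 0 < l j) := by
  obtain ⟨ha, hc, hb, hd⟩ := mean_facts hu
  obtain ⟨lam, r, l, h1, h2⟩ := exists_perronTriple_of_matrix (a := mean u 0 0)
    (d := mean u 1 1) (mean_nonneg u 0 1) hc fun h => by linarith [(mean_row hu 0).1]
  have hA : mean u = !![mean u 0 0, mean u 0 1; mean u 1 0, mean u 1 1] := by
    ext i j; fin_cases i <;> fin_cases j <;> rfl
  exact ⟨lam, r, l, hA ▸ h1, fun h => h2 (hb h)⟩

lemma perron_bounds (hu : 0 ≤ u) {lam : ℝ} {r l : Fin 2 → ℝ}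
    (h : IsPerronTriple (mean u) lam r l) : 2 < lam ∧ lam < 3 ∧ 0 < mean u 0 0 + mean u 1 1 ∧
      mean u 0 0 + mean u 1 1 < 2 * lam := by
  obtain ⟨h1, h2, h3, h4⟩ := h.eqs
  obtain ⟨a1, a2⟩ := mean_row hu 0
  obtain ⟨b1, b2⟩ := mean_row hu 1
  obtain ⟨ha, hc, -, -⟩ := mean_facts hu
  have hb := mean_nonneg u 0 1
  have hd := mean_nonneg u 1 1
  have l0 := h.left_nonneg 0
  have l1 := h.left_nonneg 1
  have r0 := h.right_pos 0
  have r1 := h.right_pos 1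
  have hl : 0 < l 0 + l 1 := by
    by_contra hn
    have e0 : l 0 = 0 := by linarith
    have e1 : l 1 = 0 := by linarith
    rw [e0, e1] at h3
    norm_num at h3
  have e : lam * (l 0 + l 1) = l 0 * (mean u 0 0 + mean u 0 1) + l 1 * (mean u 1 0 + mean u 1 1) := by
    linear_combination -(h2 0) - h2 1
  have hpos : 0 < l 0 ∨ 0 < l 1 := by
    by_contra hn
    push Not at hn
    linarith
  refine ⟨?_, ?_, by linarith, ?_⟩
  · refine lt_of_mul_lt_mul_right (a := l 0 + l 1) ?_ hl.le
    rcases hpos with hp | hp <;> nlinarith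
  · refine lt_of_mul_lt_mul_right (a := l 0 + l 1) ?_ hl.le
    rcases hpos with hp | hp <;> nlinarith
  · have e1 : mean u 0 0 ≤ lam := by
      refine le_of_mul_le_mul_right (a := r 0) ?_ r0
      nlinarith [h1 0, mul_nonneg hb r1.le]
    have e2 : mean u 1 1 < lam := by
      refine lt_of_mul_lt_mul_right (a := r 1) ?_ r1.le
      nlinarith [h1 1, mul_pos hc r0]
    linarith

end Mean

/-! ### Exponential moments of the branching process -/

section Moments

/-- The pairing of a pair of numbers with a vector. -/
def dp (z : ℕ × ℕ) (s : Fin 2 → ℝ) : ℝ := z.1 * s 0 + z.2 * s 1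

variable {u : ℝ}

lemma exists_expec_exp_le (hu : 0 ≤ u) (s : Fin 2 → ℝ) : ∃ K : ℝ, 0 ≤ K ∧ ∀ (j : Fin 2) (ε : ℝ),
    expec u j (fun z => exp (ε * dp z s)) ≤
      exp (ε * (mean u).mulVec s j + K * ε ^ 2) := by
  set C := 3 * |s 0| + 3 * |s 1| with hC
  refine ⟨C ^ 2 / 2, by positivity, fun j ε => ?_⟩
  have hb : ∀ᵐ z ∂(off u j).toMeasure, dp z s ∈ Icc (-C) C := by
    rw [ae_iff, PMF.toMeasure_apply_eq_zero_iff _ .of_discrete, Set.disjoint_left]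
    intro z hz hz'
    refine hz' (abs_le.1 ?_)
    have hz3 : z.1 ≤ 3 ∧ z.2 ≤ 3 := by
      have := (mem_support_off hu hz).1
      omega
    have h1 : (z.1 : ℝ) ≤ 3 := by exact_mod_cast hz3.1
    have h2 : (z.2 : ℝ) ≤ 3 := by exact_mod_cast hz3.2
    refine (abs_add_le _ _).trans (add_le_add ?_ ?_)
    · rw [abs_mul, Nat.abs_cast]; gcongr
    · rw [abs_mul, Nat.abs_cast]; gcongr
  have hm := (hasSubgaussianMGF_of_mem_Icc (X := fun z => dp z s)
    Measurable.of_discrete.aemeasurable hb).mgf_le ε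
  have e1 : ∫ z, dp z s ∂(off u j).toMeasure = (mean u).mulVec s j := by
    rw [expec_integral hu]
    simp only [Matrix.mulVec, dotProduct, Fin.sum_univ_two, mean, expec, Finset.sum_mul,
      ← Finset.sum_add_distrib]
    refine sum_congr rfl fun z _ => ?_
    simp [dp, toVec]; ring
  rw [mgf, e1, expec_integral hu] at hm
  have e2 : expec u j (fun z => exp (ε * (dp z s - (mean u).mulVec s j))) =
      exp (-(ε * (mean u).mulVec s j)) * expec u j (fun z => exp (ε * dp z s)) := by
    rw [expec, expec, Finset.mul_sum]
    refine sum_congr rfl fun z _ => ?_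
    rw [mul_left_comm, ← exp_add]; ring_nf
  have e3 : ((((‖C - -C‖₊ / 2) ^ 2 : NNReal) : ℝ)) = C ^ 2 := by
    push_cast
    rw [Real.norm_eq_abs, div_pow, sq_abs]; ring
  rw [e2, e3] at hm
  have := mul_le_mul_of_nonneg_left hm (exp_pos (ε * (mean u).mulVec s j)).le
  rw [← mul_assoc, ← exp_add, ← exp_add, add_neg_cancel, exp_zero, one_mul] at this
  refine this.trans (le_of_eq ?_)
  congr 1
  ring

/-- The logarithm of the generating function in logarithmic coordinates. -/
def logGen (u : ℝ) (θ : Fin 2 → ℝ) : Fin 2 → ℝ := fun j =>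
  Real.log (expec u j fun z => exp (dp z θ))

lemma expec_pos (hu : 0 ≤ u) (j : Fin 2) {f : ℕ × ℕ → ℝ} (hf : ∀ z, 0 < f z) :
    0 < expec u j f := by
  obtain ⟨z, hz⟩ := (off u j).support_nonempty
  rw [← expec_const hu j 0]
  exact expec_lt hu (fun z _ => (hf z).le) hz (hf z)

lemma exp_logGen (hu : 0 ≤ u) (θ : Fin 2 → ℝ) (j : Fin 2) :
    exp (logGen u θ j) = expec u j fun z => exp (dp z θ) :=
  Real.exp_log (expec_pos hu j fun _ => exp_pos _)

lemma dp_mono (z : ℕ × ℕ) {s t : Fin 2 → ℝ} (h : s ≤ t) : dp z s ≤ dp z t :=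
  add_le_add (mul_le_mul_of_nonneg_left (h 0) (Nat.cast_nonneg _))
    (mul_le_mul_of_nonneg_left (h 1) (Nat.cast_nonneg _))

lemma logGen_mono (hu : 0 ≤ u) : Monotone (logGen u) := fun _ _ h j =>
  Real.log_le_log (expec_pos hu j fun _ => exp_pos _)
    (expec_le fun z _ => exp_le_exp.2 (dp_mono z h))

lemma dp_smul (z : ℕ × ℕ) (ε : ℝ) (s : Fin 2 → ℝ) : dp z (ε • s) = ε * dp z s := by
  simp [dp]; ring

lemma dp_add (z : ℕ × ℕ) (s t : Fin 2 → ℝ) : dp z (s + t) = dp z s + dp z t := by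
  simp [dp]; ring

lemma exists_logGen_le (hu : 0 ≤ u) (s : Fin 2 → ℝ) : ∃ K : ℝ, 0 ≤ K ∧ ∀ (j : Fin 2) (ε : ℝ),
    logGen u (ε • s) j ≤ ε * (mean u).mulVec s j + K * ε ^ 2 := by
  obtain ⟨K, hK, h⟩ := exists_expec_exp_le hu s
  refine ⟨K, hK, fun j ε => ?_⟩
  rw [← exp_le_exp, exp_logGen hu]
  simpa only [dp_smul] using h j ε

lemma tsum_map {α β : Type*} (p : PMF α) (g : α → β) (f : β → ℝ≥0∞) :
    ∑' b, p.map g b * f b = ∑' a, p a * f (g a) := by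
  classical
  simp only [PMF.map_apply, ← ENNReal.tsum_mul_right]
  rw [tsum_comm]
  refine tsum_congr fun a => ?_
  rw [tsum_eq_single (g a)]
  · simp
  · intro b hb; simp [hb]

lemma tsum_bind {α β : Type*} (p : PMF α) (g : α → PMF β) (f : β → ℝ≥0∞) :
    ∑' b, p.bind g b * f b = ∑' a, p a * ∑' b, g a b * f b := by
  simp only [bind_apply, ← ENNReal.tsum_mul_right, ← ENNReal.tsum_mul_left]
  rw [tsum_comm]
  simp only [mul_assoc]

lemma tsum_sumPMF {A : Type*} [AddCommMonoid A] {f : A → ℝ≥0∞} (h0 : f 0 = 1)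
    (hf : ∀ a b, f (a + b) = f a * f b) (ps : List (PMF A)) :
    ∑' a, sumPMF ps a * f a = (ps.map fun p => ∑' a, p a * f a).prod := by
  induction ps with
  | nil =>
    rw [sumPMF, tsum_map, seqPMF, tsum_eq_single []]
    · simp [h0]
    · intro b hb; simp [hb]
  | cons p ps ih =>
    rw [sumPMF_cons, tsum_bind, map_cons, List.prod_cons, ← ih, ← ENNReal.tsum_mul_right]
    refine tsum_congr fun a => ?_
    rw [tsum_map, mul_assoc, ← ENNReal.tsum_mul_left (a := f a)]
    congr 1
    refine tsum_congr fun b => ?_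
    rw [hf, mul_left_comm]

lemma tsum_off (hu : 0 ≤ u) (j : Fin 2) {f : ℕ × ℕ → ℝ} (hf : ∀ z, 0 ≤ f z) :
    ∑' z, off u j z * ofReal (f z) = ofReal (expec u j f) := by
  rw [tsum_eq_sum (s := box), expec, ENNReal.ofReal_sum_of_nonneg]
  · refine sum_congr rfl fun z _ => ?_
    rw [ofReal_mul toReal_nonneg, ENNReal.ofReal_toReal (PMF.apply_ne_top _ _)]
  · exact fun z _ => mul_nonneg toReal_nonneg (hf z)
  · intro z hz
    rw [(PMF.apply_eq_zero_iff _ _).2 fun h => hz (box_of_mem_support hu h), zero_mul]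

lemma tsum_offs (hu : 0 ≤ u) (z : ℕ × ℕ) (θ : Fin 2 → ℝ) :
    ∑' z', offs u z z' * ofReal (exp (dp z' θ)) =
      ofReal (exp (dp z (logGen u θ))) := by
  rw [offs_eq, tsum_sumPMF (f := fun z => ofReal (exp (dp z θ)))]
  · have h1 := tsum_off hu 0 fun z => (exp_pos (dp z θ)).le
    have h2 := tsum_off hu 1 fun z => (exp_pos (dp z θ)).le
    rw [← exp_logGen hu] at h1 h2
    simp only [List.map_append, List.map_replicate, List.prod_append, List.prod_replicate]
    rw [show offspring u 1 = off u 0 from rfl, show offspring u 2 = off u 1 from rfl, h1, h2,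
      ← ENNReal.ofReal_pow (exp_pos _).le, ← ENNReal.ofReal_pow (exp_pos _).le,
      ← ofReal_mul (by positivity), ← exp_nat_mul, ← exp_nat_mul,
      ← exp_add, dp]
  · simp [dp]
  · intro a b
    rw [← ofReal_mul (exp_pos _).le, ← exp_add]
    congr 2
    simp [dp]; ring

lemma IsMC.lintegral_step {X : Type*} [MeasurableSpace X] [Countable X]
    [DiscreteMeasurableSpace X] {κ : ℕ → X → PMF X} {x : X} {P : Measure (ℕ → X)}
    (h : IsMC κ x P) (N : ℕ) (f : X → X → ℝ≥0∞) :
    ∫⁻ ω, f (ω N) (ω (N + 1)) ∂P = ∫⁻ ω, ∑' b, κ N (ω N) b * f (ω N) b ∂P := by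
  have hm : Measurable fun ω : ℕ → X => (ω N, ω (N + 1)) := by fun_prop
  have h1 : ∀ a, P.map (fun ω => ω N) {a} = P {ω | ω N = a} := fun a => by
    rw [Measure.map_apply (measurable_pi_apply N) (measurableSet_singleton a)]; rfl
  have h2 : ∀ p : X × X, P.map (fun ω => (ω N, ω (N + 1))) {p} =
      P {ω | ω N = p.1} * κ N p.1 p.2 := fun p => by
    have := h.step N {z | z (Fin.last N) = p.1} (fun z hz => hz) p.2
    rw [Measure.map_apply hm (measurableSet_singleton p)]
    refine Eq.trans ?_ this
    congr 1
    ext ω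
    simp [Prod.ext_iff]
  have e1 : ∫⁻ ω, f (ω N) (ω (N + 1)) ∂P =
      ∫⁻ p, f p.1 p.2 ∂(P.map fun ω => (ω N, ω (N + 1))) :=
    (lintegral_map (Measurable.of_discrete (f := fun p : X × X => f p.1 p.2)) hm).symm
  have e2 : ∫⁻ ω, ∑' b, κ N (ω N) b * f (ω N) b ∂P =
      ∫⁻ a, ∑' b, κ N a b * f a b ∂(P.map fun ω => ω N) :=
    (lintegral_map (Measurable.of_discrete (f := fun a : X => ∑' b, κ N a b * f a b))
      (measurable_pi_apply N)).symm
  rw [e1, e2, lintegral_countable', lintegral_countable', ENNReal.tsum_prod']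
  refine tsum_congr fun a => ?_
  rw [h1, ← ENNReal.tsum_mul_right]
  refine tsum_congr fun b => ?_
  rw [h2]
  ring

lemma lintegral_exp (hu : 0 ≤ u) (j : Fin 2) (N : ℕ) (θ : Fin 2 → ℝ) :
    ∫⁻ ω, ofReal (exp (dp (ω N) θ)) ∂(branchLaw u j) =
      ofReal (exp ((logGen u)^[N] θ j)) := by
  induction N generalizing θ with
  | zero =>
    have h0 : ∀ᵐ ω ∂(branchLaw u j), ω 0 = unitVec j := by
      have h1 := isMC_iff.1 (isMC_branchLaw u j) 0 fun _ => unitVec j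
      rw [hist_apply] at h1
      simp only [if_true, Finset.univ_eq_empty, Finset.prod_empty, mul_one] at h1
      refine (prob_compl_eq_zero_iff ((measurableSet_singleton (unitVec j)).preimage
        (measurable_pi_apply 0))).2 ?_
      rw [← h1]
      congr 1
      ext ω
      simp
    rw [lintegral_congr_ae (g := fun _ => ofReal (exp (θ j)))]
    · simp
    · filter_upwards [h0] with ω hω
      rw [hω]
      fin_cases j <;> simp [dp, unitVec]
  | succ N ih =>
    rw [(isMC_branchLaw u j).lintegral_step N fun _ b => ofReal (exp (dp b θ))]
    simp only [tsum_offs hu]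
    rw [ih, Function.iterate_succ_apply]

/-- The one-step deviations from the mean. -/
lemma lintegral_exp_step (hu : 0 ≤ u) (s : Fin 2 → ℝ) : ∃ K : ℝ, 0 ≤ K ∧
    ∀ (j : Fin 2) (N : ℕ) (ε : ℝ),
    ∫⁻ ω, ofReal (exp (ε * (dp (ω (N + 1)) s - dp (ω N) ((mean u).mulVec s))))
      ∂(branchLaw u j) ≤
    ∫⁻ ω, ofReal (exp (dp (ω N) fun _ => K * ε ^ 2)) ∂(branchLaw u j) := by
  obtain ⟨K, hK, h⟩ := exists_logGen_le hu s
  refine ⟨K, hK, fun j N ε => ?_⟩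
  rw [(isMC_branchLaw u j).lintegral_step N fun a b =>
    ofReal (exp (ε * (dp b s - dp a ((mean u).mulVec s))))]
  refine lintegral_mono fun ω => ?_
  set z := ω N
  have e : ∀ b : ℕ × ℕ, ofReal (exp (ε * (dp b s - dp z ((mean u).mulVec s)))) =
      ofReal (exp (dp b (ε • s))) *
        ofReal (exp (-(ε * dp z ((mean u).mulVec s)))) := fun b => by
    rw [← ofReal_mul (exp_pos _).le, ← exp_add, dp_smul]
    ring_nf
  simp only [e, ← mul_assoc]
  rw [ENNReal.tsum_mul_right, tsum_offs hu, ← ofReal_mul (exp_pos _).le,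
    ← exp_add]
  refine ofReal_le_ofReal (exp_le_exp.2 ?_)
  have h1 : dp z (logGen u (ε • s)) ≤ dp z (ε • (mean u).mulVec s + fun _ => K * ε ^ 2) :=
    dp_mono z fun j => h j ε
  rw [dp_add, dp_smul] at h1
  linarith

end Moments

/-! ### Convergence of the normalized branching process -/

section Limit

variable {u : ℝ} {lam : ℝ} {r l : Fin 2 → ℝ}

lemma exists_le_mul (hr : ∀ j, 0 < r j) : ∃ C : ℝ, 0 < C ∧ ∀ j : Fin 2, 1 ≤ C * r j := by
  have h0 := hr 0
  have h1 := hr 1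
  refine ⟨1 / r 0 + 1 / r 1, by positivity, fun j => ?_⟩
  have e0 : 0 ≤ 1 / r 1 * r 0 := by positivity
  have e1 : 0 ≤ 1 / r 0 * r 1 := by positivity
  fin_cases j
  · grind
  · grind

lemma exists_iterate_le (hu : 0 ≤ u) (h : IsPerronTriple (mean u) lam r l) :
    ∃ c : ℝ, 0 < c ∧ ∀ (n : ℕ) (β : ℝ), |β| * lam ^ n * c ≤ 1 →
      (logGen u)^[n] (β • r) ≤ (β * lam ^ n + c * (β * lam ^ n) ^ 2) • r := by
  obtain ⟨hl2, -⟩ := perron_bounds hu h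
  obtain ⟨K, hK, hlog⟩ := exists_logGen_le hu r
  obtain ⟨C, hC, hCr⟩ := exists_le_mul h.right_pos
  have hKC : 0 ≤ K * C := by positivity
  refine ⟨2 * (K * C) + 1, by positivity, fun n β hβ => ?_⟩
  set c := 2 * (K * C) + 1 with hc
  have hc0 : 0 < c := by positivity
  induction n with
  | zero =>
    intro j
    simp only [Function.iterate_zero, id, pow_zero, mul_one, Pi.smul_apply, smul_eq_mul]
    exact mul_le_mul_of_nonneg_right (by nlinarith [mul_nonneg hc0.le (sq_nonneg β)])
      (h.right_pos j).le
  | succ n ih =>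
    set x := β * lam ^ n with hx
    have hxc : |x| * lam * c ≤ 1 := by
      rw [hx, abs_mul, abs_of_pos (by positivity : 0 < lam ^ n)]
      rw [pow_succ] at hβ
      linarith
    have hxc2 : 2 * (|x| * c) ≤ 1 := by
      nlinarith [mul_nonneg (abs_nonneg x) hc0.le]
    have hih := ih (by
      rw [← abs_of_pos (by positivity : 0 < lam ^ n), ← abs_mul]
      linarith [mul_nonneg (abs_nonneg x) hc0.le])
    rw [Function.iterate_succ_apply']
    refine (logGen_mono hu hih).trans fun j => (hlog j _).trans ?_
    rw [h.right_eq, show β * lam ^ (n + 1) = x * lam by rw [hx]; ring]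
    simp only [Pi.smul_apply, smul_eq_mul]
    have hrj := h.right_pos j
    set ε := x + c * x ^ 2 with hε
    have h1 : ε ^ 2 ≤ 4 * x ^ 2 := by
      have : ε = x * (1 + c * x) := by rw [hε]; ring
      rw [this, mul_pow, mul_comm]
      have hcx : |c * x| ≤ 1 := by
        rw [abs_mul, abs_of_pos hc0]
        linarith [mul_nonneg (abs_nonneg x) hc0.le]
      obtain ⟨h3, h4⟩ := abs_le.1 hcx
      exact mul_le_mul_of_nonneg_right (by nlinarith) (sq_nonneg x)
    have h2 : K * ε ^ 2 ≤ (K * C) * (4 * x ^ 2) * r j := by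
      have : K * ε ^ 2 ≤ K * (4 * x ^ 2) := mul_le_mul_of_nonneg_left h1 hK
      have h5 : K * (4 * x ^ 2) * 1 ≤ K * (4 * x ^ 2) * (C * r j) :=
        mul_le_mul_of_nonneg_left (hCr j) (by positivity)
      nlinarith
    have h3 : ε * lam + (K * C) * (4 * x ^ 2) ≤ x * lam + c * (x * lam) ^ 2 := by
      have h6 : 2 * c * x ^ 2 ≤ c * x ^ 2 * (lam * (lam - 1)) := by
        have : 2 ≤ lam * (lam - 1) := by nlinarith
        have := mul_le_mul_of_nonneg_left this (mul_nonneg hc0.le (sq_nonneg x))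
        linarith
      have h7 : (K * C) * (4 * x ^ 2) ≤ 2 * c * x ^ 2 := by
        rw [hc]; nlinarith [sq_nonneg x]
      rw [hε]
      nlinarith
    nlinarith

/-- The normalized size of the `N`-th generation. -/
def normSize (lam : ℝ) (r : Fin 2 → ℝ) (N : ℕ) (ζ : ℕ → ℕ × ℕ) : ℝ := (lam ^ N)⁻¹ * dp (ζ N) r

lemma lintegral_exp_normSize (hu : 0 ≤ u) (j : Fin 2) (N : ℕ) (t : ℝ) :
    ∫⁻ ω, ofReal (exp (t * normSize lam r N ω)) ∂(branchLaw u j) =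
      ofReal (exp ((logGen u)^[N] ((t * (lam ^ N)⁻¹) • r) j)) := by
  rw [← lintegral_exp hu]
  simp only [normSize, dp_smul, mul_assoc]

lemma exists_lintegral_exp_le (hu : 0 ≤ u) (h : IsPerronTriple (mean u) lam r l) :
    ∃ c : ℝ, 0 < c ∧ ∀ (j : Fin 2) (t : ℝ) (N : ℕ), |t| * c ≤ 1 →
      ∫⁻ ω, ofReal (exp (t * normSize lam r N ω)) ∂(branchLaw u j) ≤
        ofReal (exp ((t + c * t ^ 2) * r j)) := by
  obtain ⟨c, hc, hi⟩ := exists_iterate_le hu h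
  have hl : 0 < lam := by linarith [(perron_bounds hu h).1]
  refine ⟨c, hc, fun j t N ht => ?_⟩
  have hN : 0 < lam ^ N := by positivity
  have e : t * (lam ^ N)⁻¹ * lam ^ N = t := by field_simp
  rw [lintegral_exp_normSize hu]
  refine ofReal_le_ofReal (exp_le_exp.2 ?_)
  have := hi N (t * (lam ^ N)⁻¹) (by rw [abs_mul, abs_inv, abs_of_pos hN]; field_simp; linarith) j
  rwa [e] at this

lemma exists_lintegral_exp_le_const (hu : 0 ≤ u) (h : IsPerronTriple (mean u) lam r l)
    (j : Fin 2) (t : ℝ) : ∃ C : ℝ, ∀ᶠ N in atTop,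
      ∫⁻ ω, ofReal (exp (t * normSize lam r N ω)) ∂(branchLaw u j) ≤
        ofReal C := by
  obtain ⟨c, hc, hi⟩ := exists_iterate_le hu h
  have hl2 := (perron_bounds hu h).1
  have hl : 0 < lam := by linarith
  obtain ⟨m, hm⟩ := pow_unbounded_of_one_lt (|t| * c) (by linarith : 1 < lam)
  set t' := t * (lam ^ m)⁻¹ with ht'
  refine ⟨exp ((logGen u)^[m] ((t' + c * t' ^ 2) • r) j), eventually_atTop.2 ⟨m, fun N hN => ?_⟩⟩
  obtain ⟨n, rfl⟩ := Nat.exists_eq_add_of_le hN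
  have hm0 : 0 < lam ^ m := by positivity
  have hn0 : 0 < lam ^ n := by positivity
  have e : t * (lam ^ (m + n))⁻¹ * lam ^ n = t' := by rw [ht', pow_add]; field_simp
  rw [lintegral_exp_normSize hu, Function.iterate_add_apply]
  refine ofReal_le_ofReal (exp_le_exp.2 ((logGen_mono hu).iterate m ?_ j))
  have := hi n (t * (lam ^ (m + n))⁻¹) (by
    rw [← abs_of_pos hn0, ← abs_mul, e, ht', abs_mul, abs_inv, abs_of_pos hm0]
    rw [mul_right_comm, ← div_eq_mul_inv, div_le_one hm0]
    exact hm.le)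
  rwa [e] at this

lemma measurable_dp (N : ℕ) (s : Fin 2 → ℝ) : Measurable fun ω : ℕ → ℕ × ℕ => dp (ω N) s :=
  (Measurable.of_discrete (f := fun p : ℕ × ℕ => dp p s)).comp (measurable_pi_apply N)

lemma exists_lintegral_step_le (hu : 0 ≤ u) (h : IsPerronTriple (mean u) lam r l)
    (s : Fin 2 → ℝ) : ∃ C : ℝ, 0 ≤ C ∧ ∀ (j : Fin 2) (N : ℕ),
    ∫⁻ ω, ofReal |dp (ω (N + 1)) s - dp (ω N) ((mean u).mulVec s)| ∂(branchLaw u j) ≤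
      ofReal (C * √lam ^ N) := by
  obtain ⟨K, hK, hstep⟩ := lintegral_exp_step hu s
  obtain ⟨c, hc, hexp⟩ := exists_lintegral_exp_le hu h
  obtain ⟨C, hC, hCr⟩ := exists_le_mul h.right_pos
  have hl2 := (perron_bounds hu h).1
  have hl : 0 < lam := by linarith
  have hq : 0 < √lam := Real.sqrt_pos.2 hl
  set τ := 1 / c with hτ
  have hτ0 : 0 < τ := by positivity
  obtain ⟨δ, hδ, hδK⟩ : ∃ δ : ℝ, 0 < δ ∧ K * C * δ ^ 2 ≤ τ := by
    refine ⟨√(τ / (K * C + 1)), Real.sqrt_pos.2 (by positivity), ?_⟩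
    rw [Real.sq_sqrt (by positivity), mul_div_assoc', div_le_iff₀ (by positivity)]
    nlinarith
  obtain ⟨R, hR⟩ : ∃ R, R = exp (τ + c * τ ^ 2) := ⟨_, rfl⟩
  have hR0 : 0 < R := hR ▸ exp_pos _
  refine ⟨2 * R / δ, by positivity, fun j N => ?_⟩
  set X : (ℕ → ℕ × ℕ) → ℝ := fun ω => dp (ω (N + 1)) s - dp (ω N) ((mean u).mulVec s) with hX
  set ε := δ / √lam ^ N with hε
  have hε0 : 0 < ε := by positivity
  have hε2 : ε ^ 2 = δ ^ 2 * (lam ^ N)⁻¹ := by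
    rw [hε, div_pow, ← pow_mul, mul_comm N 2, pow_mul, Real.sq_sqrt hl.le, div_eq_mul_inv]
  have hr1 : ∀ j, r j ≤ 1 := fun j => by
    have h0 := h.right_pos 0
    have h1 := h.right_pos 1
    have := h.eqs.2.2.2
    fin_cases j <;> simp only [Fin.zero_eta, Fin.mk_one] <;> linarith
  have key : ∀ ε' : ℝ, ε' ^ 2 = ε ^ 2 →
      ∫⁻ ω, ofReal (exp (ε' * X ω)) ∂(branchLaw u j) ≤ ofReal R := by
    intro ε' hε'
    refine (hstep j N ε').trans ?_
    have h1 : ∫⁻ ω, ofReal (exp (dp (ω N) fun _ => K * ε' ^ 2)) ∂(branchLaw u j) ≤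
        ∫⁻ ω, ofReal (exp (τ * normSize lam r N ω)) ∂(branchLaw u j) := by
      refine lintegral_mono fun ω => ofReal_le_ofReal (exp_le_exp.2 ?_)
      rw [normSize, ← mul_assoc, ← dp_smul]
      refine dp_mono _ fun k => ?_
      have h2 : K * ε' ^ 2 * 1 ≤ K * ε' ^ 2 * (C * r k) :=
        mul_le_mul_of_nonneg_left (hCr k) (by positivity)
      rw [mul_one] at h2
      refine h2.trans ?_
      rw [hε', hε2, Pi.smul_apply, smul_eq_mul]
      have h3 : K * C * δ ^ 2 * ((lam ^ N)⁻¹ * r k) ≤ τ * ((lam ^ N)⁻¹ * r k) :=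
        mul_le_mul_of_nonneg_right hδK (mul_nonneg (by positivity) (h.right_pos k).le)
      linarith
    rw [hR]
    refine (h1.trans (hexp j τ N ?_)).trans (ofReal_le_ofReal (exp_le_exp.2 ?_))
    · rw [abs_of_pos hτ0, hτ, one_div_mul_cancel hc.ne']
    · exact mul_le_of_le_one_right (by positivity) (hr1 j)
  have hpt : ∀ ω, ofReal |X ω| ≤ ofReal ε⁻¹ *
      (ofReal (exp (ε * X ω)) + ofReal (exp (-ε * X ω))) := by
    intro ω
    rw [← ENNReal.ofReal_add (exp_pos _).le (exp_pos _).le,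
      ← ofReal_mul (by positivity)]
    refine ofReal_le_ofReal ?_
    have h4 : ε * |X ω| ≤ exp (ε * X ω) + exp (-ε * X ω) := by
      have h5 := Real.add_one_le_exp (ε * X ω)
      have h6 := Real.add_one_le_exp (-ε * X ω)
      have h7 := exp_pos (ε * X ω)
      have h8 := exp_pos (-ε * X ω)
      rcases abs_cases (X ω) with ⟨h9, -⟩ | ⟨h9, -⟩ <;> rw [h9] <;> linarith
    rw [inv_mul_eq_div, le_div_iff₀ hε0]
    linarith
  have hXm : Measurable X := (measurable_dp _ _).sub (measurable_dp _ _)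
  calc ∫⁻ ω, ofReal |X ω| ∂(branchLaw u j)
      ≤ ∫⁻ ω, ofReal ε⁻¹ * (ofReal (exp (ε * X ω)) +
          ofReal (exp (-ε * X ω))) ∂(branchLaw u j) := lintegral_mono hpt
    _ ≤ ofReal ε⁻¹ * (ofReal R + ofReal R) := by
        rw [lintegral_const_mul _ (by fun_prop), lintegral_add_left (by fun_prop)]
        exact mul_le_mul_right (add_le_add (key ε rfl) (key (-ε) (by ring))) _
    _ = ofReal (2 * R / δ * √lam ^ N) := by
        rw [← ENNReal.ofReal_add hR0.le hR0.le,
          ← ofReal_mul (by positivity), hε]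
        congr 1
        field_simp
        ring

lemma ae_summable_step (hu : 0 ≤ u) (h : IsPerronTriple (mean u) lam r l)
    (s : Fin 2 → ℝ) (j : Fin 2) : ∀ᵐ ω ∂(branchLaw u j), Summable fun N : ℕ =>
      (lam ^ (N + 1))⁻¹ * |dp (ω (N + 1)) s - dp (ω N) ((mean u).mulVec s)| := by
  obtain ⟨C, hC, hstep⟩ := exists_lintegral_step_le hu h s
  have hl2 := (perron_bounds hu h).1
  have hl : 0 < lam := by linarith
  have hq : 0 < √lam := Real.sqrt_pos.2 hl
  have hq1 : 1 < √lam := Real.lt_sqrt_of_sq_lt (by linarith)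
  have hm : ∀ N : ℕ, Measurable fun ω : ℕ → ℕ × ℕ => ofReal
      ((lam ^ (N + 1))⁻¹ * |dp (ω (N + 1)) s - dp (ω N) ((mean u).mulVec s)|) := fun N =>
    ENNReal.measurable_ofReal.comp
      ((((measurable_dp _ _).sub (measurable_dp _ _)).abs).const_mul _)
  have hfin : ∫⁻ ω, ∑' N : ℕ, ofReal ((lam ^ (N + 1))⁻¹ *
      |dp (ω (N + 1)) s - dp (ω N) ((mean u).mulVec s)|) ∂(branchLaw u j) ≠ ∞ := by
    rw [lintegral_tsum fun N => (hm N).aemeasurable]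
    refine ne_top_of_le_ne_top (b := ∑' N : ℕ, ofReal (C * ((√lam)⁻¹) ^ N)) ?_ ?_
    · rw [← ENNReal.ofReal_tsum_of_nonneg (fun N => by positivity)
        ((summable_geometric_of_lt_one (by positivity) (inv_lt_one_of_one_lt₀ hq1)).mul_left C)]
      exact ofReal_ne_top
    · refine ENNReal.tsum_le_tsum fun N => ?_
      simp only [ofReal_mul (inv_nonneg.2 (pow_nonneg hl.le _))]
      rw [lintegral_const_mul' _ _ ofReal_ne_top]
      refine (mul_le_mul_right (hstep j N) _).trans ?_
      rw [← ofReal_mul (by positivity)]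
      refine ofReal_le_ofReal ?_
      have e : lam ^ N = √lam ^ N * √lam ^ N := by
        rw [← mul_pow, Real.mul_self_sqrt hl.le]
      rw [pow_succ, e, inv_pow]
      have : (√lam ^ N * √lam ^ N * lam)⁻¹ * (C * √lam ^ N) = C * (√lam ^ N)⁻¹ * lam⁻¹ := by
        field_simp
      rw [this]
      exact mul_le_of_le_one_right (by positivity) (inv_le_one_of_one_le₀ (by linarith))
  filter_upwards [ae_lt_top (Measurable.tsum hm) hfin] with ω hω
  have := ENNReal.summable_toReal hω.ne
  refine this.congr fun N => ?_
  rw [toReal_ofReal (by positivity)]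

lemma tendsto_zero_of_recursion {a d : ℕ → ℝ} {ρ : ℝ} (hρ : ρ < 1)
    (ha : ∀ n, 0 ≤ a n) (h : ∀ n, a (n + 1) ≤ ρ * a n + d n) (hd0 : ∀ n, 0 ≤ d n)
    (hd : Summable d) : Tendsto a atTop (𝓝 0) := by
  refine (summable_of_sum_range_le (c := (a 0 + ∑' n, d n) / (1 - ρ)) ha
    fun n => ?_).tendsto_atTop_zero
  rw [le_div_iff₀ (by linarith)]
  have h1 : ∑ i ∈ range n, a i ≤ ∑ i ∈ range (n + 1), a i := by
    rw [Finset.sum_range_succ]; linarith [ha n]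
  have h2 : ∑ i ∈ range n, a (i + 1) ≤
      ρ * (∑ i ∈ range n, a i) + ∑ i ∈ range n, d i := by
    rw [Finset.mul_sum, ← Finset.sum_add_distrib]
    exact Finset.sum_le_sum fun i _ => h i
  have h3 := hd.sum_le_tsum (range n) fun i _ => hd0 i
  rw [Finset.sum_range_succ'] at h1
  linarith

/-- The limit of the normalized sizes of the generations. -/
def limSize (lam : ℝ) (r : Fin 2 → ℝ) (ζ : ℕ → ℕ × ℕ) : ℝ :=
  limsup (fun N => normSize lam r N ζ) atTop

lemma measurable_normSize (lam : ℝ) (r : Fin 2 → ℝ) (N : ℕ) : Measurable (normSize lam r N) :=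
  (measurable_dp N r).const_mul _

lemma measurable_limSize (lam : ℝ) (r : Fin 2 → ℝ) : Measurable (limSize lam r) :=
  Measurable.limsup fun N => measurable_normSize lam r N

lemma ae_tendsto_normSize (hu : 0 ≤ u) (h : IsPerronTriple (mean u) lam r l) (j : Fin 2) :
    ∀ᵐ ω ∂(branchLaw u j), Tendsto (fun N => normSize lam r N ω) atTop (𝓝 (limSize lam r ω)) := by
  have hl : 0 < lam := by linarith [(perron_bounds hu h).1]
  filter_upwards [ae_summable_step hu h r j] with ω hω
  obtain ⟨x, hx⟩ := cauchySeq_tendsto_of_complete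
    (cauchySeq_of_summable_dist (f := fun N => normSize lam r N ω) (hω.congr fun N => by
      rw [dist_comm, Real.dist_eq, h.right_eq, dp_smul, normSize, normSize,
        ← abs_of_pos (a := (lam ^ (N + 1))⁻¹) (by positivity), ← abs_mul,
        abs_of_pos (a := (lam ^ (N + 1))⁻¹) (by positivity)]
      congr 1
      rw [pow_succ]
      field_simp))
  rwa [limSize, hx.limsup_eq]

lemma ae_tendsto_toVec (hu : 0 ≤ u) (h : IsPerronTriple (mean u) lam r l) (j : Fin 2) :
    ∀ᵐ ω ∂(branchLaw u j), Tendsto (fun N => (lam ^ N)⁻¹ • toVec (ω N)) atTop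
      (𝓝 (limSize lam r ω • l)) := by
  obtain ⟨hl2, -, ht0, ht⟩ := perron_bounds hu h
  have hl : 0 < lam := by linarith
  obtain ⟨-, hleft, hdot, -⟩ := h.eqs
  set r' : Fin 2 → ℝ := ![-l 1, l 0] with hr'
  set μ := mean u 0 0 + mean u 1 1 - lam with hμ
  have hA : (mean u).mulVec r' = μ • r' := by
    ext k
    have h0 := hleft 0
    have h1 := hleft 1
    fin_cases k
    · simp [Matrix.mulVec, dotProduct, hr']; linear_combination h1
    · simp [Matrix.mulVec, dotProduct, hr']; linear_combination -h0
  filter_upwards [ae_tendsto_normSize hu h j, ae_summable_step hu h r' j] with ω h1 h2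
  have h3 : Tendsto (fun N => |normSize lam r' N ω|) atTop (𝓝 0) := by
    refine tendsto_zero_of_recursion (ρ := |μ| / lam) ?_ (fun _ => abs_nonneg _)
      (fun n => ?_) (fun _ => by positivity) h2
    · rw [div_lt_one hl, abs_lt]
      constructor <;> linarith
    · have hn : 0 < (lam ^ (n + 1))⁻¹ := by positivity
      have e0 : |μ| / lam = |μ / lam| := by rw [abs_div, abs_of_pos hl]
      rw [hA, dp_smul, e0, ← abs_mul, ← abs_of_pos hn, ← abs_mul]
      refine le_trans (le_of_eq ?_) (abs_add_le _ _)
      congr 1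
      simp only [normSize, pow_succ]
      field_simp
      ring
  have h4 := (tendsto_zero_iff_abs_tendsto_zero _).2 h3
  rw [tendsto_pi_nhds]
  have e : ∀ (N : ℕ) (k : Fin 2), ((lam ^ N)⁻¹ • toVec (ω N)) k =
      normSize lam r N ω * l k + normSize lam r' N ω * (![-r 1, r 0] k) := fun N k => by
    fin_cases k
    · simp [toVec, normSize, dp, hr']
      linear_combination -((lam ^ N)⁻¹ * (ω N).1) * hdot
    · simp [toVec, normSize, dp, hr']
      linear_combination -((lam ^ N)⁻¹ * (ω N).2) * hdot
  intro k
  simp only [e]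
  have := (h1.mul_const (l k)).add (h4.mul_const (![-r 1, r 0] k))
  simpa using this

end Limit

/-! ### The Laplace transforms of the limits -/

section Laplace

variable {u : ℝ} {lam : ℝ} {r l : Fin 2 → ℝ}

/-- The law of the normalized limit of the branching process. -/
def limLaw (u lam : ℝ) (r : Fin 2 → ℝ) (j : Fin 2) : Measure ℝ :=
  (branchLaw u j).map (limSize lam r)

instance (u lam : ℝ) (r : Fin 2 → ℝ) (j : Fin 2) : IsProbabilityMeasure (limLaw u lam r j) :=
  Measure.isProbabilityMeasure_map (measurable_limSize lam r).aemeasurable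

lemma lintegral_limLaw_le (hu : 0 ≤ u) (h : IsPerronTriple (mean u) lam r l) {j : Fin 2}
    {t : ℝ} {C : ℝ≥0∞} (hC : ∀ᶠ N in atTop,
      ∫⁻ ω, ofReal (exp (t * normSize lam r N ω)) ∂(branchLaw u j) ≤ C) :
    ∫⁻ x, ofReal (exp (t * x)) ∂(limLaw u lam r j) ≤ C := by
  rw [limLaw, lintegral_map (by fun_prop) (measurable_limSize lam r)]
  have h1 : ∫⁻ ω, ofReal (exp (t * limSize lam r ω)) ∂(branchLaw u j) =
      ∫⁻ ω, liminf (fun N => ofReal (exp (t * normSize lam r N ω))) atTop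
        ∂(branchLaw u j) := by
    refine lintegral_congr_ae ?_
    filter_upwards [ae_tendsto_normSize hu h j] with ω hω
    refine Tendsto.liminf_eq ?_ |>.symm
    exact ENNReal.tendsto_ofReal ((Real.continuous_exp.tendsto _).comp (hω.const_mul t))
  rw [h1]
  refine (lintegral_liminf_le fun N => ?_).trans
    (liminf_le_of_le (by isBoundedDefault) fun b hb => ?_)
  · exact ENNReal.measurable_ofReal.comp
      (Real.measurable_exp.comp ((measurable_normSize lam r N).const_mul t))
  · obtain ⟨N, hN1, hN2⟩ := (hb.and hC).exists
    exact hN1.trans hN2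

lemma integrable_exp_limLaw (hu : 0 ≤ u) (h : IsPerronTriple (mean u) lam r l) (j : Fin 2)
    (t : ℝ) : Integrable (fun x => exp (t * x)) (limLaw u lam r j) := by
  obtain ⟨C, hC⟩ := exists_lintegral_exp_le_const hu h j t
  refine ⟨by fun_prop, ?_⟩
  rw [hasFiniteIntegral_iff_ofReal (ae_of_all _ fun x => (exp_pos _).le)]
  exact (lintegral_limLaw_le hu h hC).trans_lt ENNReal.ofReal_lt_top

lemma integrableExpSet_limLaw (hu : 0 ≤ u) (h : IsPerronTriple (mean u) lam r l) (j : Fin 2) :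
    interior (integrableExpSet id (limLaw u lam r j)) = Set.univ := by
  have : integrableExpSet id (limLaw u lam r j) = Set.univ :=
    Set.eq_univ_of_forall fun t => integrable_exp_limLaw hu h j t
  rw [this, interior_univ]

lemma limLaw_nonneg (hu : 0 ≤ u) (h : IsPerronTriple (mean u) lam r l) (j : Fin 2) :
    ∀ᵐ x ∂(limLaw u lam r j), 0 ≤ x := by
  have hl : 0 < lam := by linarith [(perron_bounds hu h).1]
  rw [limLaw, ae_map_iff (measurable_limSize lam r).aemeasurable measurableSet_Ici]
  filter_upwards [ae_tendsto_normSize hu h j] with ω hω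
  refine ge_of_tendsto' hω fun N => mul_nonneg (by positivity) ?_
  have h0 := (h.right_pos 0).le
  have h1 := (h.right_pos 1).le
  rw [dp]
  positivity

lemma mgf_limLaw_le (hu : 0 ≤ u) (h : IsPerronTriple (mean u) lam r l) :
    ∃ c : ℝ, 0 < c ∧ ∀ (j : Fin 2) (t : ℝ), |t| * c ≤ 1 →
      mgf id (limLaw u lam r j) t ≤ exp ((t + c * t ^ 2) * r j) := by
  obtain ⟨c, hc, hb⟩ := exists_lintegral_exp_le hu h
  refine ⟨c, hc, fun j t ht => ?_⟩
  have := lintegral_limLaw_le hu h (Eventually.of_forall fun N => hb j t N ht)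
  rw [← ofReal_integral_eq_lintegral_ofReal (integrable_exp_limLaw hu h j t)
    (ae_of_all _ fun x => (exp_pos _).le)] at this
  exact (ENNReal.ofReal_le_ofReal_iff (exp_pos _).le).1 this

lemma mean_limLaw (hu : 0 ≤ u) (h : IsPerronTriple (mean u) lam r l) (j : Fin 2) :
    Integrable (fun x => x) (limLaw u lam r j) ∧ ∫ x, x ∂(limLaw u lam r j) = r j := by
  have h0 : (0 : ℝ) ∈ interior (integrableExpSet id (limLaw u lam r j)) := by
    rw [integrableExpSet_limLaw hu h]; trivial
  refine ⟨by simpa using integrable_pow_of_mem_interior_integrableExpSet h0 1, ?_⟩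
  obtain ⟨c, hc, hb⟩ := mgf_limLaw_le hu h
  have hd := hasDerivAt_mgf h0
  simp only [zero_mul, exp_zero, mul_one, id] at hd
  have hq : HasDerivAt (fun t : ℝ => exp ((t + c * t ^ 2) * r j)) (r j) 0 := by
    have h1 : HasDerivAt (fun t : ℝ => (t + c * t ^ 2) * r j) (r j) 0 := by
      simpa using ((hasDerivAt_id (0 : ℝ)).add ((hasDerivAt_pow 2 (0 : ℝ)).const_mul c)).mul_const
        (r j)
    simpa using h1.exp
  have hmin : IsLocalMin (fun t : ℝ => exp ((t + c * t ^ 2) * r j) -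
      mgf id (limLaw u lam r j) t) 0 := by
    have hnear : ∀ᶠ t : ℝ in 𝓝 0, |t| * c < 1 := by
      have : ContinuousAt (fun t : ℝ => |t| * c) 0 := by fun_prop
      refine this.eventually_lt_const ?_
      simp
    filter_upwards [hnear] with t ht
    have := hb j t ht.le
    simp only [mgf_zero, mul_zero, zero_pow two_ne_zero, add_zero, zero_mul, exp_zero,
      sub_self]
    linarith
  have := hmin.hasDerivAt_eq_zero (hq.sub hd)
  linarith

lemma differentiable_complexMGF_limLaw (hu : 0 ≤ u) (h : IsPerronTriple (mean u) lam r l)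
    (j : Fin 2) : Differentiable ℂ (complexMGF id (limLaw u lam r j)) := by
  have := differentiableOn_complexMGF (X := id) (μ := limLaw u lam r j)
  rw [integrableExpSet_limLaw hu h] at this
  exact differentiableOn_univ.1 this

lemma tendsto_exp_iterate (hu : 0 ≤ u) (h : IsPerronTriple (mean u) lam r l) (j : Fin 2) {t : ℝ}
    (ht : t ≤ 0) : Tendsto (fun N : ℕ => exp ((logGen u)^[N] ((t * (lam ^ N)⁻¹) • r) j)) atTop
      (𝓝 (mgf id (limLaw u lam r j) t)) := by
  have hl : 0 < lam := by linarith [(perron_bounds hu h).1]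
  have e : mgf id (limLaw u lam r j) t = ∫ ω, exp (t * limSize lam r ω) ∂(branchLaw u j) := by
    rw [mgf, limLaw, integral_map (measurable_limSize lam r).aemeasurable (by fun_prop)]
    rfl
  have e2 : ∀ N : ℕ, exp ((logGen u)^[N] ((t * (lam ^ N)⁻¹) • r) j) =
      ∫ ω, exp (t * normSize lam r N ω) ∂(branchLaw u j) := fun N => by
    rw [integral_eq_lintegral_of_nonneg_ae (ae_of_all _ fun x => (exp_pos _).le)
      (Real.measurable_exp.comp ((measurable_normSize lam r N).const_mul t)).aestronglyMeasurable,
      lintegral_exp_normSize hu, toReal_ofReal (exp_pos _).le]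
  rw [e]
  simp only [e2]
  refine tendsto_integral_of_dominated_convergence (fun _ => 1) (fun N =>
    (Real.measurable_exp.comp ((measurable_normSize lam r N).const_mul t)).aestronglyMeasurable)
    (integrable_const _) (fun N => ae_of_all _ fun ω => ?_) ?_
  · rw [Real.norm_eq_abs, abs_of_pos (exp_pos _), Real.exp_le_one_iff]
    refine mul_nonpos_of_nonpos_of_nonneg ht (mul_nonneg (by positivity) ?_)
    have h0 := (h.right_pos 0).le
    have h1 := (h.right_pos 1).le
    rw [dp]
    positivity
  · filter_upwards [ae_tendsto_normSize hu h j] with ω hω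
    exact (Real.continuous_exp.tendsto _).comp (hω.const_mul t)

lemma mgf_limLaw_mul (hu : 0 ≤ u) (h : IsPerronTriple (mean u) lam r l) (j : Fin 2) {t : ℝ}
    (ht : t ≤ 0) : mgf id (limLaw u lam r j) (lam * t) =
      gen (off u j) (mgf id (limLaw u lam r 0) t) (mgf id (limLaw u lam r 1) t) := by
  have hl : 0 < lam := by linarith [(perron_bounds hu h).1]
  have h1 := (tendsto_exp_iterate hu h j (mul_nonpos_of_nonneg_of_nonpos hl.le ht)).comp
    (tendsto_add_atTop_nat 1)
  refine tendsto_nhds_unique h1 ?_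
  have e : (fun N : ℕ => exp ((logGen u)^[N] ((lam * t * (lam ^ N)⁻¹) • r) j)) ∘
      (fun N => N + 1) = fun N => ∑ z ∈ box, (off u j z).toReal *
        exp ((logGen u)^[N] ((t * (lam ^ N)⁻¹) • r) 0) ^ z.1 *
        exp ((logGen u)^[N] ((t * (lam ^ N)⁻¹) • r) 1) ^ z.2 := by
    funext N
    have e1 : lam * t * (lam ^ (N + 1))⁻¹ = t * (lam ^ N)⁻¹ := by
      rw [pow_succ]; field_simp
    simp only [Function.comp_apply, e1, Function.iterate_succ_apply', exp_logGen hu, expec]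
    refine sum_congr rfl fun z _ => ?_
    rw [← exp_nat_mul, ← exp_nat_mul, mul_assoc, ← exp_add, dp]
  rw [e]
  refine tendsto_finsetSum _ fun z _ => ?_
  exact (((tendsto_exp_iterate hu h 0 ht).pow z.1).const_mul _).mul
    ((tendsto_exp_iterate hu h 1 ht).pow z.2)

lemma complexMGF_limLaw_mul (hu : 0 ≤ u) (h : IsPerronTriple (mean u) lam r l) (j : Fin 2)
    (t : ℂ) : complexMGF id (limLaw u lam r j) (lam * t) =
      gen (off u j) (complexMGF id (limLaw u lam r 0) t) (complexMGF id (limLaw u lam r 1) t) := by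
  have hd := differentiable_complexMGF_limLaw hu h
  have h1 : Differentiable ℂ fun t : ℂ => complexMGF id (limLaw u lam r j) (lam * t) :=
    (hd j).comp (differentiable_id.const_mul _)
  have h2 : Differentiable ℂ fun t : ℂ => gen (off u j) (complexMGF id (limLaw u lam r 0) t)
      (complexMGF id (limLaw u lam r 1) t) := by
    refine Differentiable.fun_sum fun z _ => ?_
    exact (((hd 0).pow z.1).const_mul _).mul ((hd 1).pow z.2)
  refine congrFun ((h1.differentiableOn.analyticOnNhd isOpen_univ).eq_of_frequently_eq
    (h2.differentiableOn.analyticOnNhd isOpen_univ) (z₀ := ((-1 : ℝ) : ℂ)) ?_) t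
  have hreal : ∀ᶠ t : ℝ in 𝓝[≠] (-1 : ℝ), complexMGF id (limLaw u lam r j) (lam * (t : ℂ)) =
      gen (off u j) (complexMGF id (limLaw u lam r 0) t) (complexMGF id (limLaw u lam r 1) t) := by
    filter_upwards [nhdsWithin_le_nhds (Iio_mem_nhds (by norm_num : (-1 : ℝ) < 0))] with t ht
    rw [← Complex.ofReal_mul, complexMGF_ofReal, complexMGF_ofReal, complexMGF_ofReal,
      mgf_limLaw_mul hu h j (le_of_lt ht)]
    simp [gen]
  have htend : Tendsto (fun t : ℝ => (t : ℂ)) (𝓝[≠] (-1 : ℝ)) (𝓝[≠] ((-1 : ℝ) : ℂ)) :=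
    tendsto_nhdsWithin_of_tendsto_nhds_of_eventually_within _
      ((Complex.continuous_ofReal.tendsto _).mono_left nhdsWithin_le_nhds)
      (eventually_nhdsWithin_of_forall fun t ht hc => ht (Complex.ofReal_injective hc))
  exact htend.frequently hreal.frequently

lemma charFun_limLaw_mul (hu : 0 ≤ u) (h : IsPerronTriple (mean u) lam r l) (j : Fin 2)
    (t : ℝ) : charFun (limLaw u lam r j) (lam * t) =
      gen (off u j) (charFun (limLaw u lam r 0) t) (charFun (limLaw u lam r 1) t) := by
  have := complexMGF_limLaw_mul hu h j (t * Complex.I)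
  rw [← mul_assoc, ← Complex.ofReal_mul] at this
  simpa only [complexMGF_id_mul_I] using this

end Laplace

/-! ### Decay of the characteristic functions -/

section Decay

variable {u : ℝ} {lam : ℝ} {r l : Fin 2 → ℝ}

lemma eq_sum_of_norm_sum_eq_one (hu : 0 ≤ u) {j : Fin 2} {a : ℕ × ℕ → ℂ} (ha : ∀ z, ‖a z‖ ≤ 1)
    (h : ‖∑ z ∈ box, ((off u j z).toReal : ℂ) * a z‖ = 1) {z : ℕ × ℕ}
    (hz : z ∈ (off u j).support) : a z = ∑ z ∈ box, ((off u j z).toReal : ℂ) * a z := by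
  set s := ∑ z ∈ box, ((off u j z).toReal : ℂ) * a z with hs
  have h1 : ∀ z, ‖(starRingEnd ℂ) s * a z‖ ≤ 1 := fun z => by
    rw [norm_mul, RCLike.norm_conj, h, one_mul]; exact ha z
  have h2 : ∀ z, ((starRingEnd ℂ) s * a z).re ≤ 1 := fun z => (Complex.re_le_norm _).trans (h1 z)
  have hss : (starRingEnd ℂ) s * s = 1 := by
    rw [mul_comm, Complex.mul_conj, Complex.normSq_eq_norm_sq, h]; norm_num
  have h3 : expec u j (fun z => ((starRingEnd ℂ) s * a z).re) = 1 := by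
    have : (starRingEnd ℂ) s * s = ∑ z ∈ box, ((off u j z).toReal : ℂ) *
        ((starRingEnd ℂ) s * a z) := by
      conv_lhs => rw [hs, Finset.mul_sum]
      refine sum_congr rfl fun z _ => ?_
      ring
    rw [hss] at this
    have h4 := congrArg Complex.re this
    rw [Complex.re_sum, Complex.one_re] at h4
    rw [h4, expec]
    refine sum_congr rfl fun z _ => ?_
    rw [Complex.re_ofReal_mul]
  have h5 : ((starRingEnd ℂ) s * a z).re = 1 := by
    by_contra hne
    have := expec_lt hu (fun z _ => h2 z) hz (lt_of_le_of_ne (h2 z) hne)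
    rw [h3, expec_const hu] at this
    exact lt_irrefl _ this
  have h6 : (starRingEnd ℂ) s * a z = 1 := by
    have h7 := h1 z
    have h8 : ((starRingEnd ℂ) s * a z).im = 0 := by
      have h9 := Complex.sq_norm ((starRingEnd ℂ) s * a z)
      rw [Complex.normSq_apply, h5] at h9
      have : ‖(starRingEnd ℂ) s * a z‖ ^ 2 ≤ 1 := pow_le_one₀ (norm_nonneg _) h7
      nlinarith
    exact Complex.ext h5 h8
  calc a z = ((starRingEnd ℂ) s * s) * a z := by rw [hss, one_mul]
    _ = s * ((starRingEnd ℂ) s * a z) := by ring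
    _ = s := by rw [h6, mul_one]

/-- The larger modulus of the two characteristic functions. -/
def maxChar (u lam : ℝ) (r : Fin 2 → ℝ) (t : ℝ) : ℝ :=
  max ‖charFun (limLaw u lam r 0) t‖ ‖charFun (limLaw u lam r 1) t‖

lemma norm_charFun_le_maxChar (j : Fin 2) (t : ℝ) :
    ‖charFun (limLaw u lam r j) t‖ ≤ maxChar u lam r t := by
  fin_cases j
  · exact le_max_left _ _
  · exact le_max_right _ _

lemma maxChar_nonneg (t : ℝ) : 0 ≤ maxChar u lam r t := le_max_of_le_left (norm_nonneg _)

lemma maxChar_le_one (t : ℝ) : maxChar u lam r t ≤ 1 :=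
  max_le (norm_charFun_le_one _) (norm_charFun_le_one _)

lemma continuous_maxChar : Continuous (maxChar u lam r) :=
  continuous_charFun.norm.max continuous_charFun.norm

lemma maxChar_neg (t : ℝ) : maxChar u lam r (-t) = maxChar u lam r t := by
  simp only [maxChar, charFun_neg, RCLike.norm_conj]

lemma maxChar_mul_le (hu : 0 ≤ u) (h : IsPerronTriple (mean u) lam r l) (t : ℝ) :
    maxChar u lam r (lam * t) ≤ maxChar u lam r t ^ 2 := by
  have key : ∀ j, ‖charFun (limLaw u lam r j) (lam * t)‖ ≤ maxChar u lam r t ^ 2 := by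
    intro j
    rw [charFun_limLaw_mul hu h, gen]
    refine (norm_sum_le _ _).trans ?_
    rw [← expec_const hu j (maxChar u lam r t ^ 2)]
    refine le_trans (le_of_eq ?_) (expec_le (f := fun z =>
      ‖charFun (limLaw u lam r 0) t‖ ^ z.1 * ‖charFun (limLaw u lam r 1) t‖ ^ z.2) fun z hz => ?_)
    · refine sum_congr rfl fun z _ => ?_
      simp [mul_assoc]
    · have hz2 : 2 ≤ z.1 + z.2 := by have := (mem_support_off hu hz).1; omega
      calc _ ≤ maxChar u lam r t ^ z.1 * maxChar u lam r t ^ z.2 :=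
            mul_le_mul (pow_le_pow_left₀ (norm_nonneg _) (norm_charFun_le_maxChar 0 t) _)
              (pow_le_pow_left₀ (norm_nonneg _) (norm_charFun_le_maxChar 1 t) _) (by positivity)
              (pow_nonneg (maxChar_nonneg t) _)
        _ = maxChar u lam r t ^ (z.1 + z.2) := (pow_add _ _ _).symm
        _ ≤ _ := pow_le_pow_of_le_one (maxChar_nonneg t) (maxChar_le_one t) hz2
  exact max_le (key 0) (key 1)

lemma charFun_eq_one_of_norm (hu : 0 ≤ u) (h : IsPerronTriple (mean u) lam r l) {t : ℝ}
    (ht : ‖charFun (limLaw u lam r 0) (lam * t)‖ = 1) : charFun (limLaw u lam r 0) t = 1 := by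
  obtain ⟨h2, h3, -⟩ := offspring_values hu
  rw [charFun_limLaw_mul hu h, gen] at ht
  simp only [mul_assoc] at ht
  have ha : ∀ z : ℕ × ℕ, ‖charFun (limLaw u lam r 0) t ^ z.1 *
      charFun (limLaw u lam r 1) t ^ z.2‖ ≤ 1 := fun z => by
    rw [norm_mul, norm_pow, norm_pow]
    exact mul_le_one₀ (pow_le_one₀ (norm_nonneg _) (norm_charFun_le_one _)) (by positivity)
      (pow_le_one₀ (norm_nonneg _) (norm_charFun_le_one _))
  have e2 := eq_sum_of_norm_sum_eq_one hu (j := 0) ha ht h2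
  have e3 := eq_sum_of_norm_sum_eq_one hu (j := 0) ha ht h3
  replace ht := (congrArg norm e2).trans ht
  rw [← e2] at e3
  simp only [pow_zero, mul_one] at e3 ht
  have hne : charFun (limLaw u lam r 0) t ≠ 0 := fun h0 => by simp [h0] at ht
  have : charFun (limLaw u lam r 0) t ^ 2 * charFun (limLaw u lam r 0) t =
      charFun (limLaw u lam r 0) t ^ 2 * 1 := by
    rw [mul_one, ← pow_succ]; exact e3
  exact mul_left_cancel₀ (pow_ne_zero 2 hne) this

lemma norm_charFun_zero_lt (hu : 0 ≤ u) (h : IsPerronTriple (mean u) lam r l) {t : ℝ}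
    (ht : t ≠ 0) : ‖charFun (limLaw u lam r 0) t‖ < 1 := by
  have hl2 := (perron_bounds hu h).1
  have hl : 0 < lam := by linarith
  refine lt_of_le_of_ne (norm_charFun_le_one _) fun h1 => ?_
  have hstep : ∀ n : ℕ, charFun (limLaw u lam r 0) (t * (lam ^ (n + 1))⁻¹) = 1 := by
    intro n
    induction n with
    | zero =>
      refine charFun_eq_one_of_norm hu h ?_
      rwa [zero_add, pow_one, mul_comm, inv_mul_cancel_right₀ hl.ne']
    | succ n ih =>
      refine charFun_eq_one_of_norm hu h ?_
      rw [show lam * (t * (lam ^ (n + 1 + 1))⁻¹) = t * (lam ^ (n + 1))⁻¹ by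
        rw [pow_succ lam (n + 1)]; field_simp, ih, norm_one]
  have hd := hasDerivAt_complexMGF (X := id) (μ := limLaw u lam r 0) (z := 0) (by
    rw [integrableExpSet_limLaw hu h]; trivial)
  have hr0 : ∫ x, (((id x : ℝ) : ℂ)) * Complex.exp (0 * ((id x : ℝ) : ℂ)) ∂(limLaw u lam r 0) ≠ 0 := by
    simp only [zero_mul, Complex.exp_zero, mul_one, id]
    rw [integral_complex_ofReal, (mean_limLaw hu h 0).2]
    exact_mod_cast (h.right_pos 0).ne'
  have hne := hd.eventually_ne (c := 1) hr0
  have htend : Tendsto (fun n : ℕ => ((t * (lam ^ (n + 1))⁻¹ : ℝ) : ℂ) * Complex.I) atTop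
      (𝓝[≠] 0) := by
    refine tendsto_nhdsWithin_of_tendsto_nhds_of_eventually_within _ ?_ (Eventually.of_forall
      fun n => ?_)
    · have h2 : Tendsto (fun n : ℕ => t * (lam ^ (n + 1))⁻¹) atTop (𝓝 (t * 0)) := by
        refine Tendsto.const_mul _ ?_
        exact ((tendsto_pow_atTop_atTop_of_one_lt (by linarith)).comp
          (tendsto_add_atTop_nat 1)).inv_tendsto_atTop
      have h3 := ((Complex.continuous_ofReal.tendsto _).comp h2).mul_const Complex.I
      simpa using h3
    · have : t * (lam ^ (n + 1))⁻¹ ≠ 0 := mul_ne_zero ht (by positivity)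
      exact mul_ne_zero (by exact_mod_cast this) Complex.I_ne_zero
  obtain ⟨n, hn⟩ := (htend.eventually hne).exists
  rw [complexMGF_id_mul_I] at hn
  exact hn (hstep n)

lemma maxChar_lt_one (hu : 0 ≤ u) (h : IsPerronTriple (mean u) lam r l) {t : ℝ} (ht : t ≠ 0) :
    maxChar u lam r t < 1 := by
  have hl : 0 < lam := by linarith [(perron_bounds hu h).1]
  refine max_lt (norm_charFun_zero_lt hu h ht) (lt_of_le_of_ne (norm_charFun_le_one _) fun h1 => ?_)
  obtain ⟨t', rfl⟩ : ∃ t', t = lam * t' := ⟨lam⁻¹ * t, by field_simp⟩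
  have ht' : t' ≠ 0 := fun h0 => ht (by rw [h0, mul_zero])
  rw [charFun_limLaw_mul hu h, gen] at h1
  simp only [mul_assoc] at h1
  have ha : ∀ z : ℕ × ℕ, ‖charFun (limLaw u lam r 0) t' ^ z.1 *
      charFun (limLaw u lam r 1) t' ^ z.2‖ ≤ 1 := fun z => by
    rw [norm_mul, norm_pow, norm_pow]
    exact mul_le_one₀ (pow_le_one₀ (norm_nonneg _) (norm_charFun_le_one _)) (by positivity)
      (pow_le_one₀ (norm_nonneg _) (norm_charFun_le_one _))
  have e := eq_sum_of_norm_sum_eq_one hu (j := 1) ha h1 (offspring_values hu).2.2.2.2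
  replace h1 := (congrArg norm e).trans h1
  simp only [pow_one, norm_mul] at h1
  have h2 := norm_charFun_zero_lt hu h ht'
  have h3 : ‖charFun (limLaw u lam r 1) t'‖ ≤ 1 := norm_charFun_le_one _
  nlinarith [norm_nonneg (charFun (limLaw u lam r 0) t')]

lemma exists_maxChar_le (hu : 0 ≤ u) (h : IsPerronTriple (mean u) lam r l) :
    ∃ K : ℝ, ∀ t : ℝ, maxChar u lam r t ≤ K * (1 + t ^ 2)⁻¹ := by
  obtain ⟨hl2, hl3, -⟩ := perron_bounds hu h
  have hl : 0 < lam := by linarith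
  obtain ⟨s, hs, hmax⟩ := isCompact_Icc.exists_isMaxOn (Set.nonempty_Icc.2 (by linarith : 1 ≤ lam))
    (continuous_maxChar (u := u) (lam := lam) (r := r)).continuousOn
  set q := maxChar u lam r s with hq
  have hq1 : q < 1 := maxChar_lt_one hu h (by linarith [hs.1])
  have hq0 : 0 ≤ q := maxChar_nonneg _
  obtain ⟨K, hK⟩ := (tendsto_pow_const_mul_const_pow_of_abs_lt_one 4
    (by rwa [abs_of_nonneg hq0] : |q| < 1)).bddAbove_range
  have hK' : ∀ m : ℕ, (m : ℝ) ^ 4 * q ^ m ≤ K := fun m => hK ⟨m, rfl⟩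
  have hK0 : 0 ≤ K := by simpa using hK' 0
  have hpow : ∀ (n : ℕ) (t : ℝ), t ∈ Icc (lam ^ n) (lam ^ (n + 1)) →
      maxChar u lam r t ≤ q ^ 2 ^ n := by
    intro n
    induction n with
    | zero => intro t ht; simpa using hmax (by simpa using ht)
    | succ n ih =>
      intro t ht
      have e : t = lam * (t / lam) := by field_simp
      rw [e]
      refine (maxChar_mul_le hu h _).trans ?_
      rw [pow_succ 2 n, pow_mul]
      refine pow_le_pow_left₀ (maxChar_nonneg _) (ih _ ⟨?_, ?_⟩) 2
      · rw [le_div_iff₀ hl, ← pow_succ]; exact ht.1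
      · rw [div_le_iff₀ hl, ← pow_succ]; exact ht.2
  have hpos : ∀ t : ℝ, 0 ≤ t → maxChar u lam r t * (1 + t ^ 2) ≤ 2 + 9 * K := by
    intro t ht
    rcases le_total t 1 with h1 | h1
    · have : maxChar u lam r t * (1 + t ^ 2) ≤ 1 * 2 :=
        mul_le_mul (maxChar_le_one t) (by nlinarith) (by positivity) zero_le_one
      linarith
    · obtain ⟨n, hn1, hn2⟩ := exists_nat_pow_near h1 (by linarith : 1 < lam)
      have h2 := hpow n t ⟨hn1, hn2.le⟩
      have h3 : t ^ 2 ≤ 9 * ((2 ^ n : ℕ) : ℝ) ^ 4 := by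
        calc t ^ 2 ≤ (lam ^ (n + 1)) ^ 2 := pow_le_pow_left₀ ht hn2.le 2
          _ ≤ ((3 : ℝ) ^ (n + 1)) ^ 2 :=
            pow_le_pow_left₀ (by positivity) (pow_le_pow_left₀ hl.le hl3.le _) 2
          _ = 9 * 9 ^ n := by rw [← pow_mul, mul_comm, pow_mul, pow_succ]; norm_num; ring
          _ ≤ 9 * 16 ^ n := by gcongr; norm_num
          _ = _ := by push_cast; rw [← pow_mul, mul_comm n 4, pow_mul]; norm_num
      have h4 : maxChar u lam r t * t ^ 2 ≤ 9 * K := by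
        calc maxChar u lam r t * t ^ 2 ≤ q ^ 2 ^ n * (9 * ((2 ^ n : ℕ) : ℝ) ^ 4) :=
            mul_le_mul h2 h3 (sq_nonneg t) (by positivity)
          _ = 9 * (((2 ^ n : ℕ) : ℝ) ^ 4 * q ^ 2 ^ n) := by ring
          _ ≤ 9 * K := by linarith [hK' (2 ^ n)]
      linarith [maxChar_le_one (u := u) (lam := lam) (r := r) t]
  refine ⟨2 + 9 * K, fun t => ?_⟩
  rw [← div_eq_mul_inv, le_div_iff₀ (by positivity)]
  rcases le_total 0 t with ht | ht
  · exact hpos t ht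
  · have := hpos (-t) (by linarith)
    rwa [maxChar_neg, neg_sq] at this

lemma integrable_charFun_limLaw (hu : 0 ≤ u) (h : IsPerronTriple (mean u) lam r l) (j : Fin 2) :
    Integrable (charFun (limLaw u lam r j)) := by
  obtain ⟨K, hK⟩ := exists_maxChar_le hu h
  exact (integrable_inv_one_add_sq.const_mul K).mono' continuous_charFun.aestronglyMeasurable
    (ae_of_all _ fun t => (norm_charFun_le_maxChar j t).trans (hK t))

end Decay

/-! ### The density of a measure with integrable characteristic function -/

section Density

open scoped FourierTransform

variable {μ : Measure ℝ} [IsProbabilityMeasure μ]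

/-- The Gaussian kernel. -/
def gaussKer (c z : ℝ) : ℝ := √(Real.pi * c) * exp (-(Real.pi ^ 2 * c) * z ^ 2)

lemma gaussKer_nonneg (c z : ℝ) : 0 ≤ gaussKer c z := by unfold gaussKer; positivity

lemma continuous_gaussKer (c : ℝ) : Continuous (gaussKer c) := by unfold gaussKer; fun_prop

lemma lintegral_gaussKer {c : ℝ} (hc : 0 < c) : ∫⁻ z, ofReal (gaussKer c z) = 1 := by
  have hpi := Real.pi_pos
  have hb : 0 < Real.pi ^ 2 * c := by positivity
  unfold gaussKer
  rw [← ofReal_integral_eq_lintegral_ofReal ((integrable_exp_neg_mul_sq hb).const_mul _)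
    (ae_of_all _ fun z => gaussKer_nonneg c z), integral_const_mul, integral_gaussian, ← Real.sqrt_mul (by positivity)]
  have : Real.pi * c * (Real.pi / (Real.pi ^ 2 * c)) = 1 := by field_simp
  rw [this, Real.sqrt_one, ofReal_one]

lemma gaussKer_le (c z : ℝ) (hc : 0 < c) : gaussKer c z ≤ √(Real.pi * c) := by
  unfold gaussKer
  refine mul_le_of_le_one_right (Real.sqrt_nonneg _) (Real.exp_le_one_iff.2 ?_)
  have : 0 ≤ Real.pi ^ 2 * c * z ^ 2 := by positivity
  linarith

lemma integrable_gaussKer {c : ℝ} (hc : 0 < c) (x : ℝ) :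
    Integrable (fun y => gaussKer c (y - x)) μ := by
  refine (integrable_const (√(Real.pi * c))).mono'
    ((continuous_gaussKer c).comp (by fun_prop)).aestronglyMeasurable (ae_of_all _ fun y => ?_)
  rw [Real.norm_of_nonneg (gaussKer_nonneg _ _)]
  exact gaussKer_le _ _ hc

lemma integral_gauss_charFun {c : ℝ} (hc : 0 < c) (x : ℝ) :
    ∫ ξ : ℝ, Complex.exp (-(c : ℂ)⁻¹ * ‖ξ‖ ^ 2) • (Complex.exp (↑(-2 * Real.pi * ξ * x) * Complex.I) •
      charFun μ (2 * Real.pi * ξ)) = ((∫ y, gaussKer c (y - x) ∂μ : ℝ) : ℂ) := by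
  have e1 : ∀ ξ : ℝ, Complex.exp (-(c : ℂ)⁻¹ * ‖ξ‖ ^ 2) •
      (Complex.exp (↑(-2 * Real.pi * ξ * x) * Complex.I) • charFun μ (2 * Real.pi * ξ)) =
      ∫ y, Complex.exp (Complex.I * (2 * Real.pi * (y - x) : ℝ) * ξ) *
        Complex.exp (-(c : ℂ)⁻¹ * ξ ^ 2) ∂μ := by
    intro ξ
    rw [charFun_apply_real, smul_eq_mul, smul_eq_mul, ← integral_const_mul, ← integral_const_mul]
    congr 1
    funext y
    have : ((‖ξ‖ : ℝ) : ℂ) ^ 2 = (ξ : ℂ) ^ 2 := by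
      rw [← Complex.ofReal_pow, Real.norm_eq_abs, sq_abs, Complex.ofReal_pow]
    rw [this, ← Complex.exp_add, ← Complex.exp_add, ← Complex.exp_add]
    congr 1
    push_cast
    ring
  simp only [e1]
  have hint : Integrable (uncurry fun (ξ y : ℝ) =>
      Complex.exp (Complex.I * (2 * Real.pi * (y - x) : ℝ) * ξ) *
        Complex.exp (-(c : ℂ)⁻¹ * ξ ^ 2)) ((volume : Measure ℝ).prod μ) := by
    have h1 := (integrable_exp_neg_mul_sq (inv_pos.2 hc)).mul_prod (integrable_const (1 : ℝ) (μ := μ))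
    refine h1.mono' (Continuous.aestronglyMeasurable (by fun_prop)) (ae_of_all _ fun p => ?_)
    simp only [uncurry, norm_mul, Complex.norm_exp, mul_one]
    refine le_of_eq ?_
    have h2 : (Complex.I * ((2 * Real.pi * (p.2 - x) : ℝ) : ℂ) * (p.1 : ℂ)).re = 0 := by
      rw [mul_assoc, ← Complex.ofReal_mul, Complex.I_mul_re, Complex.ofReal_im, neg_zero]
    have h3 : (-(c : ℂ)⁻¹ * (p.1 : ℂ) ^ 2).re = -c⁻¹ * p.1 ^ 2 := by
      rw [← Complex.ofReal_inv, ← Complex.ofReal_neg, ← Complex.ofReal_pow, ← Complex.ofReal_mul,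
        Complex.ofReal_re]
    rw [h2, h3, exp_zero, one_mul]
  rw [integral_integral_swap hint, ← integral_complex_ofReal]
  congr 1
  funext y
  have hre : 0 < ((c : ℂ)⁻¹).re := by
    rw [← Complex.ofReal_inv, Complex.ofReal_re]; exact inv_pos.2 hc
  rw [fourierIntegral_gaussian hre, gaussKer]
  have hc' : (c : ℂ) ≠ 0 := by exact_mod_cast hc.ne'
  have h4 : (Real.pi / (c : ℂ)⁻¹) ^ (1 / 2 : ℂ) = ((√(Real.pi * c) : ℝ) : ℂ) := by
    rw [Real.sqrt_eq_rpow, Complex.ofReal_cpow (by positivity)]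
    push_cast
    rw [div_inv_eq_mul]
  rw [h4]
  push_cast
  congr 2
  field_simp
  ring

lemma exists_continuous_density (h : Integrable (charFun μ)) : ∃ f : ℝ → ℝ, Continuous f ∧
    (∀ x, 0 ≤ f x) ∧ μ = volume.withDensity fun x => ofReal (f x) := by
  have hpi := Real.pi_pos
  set G : ℝ → ℂ := fun ξ => charFun μ (2 * Real.pi * ξ) with hG
  have hGi : Integrable G := h.comp_mul_left' (by positivity)
  have hGc : Continuous G := continuous_charFun.comp (by fun_prop)
  have hFc : Continuous (𝓕 G) := VectorFourier.fourierIntegral_continuous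
    Real.continuous_fourierChar (by exact continuous_inner) hGi
  have hlim : ∀ x, Tendsto (fun n : ℕ => ((∫ y, gaussKer (n + 1 : ℝ) (y - x) ∂μ : ℝ) : ℂ)) atTop
      (𝓝 (𝓕 G x)) := by
    intro x
    have hi : Integrable fun ξ : ℝ =>
        Complex.exp (↑(-2 * Real.pi * ξ * x) * Complex.I) • G ξ := by
      refine hGi.norm.mono' (Continuous.aestronglyMeasurable (by fun_prop)) (ae_of_all _ fun ξ => ?_)
      rw [norm_smul, Complex.norm_exp_ofReal_mul_I, one_mul]
    have h1 := (Real.tendsto_integral_cexp_sq_smul hi).comp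
      (tendsto_atTop_add_const_right atTop (1 : ℝ) tendsto_natCast_atTop_atTop)
    rw [Real.fourier_real_eq_integral_exp_smul]
    refine h1.congr fun n => ?_
    rw [Function.comp_apply, ← integral_gauss_charFun (by positivity) x]
    simp only [Complex.ofReal_inv, hG]
  set f : ℝ → ℝ := fun x => (𝓕 G x).re with hf
  have hflim : ∀ x, Tendsto (fun n : ℕ => ∫ y, gaussKer (n + 1 : ℝ) (y - x) ∂μ) atTop (𝓝 (f x)) :=
    fun x => ((Complex.continuous_re.tendsto _).comp (hlim x)).congr fun n => Complex.ofReal_re _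
  have hfF : ∀ x, 𝓕 G x = (f x : ℂ) := fun x => by
    refine Complex.ext (by simp [hf]) ?_
    have := tendsto_nhds_unique ((Complex.continuous_im.tendsto _).comp (hlim x))
      (tendsto_const_nhds.congr fun n => by simp : Tendsto _ atTop (𝓝 (0 : ℝ)))
    simpa using this
  have hfc : Continuous f := Complex.continuous_re.comp hFc
  have hf0 : ∀ x, 0 ≤ f x := fun x =>
    ge_of_tendsto' (hflim x) fun n => integral_nonneg fun y => gaussKer_nonneg _ _
  have hfle : ∫⁻ x, ofReal (f x) ≤ 1 := by
    have e : ∀ (n : ℕ) x, ofReal (∫ y, gaussKer (n + 1 : ℝ) (y - x) ∂μ) =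
        ∫⁻ y, ofReal (gaussKer (n + 1 : ℝ) (y - x)) ∂μ := fun n x =>
      ofReal_integral_eq_lintegral_ofReal (integrable_gaussKer (by positivity) x)
        (ae_of_all _ fun y => gaussKer_nonneg _ _)
    have hm : ∀ n : ℕ, Measurable fun p : ℝ × ℝ =>
        ofReal (gaussKer (n + 1 : ℝ) (p.2 - p.1)) := fun n =>
      ENNReal.measurable_ofReal.comp ((continuous_gaussKer _).comp (by fun_prop)).measurable
    have h1 : ∀ n : ℕ, ∫⁻ x, ofReal (∫ y, gaussKer (n + 1 : ℝ) (y - x) ∂μ) = 1 := by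
      intro n
      simp only [e]
      rw [lintegral_lintegral_swap (hm n).aemeasurable]
      simp_rw [lintegral_sub_left_eq_self (fun z => ofReal (gaussKer (n + 1 : ℝ) z)),
        lintegral_gaussKer (by positivity : (0 : ℝ) < n + 1)]
      simp
    calc ∫⁻ x, ofReal (f x)
        = ∫⁻ x, liminf (fun n : ℕ => ofReal (∫ y, gaussKer (n + 1 : ℝ) (y - x) ∂μ)) atTop :=
          lintegral_congr fun x => ((ENNReal.tendsto_ofReal (hflim x)).liminf_eq).symm
      _ ≤ liminf (fun n : ℕ => ∫⁻ x, ofReal (∫ y, gaussKer (n + 1 : ℝ) (y - x) ∂μ)) atTop :=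
          lintegral_liminf_le fun n => by
            simp only [e]
            exact (hm n).lintegral_prod_right'
      _ = 1 := by simp [h1]
  have hfi : Integrable f := by
    refine ⟨hfc.aestronglyMeasurable, ?_⟩
    rw [hasFiniteIntegral_iff_ofReal (ae_of_all _ hf0)]
    exact hfle.trans_lt ENNReal.one_lt_top
  have hFi : Integrable (𝓕 G) := by
    rw [show 𝓕 G = fun x => (f x : ℂ) from funext hfF]
    exact hfi.ofReal
  have : IsFiniteMeasure (volume.withDensity fun x => ofReal (f x)) :=
    isFiniteMeasure_withDensity_ofReal hfi.2
  refine ⟨f, hfc, hf0, Measure.ext_of_charFun (funext fun t => ?_)⟩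
  have hinv := congrFun (hGc.fourierInv_fourier_eq hGi hFi) (t / (2 * Real.pi))
  have e1 : G (t / (2 * Real.pi)) = charFun μ t := by
    rw [hG]; field_simp
  rw [← e1, ← hinv, Real.fourierInv_eq', charFun_apply_real,
    integral_withDensity_eq_integral_toReal_smul (by fun_prop) (ae_of_all _ fun x =>
      ENNReal.ofReal_lt_top)]
  refine integral_congr_ae (ae_of_all _ fun x => ?_)
  simp only [toReal_ofReal (hf0 x), hfF]
  rw [smul_eq_mul, Complex.real_smul, mul_comm]
  congr 2
  simp only [RCLike.inner_apply, conj_trivial]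
  push_cast
  field_simp

end Density

/-! ### Positivity of the densities -/

section Positivity

/-- Near `x`, the measure is bounded below by a multiple of Lebesgue measure. -/
def Thick (μ : Measure ℝ) (x : ℝ) : Prop :=
  ∃ c : ℝ≥0∞, c ≠ 0 ∧ ∃ η : ℝ, 0 < η ∧
    ∀ E, MeasurableSet E → E ⊆ ball x η → c * volume E ≤ μ E

lemma Thick.measure_ball_pos {μ : Measure ℝ} {x : ℝ} (h : Thick μ x) {δ : ℝ} (hδ : 0 < δ) :
    0 < μ (ball x δ) := by
  obtain ⟨c, hc, η, hη, hE⟩ := h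
  have h1 := hE (ball x (min δ η)) measurableSet_ball
    (ball_subset_ball (min_le_right _ _))
  refine lt_of_lt_of_le ?_ (h1.trans (measure_mono (ball_subset_ball (min_le_left _ _))))
  exact ENNReal.mul_pos hc (Metric.measure_ball_pos _ _ (lt_min hδ hη)).ne'

lemma Thick.conv {μ ν : Measure ℝ} [SFinite μ] {x b : ℝ} (h : Thick μ x)
    (hb : ∀ δ : ℝ, 0 < δ → 0 < ν (ball b δ)) : Thick (ν ∗ μ) (b + x) := by
  obtain ⟨c, hc, η, hη, hE⟩ := h
  refine ⟨c * ν (ball b (η / 2)), mul_ne_zero hc (hb _ (by positivity)).ne', η / 2,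
    by positivity, fun E hEm hEs => ?_⟩
  have h1 : (ν ∗ μ) E = ∫⁻ y, μ ((fun z => y + z) ⁻¹' E) ∂ν := by
    rw [← lintegral_indicator_one hEm, Measure.lintegral_conv (measurable_one.indicator hEm)]
    refine lintegral_congr fun y => ?_
    rw [← lintegral_indicator_one (hEm.preimage (measurable_const_add y))]
    rfl
  have h2 : ∀ y ∈ ball b (η / 2), c * volume E ≤ μ ((fun z => y + z) ⁻¹' E) := by
    intro y hy
    have := hE ((fun z => y + z) ⁻¹' E) (hEm.preimage (measurable_const_add y)) fun z hz => by
      have h3 := mem_ball.1 (hEs hz)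
      rw [mem_ball, Real.dist_eq] at *
      have h4 : z - x = (y + z - (b + x)) - (y - b) := by ring
      rw [h4]
      refine (abs_sub _ _).trans_lt ?_
      linarith
    rwa [measure_preimage_add] at this
  rw [h1]
  calc c * ν (ball b (η / 2)) * volume E
      = ∫⁻ y in ball b (η / 2), c * volume E ∂ν := by
        rw [setLIntegral_const]; ring
    _ ≤ ∫⁻ y in ball b (η / 2), μ ((fun z => y + z) ⁻¹' E) ∂ν :=
        setLIntegral_mono' measurableSet_ball h2
    _ ≤ _ := setLIntegral_le_lintegral _ _

lemma Thick.of_scale {μ ν : Measure ℝ} {p : ℝ≥0∞} (hp : p ≠ 0) {lam : ℝ} (hl : 0 < lam)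
    (hle : ∀ E, MeasurableSet E → p * ν E ≤ μ ((fun x => lam * x) ⁻¹' E)) {x : ℝ}
    (h : Thick ν x) : Thick μ (x / lam) := by
  obtain ⟨c, hc, η, hη, hE⟩ := h
  refine ⟨p * (c * ofReal lam), mul_ne_zero hp (mul_ne_zero hc (by simpa using hl)),
    η / lam, by positivity, fun E hEm hEs => ?_⟩
  set E' := (fun x => lam⁻¹ * x) ⁻¹' E with hE'
  have hm : MeasurableSet E' := hEm.preimage (by fun_prop)
  have e1 : (fun x => lam * x) ⁻¹' E' = E := by
    ext y
    simp [hE', hl.ne']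
  have h1 := hle E' hm
  rw [e1] at h1
  have h2 := hE E' hm fun y hy => by
    have h3 := mem_ball.1 (hEs hy)
    rw [mem_ball, Real.dist_eq] at *
    have h4 : y - x = lam * (lam⁻¹ * y - x / lam) := by field_simp
    rw [h4, abs_mul, abs_of_pos hl]
    rwa [lt_div_iff₀ hl, mul_comm] at h3
  rw [hE', Real.volume_preimage_mul_left (inv_ne_zero hl.ne'), inv_inv, abs_of_pos hl] at h2
  refine le_trans (le_of_eq ?_) ((mul_le_mul_right h2 p).trans h1)
  ring

variable {μ : Measure ℝ} {f : ℝ → ℝ}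

lemma thick_of_density (hf : Continuous f) (hμ : μ = volume.withDensity fun x =>
    ofReal (f x)) {x : ℝ} (hx : 0 < f x) : Thick μ x := by
  obtain ⟨η, hη, hb⟩ := Metric.eventually_nhds_iff_ball.1
    (hf.continuousAt.eventually_const_lt (half_lt_self hx))
  refine ⟨ofReal (f x / 2), by simpa using hx, η, hη, fun E hEm hE => ?_⟩
  rw [hμ, withDensity_apply _ hEm, ← setLIntegral_const]
  exact setLIntegral_mono' hEm fun y hy => ofReal_le_ofReal (hb y (hE hy)).le

lemma pos_of_thick (hf : Continuous f) (hμ : μ = volume.withDensity fun x =>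
    ofReal (f x)) {x : ℝ} (h : Thick μ x) : 0 < f x := by
  by_contra hx
  push Not at hx
  obtain ⟨c, hc, η, hη, hE⟩ := h
  obtain ⟨c', hc'0, hc'⟩ : ∃ c' : ℝ, 0 < c' ∧ ofReal c' < c := by
    obtain ⟨q, hq0, hqc⟩ := ENNReal.lt_iff_exists_nnreal_btwn.1 (pos_iff_ne_zero.2 hc)
    exact ⟨q, by simpa using hq0, by simpa using hqc⟩
  obtain ⟨δ, hδ, hb⟩ := Metric.eventually_nhds_iff_ball.1
    (hf.continuousAt.eventually_lt_const (hx.trans_lt hc'0))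
  set E := ball x (min δ η)
  have hv0 : volume E ≠ 0 := (Metric.measure_ball_pos _ _ (lt_min hδ hη)).ne'
  have hv1 : volume E ≠ ∞ := measure_ball_lt_top.ne
  have h1 := hE E measurableSet_ball (ball_subset_ball (min_le_right _ _))
  have h2 : μ E ≤ ofReal c' * volume E := by
    rw [hμ, withDensity_apply _ measurableSet_ball, ← setLIntegral_const]
    exact setLIntegral_mono' measurableSet_ball fun y hy => ofReal_le_ofReal
      (hb y (ball_subset_ball (min_le_left _ _) hy)).le
  exact absurd ((ENNReal.mul_le_mul_iff_left hv0 hv1).1 (h1.trans h2)) (not_le.2 hc')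

lemma mul_div_pow_mem {A : Set ℝ} {lam : ℝ} (hl : 0 < lam)
    (h2 : ∀ a ∈ A, ∀ b ∈ A, (a + b) / lam ∈ A)
    (h3 : ∀ a ∈ A, ∀ b ∈ A, ∀ c ∈ A, (a + (b + c)) / lam ∈ A) {a : ℝ} (ha : a ∈ A) (n : ℕ) :
    ∀ N : ℕ, 2 ^ n ≤ N → N ≤ 3 ^ n → N * a / lam ^ n ∈ A := by
  induction n with
  | zero =>
    intro N h h'
    obtain rfl : N = 1 := by simp at h h'; omega
    simpa
  | succ n ih =>
    intro N hN hN'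
    have hpow : 3 * 2 ^ n ≤ 2 * 3 ^ n + 1 := by
      clear * -
      induction n with
      | zero => norm_num
      | succ n ih =>
        have : 1 ≤ 3 ^ n := Nat.one_le_pow _ _ (by norm_num)
        rw [pow_succ, pow_succ]
        omega
    have h32 : 2 ^ n ≤ 3 ^ n := Nat.pow_le_pow_left (by norm_num) n
    rw [pow_succ] at hN hN'
    by_cases hc : N ≤ 2 * 3 ^ n
    · have := h2 _ (ih (N / 2) (by omega) (by omega)) _ (ih ((N + 1) / 2) (by omega) (by omega))
      convert this using 1
      have e : (N : ℝ) = ((N / 2 : ℕ) : ℝ) + (((N + 1) / 2 : ℕ) : ℝ) := by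
        rw [← Nat.cast_add]; congr 1; omega
      rw [e, pow_succ]
      field_simp
    · have := h3 _ (ih (N / 3) (by omega) (by omega)) _ (ih ((N + 1) / 3) (by omega) (by omega)) _
        (ih ((N + 2) / 3) (by omega) (by omega))
      convert this using 1
      have e : (N : ℝ) = ((N / 3 : ℕ) : ℝ) + ((((N + 1) / 3 : ℕ) : ℝ) + (((N + 2) / 3 : ℕ) : ℝ)) := by
        rw [← Nat.cast_add, ← Nat.cast_add]; congr 1; omega
      rw [e, pow_succ]
      field_simp

lemma mem_of_closed_sums {A : Set ℝ} {lam : ℝ} (hl2 : 2 < lam) (hl3 : lam < 3)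
    (h2 : ∀ a ∈ A, ∀ b ∈ A, (a + b) / lam ∈ A)
    (h3 : ∀ a ∈ A, ∀ b ∈ A, ∀ c ∈ A, (a + (b + c)) / lam ∈ A) (hA : IsOpen A) {x : ℝ}
    (hx : x ∈ A) (hx0 : 0 < x) {y : ℝ} (hy : 0 < y) : y ∈ A := by
  have hl : 0 < lam := by linarith
  set s : ℕ → ℝ := fun n => y / x * lam ^ n with hs
  have hs0 : ∀ n, 0 < s n := fun n => by positivity
  have hs_top : Tendsto s atTop atTop :=
    (tendsto_pow_atTop_atTop_of_one_lt (by linarith)).const_mul_atTop (by positivity)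
  have e1 : ∀ᶠ n in atTop, (2 : ℝ) ^ n ≤ s n := by
    have := ((tendsto_pow_atTop_atTop_of_one_lt (by rw [lt_div_iff₀ two_pos]; linarith :
      1 < lam / 2)).const_mul_atTop (by positivity : 0 < y / x)).eventually_ge_atTop 1
    filter_upwards [this] with n hn
    rwa [div_pow, mul_div_assoc', le_div_iff₀ (by positivity), one_mul] at hn
  have e2 : ∀ᶠ n in atTop, s n ≤ (3 : ℝ) ^ n := by
    have h := (tendsto_pow_atTop_nhds_zero_of_lt_one (r := lam / 3) (by positivity)
      (by rw [div_lt_one three_pos]; exact hl3)).const_mul (y / x)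
    rw [mul_zero] at h
    filter_upwards [h.eventually_lt_const one_pos] with n hn
    rw [div_pow, mul_div_assoc', div_lt_one (by positivity)] at hn
    exact hn.le
  have hfl := (tendsto_nat_floor_div_atTop (R := ℝ)).comp hs_top
  have h4 : Tendsto (fun n => x / ((⌊s n⌋₊ : ℝ) / s n)) atTop (𝓝 (x / 1)) :=
    tendsto_const_nhds.div hfl one_ne_zero
  rw [div_one] at h4
  obtain ⟨n, hn1, hn2, hn3⟩ := (e1.and (e2.and (h4.eventually (hA.mem_nhds hx)))).exists
  have hN1 : 2 ^ n ≤ ⌊s n⌋₊ := Nat.le_floor (by exact_mod_cast hn1)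
  have hN2 : ⌊s n⌋₊ ≤ 3 ^ n := by
    exact_mod_cast (Nat.floor_le (hs0 n).le).trans hn2
  generalize ⌊s n⌋₊ = N at hN1 hN2 hn3
  have := mul_div_pow_mem hl h2 h3 hn3 n _ hN1 hN2
  convert this using 1
  have hN0 : (0 : ℝ) < (N : ℝ) := by
    have : 0 < 2 ^ n := by positivity
    exact_mod_cast this.trans_le hN1
  have h5 : s n = y / x * lam ^ n := rfl
  rw [div_div_eq_mul_div, h5]
  field_simp

end Positivity

section Identity

variable {u : ℝ} {lam : ℝ} {r l : Fin 2 → ℝ}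

/-- The powers of a measure with respect to convolution. -/
def convPow (μ : Measure ℝ) : ℕ → Measure ℝ
  | 0 => Measure.dirac 0
  | n + 1 => μ ∗ convPow μ n

instance (μ : Measure ℝ) [IsProbabilityMeasure μ] (n : ℕ) : IsProbabilityMeasure (convPow μ n) := by
  induction n with
  | zero => unfold convPow; infer_instance
  | succ n ih => unfold convPow; infer_instance

lemma charFun_convPow (μ : Measure ℝ) [IsProbabilityMeasure μ] (n : ℕ) (t : ℝ) :
    charFun (convPow μ n) t = charFun μ t ^ n := by
  induction n with
  | zero => simp [convPow]
  | succ n ih => rw [convPow, charFun_conv, ih, pow_succ']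

lemma limLaw_map_mul (hu : 0 ≤ u) (h : IsPerronTriple (mean u) lam r l) (j : Fin 2) :
    (limLaw u lam r j).map (fun x => lam * x) = ∑ z ∈ box, off u j z •
      (convPow (limLaw u lam r 0) z.1 ∗ convPow (limLaw u lam r 1) z.2) := by
  have hfin : ∀ z : ℕ × ℕ, IsFiniteMeasure (off u j z •
      (convPow (limLaw u lam r 0) z.1 ∗ convPow (limLaw u lam r 1) z.2)) := fun z =>
    ⟨by simpa using PMF.apply_lt_top _ _⟩
  have : IsFiniteMeasure (∑ z ∈ box, off u j z •
      (convPow (limLaw u lam r 0) z.1 ∗ convPow (limLaw u lam r 1) z.2)) := inferInstance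
  have : IsFiniteMeasure ((limLaw u lam r j).map (fun x => lam * x)) := inferInstance
  refine Measure.ext_of_charFun (funext fun t => ?_)
  rw [charFun_map_mul, charFun_limLaw_mul hu h, gen,
    charFun_apply_real (μ := ∑ z ∈ box, _), integral_finsetSum_measure]
  · refine sum_congr rfl fun z _ => ?_
    rw [integral_smul_measure, ← charFun_apply_real, charFun_conv, charFun_convPow, charFun_convPow,
      Complex.real_smul, mul_assoc]
    rfl
  · intro z _
    refine (integrable_const (1 : ℝ)).mono' (Continuous.aestronglyMeasurable (by fun_prop))
      (ae_of_all _ fun x => ?_)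
    rw [← Complex.ofReal_mul, Complex.norm_exp_ofReal_mul_I]

lemma limLaw_scale (hu : 0 ≤ u) (h : IsPerronTriple (mean u) lam r l) (j : Fin 2) {z : ℕ × ℕ}
    (hz : z ∈ (off u j).support) (E : Set ℝ) (hE : MeasurableSet E) :
    off u j z * (convPow (limLaw u lam r 0) z.1 ∗ convPow (limLaw u lam r 1) z.2) E ≤
      limLaw u lam r j ((fun x => lam * x) ⁻¹' E) := by
  rw [← Measure.map_apply (measurable_const_mul lam) hE, limLaw_map_mul hu h,
    Measure.finsetSum_apply]
  exact single_le_sum (f := fun z => (off u j z •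
    (convPow (limLaw u lam r 0) z.1 ∗ convPow (limLaw u lam r 1) z.2)) E) (fun _ _ => zero_le)
    (box_of_mem_support hu hz)

lemma exists_density_limLaw (hu : 0 ≤ u) (h : IsPerronTriple (mean u) lam r l) (j : Fin 2) :
    ∃ f : ℝ → ℝ, Continuous f ∧ (∀ x, 0 < x → 0 < f x) ∧
      limLaw u lam r j = volume.withDensity fun x => ofReal (f x) := by
  obtain ⟨hl2, hl3, -⟩ := perron_bounds hu h
  have hl : 0 < lam := by linarith
  obtain ⟨o2, o3, -, -, o11⟩ := offspring_values hu
  choose f hfc hf0 hf using fun j => exists_continuous_density (integrable_charFun_limLaw hu h j)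
  have hthick : ∀ {j x}, Thick (limLaw u lam r j) x ↔ 0 < f j x := fun {j x} =>
    ⟨pos_of_thick (hfc j) (hf j), thick_of_density (hfc j) (hf j)⟩
  have hex : ∀ j, ∃ x, 0 < x ∧ 0 < f j x := by
    intro j
    by_contra hn
    push Not at hn
    have h1 : limLaw u lam r j (Ioi 0) = 0 := by
      rw [hf j, withDensity_apply _ measurableSet_Ioi]
      rw [setLIntegral_congr_fun (g := fun _ => 0) measurableSet_Ioi fun x hx =>
        ENNReal.ofReal_of_nonpos (hn x hx)]
      simp
    have h2 : ∫ x, x ∂(limLaw u lam r j) ≤ 0 := by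
      refine integral_nonpos_of_ae ?_
      have : ∀ᵐ x ∂(limLaw u lam r j), x ∉ Ioi (0 : ℝ) := measure_eq_zero_iff_ae_notMem.1 h1
      filter_upwards [this] with x hx
      exact not_lt.1 hx
    rw [(mean_limLaw hu h j).2] at h2
    exact absurd (h.right_pos j) (not_lt.2 h2)
  have hδ : ∀ δ : ℝ, 0 < δ → 0 < (Measure.dirac (0 : ℝ)) (ball 0 δ) := fun δ hδ => by
    rw [Measure.dirac_apply_of_mem (Metric.mem_ball_self hδ)]; exact one_pos
  have hpos0 : ∀ y, 0 < y → 0 < f 0 y := by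
    obtain ⟨x, hx0, hx⟩ := hex 0
    intro y hy
    refine mem_of_closed_sums (A := {x | 0 < f 0 x}) hl2 hl3 ?_ ?_
      (isOpen_lt continuous_const (hfc 0)) hx hx0 hy
    · intro a ha b hb
      refine hthick.1 (Thick.of_scale ((mem_support_iff _ _).1 o2) hl
        (limLaw_scale hu h 0 o2) ?_)
      simp only [convPow, Measure.conv_dirac_zero]
      exact (hthick.2 hb).conv fun δ => (hthick.2 ha).measure_ball_pos
    · intro a ha b hb c hc
      refine hthick.1 (Thick.of_scale ((mem_support_iff _ _).1 o3) hl
        (limLaw_scale hu h 0 o3) ?_)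
      simp only [convPow, Measure.conv_dirac_zero]
      exact ((hthick.2 hc).conv fun δ => (hthick.2 hb).measure_ball_pos).conv
        fun δ => (hthick.2 ha).measure_ball_pos
  have hpos1 : ∀ y, 0 < y → 0 < f 1 y := by
    have hstep : ∀ a b, 0 < a → 0 < f 1 b → 0 < f 1 ((a + b) / lam) := by
      intro a b ha hb
      refine hthick.1 (Thick.of_scale ((mem_support_iff _ _).1 o11) hl
        (limLaw_scale hu h 1 o11) ?_)
      simp only [convPow, Measure.conv_dirac_zero]
      exact (hthick.2 hb).conv fun δ => (hthick.2 (hpos0 a ha)).measure_ball_pos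
    obtain ⟨b, hb0, hb⟩ := hex 1
    have hiter : ∀ n : ℕ, ∀ y, b / lam ^ (n + 1) < y → 0 < f 1 y := by
      intro n
      induction n with
      | zero =>
        intro y hy
        have := hstep (lam * y - b) b (by
          rw [zero_add, pow_one, div_lt_iff₀ hl] at hy; linarith) hb
        rwa [sub_add_cancel, mul_div_cancel_left₀ _ hl.ne'] at this
      | succ n ih =>
        intro y hy
        have h1 : b / lam ^ (n + 1) < lam * y := by
          rw [pow_succ, ← div_div, div_lt_iff₀ hl] at hy; linarith
        obtain ⟨c, hc1, hc2⟩ := exists_between h1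
        have := hstep (lam * y - c) c (by linarith) (ih c hc1)
        rwa [sub_add_cancel, mul_div_cancel_left₀ _ hl.ne'] at this
    intro y hy
    have htend : Tendsto (fun n : ℕ => b / lam ^ (n + 1)) atTop (𝓝 0) :=
      ((tendsto_pow_atTop_atTop_of_one_lt (by linarith)).comp
        (tendsto_add_atTop_nat 1)).const_div_atTop b
    obtain ⟨n, hn⟩ := (htend.eventually_lt_const hy).exists
    exact hiter n y hn
  refine ⟨f j, hfc j, ?_, hf j⟩
  fin_cases j
  · exact hpos0
  · exact hpos1

end Identity

/-! ### The limits for the triangles of the skeleton -/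

section SkeletonLimit

variable {u : ℝ} {lam : ℝ} {r l : Fin 2 → ℝ} {M : ℕ} {v : List Pt}

/-- The normalized limit of the numbers of triangles in the `i`-th triangle of the skeleton. -/
def skeletonLimit (lam : ℝ) (r l : Fin 2 → ℝ) (M : ℕ) (v : List Pt)
    (i : Fin (skeleton M v).length) (ω : ℕ → List Pt) : Fin 2 → ℝ :=
  ((lam ^ M)⁻¹ * limSize lam r fun n => segCounts M v n (ω (M + n)) i) • l

lemma measurable_segCounts (M : ℕ) (v : List Pt) (i : Fin (skeleton M v).length) :
    Measurable fun (ω : ℕ → List Pt) n => segCounts M v n (ω (M + n)) i :=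
  measurable_pi_lambda _ fun n => (Measurable.of_discrete
    (f := fun y : List Pt => segCounts M v n y i)).comp (measurable_pi_apply (M + n))

lemma measurable_smul_limSize (lam : ℝ) (r l : Fin 2 → ℝ) (M : ℕ) :
    Measurable fun ζ : ℕ → ℕ × ℕ => ((lam ^ M)⁻¹ * limSize lam r ζ) • l :=
  ((measurable_limSize lam r).const_mul _).smul_const l

lemma measurable_skeletonLimit (lam : ℝ) (r l : Fin 2 → ℝ) (M : ℕ) (v : List Pt)
    (i : Fin (skeleton M v).length) : Measurable (skeletonLimit lam r l M v i) :=
  (measurable_smul_limSize lam r l M).comp (measurable_segCounts M v i)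

lemma skeletonLimit_spec (hu : 0 ≤ u) (h : IsPerronTriple (mean u) lam r l)
    {P : Measure (ℕ → List Pt)} [IsProbabilityMeasure P] (hP : IsCoupledLaw u P)
    (hv : P {ω | ω M = v} ≠ 0) :
    (∀ i, ∀ᵐ ω ∂(P[|{ω | ω M = v}]), Tendsto (fun N : ℕ => (lam ^ (M + N))⁻¹ •
      typeVec (M + N) (segmentIn M (ω (M + N)) ((skeleton M v).get i))) atTop
        (𝓝 (skeletonLimit lam r l M v i ω))) ∧
    iIndepFun (skeletonLimit lam r l M v) (P[|{ω | ω M = v}]) ∧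
    ∀ i, ∃ j : Fin 2, typeIn M v ((skeleton M v).get i) = (j : ℕ) + 1 ∧
      (P[|{ω | ω M = v}]).map (skeletonLimit lam r l M v i) =
        (limLaw u lam r j).map fun x => ((lam ^ M)⁻¹ * x) • l := by
  have : IsProbabilityMeasure (P[|{ω | ω M = v}]) := cond_isProbabilityMeasure hv
  obtain ⟨j, hj, hmap⟩ := map_segCounts hu hP hv
  have hm := measurable_segCounts M v
  have hi : ∀ i, (P[|{ω | ω M = v}]).map (fun ω n => segCounts M v n (ω (M + n)) i) =
      branchLaw u (j i) := fun i => by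
    rw [← (measurePreserving_eval (fun i => branchLaw u (j i)) i).map_eq, ← hmap,
      Measure.map_map (measurable_pi_apply i) (measurable_pi_lambda _ hm)]
    rfl
  refine ⟨fun i => ?_, ?_, fun i => ⟨j i, hj i, ?_⟩⟩
  · have h1 := ae_tendsto_toVec hu h (j i)
    rw [← hi i] at h1
    filter_upwards [ae_of_ae_map (hm i).aemeasurable h1] with ω hω
    have h2 := hω.const_smul (lam ^ M)⁻¹
    rw [← mul_smul] at h2
    refine h2.congr fun N => ?_
    rw [← mul_smul, ← mul_inv, ← pow_add]
    rfl
  · have h1 : iIndepFun (fun (i : Fin (skeleton M v).length) (ω : ℕ → List Pt) n =>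
        segCounts M v n (ω (M + n)) i) (P[|{ω | ω M = v}]) := by
      rw [iIndepFun_iff_map_fun_eq_pi_map fun i => (hm i).aemeasurable, hmap]
      simp only [hi]
    exact h1.comp (fun _ ζ => ((lam ^ M)⁻¹ * limSize lam r ζ) • l)
      fun _ => measurable_smul_limSize lam r l M
  · rw [limLaw, ← hi i, Measure.map_map (measurable_limSize lam r) (hm i),
      Measure.map_map ((measurable_const_mul _).smul_const l)
        ((measurable_limSize lam r).comp (hm i))]
    rfl

end SkeletonLimit

end Gasket

end

theorem mainTheorem7 (u : ℝ) (hu0 : 0 ≤ u) (hu1 : u ≤ 1) :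
    -- the larger eigenvalue with its eigenvectors, and the coupled law, exist
    (∃ (lam : ℝ) (r l : Fin 2 → ℝ), Gasket.IsPerronTriple (Gasket.meanMatrix u) lam r l ∧
      (0 < u → ∀ j, 0 < l j)) ∧
    (∃ P : Measure (ℕ → List Gasket.Pt), IsProbabilityMeasure P ∧ Gasket.IsCoupledLaw u P) ∧
    ∀ (lam : ℝ) (r l : Fin 2 → ℝ), Gasket.IsPerronTriple (Gasket.meanMatrix u) lam r l →
    ∀ P : Measure (ℕ → List Gasket.Pt), IsProbabilityMeasure P → Gasket.IsCoupledLaw u P →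
    ∃ (E : Type) (_ : MeasurableSpace E) (Q : Measure E) (B : Fin 2 → E → ℝ),
      IsProbabilityMeasure Q ∧ (∀ j, Measurable (B j)) ∧
      -- (1)-(3): conditionally on `Y_M = v`
      (∀ (M : ℕ) (v : List Gasket.Pt), v ∈ Gasket.Loopless M → P {ω | ω M = v} ≠ 0 →
        ∃ S : Fin (Gasket.skeleton M v).length → (ℕ → List Gasket.Pt) → (Fin 2 → ℝ),
          (∀ i, Measurable (S i)) ∧
          (∀ i, ∀ᵐ ω ∂(P[|{ω | ω M = v}]),
            Tendsto (fun N : ℕ => (lam ^ (M + N))⁻¹ •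
                Gasket.typeVec (M + N)
                  (Gasket.segmentIn M (ω (M + N)) ((Gasket.skeleton M v).get i)))
              atTop (𝓝 (S i ω))) ∧
          iIndepFun S (P[|{ω | ω M = v}]) ∧
          (∀ i, ∃ j : Fin 2,
            Gasket.typeIn M v ((Gasket.skeleton M v).get i) = (j : ℕ) + 1 ∧
            IdentDistrib (S i) (fun e => ((lam ^ M)⁻¹ * B j e) • l)
              (P[|{ω | ω M = v}]) Q)) ∧
      -- (4): positivity, mean and density
      (∀ j, (∀ᵐ e ∂Q, 0 < B j e) ∧ Integrable (B j) Q ∧ ∫ e, B j e ∂Q = r j ∧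
        ∃ f : ℝ → ℝ, Measurable f ∧ (∀ x, 0 < x → 0 < f x) ∧
          Q.map (B j) =
            (volume.restrict (Set.Ioi 0)).withDensity (fun x => ENNReal.ofReal (f x))) ∧
      -- (5): the Laplace transforms
      ∃ g : Fin 2 → ℂ → ℂ,
        (∀ j t, Integrable (fun e => Complex.exp (-t * (B j e : ℂ))) Q ∧
          g j t = ∫ e, Complex.exp (-t * (B j e : ℂ)) ∂Q) ∧
        (∀ j, Differentiable ℂ (g j)) ∧
        (∀ t : ℂ, g 0 ((lam : ℂ) * t) = Gasket.genPhi u (g 0 t) (g 1 t)) ∧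
        (∀ t : ℂ, g 1 ((lam : ℂ) * t) = Gasket.genTheta u (g 0 t) (g 1 t)) ∧
        g 0 0 = 1 ∧ g 1 0 = 1 := by
  rw [Gasket.meanMatrix_eq hu0]
  refine ⟨Gasket.exists_perronTriple hu0, ?_, ?_⟩
  · obtain ⟨P, hP, hMC⟩ := Gasket.exists_isMC (Gasket.pathKernel u) [Gasket.vO, Gasket.va]
    exact ⟨P, hP, (Gasket.isCoupledLaw_iff hu0).2 hMC⟩
  intro lam r l h P hPp hP
  have hmp := fun j => measurePreserving_eval (Gasket.limLaw u lam r) j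
  have hexp : ∀ (j : Fin 2) (t : ℂ),
      Integrable (fun x : ℝ => Complex.exp (t * x)) (Gasket.limLaw u lam r j) := fun j t => by
    refine (Gasket.integrable_exp_limLaw hu0 h j t.re).mono'
      (Continuous.aestronglyMeasurable (by fun_prop)) (ae_of_all _ fun x => ?_)
    rw [Complex.norm_exp, Complex.re_mul_ofReal]
  have hB : ∀ (j : Fin 2) (t : ℂ), ∫ e, Complex.exp (-t * ((e j : ℝ) : ℂ))
      ∂(Measure.pi (Gasket.limLaw u lam r)) = complexMGF id (Gasket.limLaw u lam r j) (-t) := by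
    intro j t
    rw [complexMGF, ← (hmp j).map_eq, integral_map (measurable_pi_apply j).aemeasurable
      (Continuous.aestronglyMeasurable (by simp only [id]; fun_prop))]
    rfl
  refine ⟨Fin 2 → ℝ, inferInstance, Measure.pi (Gasket.limLaw u lam r), fun j e => e j,
    inferInstance, fun j => measurable_pi_apply j, fun M v _ hv => ?_, fun j => ?_, ?_⟩
  · obtain ⟨h1, h2, h3⟩ := Gasket.skeletonLimit_spec hu0 h hP hv
    have hS := Gasket.measurable_skeletonLimit lam r l M v
    have hf : Measurable fun x : ℝ => ((lam ^ M)⁻¹ * x) • l := (measurable_const_mul _).smul_const l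
    refine ⟨Gasket.skeletonLimit lam r l M v, hS, h1, h2, fun i => ?_⟩
    obtain ⟨j, hj, hmap⟩ := h3 i
    refine ⟨j, hj, (hS i).aemeasurable, (hf.comp (measurable_pi_apply j)).aemeasurable, ?_⟩
    rw [hmap, ← (hmp j).map_eq, Measure.map_map hf (measurable_pi_apply j)]
    rfl
  · obtain ⟨f, hfc, hfpos, hf⟩ := Gasket.exists_density_limLaw hu0 h j
    have hpos : ∀ᵐ x ∂(Gasket.limLaw u lam r j), 0 < x := by
      have h0 : ∀ᵐ x ∂(Gasket.limLaw u lam r j), x ≠ 0 := by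
        rw [hf]
        exact (withDensity_absolutelyContinuous _ _).ae_le (Measure.ae_ne volume 0)
      filter_upwards [Gasket.limLaw_nonneg hu0 h j, h0] with x hx hx0
      exact lt_of_le_of_ne hx hx0.symm
    obtain ⟨hi, hm⟩ := Gasket.mean_limLaw hu0 h j
    refine ⟨(hmp j).quasiMeasurePreserving.ae hpos, ?_, ?_, f, hfc.measurable, hfpos, ?_⟩
    · exact (hmp j).integrable_comp_of_integrable hi
    · rw [← hm, ← (hmp j).map_eq, integral_map (measurable_pi_apply j).aemeasurable
        (Continuous.aestronglyMeasurable (by fun_prop))]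
    · refine (hmp j).map_eq.trans ?_
      rw [← restrict_withDensity measurableSet_Ioi, ← hf]
      exact (Measure.restrict_eq_self_of_ae_mem (s := Set.Ioi 0) hpos).symm
  · refine ⟨fun j t => complexMGF id (Gasket.limLaw u lam r j) (-t), fun j t => ⟨?_, (hB j t).symm⟩,
      fun j => ?_, fun t => ?_, fun t => ?_, ?_, ?_⟩
    · exact (hmp j).integrable_comp_of_integrable (hexp j (-t))
    · exact (Gasket.differentiable_complexMGF_limLaw hu0 h j).comp differentiable_neg
    · rw [Gasket.genPhi_eq hu0]
      beta_reduce
      rw [← mul_neg]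
      exact Gasket.complexMGF_limLaw_mul hu0 h 0 (-t)
    · rw [Gasket.genTheta_eq hu0]
      beta_reduce
      rw [← mul_neg]
      exact Gasket.complexMGF_limLaw_mul hu0 h 1 (-t)
    · simp [complexMGF]
    · simp [complexMGF]
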